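/- **Setting.** Let $G$ be a finite-dimensional Lie group (for example $\mathrm{SO}(2m)$) with Lie algebra $\mathfrak g$, basis $b_a$ of $\mathfrak g$, structure constants $f^a_{bc}$; let $P_\Sigma\to\Sigma$ be a smooth principal $G$-bundle (right action) with connection $1$-form $A$, and $M$ a smooth Hausdorff $n$-manifold. Gauge transformations of $M\times G$ act pointwise on $C^\infty(M,P_\Sigma)$; put $\mathrm{Lie}(\mathcal G)=C^\infty(M,\mathfrak g)$. Everything is considered over a coordinate domain $U\subset M$ with coordinates $x^\mu$, and a coordinate domain $V\subset P_\Sigma$ with coordinates $u^j$. Algebras are bigraded commutative of the first kind: $\alpha\beta=(-1)^{ik+jl}\beta\alpha$ for $\alpha,\beta$ of bidegrees $(i,j),(k,l)$; vector fields of bidegree $d$ are bigraded derivations of bidegree $d$ that obey the chain rule on smooth functions; a *local function* is a smooth function of finitely many of the coordinates of bidegree $(0,0)$. $I$ runs over multi-indices, and $D_\mu$ denotes the total derivative: $D_\mu x^\nu=\delta_\mu^\nu$, $D_\mu y_I=y_{I\cup\{\mu\}}$, $D_\mu dx^\nu=0$; the horizontal differential is $d=\sum_\mu dx^\mu D_\mu$.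 In the formulas below brackets of $\mathfrak g$-valued functions are $[\alpha,\beta]^a=f^a_{bc}\alpha^b\beta^c$. Values are given on fields $y=y_\emptyset$ and extended to jets $y_I$ by commuting with all $D_\mu$; $Q,K,\iota_\lambda$ vanish on $x^\mu$ and $dx^\mu$; $L$ vanishes on $x^\mu,dx^\mu$ and $Ly_I=\sum_\mu y_{I\cup\{\mu\}}dx^\mu$; $\delta_\lambda=Q\iota_\lambda+\iota_\lambda Q$. Bidegrees: $Q$ $(0,1)$, $K$ $(1,-1)$, $L$ $(1,0)$, $\iota_\lambda$ $(0,-1)$, $\delta_\lambda$ $(0,0)$. *Universal side* $\Omega_{loc}(M\times\Gamma(\mathrm{ad}P)\times\mathcal A)$, $P=M\times G$: generated over local functions of $x^\mu,A^a_{\mu;I}$ by $dx^\mu$ of bidegree $(1,0)$, $\theta^a_I$ $(0,1)$, $\phi^a_I$ $(0,2)$, $\upsilon^a_{\mu;I}$ $(0,1)$. With $A=\sum_\mu A_\mu dx^\mu$, $\upsilon=\sum_\mu\upsilon_\mu dx^\mu$, $F=dA+\frac12[A,A]$, $F_{\nu\mu}=D_\nu A_\mu-D_\mu A_\nu+[A_\nu,A_\mu]$: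 $$Q\theta=\phi-\tfrac12[\theta,\theta],\quad Q\phi=-[\theta,\phi],\quad QA_\mu=\upsilon_\mu+D_\mu\theta+[A_\mu,\theta],\quad Q\upsilon_\mu=-[\theta,\upsilon_\mu]-D_\mu\phi-[A_\mu,\phi],$$ $$K\theta=A,\quad K\phi=-\upsilon,\quad KA_\mu=0,\quad K\upsilon_\mu=\sum_\nu F_{\nu\mu}dx^\nu,\qquad \iota_\lambda\theta=\lambda,\quad \iota_\lambda\phi=\iota_\lambda A_\mu=\iota_\lambda\upsilon_\mu=0 .$$ *Mapping space side* $\Omega_{loc}(M\times C^\infty(M,P_\Sigma))$: generated over local functions of $x^\mu,u^j_I$ by $dx^\mu$ of bidegree $(1,0)$ and $\delta u^j_I$ $(0,1)$, with $Qu^j=\delta u^j$, $Q\delta u^j=0$, $Ku^j=0$, $K\delta u^j=\sum_\mu u^j_{\{\mu\}}dx^\mu$, $\iota_\lambda u^j=0$, $\iota_\lambda\delta u^j=\sum_a\lambda^a v_a^j(u)$, where $v_a$ is the fundamental vector field of $b_a$ on $P_\Sigma$. Write $A=\sum_jA_j(u)du^j$ on $V$. Its pullback by the evaluation map $M\times C^\infty(M,P_\Sigma)\to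 P_\Sigma$ has vertical and horizontal parts $A_v=\sum_jA_j(u)\delta u^j$ and $A_h=\sum_{j,\mu}A_j(u)u^j_{\{\mu\}}dx^\mu$, and curvatures $$R_v=QA_v+\tfrac12[A_v,A_v],\quad R_h=dA_h+\tfrac12[A_h,A_h],\quad R_m=dA_v-QA_h+[A_h,A_v].$$ **Definitions.** A *$QK_{vg}$-structure* consists of vector fields $Q,K,L,\iota_\lambda,\delta_\lambda$ of the above bidegrees, $\iota_\lambda,\delta_\lambda$ linear in $\lambda$, with $L$ given by the formula above and (bigraded commutators) $$Q^2=0,\quad QK+KQ=L,\quad LK+KL=0,\quad QL=LQ,\quad L^2=0,$$ $$[\delta_\lambda,\delta_{\lambda'}]=\delta_{[\lambda,\lambda']},\quad[\delta_\lambda,\iota_{\lambda'}]=\iota_{[\lambda,\lambda']},\quad[\delta_\lambda,Q]=0,\quad[\iota_\lambda,\iota_{\lambda'}]=0,\quad[Q,\iota_\lambda]=\delta_\lambda,\quad \iota_\lambda K+K\iota_\lambda=0 .$$ It is *h-simple* if $[\delta_\lambda,K]\omega=0$ for all $\lambda$ whenever $\iota_{\lambda'}\omega=0$ for all $\lambda'$.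 **Theorem.** The vector fields on both sides exist, are uniquely determined by the formulas above, and are h-simple $QK_{vg}$-structures. There is a unique morphism of bigraded manifolds, given by a bidegree-preserving algebra homomorphism $$\phi_W:\Omega_{loc}(M\times\Gamma(\mathrm{ad}P)\times\mathcal A)\to\Omega_{loc}(M\times C^\infty(M,P_\Sigma))$$ (the Weil homomorphism for mapping spaces), which fixes $x^\mu$ and $dx^\mu$, commutes with the $D_\mu$, and satisfies $$\phi_W(\theta)=A_v,\quad \phi_W(\phi)=R_v,\quad \phi_W(A)=A_h,\quad \phi_W(\upsilon)=-R_m .$$ Moreover: 1. $\phi_W$ intertwines $Q$, $K$, $L$, and $\iota_\lambda$, $\delta_\lambda$ for all $\lambda\in C^\infty(M,\mathfrak g)$; so it is a morphism of h-simple $QK_{vg}$-manifolds. 2. It sends the universal connection $\theta+A$ to $A_v+A_h$, and the universal curvature $\phi-\upsilon+F$ to $R_v+R_m+R_h$. 3. The underlying map sends the infinite jet at $x$ of a smooth map $f:M\to P_\Sigma$ (with $x\in U$, $f(x)\in V$) to that of the $\mathfrak g$-valued $1$-form $A(Tf)$ on $M$. 4. $\phi_W$ does not depend on the coordinates of $P_\Sigma$: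 if $V\subset V'$ are coordinate domains, there is a unique morphism which expresses functions over $V'$ in the coordinates of $V$ (fixing $x^\mu,dx^\mu$, sending $u'^j$ to its expression in $u$, commuting with the $D_\mu$ and $Q$); it intertwines $Q,K,L,\iota_\lambda,\delta_\lambda$, and its composite with $\phi_W$ over $V'$ is $\phi_W$ over $V$. -/

import Mathlib

open scoped Manifold ContDiff TensorProduct

noncomputable section

namespace GaugeQK

/-! ## Commutative bigraded algebras of the first kind -/

/-- The sign `(-1)^(d₁ e₁ + d₂ e₂)` attached to two bidegrees (sign convention of the first kind). -/
def sgn (d e : ℤ × ℤ) : ℝ := ((d.1 * e.1 + d.2 * e.2).negOnePow : ℤ)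

/-- The relations `v v' = sgn (deg v) (deg v') v' v`. -/
inductive GSymRel {γ : Type} (deg : γ → ℤ × ℤ) : FreeAlgebra ℝ γ → FreeAlgebra ℝ γ → Prop
  | comm (v v' : γ) : GSymRel deg (FreeAlgebra.ι ℝ v * FreeAlgebra.ι ℝ v')
      (sgn (deg v) (deg v') • (FreeAlgebra.ι ℝ v' * FreeAlgebra.ι ℝ v))

/-- The bigraded symmetric algebra `S(V)`, where `V` is the bigraded vector space with basis `γ`. -/
abbrev GSym {γ : Type} (deg : γ → ℤ × ℤ) : Type := RingQuot (GSymRel deg)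

/-! ## Local functions -/

/-- Restriction of a family of real numbers to a finite set of indices. -/
def restr {β : Type} (s : Finset β) (p : β → ℝ) : s → ℝ := fun i => p i

/-- A function on a set `dom` of families of reals is local if it is a smooth function of finitely
many of the coordinates. -/
def IsLocal {β : Type} (dom : Set (β → ℝ)) (F : dom → ℝ) : Prop :=
  ∃ (s : Finset β) (g : (s → ℝ) → ℝ), ContDiffOn ℝ ∞ g (restr s '' dom) ∧
    ∀ p : dom, F p = g (restr s p.1)

theorem IsLocal.common {β : Type} {dom : Set (β → ℝ)} {F F' : dom → ℝ}
    (h : IsLocal dom F) (h' : IsLocal dom F') :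
    ∃ (s : Finset β) (g g' : (s → ℝ) → ℝ), ContDiffOn ℝ ∞ g (restr s '' dom) ∧
      ContDiffOn ℝ ∞ g' (restr s '' dom) ∧ (∀ p : dom, F p = g (restr s p.1)) ∧
      ∀ p : dom, F' p = g' (restr s p.1) := by
  classical
  obtain ⟨s, g, hg, hF⟩ := h
  obtain ⟨s', g', hg', hF'⟩ := h'
  refine ⟨s ∪ s', fun y => g fun i => y ⟨i.1, Finset.mem_union_left _ i.2⟩,
    fun y => g' fun i => y ⟨i.1, Finset.mem_union_right _ i.2⟩, ?_, ?_, ?_, ?_⟩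
  · refine hg.comp (f := fun (y : ↥(s ∪ s') → ℝ) (i : s) =>
      y ⟨i.1, Finset.mem_union_left _ i.2⟩) (by fun_prop) ?_
    rintro _ ⟨p, hp, rfl⟩
    exact ⟨p, hp, rfl⟩
  · refine hg'.comp (f := fun (y : ↥(s ∪ s') → ℝ) (i : s') =>
      y ⟨i.1, Finset.mem_union_right _ i.2⟩) (by fun_prop) ?_
    rintro _ ⟨p, hp, rfl⟩
    exact ⟨p, hp, rfl⟩
  · exact hF
  · exact hF'

/-- The algebra of local functions. -/
def LocFun {β : Type} (dom : Set (β → ℝ)) : Subalgebra ℝ (dom → ℝ) where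
  carrier := {F | IsLocal dom F}
  mul_mem' := by
    intro F F' h h'
    obtain ⟨s, g, g', hg, hg', hF, hF'⟩ := IsLocal.common h h'
    exact ⟨s, fun y => g y * g' y, hg.mul hg', fun p => by simp [hF, hF']⟩
  add_mem' := by
    intro F F' h h'
    obtain ⟨s, g, g', hg, hg', hF, hF'⟩ := IsLocal.common h h'
    exact ⟨s, fun y => g y + g' y, hg.add hg', fun p => by simp [hF, hF']⟩
  algebraMap_mem' := fun r => ⟨∅, fun _ => r, contDiffOn_const, fun _ => rfl⟩

/-! ## Coordinate patches of variational bigraded manifolds -/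

/-- Coordinates of degree `(0,0)`: base coordinates `x^μ` and jets `u^b_I`, where `I` is a
multi-index (a multiset of base indices, so that `I ∪ {μ}` is `μ ::ₘ I`). -/
inductive BaseCoord (n : ℕ) (B : Type) : Type
  | x (μ : Fin n) : BaseCoord n B
  | jet (b : B) (I : Multiset (Fin n)) : BaseCoord n B

/-- Coordinates of nonzero degree: `dx^μ` and the jets of the graded fields. -/
inductive GenCoord (n : ℕ) (C : Type) : Type
  | dx (μ : Fin n) : GenCoord n C
  | jet (c : C) (I : Multiset (Fin n)) : GenCoord n C

/-- A coordinate patch of a variational bigraded manifold over an `n`-dimensional base: fields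
`B` of degree `(0,0)`, graded fields `C` (which include the vertical differentials of all fields)
with their bidegrees, and the range `dom` of the coordinates of degree `(0,0)`. -/
structure Patch (n : ℕ) where
  B : Type
  C : Type
  deg : C → ℤ × ℤ
  dom : Set (BaseCoord n B → ℝ)

namespace Patch

variable {n : ℕ} (X : Patch n)

/-- Bidegrees of the graded coordinates; `dx^μ` has bidegree `(1,0)`, and a jet has the bidegree
of its field. -/
def gdeg : GenCoord n X.C → ℤ × ℤ
  | .dx _ => (1, 0)
  | .jet c _ => X.deg c

/-- Functions on the bigraded manifold over the patch (that is, local forms): the algebra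
`C^∞ ⊗ S(V)`, with `C^∞` the local functions of the coordinates of degree `(0,0)`. -/
abbrev Fn : Type := LocFun X.dom ⊗[ℝ] GSym X.gdeg

/-- A local function, seen as a function on the bigraded manifold. -/
def incl (F : LocFun X.dom) : X.Fn := F ⊗ₜ[ℝ] 1

open Classical in
/-- A real function on the range of the coordinates, seen as a function on the bigraded manifold
(it is only applied to local functions; the value is `0` otherwise). -/
def ofFun (F : X.dom → ℝ) : X.Fn := if h : IsLocal X.dom F then X.incl ⟨F, h⟩ else 0

/-- A coordinate of degree `(0,0)`. -/
def base (i : BaseCoord n X.B) : X.Fn := X.ofFun fun p => p.1 i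

/-- A graded coordinate. -/
def gen (v : GenCoord n X.C) : X.Fn :=
  1 ⊗ₜ[ℝ] RingQuot.mkAlgHom ℝ (GSymRel X.gdeg) (FreeAlgebra.ι ℝ v)

/-- `dx^μ`. -/
def dx (μ : Fin n) : X.Fn := X.gen (.dx μ)

/-- The functions of bidegree `d`. -/
def homog (d : ℤ × ℤ) : Submodule ℝ X.Fn :=
  Submodule.span ℝ {w | ∃ (F : LocFun X.dom) (l : List (GenCoord n X.C)),
    (l.map X.gdeg).sum = d ∧ w = X.incl F * (l.map X.gen).prod}

open Classical in
/-- Vector fields of bidegree `d`: bigraded derivations of bidegree `d` of the algebra of functions,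
which obey the chain rule `V(g(y_i, i ∈ s)) = ∑_i (∂g/∂y_i) V(y_i)` on smooth functions `g` of
finitely many coordinates `y_i` of degree `(0,0)`. -/
@[ext]
structure VectorField (d : ℤ × ℤ) where
  toLin : X.Fn →ₗ[ℝ] X.Fn
  map_homog : ∀ e, ∀ w ∈ X.homog e, toLin w ∈ X.homog (e + d)
  leibniz : ∀ e, ∀ w ∈ X.homog e, ∀ η,
    toLin (w * η) = toLin w * η + sgn d e • (w * toLin η)
  chain : ∀ (s : Finset (BaseCoord n X.B)) (g : (s → ℝ) → ℝ) (F : LocFun X.dom)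
    (G : s → LocFun X.dom), ContDiffOn ℝ ∞ g (restr s '' X.dom) →
    (∀ p, F.1 p = g (restr s p.1)) →
    (∀ i p, (G i).1 p = fderiv ℝ g (restr s p.1) (Pi.single i 1)) →
    toLin (X.incl F) = ∑ i, X.incl (G i) * toLin (X.base i)

instance (d : ℤ × ℤ) : CoeFun (X.VectorField d) fun _ => X.Fn → X.Fn := ⟨fun V => V.toLin⟩

variable {X}

/-- `D` is the family of total derivatives `D_μ` along the base coordinates `x^μ`. -/
structure IsTotalDerivative (D : Fin n → X.VectorField (0, 0)) : Prop where
  x : ∀ μ ν, D μ (X.base (.x ν)) = if μ = ν then 1 else 0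
  dx : ∀ μ ν, D μ (X.dx ν) = 0
  base : ∀ μ b I, D μ (X.base (.jet b I)) = X.base (.jet b (μ ::ₘ I))
  gen : ∀ μ c I, D μ (X.gen (.jet c I)) = X.gen (.jet c (μ ::ₘ I))

/-- `L` is the part `d_{h2}` of the horizontal differential, which kills `x^μ` and `dx^μ` and
sends each jet `y_I` to `∑_μ y_{I ∪ {μ}} dx^μ`. -/
structure IsFieldHorizontalDifferential (L : X.VectorField (1, 0)) : Prop where
  x : ∀ ν, L (X.base (.x ν)) = 0
  dx : ∀ ν, L (X.dx ν) = 0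
  base : ∀ b I, L (X.base (.jet b I)) = ∑ μ, X.base (.jet b (μ ::ₘ I)) * X.dx μ
  gen : ∀ c I, L (X.gen (.jet c I)) = ∑ μ, X.gen (.jet c (μ ::ₘ I)) * X.dx μ

variable (X) in
/-- The vector fields in play: total derivatives `D_μ`, the vector fields `Q`, `K`, `L`, and for
each element `l` of the Lie algebra `Lie(𝒢)` of gauge transformations the contraction `ι_l` and the
Lie derivative `δ_l`. -/
@[ext]
structure Operators (𝔏 : Type*) where
  D : Fin n → X.VectorField (0, 0)
  Q : X.VectorField (0, 1)
  K : X.VectorField (1, -1)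
  L : X.VectorField (1, 0)
  ι : 𝔏 → X.VectorField (0, -1)
  δ : 𝔏 → X.VectorField (0, 0)

namespace Operators

variable {𝔏 : Type*}

/-- The horizontal differential `d w = ∑_μ dx^μ D_μ w`. -/
def dh (S : X.Operators 𝔏) (w : X.Fn) : X.Fn := ∑ μ, X.dx μ * S.D μ w

/-- `Q`, `K`, `L`, `ι`, `δ` all commute with the total derivatives. Together with their values on the
fields `y = y_∅` this determines them on all jets `y_I = D_I y`. -/
structure IsProlonged (S : X.Operators 𝔏) : Prop where
  Q : ∀ μ w, S.Q (S.D μ w) = S.D μ (S.Q w)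
  K : ∀ μ w, S.K (S.D μ w) = S.D μ (S.K w)
  L : ∀ μ w, S.L (S.D μ w) = S.D μ (S.L w)
  ι : ∀ l μ w, S.ι l (S.D μ w) = S.D μ (S.ι l w)
  δ : ∀ l μ w, S.δ l (S.D μ w) = S.D μ (S.δ l w)

variable [AddCommGroup 𝔏] [Module ℝ 𝔏]

/-- A `QK_{vg}`-structure: a `QK`-structure with `L = d_{h2}` together with a compatible
`L_g`-structure. `br l₁ l₂ l₃` expresses `[l₁, l₂] = l₃` in the Lie algebra `𝔏`; all brackets of
vector fields are bigraded commutators of the first kind. -/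
structure IsQKvg (br : 𝔏 → 𝔏 → 𝔏 → Prop) (S : X.Operators 𝔏) : Prop where
  Q_Q : ∀ w, S.Q (S.Q w) = 0
  Q_K : ∀ w, S.Q (S.K w) + S.K (S.Q w) = S.L w
  L_K : ∀ w, S.L (S.K w) + S.K (S.L w) = 0
  Q_L : ∀ w, S.Q (S.L w) - S.L (S.Q w) = 0
  L_L : ∀ w, S.L (S.L w) = 0
  L_eq : IsFieldHorizontalDifferential S.L
  ι_linear : ∀ (r : ℝ) l₁ l₂ w, S.ι (r • l₁ + l₂) w = r • S.ι l₁ w + S.ι l₂ w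
  δ_linear : ∀ (r : ℝ) l₁ l₂ w, S.δ (r • l₁ + l₂) w = r • S.δ l₁ w + S.δ l₂ w
  δ_δ : ∀ l₁ l₂ l₃, br l₁ l₂ l₃ → ∀ w, S.δ l₁ (S.δ l₂ w) - S.δ l₂ (S.δ l₁ w) = S.δ l₃ w
  δ_ι : ∀ l₁ l₂ l₃, br l₁ l₂ l₃ → ∀ w, S.δ l₁ (S.ι l₂ w) - S.ι l₂ (S.δ l₁ w) = S.ι l₃ w
  δ_Q : ∀ l w, S.δ l (S.Q w) - S.Q (S.δ l w) = 0
  ι_ι : ∀ l₁ l₂ w, S.ι l₁ (S.ι l₂ w) + S.ι l₂ (S.ι l₁ w) = 0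
  Q_ι : ∀ l w, S.Q (S.ι l w) + S.ι l (S.Q w) = S.δ l w
  ι_K : ∀ l w, S.ι l (S.K w) + S.K (S.ι l w) = 0

/-- h-simplicity: `[δ_l, K]` vanishes on horizontal functions, the functions killed by all
contractions. -/
def IsHSimple (S : X.Operators 𝔏) : Prop :=
  ∀ w, (∀ l, S.ι l w = 0) → ∀ l, S.δ l (S.K w) - S.K (S.δ l w) = 0

end Operators

/-! ## Morphisms -/

/-- The algebra homomorphism `Φ` covers the map `τ` of the underlying spaces. -/
def Covers {X Y : Patch n} (Φ : X.Fn →ₐ[ℝ] Y.Fn) (τ : Y.dom → X.dom) : Prop :=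
  ∀ F : LocFun X.dom, ∃ F' : LocFun Y.dom, (∀ q, F'.1 q = F.1 (τ q)) ∧ Φ (X.incl F) = Y.incl F'

/-- Morphisms `Y → X` of bigraded manifolds, given by the pullback of functions: bidegree-preserving
algebra homomorphisms which cover a map of the underlying spaces. -/
structure IsMorphism {X Y : Patch n} (Φ : X.Fn →ₐ[ℝ] Y.Fn) : Prop where
  map_homog : ∀ e, ∀ w ∈ X.homog e, Φ w ∈ Y.homog e
  covers : ∃ τ, Covers Φ τ

/-- Morphisms of manifolds equipped with the operators: `Φ` intertwines all of them. -/
structure Intertwines {X Y : Patch n} {𝔏 : Type*} (S : X.Operators 𝔏) (S' : Y.Operators 𝔏)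
    (Φ : X.Fn →ₐ[ℝ] Y.Fn) : Prop where
  Q : ∀ w, Φ (S.Q w) = S'.Q (Φ w)
  K : ∀ w, Φ (S.K w) = S'.K (Φ w)
  L : ∀ w, Φ (S.L w) = S'.L (Φ w)
  ι : ∀ l w, Φ (S.ι l w) = S'.ι l (Φ w)
  δ : ∀ l w, Φ (S.δ l w) = S'.δ l (Φ w)

end Patch

/-- The bracket `[α, β]^a = ∑ f^a_{ij} α^i β^j` of Lie algebra valued functions, given by their
components; `f i j a = f^a_{ij}` are the structure constants. -/
def bkt {r : ℕ} {R : Type*} [Ring R] [Algebra ℝ R] (f : Fin r → Fin r → Fin r → ℝ)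
    (α β : Fin r → R) : Fin r → R :=
  fun a => ∑ i, ∑ j, f i j a • (α i * β j)

/-- The point of Euclidean space with coordinates `x^μ`. -/
def xPoint {n : ℕ} {B : Type} (p : BaseCoord n B → ℝ) : EuclideanSpace ℝ (Fin n) :=
  WithLp.toLp 2 fun μ => p (.x μ)

/-- The point of Euclidean space with coordinates `u^j = u^j_∅`. -/
def uPoint {n N : ℕ} (p : BaseCoord n (Fin N) → ℝ) : EuclideanSpace ℝ (Fin N) :=
  WithLp.toLp 2 fun j => p (.jet j 0)

/-! ## The universal side: `M × Γ(ad P) × 𝒜` for the trivial bundle `P` -/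

/-- The graded fields `θ^a`, `φ^a`, `υ^a_μ`. -/
inductive GhostField (r n : ℕ) : Type
  | theta (a : Fin r) : GhostField r n
  | phi (a : Fin r) : GhostField r n
  | upsilon (a : Fin r) (μ : Fin n) : GhostField r n

/-- Bidegrees `(0,1)`, `(0,2)`, `(0,1)` of `θ`, `φ`, `υ`. -/
def GhostField.deg {r n : ℕ} : GhostField r n → ℤ × ℤ
  | .theta _ => (0, 1)
  | .phi _ => (0, 2)
  | .upsilon _ _ => (0, 1)

/-- The patch over a coordinate domain `U` of the base: coordinates
`x^μ, A^a_{μ;I}, dx^μ, θ^a_I, φ^a_I, υ^a_{μ;I}`. -/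
def universalPatch (r n : ℕ) (U : Set (EuclideanSpace ℝ (Fin n))) : Patch n where
  B := Fin r × Fin n
  C := GhostField r n
  deg := GhostField.deg
  dom := {p | xPoint p ∈ U}

section Universal

variable (r n : ℕ) (U : Set (EuclideanSpace ℝ (Fin n)))

/-- `θ^a`. -/
def theta (a : Fin r) : (universalPatch r n U).Fn := (universalPatch r n U).gen (.jet (.theta a) 0)

/-- `φ^a`. -/
def phi (a : Fin r) : (universalPatch r n U).Fn := (universalPatch r n U).gen (.jet (.phi a) 0)

/-- `υ^a_μ`. -/
def upsilon (μ : Fin n) (a : Fin r) : (universalPatch r n U).Fn :=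
  (universalPatch r n U).gen (.jet (.upsilon a μ) 0)

/-- `A^a_μ`. -/
def conn (μ : Fin n) (a : Fin r) : (universalPatch r n U).Fn :=
  (universalPatch r n U).base (.jet (a, μ) 0)

/-- `A^a = ∑_μ A^a_μ dx^μ`. -/
def connForm (a : Fin r) : (universalPatch r n U).Fn :=
  ∑ μ, conn r n U μ a * (universalPatch r n U).dx μ

/-- `υ^a = ∑_μ υ^a_μ dx^μ`. -/
def upsilonForm (a : Fin r) : (universalPatch r n U).Fn :=
  ∑ μ, upsilon r n U μ a * (universalPatch r n U).dx μ

variable {r n U}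

/-- The `QK`- and `L_g`-structure on the universal side. Here `f` are the structure constants and
`comp l a` is the component `λ^a` of the Lie algebra valued function `λ` given by `l`, as a function
of the base coordinates.

`Q θ = φ - [θ,θ]/2`, `Q φ = -[θ,φ]`, `Q A = υ + d_A θ`, `Q υ = -[θ,υ] - d_A φ`, `K θ = A`,
`K φ = -υ`, `K A = 0`, `K υ = 2F` (in components `K υ_μ = ∑_ν F_{νμ} dx^ν`), `ι_λ θ = λ`, and
`ι_λ = 0` on `φ`, `A`, `υ`. -/
structure IsUniversalStructure {𝔏 : Type*} (f : Fin r → Fin r → Fin r → ℝ)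
    (comp : 𝔏 → Fin r → EuclideanSpace ℝ (Fin n) → ℝ)
    (S : (universalPatch r n U).Operators 𝔏) : Prop where
  total : Patch.IsTotalDerivative S.D
  prolonged : S.IsProlonged
  L_eq : Patch.IsFieldHorizontalDifferential S.L
  δ_eq : ∀ l w, S.δ l w = S.Q (S.ι l w) + S.ι l (S.Q w)
  Q_x : ∀ μ, S.Q ((universalPatch r n U).base (.x μ)) = 0
  Q_dx : ∀ μ, S.Q ((universalPatch r n U).dx μ) = 0
  Q_theta : ∀ a, S.Q (theta r n U a) =
    phi r n U a - (1 / 2 : ℝ) • bkt f (theta r n U) (theta r n U) a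
  Q_phi : ∀ a, S.Q (phi r n U a) = -bkt f (theta r n U) (phi r n U) a
  Q_conn : ∀ μ a, S.Q (conn r n U μ a) =
    upsilon r n U μ a + (S.D μ (theta r n U a) + bkt f (conn r n U μ) (theta r n U) a)
  Q_upsilon : ∀ μ a, S.Q (upsilon r n U μ a) =
    -bkt f (theta r n U) (upsilon r n U μ) a
      - (S.D μ (phi r n U a) + bkt f (conn r n U μ) (phi r n U) a)
  K_x : ∀ μ, S.K ((universalPatch r n U).base (.x μ)) = 0
  K_dx : ∀ μ, S.K ((universalPatch r n U).dx μ) = 0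
  K_theta : ∀ a, S.K (theta r n U a) = connForm r n U a
  K_phi : ∀ a, S.K (phi r n U a) = -upsilonForm r n U a
  K_conn : ∀ μ a, S.K (conn r n U μ a) = 0
  K_upsilon : ∀ μ a, S.K (upsilon r n U μ a) =
    ∑ ν, (S.D ν (conn r n U μ a) - S.D μ (conn r n U ν a)
      + bkt f (conn r n U ν) (conn r n U μ) a) * (universalPatch r n U).dx ν
  ι_x : ∀ l μ, S.ι l ((universalPatch r n U).base (.x μ)) = 0
  ι_dx : ∀ l μ, S.ι l ((universalPatch r n U).dx μ) = 0
  ι_theta : ∀ l a, S.ι l (theta r n U a) =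
    (universalPatch r n U).ofFun fun p => comp l a (xPoint p.1)
  ι_phi : ∀ l a, S.ι l (phi r n U a) = 0
  ι_conn : ∀ l μ a, S.ι l (conn r n U μ a) = 0
  ι_upsilon : ∀ l μ a, S.ι l (upsilon r n U μ a) = 0

/-- The universal connection `θ_K = θ + A`. -/
def universalConnection (a : Fin r) : (universalPatch r n U).Fn :=
  theta r n U a + connForm r n U a

/-- The curvature `F = dA + [A,A]/2` of `A`. -/
def connCurvature {𝔏 : Type*} (f : Fin r → Fin r → Fin r → ℝ)
    (S : (universalPatch r n U).Operators 𝔏) (a : Fin r) : (universalPatch r n U).Fn :=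
  S.dh (connForm r n U a) + (1 / 2 : ℝ) • bkt f (connForm r n U) (connForm r n U) a

/-- The universal curvature `φ_K = φ - υ + F`. -/
def universalCurvature {𝔏 : Type*} (f : Fin r → Fin r → Fin r → ℝ)
    (S : (universalPatch r n U).Operators 𝔏) (a : Fin r) : (universalPatch r n U).Fn :=
  phi r n U a - upsilonForm r n U a + connCurvature f S a

end Universal

/-! ## The mapping space side: `M × C^∞(M, P_Σ)` -/

/-- The patch over coordinate domains `U` of the base and `V` of the fibre: coordinates
`x^μ, u^j_I, dx^μ, δu^j_I`. -/
def mappingPatch (n N : ℕ) (U : Set (EuclideanSpace ℝ (Fin n)))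
    (V : Set (EuclideanSpace ℝ (Fin N))) : Patch n where
  B := Fin N
  C := Fin N
  deg := fun _ => (0, 1)
  dom := {p | xPoint p ∈ U ∧ uPoint p ∈ V}

section Mapping

variable (n N : ℕ) (U : Set (EuclideanSpace ℝ (Fin n))) (V : Set (EuclideanSpace ℝ (Fin N)))

/-- `u^j`. -/
def uCoord (j : Fin N) : (mappingPatch n N U V).Fn := (mappingPatch n N U V).base (.jet j 0)

/-- `u^j_μ`. -/
def uFirst (j : Fin N) (μ : Fin n) : (mappingPatch n N U V).Fn :=
  (mappingPatch n N U V).base (.jet j {μ})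

/-- `δu^j`. -/
def deltaU (j : Fin N) : (mappingPatch n N U V).Fn := (mappingPatch n N U V).gen (.jet j 0)

variable {n N U V}

/-- The canonical `QK`- and `L_g`-structure of `M × C^∞(M, P_Σ)`: `Q` is the vertical differential,
`K δu^j = ∑_μ u^j_μ dx^μ`, and `ι_λ` is the contraction with the fundamental vector field
`u ↦ ∑_a λ^a(x) v_a^j(u)` of the pointwise action of the gauge group, where `vert a j = v_a^j` are the
components of the fundamental vector fields of the fibre. -/
structure IsCanonicalStructure {𝔏 : Type*} {r : ℕ}
    (comp : 𝔏 → Fin r → EuclideanSpace ℝ (Fin n) → ℝ)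
    (vert : Fin r → Fin N → EuclideanSpace ℝ (Fin N) → ℝ)
    (S : (mappingPatch n N U V).Operators 𝔏) : Prop where
  total : Patch.IsTotalDerivative S.D
  prolonged : S.IsProlonged
  L_eq : Patch.IsFieldHorizontalDifferential S.L
  δ_eq : ∀ l w, S.δ l w = S.Q (S.ι l w) + S.ι l (S.Q w)
  Q_x : ∀ μ, S.Q ((mappingPatch n N U V).base (.x μ)) = 0
  Q_dx : ∀ μ, S.Q ((mappingPatch n N U V).dx μ) = 0
  Q_u : ∀ j, S.Q (uCoord n N U V j) = deltaU n N U V j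
  Q_deltaU : ∀ j, S.Q (deltaU n N U V j) = 0
  K_x : ∀ μ, S.K ((mappingPatch n N U V).base (.x μ)) = 0
  K_dx : ∀ μ, S.K ((mappingPatch n N U V).dx μ) = 0
  K_u : ∀ j, S.K (uCoord n N U V j) = 0
  K_deltaU : ∀ j, S.K (deltaU n N U V j) =
    ∑ μ, uFirst n N U V j μ * (mappingPatch n N U V).dx μ
  ι_x : ∀ l μ, S.ι l ((mappingPatch n N U V).base (.x μ)) = 0
  ι_dx : ∀ l μ, S.ι l ((mappingPatch n N U V).dx μ) = 0
  ι_u : ∀ l j, S.ι l (uCoord n N U V j) = 0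
  ι_deltaU : ∀ l j, S.ι l (deltaU n N U V j) =
    (mappingPatch n N U V).ofFun fun p => ∑ a, comp l a (xPoint p.1) * vert a j (uPoint p.1)

variable (n U V)

/-- The vertical part `A_v = ∑_j A_j(u) δu^j` of the pullback of the form `∑_j A_j(u) du^j` along the
evaluation map, for which `ev^* du^j = δu^j + ∑_μ u^j_μ dx^μ`; here `cf a j = A^a_j`. -/
def vertConn {r : ℕ} (cf : Fin r → Fin N → EuclideanSpace ℝ (Fin N) → ℝ) (a : Fin r) :
    (mappingPatch n N U V).Fn :=
  ∑ j, (mappingPatch n N U V).ofFun (fun p => cf a j (uPoint p.1)) * deltaU n N U V j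

/-- The horizontal part `A_h = ∑_{j,μ} A_j(u) u^j_μ dx^μ` of the same pullback. -/
def horConn {r : ℕ} (cf : Fin r → Fin N → EuclideanSpace ℝ (Fin N) → ℝ) (a : Fin r) :
    (mappingPatch n N U V).Fn :=
  ∑ j, ∑ μ, (mappingPatch n N U V).ofFun (fun p => cf a j (uPoint p.1)) * uFirst n N U V j μ
    * (mappingPatch n N U V).dx μ

variable {n U V}

/-- `R_v = δ A_v + [A_v,A_v]/2`. -/
def vertCurv {𝔏 : Type*} {r : ℕ} (f : Fin r → Fin r → Fin r → ℝ)
    (cf : Fin r → Fin N → EuclideanSpace ℝ (Fin N) → ℝ)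
    (S : (mappingPatch n N U V).Operators 𝔏) (a : Fin r) : (mappingPatch n N U V).Fn :=
  S.Q (vertConn n U V cf a) + (1 / 2 : ℝ) • bkt f (vertConn n U V cf) (vertConn n U V cf) a

/-- `R_h = d A_h + [A_h,A_h]/2`. -/
def horCurv {𝔏 : Type*} {r : ℕ} (f : Fin r → Fin r → Fin r → ℝ)
    (cf : Fin r → Fin N → EuclideanSpace ℝ (Fin N) → ℝ)
    (S : (mappingPatch n N U V).Operators 𝔏) (a : Fin r) : (mappingPatch n N U V).Fn :=
  S.dh (horConn n U V cf a) + (1 / 2 : ℝ) • bkt f (horConn n U V cf) (horConn n U V cf) a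

/-- `R_m = d A_v - δ A_h + [A_h,A_v]` (sign convention of the first kind). -/
def mixedCurv {𝔏 : Type*} {r : ℕ} (f : Fin r → Fin r → Fin r → ℝ)
    (cf : Fin r → Fin N → EuclideanSpace ℝ (Fin N) → ℝ)
    (S : (mappingPatch n N U V).Operators 𝔏) (a : Fin r) : (mappingPatch n N U V).Fn :=
  S.dh (vertConn n U V cf a) - S.Q (horConn n U V cf a)
    + bkt f (horConn n U V cf) (vertConn n U V cf) a

/-- `Φ` is the Weil homomorphism for mapping spaces: the morphism which is the identity on `x^μ` and
`dx^μ`, sends `θ, φ, A, υ` to `A_v, R_v, A_h, -R_m`, and sends jets to jets (that is, commutes with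
the total derivatives). -/
structure IsWeilHom {𝔏 : Type*} {r : ℕ} (f : Fin r → Fin r → Fin r → ℝ)
    (cf : Fin r → Fin N → EuclideanSpace ℝ (Fin N) → ℝ)
    (S : (universalPatch r n U).Operators 𝔏) (S' : (mappingPatch n N U V).Operators 𝔏)
    (Φ : (universalPatch r n U).Fn →ₐ[ℝ] (mappingPatch n N U V).Fn) : Prop where
  morphism : Patch.IsMorphism Φ
  x : ∀ μ, Φ ((universalPatch r n U).base (.x μ)) = (mappingPatch n N U V).base (.x μ)
  dx : ∀ μ, Φ ((universalPatch r n U).dx μ) = (mappingPatch n N U V).dx μ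
  theta : ∀ a, Φ (theta r n U a) = vertConn n U V cf a
  phi : ∀ a, Φ (phi r n U a) = vertCurv f cf S' a
  conn : ∀ a, Φ (connForm r n U a) = horConn n U V cf a
  upsilon : ∀ a, Φ (upsilonForm r n U a) = -mixedCurv f cf S' a
  total : ∀ μ w, Φ (S.D μ w) = S'.D μ (Φ w)

/-- `T` is the change of fibre coordinates `u' = t(u)`, as a morphism from the patch over `V` to the
patch over `V'`: it fixes `x^μ` and `dx^μ`, sends `u'^j` to `t^j(u)`, and commutes with the total
derivatives and with the vertical differential. -/
structure IsFibreChange {𝔏 : Type*} {V' : Set (EuclideanSpace ℝ (Fin N))}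
    (t : EuclideanSpace ℝ (Fin N) → EuclideanSpace ℝ (Fin N))
    (S' : (mappingPatch n N U V').Operators 𝔏) (S : (mappingPatch n N U V).Operators 𝔏)
    (T : (mappingPatch n N U V').Fn →ₐ[ℝ] (mappingPatch n N U V).Fn) : Prop where
  morphism : Patch.IsMorphism T
  x : ∀ μ, T ((mappingPatch n N U V').base (.x μ)) = (mappingPatch n N U V).base (.x μ)
  dx : ∀ μ, T ((mappingPatch n N U V').dx μ) = (mappingPatch n N U V).dx μ
  u : ∀ j, T (uCoord n N U V' j) = (mappingPatch n N U V).ofFun fun p => t (uPoint p.1) j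
  total : ∀ μ w, T (S'.D μ w) = S.D μ (T w)
  vertical : ∀ w, T (S'.Q w) = S.Q (T w)

end Mapping

/-! ## Principal bundles and connections -/

section Bundle

variable {EG : Type*} [NormedAddCommGroup EG] [NormedSpace ℝ EG]
  (G : Type*) [TopologicalSpace G] [ChartedSpace EG G] [Group G]

/-- The Lie bracket of the Lie algebra `T_1 G` of `G`, where `T_1 G` is identified with the model
space. -/
def lieBr (ξ η : EG) : EG :=
  (⁅(show GroupLieAlgebra 𝓘(ℝ, EG) G from ξ), (show GroupLieAlgebra 𝓘(ℝ, EG) G from η)⁆ :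
    GroupLieAlgebra 𝓘(ℝ, EG) G)

variable {G} in
/-- The adjoint action of `G` on its Lie algebra. -/
def adjoint (g : G) (ξ : EG) : EG :=
  mfderiv 𝓘(ℝ, EG) 𝓘(ℝ, EG) (fun h : G => g * h * g⁻¹) 1 ξ

/-- The structure constants in a basis: `[b_i, b_j] = ∑_a f^a_{ij} b_a`. -/
def structConst {r : ℕ} (b : Module.Basis (Fin r) ℝ EG) (i j a : Fin r) : ℝ :=
  b.repr (lieBr G (b i) (b j)) a

variable {ES : Type*} [NormedAddCommGroup ES] [NormedSpace ℝ ES]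
  {N : ℕ} (P : Type*) [TopologicalSpace P] [ChartedSpace (EuclideanSpace ℝ (Fin N)) P]
  (Sg : Type*) [TopologicalSpace Sg] [ChartedSpace ES Sg]

/-- Smooth principal `G`-bundles `P → Sg`, with `G` acting from the right. -/
structure PrincipalBundle where
  proj : P → Sg
  act : P → G → P
  contMDiff_proj : ContMDiff 𝓘(ℝ, EuclideanSpace ℝ (Fin N)) 𝓘(ℝ, ES) ∞ proj
  contMDiff_act : ContMDiff (𝓘(ℝ, EuclideanSpace ℝ (Fin N)).prod 𝓘(ℝ, EG))
    𝓘(ℝ, EuclideanSpace ℝ (Fin N)) ∞ (fun q : P × G => act q.1 q.2)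
  proj_act : ∀ p g, proj (act p g) = proj p
  act_one : ∀ p, act p 1 = p
  act_mul : ∀ p g h, act p (g * h) = act (act p g) h
  locally_trivial : ∀ s : Sg, ∃ (W : Set Sg) (e : OpenPartialHomeomorph P (Sg × G)),
    IsOpen W ∧ s ∈ W ∧ e.source = proj ⁻¹' W ∧ e.target = W ×ˢ Set.univ ∧
    ContMDiffOn 𝓘(ℝ, EuclideanSpace ℝ (Fin N)) (𝓘(ℝ, ES).prod 𝓘(ℝ, EG)) ∞ e e.source ∧
    ContMDiffOn (𝓘(ℝ, ES).prod 𝓘(ℝ, EG)) 𝓘(ℝ, EuclideanSpace ℝ (Fin N)) ∞ e.symm e.target ∧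
    ∀ p ∈ e.source, (e p).1 = proj p ∧ ∀ g, e (act p g) = (proj p, (e p).2 * g)

variable {G P Sg}

/-- The value at `p` of the fundamental vector field of `ξ`: the derivative of `g ↦ p g` at `1`. -/
def PrincipalBundle.fundamental (B : PrincipalBundle (EG := EG) (ES := ES) (N := N) G P Sg)
    (p : P) (ξ : EG) : EuclideanSpace ℝ (Fin N) :=
  mfderiv 𝓘(ℝ, EG) 𝓘(ℝ, EuclideanSpace ℝ (Fin N)) (fun g : G => B.act p g) 1 ξ

/-- Connection `1`-forms on a principal bundle. -/
structure Connection [IsManifold 𝓘(ℝ, EuclideanSpace ℝ (Fin N)) ∞ P]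
    (B : PrincipalBundle (EG := EG) (ES := ES) (N := N) G P Sg) where
  form : ∀ p : P, TangentSpace 𝓘(ℝ, EuclideanSpace ℝ (Fin N)) p →L[ℝ] EG
  contMDiff_form : ContMDiff 𝓘(ℝ, EuclideanSpace ℝ (Fin N)).tangent 𝓘(ℝ, EG) ∞
    (fun X : TangentBundle 𝓘(ℝ, EuclideanSpace ℝ (Fin N)) P => form X.1 X.2)
  form_fundamental : ∀ p ξ, form p (B.fundamental p ξ) = ξ
  equivariant : ∀ p g (v : TangentSpace 𝓘(ℝ, EuclideanSpace ℝ (Fin N)) p),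
    form (B.act p g) (mfderiv 𝓘(ℝ, EuclideanSpace ℝ (Fin N)) 𝓘(ℝ, EuclideanSpace ℝ (Fin N))
      (fun q => B.act q g) p v) = adjoint g⁻¹ (form p v)

variable [IsManifold 𝓘(ℝ, EuclideanSpace ℝ (Fin N)) ∞ P]
  {B : PrincipalBundle (EG := EG) (ES := ES) (N := N) G P Sg} {r n : ℕ}

/-- The components `A^a_j` of a connection form in a chart `k` of `P`. -/
def connCoeff (A : Connection B) (b : Module.Basis (Fin r) ℝ EG)
    (k : OpenPartialHomeomorph P (EuclideanSpace ℝ (Fin N))) (a : Fin r) (j : Fin N)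
    (y : EuclideanSpace ℝ (Fin N)) : ℝ :=
  b.repr (A.form (k.symm y) (mfderiv 𝓘(ℝ, EuclideanSpace ℝ (Fin N))
    𝓘(ℝ, EuclideanSpace ℝ (Fin N)) k.symm y (EuclideanSpace.single j (1 : ℝ)))) a

variable (B) in
/-- The components `v_a^j` of the fundamental vector field of `b_a` in a chart `k` of `P`. -/
def vertCoeff (b : Module.Basis (Fin r) ℝ EG)
    (k : OpenPartialHomeomorph P (EuclideanSpace ℝ (Fin N))) (a : Fin r) (j : Fin N)
    (y : EuclideanSpace ℝ (Fin N)) : ℝ :=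
  (show EuclideanSpace ℝ (Fin N) from mfderiv 𝓘(ℝ, EuclideanSpace ℝ (Fin N))
    𝓘(ℝ, EuclideanSpace ℝ (Fin N)) k (k.symm y) (B.fundamental (k.symm y) (b a))) j

/-! ## Gauge transformations and jets of actual maps -/

variable (EG) in
/-- `Lie(𝒢) = C^∞(M, 𝔤)`. -/
abbrev GaugeAlgebra (n : ℕ) (M : Type*) [TopologicalSpace M]
    [ChartedSpace (EuclideanSpace ℝ (Fin n)) M] : Type _ :=
  C^∞⟮𝓘(ℝ, EuclideanSpace ℝ (Fin n)), M; 𝓘(ℝ, EG), EG⟯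

variable {M : Type*} [TopologicalSpace M] [ChartedSpace (EuclideanSpace ℝ (Fin n)) M]

variable (G) in
/-- The pointwise Lie bracket, as a relation: `l₃ = [l₁, l₂]`. -/
def gaugeBr (l₁ l₂ l₃ : GaugeAlgebra EG n M) : Prop := ∀ m, l₃ m = lieBr G (l₁ m) (l₂ m)

/-- The components `λ^a` in a chart `c` of `M`. -/
def gaugeComp (b : Module.Basis (Fin r) ℝ EG)
    (c : OpenPartialHomeomorph M (EuclideanSpace ℝ (Fin n))) (l : GaugeAlgebra EG n M) (a : Fin r)
    (x : EuclideanSpace ℝ (Fin n)) : ℝ :=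
  b.repr (l (c.symm x)) a

/-- The iterated partial derivative `∂_I h`. -/
def partialDeriv (I : Multiset (Fin n)) (h : EuclideanSpace ℝ (Fin n) → ℝ) :
    EuclideanSpace ℝ (Fin n) → ℝ :=
  I.toList.foldr (fun μ g x => fderiv ℝ g x (EuclideanSpace.single μ (1 : ℝ))) h

/-- The coordinates `x^μ, u^j_I = ∂_I (u^j ∘ f)` of the infinite jet of a map `f : M → P`, in charts
`c` of `M` and `k` of `P`. -/
def mapJet (c : OpenPartialHomeomorph M (EuclideanSpace ℝ (Fin n)))
    (k : OpenPartialHomeomorph P (EuclideanSpace ℝ (Fin N))) (f : M → P)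
    (x : EuclideanSpace ℝ (Fin n)) : BaseCoord n (Fin N) → ℝ
  | .x μ => x μ
  | .jet j I => partialDeriv I (fun y => k (f (c.symm y)) j) x

/-- The coordinates `x^μ, A^a_{μ;I}` of the infinite jet of the Lie algebra valued form `A(Tf)` on
`M`, for a map `f : M → P`, in a chart `c` of `M`. -/
def pullbackConnJet (A : Connection B) (b : Module.Basis (Fin r) ℝ EG)
    (c : OpenPartialHomeomorph M (EuclideanSpace ℝ (Fin n))) (f : M → P)
    (x : EuclideanSpace ℝ (Fin n)) : BaseCoord n (Fin r × Fin n) → ℝ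
  | .x μ => x μ
  | .jet (a, μ) I => partialDeriv I (fun y => b.repr (A.form (f (c.symm y))
      (mfderiv 𝓘(ℝ, EuclideanSpace ℝ (Fin n)) 𝓘(ℝ, EuclideanSpace ℝ (Fin N)) f (c.symm y)
        (mfderiv 𝓘(ℝ, EuclideanSpace ℝ (Fin n)) 𝓘(ℝ, EuclideanSpace ℝ (Fin n)) c.symm y
          (EuclideanSpace.single μ (1 : ℝ))))) a) x

end Bundle

end GaugeQK

end

open GaugeQK

open scoped Manifold ContDiff TensorProduct

noncomputable section

namespace GaugeQK

section

/-! ## Signs -/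

/-! Two determination principles carry the whole argument. First, every function on a patch is a sum
of monomials, a local function times a product of graded coordinates. A vector field or a morphism
is therefore determined by its values on coordinates, and homogeneous values of the right bidegree
can be prescribed freely (`IsVF.ext`, `exists_isVF`, `IsMorphism.ext`, `exists_isMorphism`). Second,
an operator that commutes with all `D_μ` and kills `x^μ` and `dx^μ` is determined by its values on
the fields `y_∅`, which are again free (`IsProl.eq`, `exists_isProl`). Bigraded commutators of such
operators are of the same kind (`IsProl.gcomm`), so each relation of a `QK_{vg}`-structure need only
be checked on fields.

On the universal side these checks amount to the Jacobi identity and to the covariance of `F`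
(`Q_Q_theta` to `Q_K_upsilon`). On the mapping space side the one relation with geometric content is
`[v_a, v_b] = f^c_{ab} v_c`. Relations with `L` use `L = d - E`, where `E` differentiates only the
explicit dependence on the `x^μ`. Since `d` commutes in the graded sense with prolonged operators, a
commutator with `L` is measured on fields by `E` (`gcomm_L_apply`). This also gives h-simplicity:
`[δ_λ, K] = [ι_λ, L]`, which on a field `y` equals `E ι_λ y = ∑ dx^μ ι_{∂_μ λ} y` near each point,
so it vanishes on horizontal functions. As `∂_μ λ` lives only on the chart, a bump function extends
it to a gauge parameter on `M` (`hasLocalPartials_gaugeComp`).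

For the Weil homomorphism the point is that `φ` and `υ` are polynomials in `θ`, `A`, their total
derivatives, `Qθ` and `QA`. The values `R_v` and `-R_m` are those forced by compatibility with `Q`.
An operator intertwined on `θ` and `A` is then intertwined everywhere, provided its commutator with
`Q` is under control (`IsWeilHom.intertwines_fields`): by `Q² = 0` for `Q`, by `QL = LQ` for `L`, by
`QK + KQ = L` for `K`. No Bianchi identity has to be computed. For `ι_λ` two properties of a
connection enter: `A(v_ξ) = ξ` gives `ι_λ A_v = λ`, and horizontality of the curvature gives `ι_λ
R_v = 0`. Then `ι_λ R_m = 0` follows by applying `K`, because `υ = -Kφ`.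

The geometric inputs are proved from the group action written in charts (`localAct`): fundamental
fields are images of left invariant fields under orbit maps (`lieBracket_vertField`), and
equivariance of the form makes its curvature vanish on fundamental vectors
(`fderiv_localForm_vertField`). Independence of the chart follows from the transformation laws of
`A_j` and `v_a^j` together with uniqueness of the Weil homomorphism. -/

theorem sgn_add_left (d d' e : ℤ × ℤ) : sgn (d + d') e = sgn d e * sgn d' e := by
  simp only [sgn, Prod.fst_add, Prod.snd_add]
  rw [show (d.1 + d'.1) * e.1 + (d.2 + d'.2) * e.2
    = (d.1 * e.1 + d.2 * e.2) + (d'.1 * e.1 + d'.2 * e.2) by ring, Int.negOnePow_add]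
  push_cast
  rfl

theorem sgn_comm (d e : ℤ × ℤ) : sgn d e = sgn e d := by
  simp only [sgn, mul_comm]

theorem sgn_add_right (d e e' : ℤ × ℤ) : sgn d (e + e') = sgn d e * sgn d e' := by
  rw [sgn_comm, sgn_add_left, sgn_comm e, sgn_comm e']

@[simp] theorem sgn_zero_left (e : ℤ × ℤ) : sgn 0 e = 1 := by simp [sgn]

@[simp] theorem sgn_zero_right (e : ℤ × ℤ) : sgn e 0 = 1 := by simp [sgn]

@[simp] theorem sgn_zero_left' (e : ℤ × ℤ) : sgn (0, 0) e = 1 := sgn_zero_left e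

@[simp] theorem sgn_zero_right' (e : ℤ × ℤ) : sgn e (0, 0) = 1 := sgn_zero_right e

theorem sgn_mul_self (d e : ℤ × ℤ) : sgn d e * sgn d e = 1 := by
  have h := Int.units_coe_mul_self (d.1 * e.1 + d.2 * e.2).negOnePow
  have h' := congrArg (fun u : ℤ => (u : ℝ)) h
  rwa [Int.cast_mul, Int.cast_one] at h'

theorem sgn_smul_smul {E : Type*} [AddCommGroup E] [Module ℝ E] (d e : ℤ × ℤ) (w : E) :
    sgn d e • sgn d e • w = w := by
  rw [smul_smul, sgn_mul_self, one_smul]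

theorem sgn_even {d e : ℤ × ℤ} (h : Even (d.1 * e.1 + d.2 * e.2)) : sgn d e = 1 := by
  simp [sgn, Int.negOnePow_even _ h]

theorem sgn_odd {d e : ℤ × ℤ} (h : Odd (d.1 * e.1 + d.2 * e.2)) : sgn d e = -1 := by
  simp [sgn, Int.negOnePow_odd _ h]

namespace Patch

variable {n : ℕ} {X : Patch n}

-- Shortcuts through the definition of `X.Fn` as a tensor product with a quotient of a free algebra.
scoped instance : Ring X.Fn := inferInstance
scoped instance : Semiring X.Fn := inferInstance
scoped instance : AddGroup X.Fn := inferInstance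
scoped instance : AddCommGroup X.Fn := inferInstance
scoped instance : AddCommMonoid X.Fn := inferInstance
scoped instance : AddMonoid X.Fn := inferInstance
scoped instance : Monoid X.Fn := inferInstance
scoped instance : NonUnitalNonAssocSemiring X.Fn := inferInstance
scoped instance : Algebra ℝ X.Fn := inferInstance
scoped instance : Module ℝ X.Fn := inferInstance
scoped instance : Mul X.Fn := inferInstance
scoped instance : Add X.Fn := inferInstance
scoped instance : Sub X.Fn := inferInstance
scoped instance : Neg X.Fn := inferInstance
scoped instance : Zero X.Fn := inferInstance
scoped instance : One X.Fn := inferInstance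
scoped instance : SMul ℝ X.Fn := inferInstance

/-! ## Monomials and graded commutativity -/

theorem gen_mul_gen (v v' : GenCoord n X.C) :
    X.gen v * X.gen v' = sgn (X.gdeg v) (X.gdeg v') • (X.gen v' * X.gen v) := by
  simp only [gen, Algebra.TensorProduct.tmul_mul_tmul, mul_one, ← map_mul]
  rw [RingQuot.mkAlgHom_rel ℝ (GSymRel.comm v v'), map_smul, TensorProduct.tmul_smul]

theorem incl_eq (F : LocFun X.dom) :
    X.incl F = (Algebra.TensorProduct.includeLeft : LocFun X.dom →ₐ[ℝ] X.Fn) F := rfl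

@[simp] theorem incl_mul (F F' : LocFun X.dom) : X.incl (F * F') = X.incl F * X.incl F' := by
  simp only [incl_eq, map_mul]

@[simp] theorem incl_add (F F' : LocFun X.dom) : X.incl (F + F') = X.incl F + X.incl F' := by
  simp only [incl_eq, map_add]

@[simp] theorem incl_smul (r : ℝ) (F : LocFun X.dom) : X.incl (r • F) = r • X.incl F := by
  simp only [incl_eq, map_smul]

@[simp] theorem incl_one : X.incl 1 = 1 := by simp only [incl_eq, map_one]

@[simp] theorem incl_zero : X.incl 0 = 0 := by simp only [incl_eq, map_zero]

theorem incl_sum {ι : Type*} (s : Finset ι) (F : ι → LocFun X.dom) :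
    X.incl (∑ i ∈ s, F i) = ∑ i ∈ s, X.incl (F i) := by simp only [incl_eq, map_sum]

/-- No sign and no homogeneity is needed: the left tensor factor is commutative and commutes with
the right one. -/
theorem incl_comm (F : LocFun X.dom) (w : X.Fn) : X.incl F * w = w * X.incl F := by
  induction w using TensorProduct.induction_on with
  | zero => simp
  | tmul G s => simp [incl, Algebra.TensorProduct.tmul_mul_tmul, mul_comm]
  | add a b ha hb => rw [mul_add, add_mul, ha, hb]

theorem incl_left_comm (F : LocFun X.dom) (w η : X.Fn) :
    w * (X.incl F * η) = X.incl F * (w * η) := by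
  rw [← mul_assoc, ← incl_comm, mul_assoc]

/-- Monomials in the graded coordinates, with coefficients in the local functions. -/
def mono (F : LocFun X.dom) (l : List (GenCoord n X.C)) : X.Fn := X.incl F * (l.map X.gen).prod

theorem mono_mul (F F' : LocFun X.dom) (l l' : List (GenCoord n X.C)) :
    mono F l * mono F' l' = mono (F * F') (l ++ l') := by
  simp only [mono, List.map_append, List.prod_append, incl_mul]
  rw [mul_assoc, incl_left_comm, ← mul_assoc, mul_assoc]

theorem gen_eq (v : GenCoord n X.C) :
    X.gen v = (Algebra.TensorProduct.includeRight : GSym X.gdeg →ₐ[ℝ] X.Fn)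
      (RingQuot.mkAlgHom ℝ (GSymRel X.gdeg) (FreeAlgebra.ι ℝ v)) := rfl

theorem tmul_eq (F : LocFun X.dom) (s : GSym X.gdeg) :
    (F ⊗ₜ[ℝ] s : X.Fn) = X.incl F * (Algebra.TensorProduct.includeRight : _ →ₐ[ℝ] X.Fn) s := by
  simp [incl, Algebra.TensorProduct.tmul_mul_tmul]

/-- Words in the generators span the free algebra, hence its quotient. The span is closed under
products because words can be concatenated. -/
theorem includeRight_mem_span (s : GSym X.gdeg) :
    (Algebra.TensorProduct.includeRight : _ →ₐ[ℝ] X.Fn) s ∈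
      Submodule.span ℝ (Set.range fun l : List (GenCoord n X.C) => (l.map X.gen).prod) := by
  obtain ⟨a, rfl⟩ := RingQuot.mkAlgHom_surjective ℝ (GSymRel X.gdeg) s
  induction a using FreeAlgebra.induction with
  | grade0 r =>
    rw [AlgHom.commutes, AlgHom.commutes, Algebra.algebraMap_eq_smul_one]
    exact Submodule.smul_mem _ _ (Submodule.subset_span ⟨[], by simp⟩)
  | grade1 v => exact Submodule.subset_span ⟨[v], by simp [gen_eq]⟩
  | mul a b ha hb =>
    rw [map_mul, map_mul]
    have := Submodule.mul_mem_mul ha hb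
    rw [Submodule.span_mul_span] at this
    refine Submodule.span_mono ?_ this
    rintro _ ⟨_, ⟨l, rfl⟩, _, ⟨l', rfl⟩, rfl⟩
    exact ⟨l ++ l', by simp⟩
  | add a b ha hb =>
    rw [map_add, map_add]
    exact add_mem ha hb

/-- Every function on the bigraded manifold is a sum of monomials. -/
theorem span_mono_eq_top :
    Submodule.span ℝ {w : X.Fn | ∃ F l, w = mono F l} = ⊤ := by
  rw [eq_top_iff]
  rintro w -
  induction w using TensorProduct.induction_on with
  | zero => exact zero_mem _
  | add a b ha hb => exact add_mem ha hb
  | tmul F s =>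
    rw [tmul_eq]
    have h := includeRight_mem_span s
    refine Submodule.span_induction (p := fun w _ => X.incl F * w ∈
      Submodule.span ℝ {w : X.Fn | ∃ F l, w = mono F l}) ?_ (by simp)
      (fun a b _ _ ha hb => by rw [mul_add]; exact add_mem ha hb)
      (fun r a _ ha => by rw [mul_smul_comm]; exact Submodule.smul_mem _ _ ha) h
    rintro _ ⟨l, rfl⟩
    exact Submodule.subset_span ⟨F, l, rfl⟩

/-- Real scalars can be absorbed into the coefficient of a monomial, so the induction has no case
for scalars, and zero is itself a monomial. -/
theorem fn_induction {p : X.Fn → Prop} (mono : ∀ F l, p (mono F l))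
    (add : ∀ a b, p a → p b → p (a + b)) (w : X.Fn) : p w := by
  have h : w ∈ Submodule.span ℝ {w : X.Fn | ∃ F l, w = Patch.mono F l} := by
    rw [span_mono_eq_top]; trivial
  rw [Submodule.mem_span_iff_exists_finset_subset] at h
  obtain ⟨c, t, ht, -, rfl⟩ := h
  refine Finset.sum_induction _ p add ?_ fun i hi => ?_
  · have := mono 0 []
    rwa [Patch.mono, incl_zero, zero_mul] at this
  · obtain ⟨F, l, h⟩ := ht hi
    have := mono (c i • F) l
    rwa [Patch.mono, incl_smul, smul_mul_assoc, ← Patch.mono, ← h] at this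

theorem mono_mem_homog (F : LocFun X.dom) (l : List (GenCoord n X.C)) :
    mono F l ∈ X.homog (l.map X.gdeg).sum :=
  Submodule.subset_span ⟨F, l, rfl, rfl⟩

/-- Unlike in `fn_induction`, zero is a separate case: there may be no monomial of bidegree `e` at
all. -/
theorem homog_induction {e : ℤ × ℤ} {p : X.Fn → Prop}
    (mono : ∀ F l, (l.map X.gdeg).sum = e → p (mono F l)) (zero : p 0)
    (add : ∀ a b, p a → p b → p (a + b)) {w : X.Fn} (h : w ∈ X.homog e) : p w := by
  have hset : X.homog e = Submodule.span ℝ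
      {w : X.Fn | ∃ F l, (l.map X.gdeg).sum = e ∧ w = Patch.mono F l} := rfl
  rw [hset, Submodule.mem_span_iff_exists_finset_subset] at h
  obtain ⟨c, t, ht, -, rfl⟩ := h
  refine Finset.sum_induction _ p add zero fun i hi => ?_
  obtain ⟨F, l, hl, h⟩ := ht hi
  have := mono (c i • F) l hl
  rwa [Patch.mono, incl_smul, smul_mul_assoc, ← Patch.mono, ← h] at this

theorem incl_mem (F : LocFun X.dom) : X.incl F ∈ X.homog 0 := by
  simpa [mono] using mono_mem_homog F ([] : List (GenCoord n X.C))

theorem gen_mem (v : GenCoord n X.C) : X.gen v ∈ X.homog (X.gdeg v) := by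
  simpa [mono] using mono_mem_homog (1 : LocFun X.dom) [v]

theorem one_mem_homog : (1 : X.Fn) ∈ X.homog 0 := by
  rw [← incl_one]; exact incl_mem _

theorem mul_mem_homog {d e : ℤ × ℤ} {w η : X.Fn} (hw : w ∈ X.homog d) (hη : η ∈ X.homog e) :
    w * η ∈ X.homog (d + e) := by
  refine homog_induction (p := fun w => w * η ∈ X.homog (d + e)) ?_ (by simp)
    (fun a b ha hb => by rw [add_mul]; exact add_mem ha hb) hw
  intro F l hl
  refine homog_induction (p := fun η => mono F l * η ∈ X.homog (d + e)) ?_ (by simp)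
    (fun a b ha hb => by rw [mul_add]; exact add_mem ha hb) hη
  intro F' l' hl'
  rw [mono_mul]
  have := mono_mem_homog (F * F') (l ++ l')
  rwa [List.map_append, List.sum_append, hl, hl'] at this

theorem homog_congr {d e : ℤ × ℤ} {w : X.Fn} (hw : w ∈ X.homog d) (h : d = e) :
    w ∈ X.homog e := h ▸ hw

theorem prod_gen_mul_gen (l : List (GenCoord n X.C)) (v : GenCoord n X.C) :
    (l.map X.gen).prod * X.gen v =
      sgn (l.map X.gdeg).sum (X.gdeg v) • (X.gen v * (l.map X.gen).prod) := by
  induction l with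
  | nil => simp
  | cons a l ih =>
    simp only [List.map_cons, List.prod_cons, List.sum_cons]
    rw [mul_assoc, ih, mul_smul_comm, ← mul_assoc, gen_mul_gen, sgn_add_left, smul_mul_assoc,
      smul_smul, mul_assoc, mul_comm (sgn _ _)]

theorem prod_gen_mul_prod_gen (l l' : List (GenCoord n X.C)) :
    (l.map X.gen).prod * (l'.map X.gen).prod =
      sgn (l.map X.gdeg).sum (l'.map X.gdeg).sum •
        ((l'.map X.gen).prod * (l.map X.gen).prod) := by
  induction l' with
  | nil => simp
  | cons a l' ih =>
    simp only [List.map_cons, List.prod_cons, List.sum_cons]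
    rw [← mul_assoc, prod_gen_mul_gen, smul_mul_assoc, mul_assoc, ih, mul_smul_comm, smul_smul,
      sgn_add_right, mul_assoc]

/-- Graded commutativity. -/
theorem homog_comm {d e : ℤ × ℤ} {w η : X.Fn} (hw : w ∈ X.homog d) (hη : η ∈ X.homog e) :
    w * η = sgn d e • (η * w) := by
  refine homog_induction (p := fun w => w * η = sgn d e • (η * w)) ?_ (by simp)
    (fun a b ha hb => by rw [add_mul, mul_add, smul_add, ha, hb]) hw
  intro F l hl
  refine homog_induction (p := fun η => mono F l * η = sgn d e • (η * mono F l)) ?_ (by simp)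
    (fun a b ha hb => by rw [add_mul, mul_add, smul_add, ha, hb]) hη
  intro F' l' hl'
  rw [mono_mul, mono_mul]
  simp only [mono, List.map_append, List.prod_append]
  rw [prod_gen_mul_prod_gen, hl, hl', mul_smul_comm, mul_comm F]

/-! ## Evaluation of the local coefficients at a point -/

/-- Evaluation of local functions. -/
def evalLoc {β : Type} {dom : Set (β → ℝ)} (p : dom) : LocFun dom →ₐ[ℝ] ℝ :=
  (Pi.evalAlgHom ℝ (fun _ : dom => ℝ) p).comp (LocFun dom).val

/-- Evaluation of the local coefficients of a function on a bigraded manifold. -/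
def evalAt (p : X.dom) : X.Fn →ₐ[ℝ] GSym X.gdeg :=
  Algebra.TensorProduct.lift ((Algebra.ofId ℝ (GSym X.gdeg)).comp (evalLoc p)) (AlgHom.id ℝ _)
    fun F _ => Algebra.commutes (evalLoc p F) _

theorem evalAt_tmul (p : X.dom) (F : LocFun X.dom) (s : GSym X.gdeg) :
    evalAt p (F ⊗ₜ s : X.Fn) = F.1 p • s := by
  rw [Algebra.smul_def]
  exact Algebra.TensorProduct.lift_tmul _ _ _ _ _

@[simp] theorem evalAt_incl (p : X.dom) (F : LocFun X.dom) :
    evalAt p (X.incl F) = algebraMap ℝ _ (F.1 p) := by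
  rw [incl, evalAt_tmul, Algebra.algebraMap_eq_smul_one]

open Classical in
-- Over a field the symmetric algebra is free, so an element of the tensor product is a finite
-- combination of basis vectors with local functions as coefficients. Evaluation at points recovers
-- these coefficients.
theorem exists_basis_expansion {κ : Type*} (b : Module.Basis κ ℝ (GSym X.gdeg)) (w : X.Fn) :
    ∃ c : κ →₀ LocFun X.dom,
      w = (c.sum fun i F => (F ⊗ₜ b i : X.Fn)) ∧ ∀ p i, (c i).1 p = b.repr (evalAt p w) i := by
  refine ⟨TensorProduct.equivFinsuppOfBasisRight b w, ?_, ?_⟩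
  · rw [← TensorProduct.equivFinsuppOfBasisRight_symm_apply, LinearEquiv.symm_apply_apply]
  · intro p i
    induction w using TensorProduct.induction_on with
    | zero => simp
    | tmul F s =>
      rw [TensorProduct.equivFinsuppOfBasisRight_apply_tmul_apply, evalAt_tmul]
      simp [mul_comm]
    | add a b ha hb =>
      rw [map_add, Finsupp.add_apply, map_add, map_add, Finsupp.add_apply, ← ha, ← hb]
      rfl

/-- A function on a bigraded manifold is determined by the values of its local coefficients. -/
theorem ext_evalAt {w η : X.Fn} (h : ∀ p, evalAt p w = evalAt p η) : w = η := by
  rw [← sub_eq_zero]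
  obtain ⟨c, hc, hc'⟩ := exists_basis_expansion (Module.Basis.ofVectorSpace ℝ (GSym X.gdeg)) (w - η)
  have : c = 0 := by
    ext i p
    rw [hc', map_sub, h, sub_self]
    simp
  rw [hc, this, Finsupp.sum_zero_index]

theorem algebraMap_gsym_injective : Function.Injective (algebraMap ℝ (GSym X.gdeg)) := by
  -- The augmentation that kills all generators respects the relations, both sides being sent to
  -- zero; it is a left inverse of the scalars.
  let aug : GSym X.gdeg →ₐ[ℝ] ℝ := RingQuot.liftAlgHom ℝ ⟨FreeAlgebra.lift ℝ fun _ => 0, by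
    rintro _ _ ⟨v, v'⟩
    simp⟩
  intro a b h
  have := congrArg aug h
  simpa using this

theorem incl_injective : Function.Injective X.incl := by
  intro F F' h
  ext p
  have := congrArg (evalAt p) h
  rw [evalAt_incl, evalAt_incl] at this
  exact algebraMap_gsym_injective this

end Patch

end

section

/-! ## Partial derivatives of local functions -/

section LocalFunctions

open Classical Filter Topology

variable {β : Type} {dom : Set (β → ℝ)}

/-- `F` is the smooth function `g` of the coordinates in `s`. -/
def IsRep (s : Finset β) (g : (s → ℝ) → ℝ) (F : dom → ℝ) : Prop :=
  ContDiffOn ℝ ∞ g (restr s '' dom) ∧ ∀ p : dom, F p = g (restr s p.1)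

/-- Near a projected point, a nearby value of the finitely many coordinates lifts to `dom` by
keeping the other coordinates of `p`. The lift is continuous for the product topology. Openness is
what makes derivatives of representing functions meaningful. -/
theorem isOpen_restr_image (hd : IsOpen dom) (s : Finset β) : IsOpen (restr s '' dom) := by
  rw [isOpen_iff_mem_nhds]
  rintro _ ⟨p, hp, rfl⟩
  let ext : (s → ℝ) → β → ℝ := fun y i => if h : i ∈ s then y ⟨i, h⟩ else p i
  have hext : Continuous ext := by
    refine continuous_pi fun i => ?_
    by_cases h : i ∈ s
    · simpa [ext, h] using continuous_apply _
    · simpa [ext, h] using continuous_const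
  have h0 : ext (restr s p) = p := by
    ext i
    by_cases h : i ∈ s <;> simp [ext, h, restr]
  have h1 : ∀ y, restr s (ext y) = y := by
    intro y
    ext i
    simp [ext, restr]
  have h2 : ext ⁻¹' dom ∈ 𝓝 (restr s p) :=
    hext.continuousAt.preimage_mem_nhds (by rw [h0]; exact hd.mem_nhds hp)
  filter_upwards [h2] with y hy
  exact ⟨ext y, hy, h1 y⟩

theorem IsRep.mono {s s' : Finset β} {g : (s → ℝ) → ℝ} {F : dom → ℝ} (h : IsRep s g F)
    (hs : s ⊆ s') : IsRep s' (fun y => g fun i => y ⟨i.1, hs i.2⟩) F := by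
  refine ⟨h.1.comp (f := fun (y : s' → ℝ) (i : s) => y ⟨i.1, hs i.2⟩) (by fun_prop) ?_, h.2⟩
  rintro _ ⟨p, hp, rfl⟩
  exact ⟨p, hp, rfl⟩

/-- Extension by zero. -/
def extendZero (F : dom → ℝ) (p : β → ℝ) : ℝ := if h : p ∈ dom then F ⟨p, h⟩ else 0

theorem extendZero_of_mem (F : dom → ℝ) {p : β → ℝ} (h : p ∈ dom) :
    extendZero F p = F ⟨p, h⟩ := dif_pos h

/-- The partial derivative by the coordinate `i`. -/
def pdFun (i : β) (F : dom → ℝ) (p : dom) : ℝ :=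
  deriv (fun t => extendZero F (Function.update p.1 i t)) (p.1 i)

theorem eventually_update_mem {O : Set (β → ℝ)} (hO : IsOpen O) {p : β → ℝ} (hp : p ∈ O) (i : β) :
    ∀ᶠ t in 𝓝 (p i), Function.update p i t ∈ O := by
  have hc : Continuous fun t : ℝ => Function.update p i t := continuous_const.update i continuous_id
  exact hc.continuousAt.preimage_mem_nhds (by simpa using hO.mem_nhds hp)

/-- The left side does not mention `s` or `g`. Hence all representations of a local function have
the same partial derivatives, with the value zero for coordinates that a representation does not
use. -/
theorem IsRep.hasDerivAt (hd : IsOpen dom) {s : Finset β} {g : (s → ℝ) → ℝ} {F : dom → ℝ}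
    (h : IsRep s g F) (i : β) (p : dom) :
    HasDerivAt (fun t => extendZero F (Function.update p.1 i t))
      (if hi : i ∈ s then fderiv ℝ g (restr s p.1) (Pi.single ⟨i, hi⟩ 1) else 0) (p.1 i) := by
  have hev : (fun t => extendZero F (Function.update p.1 i t)) =ᶠ[𝓝 (p.1 i)]
      fun t => g (restr s (Function.update p.1 i t)) := by
    filter_upwards [eventually_update_mem hd p.2 i] with t ht
    rw [extendZero_of_mem F ht, h.2]
  refine HasDerivAt.congr_of_eventuallyEq ?_ hev
  split_ifs with hi
  · have hu : (fun t => restr s (Function.update p.1 i t)) =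
        fun t => Function.update (restr s p.1) ⟨i, hi⟩ t := by
      ext t j
      by_cases hj : j = ⟨i, hi⟩
      · subst hj; simp [restr]
      · have : (j : β) ≠ i := fun h => hj (Subtype.ext h)
        simp [restr, hj, this]
    have hg : HasFDerivAt g (fderiv ℝ g (restr s p.1)) (restr s p.1) :=
      ((h.1.contDiffAt ((isOpen_restr_image hd s).mem_nhds ⟨p.1, p.2, rfl⟩)).differentiableAt
        (by simp)).hasFDerivAt
    have hupd := hasDerivAt_update (restr s p.1) ⟨i, hi⟩ (p.1 i)
    have h0 : Function.update (restr s p.1) ⟨i, hi⟩ (p.1 i) = restr s p.1 := by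
      rw [Function.update_eq_self_iff]; rfl
    rw [← h0] at hg
    have := hg.comp_hasDerivAt (p.1 i) hupd
    rw [h0] at this
    simp only [Function.comp_def] at this
    simpa only [← congrFun hu] using this
  · have hu : (fun t => g (restr s (Function.update p.1 i t))) = fun _ => g (restr s p.1) := by
      ext t
      congr 1
      ext j
      have : (j : β) ≠ i := fun h => hi (h ▸ j.2)
      simp [restr, this]
    rw [hu]
    exact hasDerivAt_const _ _

theorem IsRep.pdFun_eq (hd : IsOpen dom) {s : Finset β} {g : (s → ℝ) → ℝ} {F : dom → ℝ}
    (h : IsRep s g F) (i : β) (p : dom) :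
    pdFun i F p =
      if hi : i ∈ s then fderiv ℝ g (restr s p.1) (Pi.single ⟨i, hi⟩ 1) else 0 :=
  (h.hasDerivAt hd i p).deriv

theorem IsRep.pd (hd : IsOpen dom) {s : Finset β} {g : (s → ℝ) → ℝ} {F : dom → ℝ}
    (h : IsRep s g F) (i : s) :
    IsRep s (fun y => fderiv ℝ g y (Pi.single i 1)) (pdFun i.1 F) := by
  refine ⟨?_, fun p => by rw [h.pdFun_eq hd, dif_pos i.2]⟩
  exact (h.1.fderiv_of_isOpen (isOpen_restr_image hd s) (m := ∞) (by simp)).clm_apply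
    contDiffOn_const

theorem IsLocal.exists_rep {F : dom → ℝ} (h : IsLocal dom F) (s₀ : Finset β) :
    ∃ s g, s₀ ⊆ s ∧ IsRep s g F := by
  obtain ⟨s, g, hg⟩ := h
  exact ⟨s₀ ∪ s, _, Finset.subset_union_left, IsRep.mono hg Finset.subset_union_right⟩

theorem IsLocal.pdFun (hd : IsOpen dom) {F : dom → ℝ} (h : IsLocal dom F) (i : β) :
    IsLocal dom (pdFun i F) := by
  obtain ⟨s, g, hs, hg⟩ := h.exists_rep {i}
  exact ⟨s, _, hg.pd hd ⟨i, hs (Finset.mem_singleton_self i)⟩⟩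

theorem IsLocal.hasDerivAt (hd : IsOpen dom) {F : dom → ℝ} (h : IsLocal dom F) (i : β) (p : dom) :
    HasDerivAt (fun t => extendZero F (Function.update p.1 i t)) (GaugeQK.pdFun i F p) (p.1 i) := by
  obtain ⟨s, g, hg⟩ := h
  have := IsRep.hasDerivAt hd hg i p
  rwa [← IsRep.pdFun_eq hd hg] at this

/-- The partial derivative by the coordinate `i`, on local functions. -/
def pd (hd : IsOpen dom) (i : β) : LocFun dom →ₗ[ℝ] LocFun dom where
  toFun F := ⟨pdFun i F.1, F.2.pdFun hd i⟩
  map_add' F F' := by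
    ext p
    refine ((((F.2.hasDerivAt hd i p).add (F'.2.hasDerivAt hd i p)).congr_of_eventuallyEq
      ?_).deriv :)
    filter_upwards [eventually_update_mem hd p.2 i] with t ht
    simp [extendZero_of_mem _ ht]
  map_smul' r F := by
    ext p
    refine (((F.2.hasDerivAt hd i p).const_mul r).congr_of_eventuallyEq ?_).deriv
    filter_upwards [eventually_update_mem hd p.2 i] with t ht
    simp [extendZero_of_mem _ ht]

theorem pd_apply (hd : IsOpen dom) (i : β) (F : LocFun dom) (p : dom) :
    (pd hd i F).1 p = pdFun i F.1 p := rfl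

theorem pd_eq_of_hasDerivAt (hd : IsOpen dom) {i : β} {F : LocFun dom} {p : dom} {f : ℝ → ℝ} {c : ℝ}
    (h : HasDerivAt f c (p.1 i))
    (he : ∀ t (ht : Function.update p.1 i t ∈ dom), F.1 ⟨_, ht⟩ = f t) : (pd hd i F).1 p = c := by
  refine (h.congr_of_eventuallyEq ?_).deriv
  filter_upwards [eventually_update_mem hd p.2 i] with t ht
  rw [extendZero_of_mem _ ht, he]

theorem pd_hasDerivAt (hd : IsOpen dom) (i : β) (F : LocFun dom) (p : dom) :
    HasDerivAt (fun t => extendZero F.1 (Function.update p.1 i t)) ((pd hd i F).1 p) (p.1 i) :=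
  F.2.hasDerivAt hd i p

theorem extendZero_update_self (F : dom → ℝ) (i : β) (p : dom) :
    extendZero F (Function.update p.1 i (p.1 i)) = F p := by
  rw [Function.update_eq_self, extendZero_of_mem F p.2]

theorem pd_mul (hd : IsOpen dom) (i : β) (F F' : LocFun dom) :
    pd hd i (F * F') = pd hd i F * F' + F * pd hd i F' := by
  ext p
  refine (pd_eq_of_hasDerivAt hd ((pd_hasDerivAt hd i F p).mul (pd_hasDerivAt hd i F' p)) ?_).trans
    ?_
  · intro t ht
    simp [extendZero_of_mem _ ht]
  · simp only [extendZero_update_self]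
    rfl

theorem pd_one (hd : IsOpen dom) (i : β) : pd hd i (1 : LocFun dom) = 0 := by
  have := pd_mul hd i (1 : LocFun dom) 1
  simpa using this

/-- This keeps the sum in the chain rule finite although there are infinitely many jet coordinates.
-/
theorem exists_pd_support (hd : IsOpen dom) (F : LocFun dom) :
    ∃ s : Finset β, ∀ i ∉ s, pd hd i F = 0 := by
  obtain ⟨s, g, hg⟩ := F.2
  refine ⟨s, fun i hi => ?_⟩
  ext p
  rw [pd_apply, IsRep.pdFun_eq hd hg, dif_neg hi]
  rfl

theorem pd_comm (hd : IsOpen dom) (i j : β) (F : LocFun dom) :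
    pd hd i (pd hd j F) = pd hd j (pd hd i F) := by
  -- With both coordinates in the representing set, the claim is the symmetry of the second
  -- derivative of `g`.
  obtain ⟨s, g, hs, hg⟩ := F.2.exists_rep {i, j}
  have hi : i ∈ s := hs (by simp)
  have hj : j ∈ s := hs (by simp)
  ext p
  have h1 := (hg.pd hd ⟨j, hj⟩).pdFun_eq hd i p
  have h2 := (hg.pd hd ⟨i, hi⟩).pdFun_eq hd j p
  rw [dif_pos hi] at h1
  rw [dif_pos hj] at h2
  have hgs : ContDiffAt ℝ ∞ g (restr s p.1) :=
    hg.1.contDiffAt ((isOpen_restr_image hd s).mem_nhds ⟨p.1, p.2, rfl⟩)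
  have hd' : DifferentiableAt ℝ (fderiv ℝ g) (restr s p.1) :=
    (hgs.fderiv_right (m := 1) (by norm_cast)).differentiableAt (by simp)
  have hsymm : IsSymmSndFDerivAt ℝ g (restr s p.1) :=
    hgs.isSymmSndFDerivAt (by
      rw [minSmoothness_of_isRCLikeNormedField]
      exact ENat.LEInfty.out)
  change pdFun i (pdFun j F.1) p = pdFun j (pdFun i F.1) p
  rw [h1, h2, fderiv_clm_apply hd' (by fun_prop), fderiv_clm_apply hd' (by fun_prop)]
  simpa using hsymm _ _

/-- A coordinate, as a local function. -/
def coordLoc (i : β) : LocFun dom :=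
  ⟨fun p => p.1 i, {i}, fun y => y ⟨i, Finset.mem_singleton_self i⟩,
    (contDiff_apply ℝ ℝ _).contDiffOn, fun _ => rfl⟩

theorem pd_coordLoc (hd : IsOpen dom) (i j : β) :
    pd hd i (coordLoc j : LocFun dom) = if i = j then 1 else 0 := by
  ext p
  split_ifs with h
  · subst h
    refine pd_eq_of_hasDerivAt hd (hasDerivAt_id _) fun t ht => ?_
    simp [coordLoc]
  · refine pd_eq_of_hasDerivAt hd (hasDerivAt_const (p.1 i) (p.1 j)) fun t ht => ?_
    simp [coordLoc, Ne.symm h]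

/-- Partial derivatives see only the germ of a function. The locality of vector fields, and through
it h-simplicity, depends on this. -/
theorem pd_congr_on (hd : IsOpen dom) {O : Set (β → ℝ)} (hO : IsOpen O) {F F' : LocFun dom}
    (h : ∀ q : dom, q.1 ∈ O → F.1 q = F'.1 q) (i : β) (p : dom) (hp : p.1 ∈ O) :
    (pd hd i F).1 p = (pd hd i F').1 p := by
  refine ((pd_hasDerivAt hd i F' p).congr_of_eventuallyEq ?_).deriv
  filter_upwards [eventually_update_mem hd p.2 i, eventually_update_mem hO hp i] with t ht ht'
  rw [extendZero_of_mem _ ht, extendZero_of_mem _ ht, h _ ht']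

/-! ### Smooth functions of local functions -/

theorem exists_common_rep {ι : Type*} [Fintype ι] (t : ι → LocFun dom) :
    ∃ (s : Finset β) (g : ι → (s → ℝ) → ℝ), ∀ i, IsRep s (g i) (t i).1 := by
  choose s g hg using fun i => (t i).2
  exact ⟨Finset.univ.biUnion s, _, fun i =>
    IsRep.mono (hg i) (Finset.subset_biUnion_of_mem s (Finset.mem_univ i))⟩

theorem IsLocal.comp {ι : Type*} [Fintype ι] {g : (ι → ℝ) → ℝ} {S : Set (ι → ℝ)}
    (hg : ContDiffOn ℝ ∞ g S) (t : ι → LocFun dom) (ht : ∀ p, (fun i => (t i).1 p) ∈ S) :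
    IsLocal dom fun p => g fun i => (t i).1 p := by
  obtain ⟨s, h, hh⟩ := exists_common_rep t
  refine ⟨s, fun y => g fun i => h i y, ?_, fun p => ?_⟩
  · refine hg.comp (f := fun y i => h i y) (contDiffOn_pi.2 fun i => (hh i).1) ?_
    rintro _ ⟨p, hp, rfl⟩
    have := ht ⟨p, hp⟩
    simpa only [(hh _).2] using this
  · simp only [(hh _).2]

theorem pd_comp (hd : IsOpen dom) {ι : Type*} [Fintype ι] {g : (ι → ℝ) → ℝ}
    (t : ι → LocFun dom) {F : LocFun dom}
    (hF : ∀ p, F.1 p = g fun i => (t i).1 p) (j : β) (p : dom)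
    (hg : DifferentiableAt ℝ g fun i => (t i).1 p) :
    (pd hd j F).1 p =
      ∑ i, fderiv ℝ g (fun i => (t i).1 p) (Pi.single i 1) * (pd hd j (t i)).1 p := by
  have h1 : HasDerivAt (fun y i => extendZero (t i).1 (Function.update p.1 j y))
      (fun i => (pd hd j (t i)).1 p) (p.1 j) := hasDerivAt_pi.2 fun i => pd_hasDerivAt hd j (t i) p
  have h0 : (fun i => extendZero (t i).1 (Function.update p.1 j (p.1 j))) = fun i => (t i).1 p := by
    ext i
    rw [extendZero_update_self]
  have h2 := hg.hasFDerivAt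
  rw [← h0] at h2
  have h3 := h2.comp_hasDerivAt (p.1 j) h1
  rw [h0] at h3
  rw [pd_eq_of_hasDerivAt hd h3]
  · conv_lhs => rw [← Finset.univ_sum_single fun i => (pd hd j (t i)).1 p]
    rw [map_sum]
    refine Finset.sum_congr rfl fun i _ => ?_
    rw [show Pi.single i ((pd hd j (t i)).1 p) = (pd hd j (t i)).1 p • Pi.single (M := fun _ => ℝ) i 1
      by rw [← Pi.single_smul]; simp, map_smul, smul_eq_mul, mul_comm]
  · intro y hy
    rw [hF]
    simp [extendZero_of_mem _ hy]

end LocalFunctions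

end

section

namespace Patch

variable {n : ℕ} {X : Patch n}

open Classical

/-! ## Vector fields as a property of linear maps -/

theorem ofFun_of_isLocal {F : X.dom → ℝ} (h : IsLocal X.dom F) : X.ofFun F = X.incl ⟨F, h⟩ :=
  dif_pos h

theorem base_eq (i : BaseCoord n X.B) : X.base i = X.incl (coordLoc i) :=
  ofFun_of_isLocal (coordLoc i : LocFun X.dom).2

theorem base_mem (i : BaseCoord n X.B) : X.base i ∈ X.homog 0 := by
  rw [base_eq]; exact incl_mem _

theorem prod_gen_mem (l : List (GenCoord n X.C)) :
    (l.map X.gen).prod ∈ X.homog (l.map X.gdeg).sum := by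
  simpa [mono] using mono_mem_homog (1 : LocFun X.dom) l

theorem dx_mem (μ : Fin n) : X.dx μ ∈ X.homog (1, 0) := gen_mem (GenCoord.dx μ)

/-- Vector fields of bidegree `d`, as a property of linear maps. -/
structure IsVF (hX : IsOpen X.dom) (d : ℤ × ℤ) (f : X.Fn →ₗ[ℝ] X.Fn) : Prop where
  map_homog : ∀ {e w}, w ∈ X.homog e → f w ∈ X.homog (e + d)
  leibniz : ∀ {e w}, w ∈ X.homog e → ∀ η, f (w * η) = f w * η + sgn d e • (w * f η)
  chain : ∀ (F : LocFun X.dom) (s : Finset (BaseCoord n X.B)), (∀ i ∉ s, pd hX i F = 0) →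
    f (X.incl F) = ∑ i ∈ s, X.incl (pd hX i F) * f (X.base i)

/-- Both sums equal the sum over the union of the two supports. The chain rule may thus be used with
any finite set that carries the derivatives. -/
theorem sum_pd_eq (hX : IsOpen X.dom) (bv : BaseCoord n X.B → X.Fn) (F : LocFun X.dom)
    {s s' : Finset (BaseCoord n X.B)} (h : ∀ i ∉ s, pd hX i F = 0) (h' : ∀ i ∉ s', pd hX i F = 0) :
    ∑ i ∈ s, X.incl (pd hX i F) * bv i = ∑ i ∈ s', X.incl (pd hX i F) * bv i := by
  rw [Finset.sum_subset (Finset.subset_union_left (s₂ := s')) fun i _ hi => by simp [h i hi],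
    ← Finset.sum_subset (Finset.subset_union_right (s₁ := s)) fun i _ hi => by simp [h' i hi]]

/-- The chain rule of `VectorField` refers to a representing function; here it passes to the
intrinsic derivatives `pd`. From here on vector fields are treated as linear maps with a property,
so that sums and commutators can be formed freely. -/
theorem VectorField.isVF (hX : IsOpen X.dom) {d : ℤ × ℤ} (V : X.VectorField d) :
    IsVF hX d V.toLin where
  map_homog h := V.map_homog _ _ h
  leibniz h η := V.leibniz _ _ h η
  chain F s hs := by
    obtain ⟨s₀, g, hg⟩ := F.2
    rw [V.chain s₀ g F (fun i => pd hX i F) hg.1 hg.2 fun i p => by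
      rw [pd_apply, IsRep.pdFun_eq hX hg, dif_pos i.2]]
    rw [Finset.sum_coe_sort s₀ fun i => X.incl (pd hX i F) * V.toLin (X.base i)]
    refine sum_pd_eq hX _ F (fun i hi => ?_) hs
    ext p
    rw [pd_apply, IsRep.pdFun_eq hX hg, dif_neg hi]
    rfl

/-- The vector field given by a linear map with the properties of a vector field. -/
def IsVF.toVectorField {hX : IsOpen X.dom} {d : ℤ × ℤ} {f : X.Fn →ₗ[ℝ] X.Fn} (h : IsVF hX d f) :
    X.VectorField d where
  toLin := f
  map_homog _ _ hw := h.map_homog hw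
  leibniz _ _ hw η := h.leibniz hw η
  chain s g F G hg hF hG := by
    have hrep : IsRep s g F.1 := ⟨hg, hF⟩
    rw [h.chain F s, ← Finset.sum_coe_sort s fun i => X.incl (pd hX i F) * f (X.base i)]
    · refine Finset.sum_congr rfl fun i _ => ?_
      congr 2
      ext p
      rw [hG, pd_apply, hrep.pdFun_eq hX, dif_pos i.2]
    · intro i hi
      ext p
      rw [pd_apply, hrep.pdFun_eq hX, dif_neg hi]
      rfl

/-! ### Uniqueness -/

/-- Two derivations along an algebra homomorphism `Ψ` which agree on local functions and on the
graded coordinates are equal. -/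
theorem derivation_ext {Z : Type*} [Ring Z] [Algebra ℝ Z] (Ψ : X.Fn →ₐ[ℝ] Z) {d : ℤ × ℤ}
    {f g : X.Fn →ₗ[ℝ] Z}
    (hf : ∀ e, ∀ w ∈ X.homog e, ∀ η, f (w * η) = f w * Ψ η + sgn d e • (Ψ w * f η))
    (hg : ∀ e, ∀ w ∈ X.homog e, ∀ η, g (w * η) = g w * Ψ η + sgn d e • (Ψ w * g η))
    (hloc : ∀ F, f (X.incl F) = g (X.incl F)) (hgen : ∀ v, f (X.gen v) = g (X.gen v)) : f = g := by
  refine LinearMap.ext fun w => ?_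
  induction w using fn_induction with
  | add a b ha hb => rw [map_add, map_add, ha, hb]
  | mono F l =>
    rw [mono, hf _ _ (incl_mem F), hg _ _ (incl_mem F), hloc]
    congr 3
    induction l with
    | nil =>
      rw [List.map_nil, List.prod_nil, ← incl_one, hloc]
    | cons v l ih =>
      rw [List.map_cons, List.prod_cons, hf _ _ (gen_mem v), hg _ _ (gen_mem v), hgen, ih]

theorem IsVF.apply_incl_eq_zero {hX : IsOpen X.dom} {d : ℤ × ℤ} {f : X.Fn →ₗ[ℝ] X.Fn}
    (h : IsVF hX d f) (hb : ∀ i, f (X.base i) = 0) (F : LocFun X.dom) : f (X.incl F) = 0 := by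
  obtain ⟨s, hs⟩ := exists_pd_support hX F
  rw [h.chain F s hs]
  simp [hb]

theorem IsVF.ext {hX : IsOpen X.dom} {d : ℤ × ℤ} {f g : X.Fn →ₗ[ℝ] X.Fn}
    (hf : IsVF hX d f) (hg : IsVF hX d g) (hb : ∀ i, f (X.base i) = g (X.base i))
    (hgen : ∀ v, f (X.gen v) = g (X.gen v)) : f = g := by
  refine derivation_ext (AlgHom.id ℝ _) (d := d) (fun e w hw η => hf.leibniz hw η)
    (fun e w hw η => hg.leibniz hw η) (fun F => ?_) hgen
  obtain ⟨s, hs⟩ := exists_pd_support hX F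
  rw [hf.chain F s hs, hg.chain F s hs]
  simp only [hb]

/-! ### Closure properties -/

theorem IsVF.zero (hX : IsOpen X.dom) (d : ℤ × ℤ) : IsVF hX d 0 where
  map_homog _ := by simp
  leibniz _ _ := by simp
  chain _ _ _ := by simp

theorem IsVF.add {hX : IsOpen X.dom} {d : ℤ × ℤ} {f g : X.Fn →ₗ[ℝ] X.Fn}
    (hf : IsVF hX d f) (hg : IsVF hX d g) : IsVF hX d (f + g) where
  map_homog h := add_mem (hf.map_homog h) (hg.map_homog h)
  leibniz h η := by
    simp only [LinearMap.add_apply, hf.leibniz h, hg.leibniz h, mul_add, add_mul, smul_add]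
    abel
  chain F s hs := by
    simp only [LinearMap.add_apply, hf.chain F s hs, hg.chain F s hs, mul_add,
      Finset.sum_add_distrib]

theorem IsVF.smul {hX : IsOpen X.dom} {d : ℤ × ℤ} {f : X.Fn →ₗ[ℝ] X.Fn}
    (hf : IsVF hX d f) (r : ℝ) : IsVF hX d (r • f) where
  map_homog h := Submodule.smul_mem _ _ (hf.map_homog h)
  leibniz h η := by
    simp only [LinearMap.smul_apply, hf.leibniz h, mul_smul_comm, smul_mul_assoc, smul_add]
    rw [smul_comm r]
  chain F s hs := by
    simp only [LinearMap.smul_apply, hf.chain F s hs, mul_smul_comm, Finset.smul_sum]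

theorem IsVF.sum {ι : Type*} {hX : IsOpen X.dom} {d : ℤ × ℤ} (s : Finset ι)
    {f : ι → X.Fn →ₗ[ℝ] X.Fn} (hf : ∀ i ∈ s, IsVF hX d (f i)) : IsVF hX d (∑ i ∈ s, f i) :=
  Finset.sum_induction _ _ (fun _ _ => IsVF.add) (IsVF.zero hX d) hf

theorem IsVF.mul_left {hX : IsOpen X.dom} {d e : ℤ × ℤ} {f : X.Fn →ₗ[ℝ] X.Fn}
    (hf : IsVF hX d f) {u : X.Fn} (hu : u ∈ X.homog e) :
    IsVF hX (e + d) (LinearMap.mulLeft ℝ u ∘ₗ f) where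
  map_homog {e' w} h := by
    refine homog_congr (mul_mem_homog hu (hf.map_homog h)) ?_
    abel
  leibniz {e' w} h η := by
    simp only [LinearMap.comp_apply, LinearMap.mulLeft_apply, hf.leibniz h, mul_add, mul_smul_comm]
    rw [mul_assoc, ← mul_assoc u w, homog_comm hu h, sgn_add_left, mul_smul, smul_comm,
      smul_mul_assoc, mul_assoc]
  chain F s hs := by
    simp only [LinearMap.comp_apply, LinearMap.mulLeft_apply, hf.chain F s hs, Finset.mul_sum,
      incl_left_comm]

/-- The bigraded commutator. -/
def gcomm (d e : ℤ × ℤ) (f g : X.Fn →ₗ[ℝ] X.Fn) : X.Fn →ₗ[ℝ] X.Fn :=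
  f ∘ₗ g - sgn d e • g ∘ₗ f

theorem gcomm_apply (d e : ℤ × ℤ) (f g : X.Fn →ₗ[ℝ] X.Fn) (w : X.Fn) :
    gcomm d e f g w = f (g w) - sgn d e • g (f w) := rfl

/-- In the Leibniz rule the mixed terms cancel because of the sign in the commutator. In the chain
rule the terms with second derivatives cancel, so the result is again of first order. -/
theorem IsVF.gcomm {hX : IsOpen X.dom} {d e : ℤ × ℤ} {f g : X.Fn →ₗ[ℝ] X.Fn}
    (hf : IsVF hX d f) (hg : IsVF hX e g) : IsVF hX (d + e) (Patch.gcomm d e f g) where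
  map_homog {c w} h := by
    refine sub_mem (homog_congr (hf.map_homog (hg.map_homog h)) (by abel))
      (Submodule.smul_mem _ _ (homog_congr (hg.map_homog (hf.map_homog h)) (by abel)))
  leibniz {c w} h η := by
    simp only [gcomm_apply, hg.leibniz h, hf.leibniz h, map_add, map_smul,
      hf.leibniz (hg.map_homog h), hg.leibniz (hf.map_homog h), sgn_add_left, sgn_add_right,
      sub_mul, mul_sub, smul_add, smul_sub, mul_smul_comm, smul_mul_assoc, smul_smul]
    rw [sgn_comm e d]
    have h1 : sgn d e * (sgn e c * sgn d e) = sgn e c := by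
      rw [mul_left_comm, sgn_mul_self, mul_one]
    rw [h1]
    module
  chain F s hs := by
    -- A composite of two vector fields has a second order part, written as a double sum, and a
    -- first order part. One finite set `s` serves for `F` and for its derivatives because mixed
    -- partials commute.
    have key : ∀ (d e : ℤ × ℤ) (f g : X.Fn →ₗ[ℝ] X.Fn), IsVF hX d f → IsVF hX e g →
        f (g (X.incl F)) = ∑ i ∈ s, ∑ j ∈ s, X.incl (pd hX j (pd hX i F)) *
          (f (X.base j) * g (X.base i)) + ∑ i ∈ s, X.incl (pd hX i F) * f (g (X.base i)) := by
      intro d e f g hf hg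
      rw [hg.chain F s hs, map_sum, ← Finset.sum_add_distrib]
      refine Finset.sum_congr rfl fun i _ => ?_
      rw [hf.leibniz (incl_mem _), sgn_zero_right, one_smul, hf.chain (pd hX i F) s, Finset.sum_mul]
      · simp only [mul_assoc]
      · intro j hj
        rw [pd_comm, hs j hj, map_zero]
    simp only [gcomm_apply, mul_sub, Finset.sum_sub_distrib, mul_smul_comm]
    rw [key d e f g hf hg, key e d g f hg hf, smul_add, Finset.smul_sum, Finset.smul_sum]
    -- The second order parts of the two composites agree up to the sign of the commutator: `f y_j`
    -- and `g y_i` have bidegrees `d` and `e`, and the Hessian is symmetric.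
    have hswap : ∑ i ∈ s, sgn d e • ∑ j ∈ s, X.incl (pd hX j (pd hX i F)) *
        (g (X.base j) * f (X.base i)) = ∑ i ∈ s, ∑ j ∈ s, X.incl (pd hX j (pd hX i F)) *
          (f (X.base j) * g (X.base i)) := by
      simp only [Finset.smul_sum]
      rw [Finset.sum_comm]
      refine Finset.sum_congr rfl fun i _ => Finset.sum_congr rfl fun j _ => ?_
      have h1 := hf.map_homog (base_mem j)
      have h2 := hg.map_homog (base_mem i)
      rw [zero_add] at h1 h2
      rw [pd_comm, homog_comm h1 h2, mul_smul_comm]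
    rw [hswap]
    abel

end Patch

end

section

namespace Patch

variable {n : ℕ} {X : Patch n}

open Classical

/-! ### Existence -/

/-- The derivation on local functions with values `bv` on the coordinates. -/
def locDer (hX : IsOpen X.dom) (bv : BaseCoord n X.B → X.Fn) (F : LocFun X.dom) : X.Fn :=
  ∑ i ∈ (exists_pd_support hX F).choose, X.incl (pd hX i F) * bv i

theorem locDer_eq (hX : IsOpen X.dom) (bv : BaseCoord n X.B → X.Fn) (F : LocFun X.dom)
    (s : Finset (BaseCoord n X.B)) (hs : ∀ i ∉ s, pd hX i F = 0) :
    locDer hX bv F = ∑ i ∈ s, X.incl (pd hX i F) * bv i :=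
  sum_pd_eq hX bv F (exists_pd_support hX F).choose_spec hs

theorem exists_common_pd_support (hX : IsOpen X.dom) (F F' : LocFun X.dom) :
    ∃ s : Finset (BaseCoord n X.B), (∀ i ∉ s, pd hX i F = 0) ∧ ∀ i ∉ s, pd hX i F' = 0 := by
  obtain ⟨s, hs⟩ := exists_pd_support hX F
  obtain ⟨s', hs'⟩ := exists_pd_support hX F'
  exact ⟨s ∪ s', fun i hi => hs i (by simp_all), fun i hi => hs' i (by simp_all)⟩

theorem locDer_add (hX : IsOpen X.dom) (bv : BaseCoord n X.B → X.Fn) (F F' : LocFun X.dom) :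
    locDer hX bv (F + F') = locDer hX bv F + locDer hX bv F' := by
  obtain ⟨s, hs, hs'⟩ := exists_common_pd_support hX F F'
  rw [locDer_eq hX bv F s hs, locDer_eq hX bv F' s hs', locDer_eq hX bv (F + F') s]
  · simp only [map_add, incl_add, add_mul, Finset.sum_add_distrib]
  · intro i hi
    rw [map_add, hs i hi, hs' i hi, add_zero]

theorem locDer_mul (hX : IsOpen X.dom) (bv : BaseCoord n X.B → X.Fn) (F F' : LocFun X.dom) :
    locDer hX bv (F * F') = X.incl F * locDer hX bv F' + locDer hX bv F * X.incl F' := by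
  obtain ⟨s, hs, hs'⟩ := exists_common_pd_support hX F F'
  rw [locDer_eq hX bv F s hs, locDer_eq hX bv F' s hs', locDer_eq hX bv (F * F') s,
    Finset.mul_sum, Finset.sum_mul, ← Finset.sum_add_distrib]
  · refine Finset.sum_congr rfl fun i _ => ?_
    rw [pd_mul, incl_add, add_mul, incl_mul, incl_mul, mul_assoc, mul_assoc, mul_assoc,
      incl_comm F' (bv i), add_comm]
  · intro i hi
    rw [pd_mul, hs i hi, hs' i hi, mul_zero, zero_mul, add_zero]

theorem locDer_smul (hX : IsOpen X.dom) (bv : BaseCoord n X.B → X.Fn) (r : ℝ) (F : LocFun X.dom) :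
    locDer hX bv (r • F) = r • locDer hX bv F := by
  obtain ⟨s, hs⟩ := exists_pd_support hX F
  rw [locDer_eq hX bv F s hs, locDer_eq hX bv (r • F) s, Finset.smul_sum]
  · simp only [map_smul, incl_smul, smul_mul_assoc]
  · intro i hi
    rw [map_smul, hs i hi, smul_zero]

theorem locDer_one (hX : IsOpen X.dom) (bv : BaseCoord n X.B → X.Fn) : locDer hX bv 1 = 0 := by
  rw [locDer_eq hX bv 1 ∅ fun i _ => pd_one hX i, Finset.sum_empty]

theorem locDer_coordLoc (hX : IsOpen X.dom) (bv : BaseCoord n X.B → X.Fn) (i : BaseCoord n X.B) :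
    locDer hX bv (coordLoc i) = bv i := by
  rw [locDer_eq hX bv _ {i}, Finset.sum_singleton, pd_coordLoc, if_pos rfl, incl_one, one_mul]
  intro j hj
  rw [pd_coordLoc, if_neg (by simpa using hj)]

theorem locDer_mem (hX : IsOpen X.dom) {d : ℤ × ℤ} {bv : BaseCoord n X.B → X.Fn}
    (hbv : ∀ i, bv i ∈ X.homog d) (F : LocFun X.dom) : locDer hX bv F ∈ X.homog d :=
  sum_mem fun i _ => homog_congr (mul_mem_homog (incl_mem _) (hbv i)) (zero_add d)

section Existence

variable (hX : IsOpen X.dom) (d : ℤ × ℤ) (bv : BaseCoord n X.B → X.Fn)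
  (gv : GenCoord n X.C → X.Fn)

/-- The matrix `[[F, V F], [0, F]]`. -/
def locMat : LocFun X.dom →ₐ[ℝ] Matrix (Fin 2) (Fin 2) X.Fn :=
  AlgHom.ofLinearMap
    { toFun := fun F => !![X.incl F, locDer hX bv F; 0, X.incl F]
      map_add' := fun F F' => by
        rw [incl_add, locDer_add]
        ext i j
        fin_cases i <;> fin_cases j <;> simp
      map_smul' := fun r F => by
        rw [incl_smul, locDer_smul]
        ext i j
        fin_cases i <;> fin_cases j <;> simp }
    (by
      change !![X.incl 1, locDer hX bv 1; 0, X.incl 1] = 1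
      rw [incl_one, locDer_one, Matrix.one_fin_two])
    (fun F F' => by
      change !![X.incl (F * F'), locDer hX bv (F * F'); 0, X.incl (F * F')] =
        !![X.incl F, locDer hX bv F; 0, X.incl F] * !![X.incl F', locDer hX bv F'; 0, X.incl F']
      rw [Matrix.mul_fin_two, locDer_mul, incl_mul]
      simp only [mul_zero, zero_mul, add_zero, zero_add])

/-- The matrix `[[± v, V v], [0, v]]`. -/
def genMat₀ (v : GenCoord n X.C) : Matrix (Fin 2) (Fin 2) X.Fn :=
  !![sgn d (X.gdeg v) • X.gen v, gv v; 0, X.gen v]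

variable {d bv gv}

/-- A derivation `V` is encoded as an algebra homomorphism `w ↦ [[± w, V w], [0, w]]`: the upper
right entry of a product is the Leibniz rule. Such a homomorphism can be defined on generators,
provided the matrices satisfy the defining relations of the symmetric algebra. Homogeneity of the
values `gv v` makes the upper right entry of the relation hold. -/
theorem genMat₀_comm (hgv : ∀ v, gv v ∈ X.homog (X.gdeg v + d)) (v v' : GenCoord n X.C) :
    genMat₀ d gv v * genMat₀ d gv v' =
      sgn (X.gdeg v) (X.gdeg v') • (genMat₀ d gv v' * genMat₀ d gv v) := by
  simp only [genMat₀, Matrix.mul_fin_two, Matrix.smul_of]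
  have h1 : X.gen v * gv v' = (sgn (X.gdeg v) (X.gdeg v') * sgn (X.gdeg v) d) • (gv v' * X.gen v) :=
    by rw [homog_comm (gen_mem v) (hgv v'), sgn_add_right]
  have h2 : gv v * X.gen v' = (sgn (X.gdeg v) (X.gdeg v') * sgn d (X.gdeg v')) • (X.gen v' * gv v) :=
    by rw [homog_comm (hgv v) (gen_mem v'), sgn_add_left]
  congr 1
  ext i j
  fin_cases i <;> fin_cases j
  · simp only [Matrix.smul_cons, smul_mul_assoc, mul_smul_comm, mul_zero, add_zero]
    simp [gen_mul_gen v v', smul_smul]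
    congr 1
    ring
  · have h3 : sgn d (X.gdeg v) • (X.gen v * gv v') + gv v * X.gen v' = sgn (X.gdeg v) (X.gdeg v') •
        (sgn d (X.gdeg v') • (X.gen v' * gv v) + gv v' * X.gen v) := by
      rw [h1, h2, smul_smul, smul_add, smul_smul, sgn_comm (X.gdeg v) d, mul_left_comm,
        sgn_mul_self, mul_one, add_comm]
    simpa [smul_mul_assoc, mul_smul_comm] using h3
  · simp
  · simpa using gen_mul_gen v v'

variable (hgv : ∀ v, gv v ∈ X.homog (X.gdeg v + d))

/-- The extension of `genMat₀` to the symmetric algebra. -/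
def genMat : GSym X.gdeg →ₐ[ℝ] Matrix (Fin 2) (Fin 2) X.Fn :=
  RingQuot.liftAlgHom ℝ ⟨FreeAlgebra.lift ℝ (genMat₀ d gv), by
    rintro _ _ ⟨v, v'⟩
    simpa using genMat₀_comm hgv v v'⟩

theorem genMat_gen (v : GenCoord n X.C) :
    genMat hgv (RingQuot.mkAlgHom ℝ (GSymRel X.gdeg) (FreeAlgebra.ι ℝ v)) = genMat₀ d gv v := by
  rw [genMat, RingQuot.liftAlgHom_mkAlgHom_apply, FreeAlgebra.lift_ι_apply]

/-- Moving `V F`, of bidegree `d`, past a generator `v` produces exactly the sign in the upper left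
entry of `genMat₀`. This commutation allows the two homomorphisms to be combined on the tensor
product. -/
theorem locMat_genMat_comm (hbv : ∀ i, bv i ∈ X.homog d) (F : LocFun X.dom) (s : GSym X.gdeg) :
    Commute (locMat hX bv F) (genMat hgv s) := by
  obtain ⟨a, rfl⟩ := RingQuot.mkAlgHom_surjective ℝ (GSymRel X.gdeg) s
  induction a using FreeAlgebra.induction with
  | grade0 r =>
    rw [AlgHom.commutes, AlgHom.commutes]
    exact Algebra.commutes' r _ |>.symm
  | mul a b ha hb => rw [map_mul, map_mul]; exact ha.mul_right hb
  | add a b ha hb => rw [map_add, map_add]; exact ha.add_right hb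
  | grade1 v =>
    rw [genMat_gen, Commute, SemiconjBy]
    change !![X.incl F, locDer hX bv F; 0, X.incl F] * genMat₀ d gv v =
      genMat₀ d gv v * !![X.incl F, locDer hX bv F; 0, X.incl F]
    have h := homog_comm (locDer_mem hX hbv F) (gen_mem v)
    rw [genMat₀, Matrix.mul_fin_two, Matrix.mul_fin_two, h, incl_comm F (gv v), incl_comm F,
      incl_comm F (X.gen v), add_comm]
    simp only [mul_zero, zero_mul, add_zero, smul_mul_assoc, add_comm]

/-- The algebra homomorphism `w ↦ [[± w, V w], [0, w]]`. -/
def vfMat (hbv : ∀ i, bv i ∈ X.homog d) : X.Fn →ₐ[ℝ] Matrix (Fin 2) (Fin 2) X.Fn :=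
  Algebra.TensorProduct.lift (locMat hX bv) (genMat hgv) (locMat_genMat_comm hX hgv hbv)

variable (hbv : ∀ i, bv i ∈ X.homog d)

theorem vfMat_incl (F : LocFun X.dom) :
    vfMat hX hgv hbv (X.incl F) = !![X.incl F, locDer hX bv F; 0, X.incl F] := by
  rw [incl, vfMat, Algebra.TensorProduct.lift_tmul, map_one, mul_one]
  rfl

theorem vfMat_gen (v : GenCoord n X.C) : vfMat hX hgv hbv (X.gen v) = genMat₀ d gv v := by
  rw [gen, vfMat, Algebra.TensorProduct.lift_tmul, map_one, one_mul, genMat_gen]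

/-- The sign in the upper left corner depends on the bidegree of the argument, so it can be written
only for homogeneous elements; monomials come first. -/
theorem vfMat_mono (F : LocFun X.dom) (l : List (GenCoord n X.C)) :
    ∃ η ∈ X.homog ((l.map X.gdeg).sum + d), vfMat hX hgv hbv (mono F l) =
      !![sgn d (l.map X.gdeg).sum • mono F l, η; 0, mono F l] := by
  have key : ∃ η ∈ X.homog ((l.map X.gdeg).sum + d), vfMat hX hgv hbv (l.map X.gen).prod =
      !![sgn d (l.map X.gdeg).sum • (l.map X.gen).prod, η; 0, (l.map X.gen).prod] := by
    induction l with
    | nil => exact ⟨0, zero_mem _, by simp [Matrix.one_fin_two]⟩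
    | cons v l ih =>
      obtain ⟨η, hη, h⟩ := ih
      simp only [List.map_cons, List.prod_cons, List.sum_cons, map_mul, vfMat_gen, h, genMat₀,
        Matrix.mul_fin_two, mul_zero, zero_mul, zero_add, add_zero]
      refine ⟨_, add_mem (homog_congr (mul_mem_homog (Submodule.smul_mem _ (sgn d (X.gdeg v)) (gen_mem v)) hη)
        (by abel)) (homog_congr (mul_mem_homog (hgv v) (prod_gen_mem l)) (by abel)), ?_⟩
      rw [sgn_add_right, smul_mul_smul_comm]
  obtain ⟨η, hη, h⟩ := key
  rw [mono, map_mul, h, vfMat_incl, Matrix.mul_fin_two]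
  simp only [mul_zero, zero_mul, zero_add, add_zero, mul_smul_comm]
  exact ⟨_, add_mem (homog_congr (mul_mem_homog (incl_mem F) hη) (zero_add _))
    (homog_congr (mul_mem_homog (locDer_mem hX hbv F) (prod_gen_mem l)) (add_comm _ _)), rfl⟩

theorem vfMat_entries (w : X.Fn) : vfMat hX hgv hbv w 1 0 = 0 ∧ vfMat hX hgv hbv w 1 1 = w := by
  induction w using fn_induction with
  | mono F l =>
    obtain ⟨η, -, h⟩ := vfMat_mono hX hgv hbv F l
    rw [h]
    exact ⟨rfl, rfl⟩
  | add a b ha hb => simp [map_add, ha, hb]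

theorem vfMat_homog {e : ℤ × ℤ} {w : X.Fn} (hw : w ∈ X.homog e) :
    vfMat hX hgv hbv w 0 0 = sgn d e • w ∧ vfMat hX hgv hbv w 0 1 ∈ X.homog (e + d) := by
  refine homog_induction (p := fun w => vfMat hX hgv hbv w 0 0 = sgn d e • w ∧
    vfMat hX hgv hbv w 0 1 ∈ X.homog (e + d)) ?_ (by simp) ?_ hw
  · intro F l hl
    obtain ⟨η, hη, h⟩ := vfMat_mono hX hgv hbv F l
    rw [h, ← hl]
    exact ⟨rfl, hη⟩
  · intro a b ha hb
    simp only [map_add, Matrix.add_apply, ha.1, hb.1, smul_add, true_and]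
    exact add_mem ha.2 hb.2

/-- A vector field with given homogeneous values on the coordinates. -/
def mkVF : X.Fn →ₗ[ℝ] X.Fn where
  toFun w := vfMat hX hgv hbv w 0 1
  map_add' _ _ := by rw [map_add, Matrix.add_apply]
  map_smul' _ _ := by rw [map_smul, Matrix.smul_apply, RingHom.id_apply]

theorem mkVF_apply (w : X.Fn) : mkVF hX hgv hbv w = vfMat hX hgv hbv w 0 1 := rfl

theorem mkVF_incl (F : LocFun X.dom) : mkVF hX hgv hbv (X.incl F) = locDer hX bv F := by
  rw [mkVF_apply, vfMat_incl]
  rfl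

theorem mkVF_base (i : BaseCoord n X.B) : mkVF hX hgv hbv (X.base i) = bv i := by
  rw [base_eq, mkVF_incl, locDer_coordLoc]

theorem mkVF_gen (v : GenCoord n X.C) : mkVF hX hgv hbv (X.gen v) = gv v := by
  rw [mkVF_apply, vfMat_gen]
  rfl

/-- The Leibniz rule is the upper right entry of the multiplicativity of `vfMat`. -/
theorem isVF_mkVF : IsVF hX d (mkVF hX hgv hbv) where
  map_homog hw := (vfMat_homog hX hgv hbv hw).2
  leibniz {e w} hw η := by
    change vfMat hX hgv hbv (w * η) 0 1 = vfMat hX hgv hbv w 0 1 * η +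
      sgn d e • (w * vfMat hX hgv hbv η 0 1)
    rw [map_mul, Matrix.mul_apply, Fin.sum_univ_two, (vfMat_homog hX hgv hbv hw).1,
      (vfMat_entries hX hgv hbv η).2, smul_mul_assoc, add_comm]
  chain F s hs := by
    simp only [mkVF_incl, mkVF_base]
    exact locDer_eq hX bv F s hs

end Existence

theorem exists_isVF (hX : IsOpen X.dom) {d : ℤ × ℤ} {bv : BaseCoord n X.B → X.Fn}
    {gv : GenCoord n X.C → X.Fn} (hgv : ∀ v, gv v ∈ X.homog (X.gdeg v + d))
    (hbv : ∀ i, bv i ∈ X.homog d) :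
    ∃ f, IsVF hX d f ∧ (∀ i, f (X.base i) = bv i) ∧ ∀ v, f (X.gen v) = gv v :=
  ⟨_, isVF_mkVF hX hgv hbv, mkVF_base hX hgv hbv, mkVF_gen hX hgv hbv⟩

/-- Vector fields are local operators. -/
theorem IsVF.evalAt_eq_zero {hX : IsOpen X.dom} {d : ℤ × ℤ} {f : X.Fn →ₗ[ℝ] X.Fn}
    (hf : IsVF hX d f) {O : Set (BaseCoord n X.B → ℝ)} (hO : IsOpen O) {w : X.Fn}
    (hw : ∀ p : X.dom, p.1 ∈ O → evalAt p w = 0) (p : X.dom) (hp : p.1 ∈ O) :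
    evalAt p (f w) = 0 := by
  -- The coefficients of `w` in a basis of the symmetric algebra vanish on `O`. The chain rule
  -- involves only their first derivatives, which vanish there as well.
  obtain ⟨c, hc, hc'⟩ := exists_basis_expansion (Module.Basis.ofVectorSpace ℝ (GSym X.gdeg)) w
  have hz : ∀ i (q : X.dom), q.1 ∈ O → (c i).1 q = 0 := by
    intro i q hq
    rw [hc', hw q hq, map_zero, Finsupp.zero_apply]
  rw [hc, Finsupp.sum, map_sum, map_sum]
  refine Finset.sum_eq_zero fun i _ => ?_
  rw [tmul_eq, hf.leibniz (incl_mem _), map_add, map_mul, map_smul, map_mul, evalAt_incl,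
    hz i p hp, map_zero, zero_mul, smul_zero, add_zero]
  obtain ⟨s, hs⟩ := exists_pd_support hX (c i)
  rw [hf.chain _ s hs, map_sum, Finset.sum_mul]
  refine Finset.sum_eq_zero fun j _ => ?_
  have := pd_congr_on hX hO (F := c i) (F' := 0) (fun q hq => hz i q hq) j p hp
  rw [map_mul, evalAt_incl, this, map_zero]
  change algebraMap ℝ _ 0 * _ * _ = _
  rw [map_zero, zero_mul, zero_mul]

end Patch

end

section

namespace Patch

variable {n : ℕ} {X : Patch n} {D : Fin n → X.VectorField (0, 0)}

open Classical

/-! ## Total derivatives -/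

theorem VectorField.ext_of_coords (hX : IsOpen X.dom) {d : ℤ × ℤ} {V W : X.VectorField d}
    (hb : ∀ i, V (X.base i) = W (X.base i)) (hg : ∀ v, V (X.gen v) = W (X.gen v)) : V = W :=
  VectorField.ext ((V.isVF hX).ext (W.isVF hX) hb hg)

theorem exists_isTotalDerivative (hX : IsOpen X.dom) :
    ∃ D : Fin n → X.VectorField (0, 0), IsTotalDerivative D := by
  have key : ∀ μ : Fin n, ∃ f : X.Fn →ₗ[ℝ] X.Fn, IsVF hX (0, 0) f ∧
      (∀ i, f (X.base i) = (match i with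
        | .x ν => if μ = ν then 1 else 0
        | .jet b I => X.base (.jet b (μ ::ₘ I)) : X.Fn)) ∧
      ∀ v, f (X.gen v) = (match v with
        | .dx _ => 0
        | .jet c I => X.gen (.jet c (μ ::ₘ I)) : X.Fn) := by
    intro μ
    refine exists_isVF hX ?_ ?_
    · rintro (ν | ⟨c, I⟩)
      · exact zero_mem _
      · exact homog_congr (gen_mem (GenCoord.jet c (μ ::ₘ I))) (add_zero _).symm
    · rintro (ν | ⟨b, I⟩)
      · change (if μ = ν then (1 : X.Fn) else 0) ∈ _
        split_ifs
        · exact one_mem_homog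
        · exact zero_mem _
      · exact base_mem _
  choose f hf hb hg using key
  exact ⟨fun μ => (hf μ).toVectorField, fun μ ν => hb μ (.x ν), fun μ ν => hg μ (.dx ν),
    fun μ b I => hb μ (.jet b I), fun μ c I => hg μ (.jet c I)⟩

theorem IsTotalDerivative.unique (hX : IsOpen X.dom) {D' : Fin n → X.VectorField (0, 0)}
    (h : IsTotalDerivative D) (h' : IsTotalDerivative D') : D = D' := by
  funext μ
  refine VectorField.ext_of_coords hX ?_ ?_
  · rintro (ν | ⟨b, I⟩)
    · rw [h.x, h'.x]
    · rw [h.base, h'.base]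
  · rintro (ν | ⟨c, I⟩)
    · exact (h.dx μ ν).trans (h'.dx μ ν).symm
    · rw [h.gen, h'.gen]

theorem VectorField.map_one {d : ℤ × ℤ} (V : X.VectorField d) : V 1 = 0 := by
  have h := V.leibniz 0 1 one_mem_homog 1
  rw [sgn_zero_right, one_smul, mul_one, mul_one, one_mul] at h
  exact left_eq_add.mp h

theorem IsTotalDerivative.comm (hX : IsOpen X.dom) (h : IsTotalDerivative D) (μ ν : Fin n)
    (w : X.Fn) : D μ (D ν w) = D ν (D μ w) := by
  have h0 : Patch.gcomm (0, 0) (0, 0) (D μ).toLin (D ν).toLin = 0 := by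
    refine (((D μ).isVF hX).gcomm ((D ν).isVF hX)).ext (IsVF.zero hX _) ?_ ?_
    · rintro (ρ | ⟨b, I⟩)
      · simp only [gcomm_apply, h.x, sgn_zero_left', one_smul, LinearMap.zero_apply]
        split_ifs <;> simp [VectorField.map_one]
      · simp only [gcomm_apply, h.base, sgn_zero_left', one_smul, LinearMap.zero_apply,
          Multiset.cons_swap, sub_self]
    · rintro (ρ | ⟨c, I⟩)
      · have := h.dx
        simp only [Patch.dx] at this
        simp only [gcomm_apply, this, map_zero, smul_zero, LinearMap.zero_apply, sub_self]
      · simp only [gcomm_apply, h.gen, sgn_zero_left', one_smul, LinearMap.zero_apply,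
          Multiset.cons_swap, sub_self]
  have := LinearMap.congr_fun h0 w
  rw [gcomm_apply, sgn_zero_left', one_smul] at this
  exact sub_eq_zero.mp this

/-- The iterated total derivative `D_I`. -/
def iterD (D : Fin n → X.VectorField (0, 0)) (I : Multiset (Fin n)) (w : X.Fn) : X.Fn :=
  I.toList.foldr (fun μ η => D μ η) w

@[simp] theorem iterD_zero (w : X.Fn) : iterD D 0 w = w := by simp [iterD]

/-- A multi-index is unordered while `iterD` runs through a chosen list of its elements; the choice
does not matter because total derivatives commute. -/
theorem iterD_cons (hX : IsOpen X.dom) (h : IsTotalDerivative D) (μ : Fin n) (I : Multiset (Fin n))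
    (w : X.Fn) : iterD D (μ ::ₘ I) w = D μ (iterD D I w) := by
  have hp : (μ ::ₘ I).toList.Perm (μ :: I.toList) := by
    rw [← Multiset.coe_eq_coe, Multiset.coe_toList, ← Multiset.cons_coe, Multiset.coe_toList]
  exact hp.foldr_eq' (f := fun μ η => D μ η) (fun x _ y _ z => h.comm hX _ _ _) w

theorem iterD_induction (hX : IsOpen X.dom) (h : IsTotalDerivative D) {p : X.Fn → Prop}
    (hp : ∀ μ w, p w → p (D μ w)) (I : Multiset (Fin n)) {w : X.Fn} (hw : p w) :
    p (iterD D I w) := by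
  induction I using Multiset.induction_on with
  | empty => simpa
  | cons μ I ih => rw [iterD_cons hX h]; exact hp _ _ ih

theorem iterD_mem (hX : IsOpen X.dom) (h : IsTotalDerivative D) {d : ℤ × ℤ} {w : X.Fn}
    (I : Multiset (Fin n)) (hw : w ∈ X.homog d) : iterD D I w ∈ X.homog d :=
  iterD_induction hX h (fun μ _ hw => homog_congr ((D μ).map_homog _ _ hw) (add_zero d)) I hw

theorem map_iterD (hX : IsOpen X.dom) {Y : Patch n} (hY : IsOpen Y.dom)
    {D' : Fin n → Y.VectorField (0, 0)} (h : IsTotalDerivative D) (h' : IsTotalDerivative D')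
    {f : X.Fn → Y.Fn} (hf : ∀ μ w, f (D μ w) = D' μ (f w)) (I : Multiset (Fin n)) (w : X.Fn) :
    f (iterD D I w) = iterD D' I (f w) := by
  induction I using Multiset.induction_on with
  | empty => simp
  | cons μ I ih => rw [iterD_cons hX h, iterD_cons hY h', hf, ih]

theorem base_jet_eq (hX : IsOpen X.dom) (h : IsTotalDerivative D) (b : X.B) (I : Multiset (Fin n)) :
    X.base (.jet b I) = iterD D I (X.base (.jet b 0)) := by
  induction I using Multiset.induction_on with
  | empty => simp
  | cons μ I ih => rw [iterD_cons hX h, ← ih, h.base]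

theorem gen_jet_eq (hX : IsOpen X.dom) (h : IsTotalDerivative D) (c : X.C) (I : Multiset (Fin n)) :
    X.gen (.jet c I) = iterD D I (X.gen (.jet c 0)) := by
  induction I using Multiset.induction_on with
  | empty => simp
  | cons μ I ih => rw [iterD_cons hX h, ← ih, h.gen]

/-! ## Prolonged vector fields -/

/-- The fields `y = y_∅` of the patch. -/
def IsField (y : X.Fn) : Prop := (∃ b, y = X.base (.jet b 0)) ∨ ∃ c, y = X.gen (.jet c 0)

/-- Vector fields which commute with the total derivatives and kill `x^μ` and `dx^μ`. -/
structure IsProl (hX : IsOpen X.dom) (D : Fin n → X.VectorField (0, 0)) (d : ℤ × ℤ)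
    (f : X.Fn →ₗ[ℝ] X.Fn) : Prop extends IsVF hX d f where
  comm : ∀ μ w, f (D μ w) = D μ (f w)
  x : ∀ μ, f (X.base (.x μ)) = 0
  dx : ∀ μ, f (X.dx μ) = 0

variable {hX : IsOpen X.dom}

/-- A prolonged vector field along an algebra homomorphism is determined by the fields. -/
theorem IsProl.comp_eq_zero {Z : Type*} [Ring Z] [Algebra ℝ Z] (hD : IsTotalDerivative D)
    {d : ℤ × ℤ} {f : X.Fn →ₗ[ℝ] X.Fn} (hf : IsProl hX D d f) (Ψ : X.Fn →ₐ[ℝ] Z) (P : X.Fn → Prop)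
    (hP : ∀ w, P w → Ψ w = 0) (hPD : ∀ μ w, P w → P (D μ w))
    (hfield : ∀ y, IsField y → P (f y)) (w : X.Fn) : Ψ (f w) = 0 := by
  -- Vanishing of `Ψ w` need not pass to `Ψ (D_μ w)`. The predicate `P` is a condition that implies
  -- vanishing and is stable under `D_μ`, so it reaches all jets. Two choices of `P` are used: being
  -- zero, and vanishing on an open set around a point.
  have hb : ∀ i, Ψ (f (X.base i)) = 0 := by
    rintro (μ | ⟨b, I⟩)
    · rw [hf.x, map_zero]
    · rw [base_jet_eq hX hD, map_iterD hX hX hD hD hf.comm]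
      exact hP _ (iterD_induction hX hD hPD I (hfield _ (Or.inl ⟨b, rfl⟩)))
  have h0 : Ψ.toLinearMap ∘ₗ f = 0 := by
    refine derivation_ext Ψ (d := d) (fun e w hw η => ?_) (fun e w hw η => ?_) (fun F => ?_) ?_
    · simp only [LinearMap.comp_apply, AlgHom.toLinearMap_apply, hf.leibniz hw, map_add, map_smul,
        map_mul]
    · simp
    · obtain ⟨s, hs⟩ := exists_pd_support hX F
      simp only [LinearMap.comp_apply, AlgHom.toLinearMap_apply, hf.chain F s hs, map_sum, map_mul,
        hb, mul_zero, Finset.sum_const_zero, LinearMap.zero_apply]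
    · rintro (μ | ⟨c, I⟩)
      · have := hf.dx μ
        rw [Patch.dx] at this
        simp only [LinearMap.comp_apply, this, map_zero,
          LinearMap.zero_apply]
      · simp only [LinearMap.comp_apply, AlgHom.toLinearMap_apply, LinearMap.zero_apply]
        rw [gen_jet_eq hX hD, map_iterD hX hX hD hD hf.comm]
        exact hP _ (iterD_induction hX hD hPD I (hfield _ (Or.inr ⟨c, rfl⟩)))
  exact LinearMap.congr_fun h0 w

theorem IsProl.eq_zero (hD : IsTotalDerivative D) {d : ℤ × ℤ} {f : X.Fn →ₗ[ℝ] X.Fn}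
    (hf : IsProl hX D d f) (hfield : ∀ y, IsField y → f y = 0) (w : X.Fn) : f w = 0 :=
  hf.comp_eq_zero hD (AlgHom.id ℝ _) (fun w => w = 0) (fun _ h => h)
    (fun μ w h => by rw [h, map_zero]) hfield w

theorem IsProl.add {d : ℤ × ℤ} {f g : X.Fn →ₗ[ℝ] X.Fn}
    (hf : IsProl hX D d f) (hg : IsProl hX D d g) : IsProl hX D d (f + g) where
  toIsVF := hf.toIsVF.add hg.toIsVF
  comm μ w := by simp only [LinearMap.add_apply, hf.comm, hg.comm, map_add]
  x μ := by rw [LinearMap.add_apply, hf.x, hg.x, add_zero]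
  dx μ := by rw [LinearMap.add_apply, hf.dx, hg.dx, add_zero]

theorem IsProl.smul {d : ℤ × ℤ} {f : X.Fn →ₗ[ℝ] X.Fn}
    (hf : IsProl hX D d f) (r : ℝ) : IsProl hX D d (r • f) where
  toIsVF := hf.toIsVF.smul r
  comm μ w := by simp only [LinearMap.smul_apply, hf.comm, map_smul]
  x μ := by rw [LinearMap.smul_apply, hf.x, smul_zero]
  dx μ := by rw [LinearMap.smul_apply, hf.dx, smul_zero]

theorem IsProl.sub {d : ℤ × ℤ} {f g : X.Fn →ₗ[ℝ] X.Fn}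
    (hf : IsProl hX D d f) (hg : IsProl hX D d g) : IsProl hX D d (f - g) := by
  have := hf.add (hg.smul (-1))
  rwa [neg_one_smul ℝ g, ← sub_eq_add_neg] at this

theorem IsProl.gcomm {d e : ℤ × ℤ} {f g : X.Fn →ₗ[ℝ] X.Fn}
    (hf : IsProl hX D d f) (hg : IsProl hX D e g) :
    IsProl hX D (d + e) (Patch.gcomm d e f g) where
  toIsVF := hf.toIsVF.gcomm hg.toIsVF
  comm μ w := by simp only [gcomm_apply, hf.comm, hg.comm, map_sub, map_smul]
  x μ := by rw [gcomm_apply, hf.x, hg.x, map_zero, map_zero, smul_zero, sub_zero]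
  dx μ := by rw [gcomm_apply, hf.dx, hg.dx, map_zero, map_zero, smul_zero, sub_zero]

theorem IsProl.congr_deg {d e : ℤ × ℤ} {f : X.Fn →ₗ[ℝ] X.Fn} (hf : IsProl hX D d f) (h : d = e) :
    IsProl hX D e f := h ▸ hf

theorem IsProl.eq (hD : IsTotalDerivative D) {d : ℤ × ℤ} {f g : X.Fn →ₗ[ℝ] X.Fn}
    (hf : IsProl hX D d f) (hg : IsProl hX D d g) (h : ∀ y, IsField y → f y = g y) : f = g := by
  refine LinearMap.ext fun w => sub_eq_zero.mp ?_
  exact (hf.sub hg).eq_zero hD (fun y hy => by rw [LinearMap.sub_apply, h y hy, sub_self]) w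

theorem IsTotalDerivative.dx_mul (hD : IsTotalDerivative D) (μ ν : Fin n) (w : X.Fn) :
    D ν (X.dx μ * w) = X.dx μ * D ν w := by
  rw [(D ν).leibniz _ _ (dx_mem μ), hD.dx, zero_mul, sgn_zero_left', one_smul, zero_add]

theorem IsProl.dx_mul {d : ℤ × ℤ} {f : X.Fn →ₗ[ℝ] X.Fn} (hf : IsProl hX D d f) (μ : Fin n)
    (w : X.Fn) : f (X.dx μ * w) = sgn d (1, 0) • (X.dx μ * f w) := by
  rw [hf.leibniz (dx_mem μ), hf.dx, zero_mul, zero_add]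

theorem IsProl.dx_mul_left (hD : IsTotalDerivative D) {d : ℤ × ℤ} {f : X.Fn →ₗ[ℝ] X.Fn}
    (hf : IsProl hX D d f) (μ : Fin n) :
    IsProl hX D ((1, 0) + d) (LinearMap.mulLeft ℝ (X.dx μ) ∘ₗ f) where
  toIsVF := hf.toIsVF.mul_left (dx_mem μ)
  comm ν w := by
    simp only [LinearMap.comp_apply, LinearMap.mulLeft_apply, hf.comm, hD.dx_mul]
  x ν := by simp only [LinearMap.comp_apply, hf.x, map_zero]
  dx ν := by simp only [LinearMap.comp_apply, hf.dx, map_zero]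

/-- Commutation with the total derivatives leaves no choice: the value on `y_I` has to be `D_I` of
the value on `y`. -/
theorem exists_isProl (hX : IsOpen X.dom) (hD : IsTotalDerivative D) {d : ℤ × ℤ} (bv : X.B → X.Fn)
    (gv : X.C → X.Fn) (hbv : ∀ b, bv b ∈ X.homog d) (hgv : ∀ c, gv c ∈ X.homog (X.deg c + d)) :
    ∃ f, IsProl hX D d f ∧ (∀ b, f (X.base (.jet b 0)) = bv b) ∧
      ∀ c, f (X.gen (.jet c 0)) = gv c := by
  obtain ⟨f, hf, hb, hg⟩ := exists_isVF hX (d := d)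
    (bv := fun i => (match i with
      | .x ν => 0
      | .jet b I => iterD D I (bv b) : X.Fn))
    (gv := fun v => (match v with
      | .dx _ => 0
      | .jet c I => iterD D I (gv c) : X.Fn))
    (by
      rintro (ν | ⟨c, I⟩)
      · exact zero_mem _
      · exact iterD_mem hX hD I (hgv c))
    (by
      rintro (ν | ⟨b, I⟩)
      · exact zero_mem _
      · exact iterD_mem hX hD I (hbv b))
  have hbx : ∀ μ, f (X.base (.x μ)) = 0 := fun μ => hb (.x μ)
  have hbj : ∀ b I, f (X.base (.jet b I)) = iterD D I (bv b) := fun b I => hb (.jet b I)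
  have hgx : ∀ μ, f (X.gen (.dx μ)) = 0 := fun μ => hg (.dx μ)
  have hgj : ∀ c I, f (X.gen (.jet c I)) = iterD D I (gv c) := fun c I => hg (.jet c I)
  refine ⟨f, ⟨hf, fun μ w => ?_, hbx, hgx⟩, fun b => by rw [hbj, iterD_zero],
    fun c => by rw [hgj, iterD_zero]⟩
  -- The commutator with `D_μ` is again a vector field, so it is enough that it kills the
  -- coordinates. On jets this is `iterD_cons`.
  have h0 : Patch.gcomm d (0, 0) f (D μ).toLin = 0 := by
    refine (hf.gcomm ((D μ).isVF hX)).ext (IsVF.zero hX _) ?_ ?_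
    · rintro (ρ | ⟨b, I⟩)
      · have hf1 : f 1 = 0 := hf.toVectorField.map_one
        simp only [gcomm_apply, hD.x, sgn_zero_right', one_smul, LinearMap.zero_apply, hbx]
        split_ifs <;> simp [hf1]
      · simp only [gcomm_apply, hD.base, sgn_zero_right', one_smul, LinearMap.zero_apply,
          hbj, iterD_cons hX hD, sub_self]
    · rintro (ρ | ⟨c, I⟩)
      · have := hD.dx
        simp only [Patch.dx] at this
        simp only [gcomm_apply, this, hgx, map_zero, smul_zero, LinearMap.zero_apply, sub_self]
      · simp only [gcomm_apply, hD.gen, sgn_zero_right', one_smul, LinearMap.zero_apply,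
          hgj, iterD_cons hX hD, sub_self]
  have := LinearMap.congr_fun h0 w
  rw [gcomm_apply, sgn_zero_right', one_smul] at this
  exact sub_eq_zero.mp this

end Patch

end

section

namespace Patch

variable {n : ℕ} {X : Patch n} {D : Fin n → X.VectorField (0, 0)} {hX : IsOpen X.dom}

open Classical

/-! ## The explicit horizontal differential -/

/-- `E` is the explicit part of the horizontal differential: `x^μ ↦ dx^μ`, and `E` kills all other
coordinates. -/
structure IsExplicit (hX : IsOpen X.dom) (E : X.Fn →ₗ[ℝ] X.Fn) : Prop extends IsVF hX (1, 0) E where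
  x : ∀ μ, E (X.base (.x μ)) = X.dx μ
  base : ∀ b I, E (X.base (.jet b I)) = 0
  gen : ∀ v, E (X.gen v) = 0

theorem exists_isExplicit (hX : IsOpen X.dom) : ∃ E : X.Fn →ₗ[ℝ] X.Fn, IsExplicit hX E := by
  obtain ⟨E, hE, hb, hg⟩ := exists_isVF hX (d := (1, 0))
    (bv := fun i => (match i with
      | .x μ => X.dx μ
      | .jet _ _ => 0 : X.Fn)) (gv := fun _ => 0) (fun _ => zero_mem _) (by
        rintro (μ | ⟨b, I⟩)
        · exact dx_mem μ
        · exact zero_mem _)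
  exact ⟨E, hE, fun μ => hb (.x μ), fun b I => hb (.jet b I), hg⟩

theorem dx_comm_of_mem {d : ℤ × ℤ} {w : X.Fn} (hw : w ∈ X.homog d) (hd : d.1 = 0) (μ : Fin n) :
    X.dx μ * w = w * X.dx μ := by
  rw [homog_comm (dx_mem μ) hw, sgn_even (by simp [hd]), one_smul]

/-- The horizontal differential as a linear map. -/
def dhMap (D : Fin n → X.VectorField (0, 0)) : X.Fn →ₗ[ℝ] X.Fn :=
  ∑ μ, LinearMap.mulLeft ℝ (X.dx μ) ∘ₗ (D μ).toLin

theorem dhMap_apply (w : X.Fn) : dhMap D w = ∑ μ, X.dx μ * D μ w := by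
  simp [dhMap]

theorem isVF_dhMap (hX : IsOpen X.dom) : IsVF hX (1, 0) (dhMap D) :=
  IsVF.sum _ fun μ _ => ((D μ).isVF hX).mul_left (dx_mem μ)

/-- `L = d - E`. -/
theorem IsFieldHorizontalDifferential.eq_sub (hdeg : ∀ c, (X.deg c).1 = 0)
    (hD : IsTotalDerivative D) {L : X.VectorField (1, 0)} (hL : IsFieldHorizontalDifferential L)
    {E : X.Fn →ₗ[ℝ] X.Fn} (hE : IsExplicit hX E) (w : X.Fn) :
    L w = dhMap D w - E w := by
  have h : L.toLin + E = dhMap D := by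
    refine ((L.isVF hX).add hE.toIsVF).ext (isVF_dhMap hX) ?_ ?_
    · rintro (ν | ⟨b, I⟩)
      · simp [hL.x, hE.x, dhMap_apply, hD.x]
      · simp only [LinearMap.add_apply, hL.base, hE.base, add_zero, dhMap_apply, hD.base]
        exact Finset.sum_congr rfl fun μ _ => (dx_comm_of_mem (base_mem _) rfl μ).symm
    · rintro (ν | ⟨c, I⟩)
      · have h1 := hL.dx ν
        have h2 := fun μ => hD.dx μ ν
        rw [Patch.dx] at h1
        simp only [Patch.dx] at h2
        simp only [LinearMap.add_apply, h1, hE.gen, add_zero, dhMap_apply, h2, mul_zero,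
          Finset.sum_const_zero]
      · simp only [LinearMap.add_apply, hL.gen, hE.gen, add_zero, dhMap_apply, hD.gen]
        exact Finset.sum_congr rfl fun μ _ =>
          (dx_comm_of_mem (gen_mem (GenCoord.jet c (μ ::ₘ I))) (hdeg c) μ).symm
  rw [← h, LinearMap.add_apply, add_sub_cancel_right]

theorem exists_isFieldHorizontalDifferential (hX : IsOpen X.dom) (hD : IsTotalDerivative D) :
    ∃ L : X.VectorField (1, 0), IsFieldHorizontalDifferential L ∧
      ∀ μ w, L (D μ w) = D μ (L w) := by
  obtain ⟨f, hf, hb, hg⟩ := exists_isProl hX hD (d := (1, 0))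
    (fun b => ∑ μ, X.base (.jet b {μ}) * X.dx μ) (fun c => ∑ μ, X.gen (.jet c {μ}) * X.dx μ)
    (fun b => sum_mem fun μ _ => homog_congr (mul_mem_homog (base_mem _) (dx_mem μ)) (zero_add _))
    (fun c => sum_mem fun μ _ => mul_mem_homog (gen_mem (GenCoord.jet c {μ})) (dx_mem μ))
  have hDdx : ∀ (μ ν : Fin n) (w : X.Fn), D ν (w * X.dx μ) = D ν w * X.dx μ := by
    intro μ ν w
    induction w using fn_induction with
    | add a b ha hb => rw [add_mul, map_add, map_add, add_mul, ha, hb]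
    | mono F l =>
      rw [(D ν).leibniz _ _ (mono_mem_homog F l), hD.dx, mul_zero, smul_zero, add_zero]
  refine ⟨hf.toVectorField, ⟨hf.x, hf.dx, fun b I => ?_, fun c I => ?_⟩, hf.comm⟩
  · change f _ = _
    induction I using Multiset.induction_on with
    | empty => exact hb b
    | cons μ I ih =>
      rw [← hD.base, hf.comm, ih, map_sum]
      exact Finset.sum_congr rfl fun ν _ => by rw [hDdx, hD.base, Multiset.cons_swap]
  · change f _ = _
    induction I using Multiset.induction_on with
    | empty => exact hg c
    | cons μ I ih =>
      rw [← hD.gen, hf.comm, ih, map_sum]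
      exact Finset.sum_congr rfl fun ν _ => by rw [hDdx, hD.gen, Multiset.cons_swap]

theorem IsFieldHorizontalDifferential.unique (hX : IsOpen X.dom) {L L' : X.VectorField (1, 0)}
    (h : IsFieldHorizontalDifferential L) (h' : IsFieldHorizontalDifferential L') : L = L' := by
  refine VectorField.ext_of_coords hX ?_ ?_
  · rintro (ν | ⟨b, I⟩)
    · rw [h.x, h'.x]
    · rw [h.base, h'.base]
  · rintro (ν | ⟨c, I⟩)
    · exact (h.dx ν).trans (h'.dx ν).symm
    · rw [h.gen, h'.gen]

theorem IsField.E_eq_zero {E : X.Fn →ₗ[ℝ] X.Fn} (hE : IsExplicit hX E) {y : X.Fn} (hy : IsField y) :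
    E y = 0 := by
  obtain ⟨b, rfl⟩ | ⟨c, rfl⟩ := hy
  · exact hE.base _ _
  · exact hE.gen _

/-- Because `E η = 0`, the signed term of the Leibniz rule drops out, and `w` need not be
homogeneous. -/
theorem IsExplicit.mul {E : X.Fn →ₗ[ℝ] X.Fn} (hE : IsExplicit hX E) {w η : X.Fn} (hw : E w = 0)
    (hη : E η = 0) : E (w * η) = 0 := by
  suffices ∀ w : X.Fn, E (w * η) = E w * η by rw [this, hw, zero_mul]
  intro w
  induction w using fn_induction with
  | add a b ha hb => rw [add_mul, map_add, map_add, add_mul, ha, hb]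
  | mono F l =>
    rw [hE.leibniz (mono_mem_homog F l), hη, mul_zero, smul_zero, add_zero]

theorem IsExplicit.dx {E : X.Fn →ₗ[ℝ] X.Fn} (hE : IsExplicit hX E) (μ : Fin n) : E (X.dx μ) = 0 :=
  hE.gen _

theorem IsExplicit.comm {E : X.Fn →ₗ[ℝ] X.Fn} (hE : IsExplicit hX E) (hD : IsTotalDerivative D)
    (μ : Fin n) (w : X.Fn) : E (D μ w) = D μ (E w) := by
  have h0 : Patch.gcomm (1, 0) (0, 0) E (D μ).toLin = 0 := by
    refine (hE.toIsVF.gcomm ((D μ).isVF hX)).ext (IsVF.zero hX _) ?_ ?_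
    · rintro (ρ | ⟨b, I⟩)
      · have hf1 : E 1 = 0 := hE.toIsVF.toVectorField.map_one
        simp only [gcomm_apply, hD.x, sgn_zero_right', one_smul, LinearMap.zero_apply, hE.x, hD.dx]
        split_ifs <;> simp [hf1]
      · simp only [gcomm_apply, hD.base, sgn_zero_right', one_smul, LinearMap.zero_apply,
          hE.base, map_zero, sub_self]
    · rintro (ρ | ⟨c, I⟩)
      · have := hD.dx
        simp only [Patch.dx] at this
        simp only [gcomm_apply, this, hE.gen, map_zero, smul_zero, LinearMap.zero_apply, sub_self]
      · simp only [gcomm_apply, hD.gen, sgn_zero_right', one_smul, LinearMap.zero_apply,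
          hE.gen, map_zero, sub_self]
  have := LinearMap.congr_fun h0 w
  rw [gcomm_apply, sgn_zero_right', one_smul] at this
  exact sub_eq_zero.mp this

theorem IsExplicit.comm_eq_zero {E : X.Fn →ₗ[ℝ] X.Fn} (hE : IsExplicit hX E)
    (hD : IsTotalDerivative D) (μ : Fin n) {w : X.Fn} (hw : E w = 0) : E (D μ w) = 0 := by
  rw [hE.comm hD, hw, map_zero]

/-- The commutator of `L` with a prolonged vector field, on fields. -/
theorem gcomm_L_apply (hdeg : ∀ c, (X.deg c).1 = 0)
    (hD : IsTotalDerivative D) {L : X.VectorField (1, 0)} (hL : IsFieldHorizontalDifferential L)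
    {E : X.Fn →ₗ[ℝ] X.Fn} (hE : IsExplicit hX E) {d : ℤ × ℤ} {f : X.Fn →ₗ[ℝ] X.Fn}
    (hf : IsProl hX D d f) {y : X.Fn} (hy : IsField y) :
    gcomm (1, 0) d L.toLin f y = - E (f y) := by
  -- A prolonged `f` commutes in the graded sense with `d = ∑ dx^μ D_μ`, and `E` kills the field `y`
  -- itself. Only `E (f y)` survives.
  rw [gcomm_apply, hL.eq_sub hdeg hD hE, hL.eq_sub hdeg hD hE, hy.E_eq_zero hE, sub_zero,
    dhMap_apply, dhMap_apply, map_sum]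
  simp only [hf.dx_mul, sgn_comm d, ← Finset.smul_sum, sgn_smul_smul, hf.comm]
  abel

/-- A prolonged vector field whose values on fields do not depend explicitly on the `x^μ` commutes
with `L`. -/
theorem gcomm_L_eq_zero (hdeg : ∀ c, (X.deg c).1 = 0)
    (hD : IsTotalDerivative D) {L : X.VectorField (1, 0)} (hL : IsFieldHorizontalDifferential L)
    (hLp : IsProl hX D (1, 0) L.toLin)
    {E : X.Fn →ₗ[ℝ] X.Fn} (hE : IsExplicit hX E) {d : ℤ × ℤ} {f : X.Fn →ₗ[ℝ] X.Fn}
    (hf : IsProl hX D d f) (hEf : ∀ y, IsField y → E (f y) = 0) (w : X.Fn) :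
    L (f w) - sgn (1, 0) d • f (L w) = 0 :=
  (hLp.gcomm hf).eq_zero hD (fun y hy => by
    rw [gcomm_L_apply hdeg hD hL hE hf hy, hEf y hy, neg_zero]) w

/-! ## Criteria for `QK_{vg}`-structures -/

section Criteria

variable {𝔏 : Type*} {S : X.Operators 𝔏}

/-- The data common to the structures on both sides. -/
structure Operators.IsAdmissible (hX : IsOpen X.dom) (S : X.Operators 𝔏) : Prop where
  deg : ∀ c, (X.deg c).1 = 0
  total : IsTotalDerivative S.D
  L_eq : IsFieldHorizontalDifferential S.L
  Q : IsProl hX S.D (0, 1) S.Q.toLin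
  K : IsProl hX S.D (1, -1) S.K.toLin
  L : IsProl hX S.D (1, 0) S.L.toLin
  ι : ∀ l, IsProl hX S.D (0, -1) (S.ι l).toLin
  δ_eq : ∀ l w, S.δ l w = S.Q (S.ι l w) + S.ι l (S.Q w)

namespace Operators.IsAdmissible

variable (hS : S.IsAdmissible hX)
include hS

theorem gcomm_ι_L {E : X.Fn →ₗ[ℝ] X.Fn} (hE : IsExplicit hX E) (l : 𝔏) {y : X.Fn}
    (hy : IsField y) : S.L (S.ι l y) - S.ι l (S.L y) = - E (S.ι l y) := by
  have := gcomm_L_apply hS.deg hS.total hS.L_eq hE (hS.ι l) hy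
  rwa [gcomm_apply, sgn_even (by simp), one_smul] at this

variable [AddCommGroup 𝔏] [Module ℝ 𝔏]

/-- The relations assumed on fields extend to all functions because both sides are prolonged. The
remaining ones are formal consequences: `[Q, L]` and `[δ, Q]` vanish by `Q² = 0`, `[δ, δ]` is `Q`
applied to `[δ, ι]`, and the relations of `L` with `K` and with itself need only the absence of
explicit `x^μ` in the values on fields. -/
theorem isQKvg {br : 𝔏 → 𝔏 → 𝔏 → Prop} {E : X.Fn →ₗ[ℝ] X.Fn} (hE : IsExplicit hX E)
    (hQQ : ∀ y, IsField y → S.Q (S.Q y) = 0)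
    (hQK : ∀ y, IsField y → S.Q (S.K y) + S.K (S.Q y) = S.L y)
    (hEK : ∀ y, IsField y → E (S.K y) = 0)
    (hι : ∀ (r : ℝ) l₁ l₂ y, IsField y → S.ι (r • l₁ + l₂) y = r • S.ι l₁ y + S.ι l₂ y)
    (hδι : ∀ l₁ l₂ l₃, br l₁ l₂ l₃ → ∀ y, IsField y →
      S.δ l₁ (S.ι l₂ y) - S.ι l₂ (S.δ l₁ y) = S.ι l₃ y)
    (hιι : ∀ l₁ l₂ y, IsField y → S.ι l₁ (S.ι l₂ y) = 0)
    (hιK : ∀ l y, IsField y → S.ι l (S.K y) + S.K (S.ι l y) = 0) : S.IsQKvg br := by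
  have hD := hS.total
  have o1 : sgn (0, 1) (0, 1) = -1 := sgn_odd (by simp)
  have o2 : sgn (0, 1) (1, -1) = -1 := sgn_odd (by simp)
  have o3 : sgn (1, 0) (1, -1) = -1 := sgn_odd (by simp)
  have o4 : sgn (1, 0) (0, 1) = 1 := sgn_even (by simp)
  have o5 : sgn (1, 0) (1, 0) = -1 := sgn_odd (by simp)
  have o6 : sgn (0, -1) (0, -1) = -1 := sgn_odd (by simp)
  have o7 : sgn (0, -1) (1, -1) = -1 := sgn_odd (by simp)
  have o8 : sgn (0, 1) (0, -1) = -1 := sgn_odd (by simp)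
  -- For the odd operator `Q` the graded commutator with itself is `2 Q²`, so `Q²` is a prolonged
  -- vector field up to a factor.
  have Q_Q : ∀ w, S.Q (S.Q w) = 0 := fun w => by
    have := (hS.Q.gcomm hS.Q).eq_zero hD (fun y hy => by
      rw [gcomm_apply, hQQ y hy, smul_zero, sub_zero]) w
    rw [gcomm_apply, o1, neg_one_smul, sub_neg_eq_add, ← two_smul ℝ] at this
    exact (smul_eq_zero.mp this).resolve_left two_ne_zero
  have Q_K : ∀ w, S.Q (S.K w) + S.K (S.Q w) = S.L w := fun w => by
    have := LinearMap.congr_fun (((hS.Q.gcomm hS.K).congr_deg (e := (1, 0)) rfl).eq hD hS.L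
      fun y hy => by rw [gcomm_apply, o2, neg_one_smul, sub_neg_eq_add, hQK y hy]) w
    rwa [gcomm_apply, o2, neg_one_smul, sub_neg_eq_add] at this
  have δp : ∀ l, IsProl hX S.D (0, 0) (S.δ l).toLin := fun l => by
    have h : (S.δ l).toLin = Patch.gcomm (0, 1) (0, -1) S.Q.toLin (S.ι l).toLin := by
      refine LinearMap.ext fun w => ?_
      rw [gcomm_apply, o8, neg_one_smul, sub_neg_eq_add, hS.δ_eq]
    rw [h]
    exact hS.Q.gcomm (hS.ι l)
  have ι_linear : ∀ (r : ℝ) l₁ l₂ w, S.ι (r • l₁ + l₂) w = r • S.ι l₁ w + S.ι l₂ w :=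
    fun r l₁ l₂ w => LinearMap.congr_fun
      ((hS.ι _).eq hD (((hS.ι l₁).smul r).add (hS.ι l₂)) (hι r l₁ l₂)) w
  have δ_Q : ∀ l w, S.δ l (S.Q w) - S.Q (S.δ l w) = 0 := fun l w => by
    rw [hS.δ_eq, hS.δ_eq, Q_Q, map_zero, map_add, Q_Q]
    abel
  have δ_ι : ∀ l₁ l₂ l₃, br l₁ l₂ l₃ → ∀ w, S.δ l₁ (S.ι l₂ w) - S.ι l₂ (S.δ l₁ w) = S.ι l₃ w := by
    intro l₁ l₂ l₃ h w
    have := LinearMap.congr_fun ((((δp l₁).gcomm (hS.ι l₂)).congr_deg (e := (0, -1)) rfl).eq hD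
      (hS.ι l₃) fun y hy => by rw [gcomm_apply, sgn_zero_left', one_smul, hδι _ _ _ h y hy]) w
    rwa [gcomm_apply, sgn_zero_left', one_smul] at this
  refine ⟨Q_Q, Q_K, ?_, ?_, ?_, hS.L_eq, ι_linear, ?_, ?_, δ_ι, δ_Q, ?_, ?_, ?_⟩
  · intro w
    have := gcomm_L_eq_zero hS.deg hD hS.L_eq hS.L hE hS.K hEK w
    rwa [o3, neg_one_smul, sub_neg_eq_add] at this
  · intro w
    rw [← Q_K, ← Q_K, map_add, Q_Q, Q_Q, map_zero]
    abel
  · intro w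
    have := gcomm_L_eq_zero hS.deg hD hS.L_eq hS.L hE hS.L (fun y hy => by
      obtain ⟨b, rfl⟩ | ⟨c, rfl⟩ := hy
      · rw [hS.L_eq.base, map_sum]
        exact Finset.sum_eq_zero fun μ _ => hE.mul (hE.base _ _) (hE.gen _)
      · rw [hS.L_eq.gen, map_sum]
        exact Finset.sum_eq_zero fun μ _ => hE.mul (hE.gen _) (hE.gen _)) w
    rw [o5, neg_one_smul, sub_neg_eq_add, ← two_smul ℝ] at this
    exact (smul_eq_zero.mp this).resolve_left two_ne_zero
  · intro r l₁ l₂ w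
    simp only [hS.δ_eq, ι_linear, map_add, map_smul, smul_add]
    abel
  -- Write `δ_{l₂} = Q ι_{l₂} + ι_{l₂} Q` and move `δ_{l₁}` through `Q`; what is left are two copies
  -- of `[δ, ι]`.
  · intro l₁ l₂ l₃ h w
    have h1 : S.δ l₁ (S.Q (S.ι l₂ w)) = S.Q (S.δ l₁ (S.ι l₂ w)) := sub_eq_zero.mp (δ_Q _ _)
    have h2 : S.Q (S.δ l₁ w) = S.δ l₁ (S.Q w) := (sub_eq_zero.mp (δ_Q _ _)).symm
    rw [hS.δ_eq l₂, hS.δ_eq l₂, map_add, h1, h2, hS.δ_eq l₃, ← δ_ι _ _ _ h, ← δ_ι _ _ _ h, map_sub]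
    abel
  · intro l₁ l₂ w
    have := ((hS.ι l₁).gcomm (hS.ι l₂)).eq_zero hD (fun y hy => by
      rw [gcomm_apply, hιι _ _ y hy, hιι _ _ y hy, smul_zero, sub_zero]) w
    rwa [gcomm_apply, o6, neg_one_smul, sub_neg_eq_add] at this
  · exact fun l w => (hS.δ_eq l w).symm
  · intro l w
    have := ((hS.ι l).gcomm hS.K).eq_zero hD (fun y hy => by
      rw [gcomm_apply, o7, neg_one_smul, sub_neg_eq_add, hιK _ y hy]) w
    rwa [gcomm_apply, o7, neg_one_smul, sub_neg_eq_add] at this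

/-- h-simplicity holds if the explicit derivative of each contraction is, locally, a combination of
contractions. -/
theorem isHSimple {br : 𝔏 → 𝔏 → 𝔏 → Prop} (hqk : S.IsQKvg br) {E : X.Fn →ₗ[ℝ] X.Fn}
    (hE : IsExplicit hX E)
    (hloc : ∀ l (p : X.dom), ∃ O, IsOpen O ∧ p.1 ∈ O ∧ ∃ l' : Fin n → 𝔏, ∀ y, IsField y →
      ∀ q : X.dom, q.1 ∈ O → evalAt q (E (S.ι l y)) = evalAt q (∑ μ, X.dx μ * S.ι (l' μ) y)) :
    S.IsHSimple := by
  intro w hw l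
  -- Graded Jacobi for `δ = [Q, ι]` together with `[ι, K] = 0` turns `[δ, K]` into `[ι, [Q, K]] =
  -- [ι, L]`.
  have hcomm : S.δ l (S.K w) - S.K (S.δ l w) = S.ι l (S.L w) - S.L (S.ι l w) := by
    have h1 : ∀ w, S.ι l (S.K w) = - S.K (S.ι l w) := fun w => eq_neg_of_add_eq_zero_left (hqk.ι_K l w)
    rw [hS.δ_eq, hS.δ_eq, map_add, h1 w, map_neg, ← hqk.Q_K w, ← hqk.Q_K (S.ι l w), map_add, h1 (S.Q w)]
    abel
  rw [hcomm]
  refine ext_evalAt fun p => ?_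
  obtain ⟨O, hO, hp, l', hl'⟩ := hloc l p
  have h7 : sgn (0, -1) (1, 0) = 1 := sgn_even (by simp)
  -- The difference of `[ι_l, L]` and `∑ dx^μ ι_{l'_μ}` is prolonged. On fields it is the difference
  -- of `E ι_l y` and `∑ dx^μ ι_{l'_μ} y`, so by assumption it vanishes on `O`.
  have hW : IsProl hX S.D (1, -1) (Patch.gcomm (0, -1) (1, 0) (S.ι l).toLin S.L.toLin -
      ∑ μ, LinearMap.mulLeft ℝ (X.dx μ) ∘ₗ (S.ι (l' μ)).toLin) := by
    refine (((hS.ι l).gcomm hS.L).congr_deg (e := (1, -1)) rfl).sub ?_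
    refine Finset.sum_induction _ (IsProl hX S.D (1, -1)) (fun _ _ => IsProl.add) ?_ fun μ _ =>
      (hS.ι (l' μ)).dx_mul_left hS.total μ
    -- The zero map, needed to start the sum, is obtained as a multiple of `K`, which has the
    -- bidegree required here.
    have := hS.K.smul 0
    rwa [zero_smul] at this
  have hWa : ∀ w, (Patch.gcomm (0, -1) (1, 0) (S.ι l).toLin S.L.toLin -
      ∑ μ, LinearMap.mulLeft ℝ (X.dx μ) ∘ₗ (S.ι (l' μ)).toLin) w =
      S.ι l (S.L w) - S.L (S.ι l w) - ∑ μ, X.dx μ * S.ι (l' μ) w := by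
    intro w
    rw [LinearMap.sub_apply, gcomm_apply, h7, one_smul, LinearMap.sum_apply]
    rfl
  -- Vanishing on all of `O`, and not merely at `p`, is preserved by total derivatives, since vector
  -- fields are local.
  have := hW.comp_eq_zero hS.total (evalAt p) (fun w => ∀ q : X.dom, q.1 ∈ O → evalAt q w = 0)
    (fun w h => h p hp) (fun μ w h q hq => ((S.D μ).isVF hX).evalAt_eq_zero hO h q hq)
    (fun y hy q hq => by
      rw [hWa, ← neg_sub (S.L (S.ι l y)), hS.gcomm_ι_L hE l hy, neg_neg, map_sub, hl' y hy q hq,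
        sub_self]) w
  rw [hWa] at this
  simpa [hw] using this

end Operators.IsAdmissible

end Criteria

end Patch

end

section

/-! ## Calculus of brackets -/

/-- Structure constants of a Lie algebra. -/
structure IsLieConst {r : ℕ} (f : Fin r → Fin r → Fin r → ℝ) : Prop where
  anti : ∀ i j a, f i j a = -f j i a
  jacobi : ∀ i j k a,
    ∑ m, f j k m * f i m a = ∑ m, f i j m * f m k a + ∑ m, f i k m * f j m a

section Brackets

variable {r : ℕ} {R : Type*} [Ring R] [Algebra ℝ R] (f : Fin r → Fin r → Fin r → ℝ)

theorem bkt_add_left (α α' β : Fin r → R) : bkt f (α + α') β = bkt f α β + bkt f α' β := by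
  ext a
  simp only [bkt, Pi.add_apply, add_mul, smul_add, Finset.sum_add_distrib]

theorem bkt_add_right (α β β' : Fin r → R) : bkt f α (β + β') = bkt f α β + bkt f α β' := by
  ext a
  simp only [bkt, Pi.add_apply, mul_add, smul_add, Finset.sum_add_distrib]

theorem bkt_smul_left (c : ℝ) (α β : Fin r → R) : bkt f (c • α) β = c • bkt f α β := by
  ext a
  simp only [bkt, Pi.smul_apply, smul_mul_assoc, Finset.smul_sum, smul_comm c]

theorem bkt_smul_right (c : ℝ) (α β : Fin r → R) : bkt f α (c • β) = c • bkt f α β := by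
  ext a
  simp only [bkt, Pi.smul_apply, mul_smul_comm, Finset.smul_sum, smul_comm c]

theorem bkt_neg_left (α β : Fin r → R) : bkt f (-α) β = -bkt f α β := by
  rw [← neg_one_smul ℝ α, bkt_smul_left, neg_one_smul]

theorem bkt_neg_right (α β : Fin r → R) : bkt f α (-β) = -bkt f α β := by
  rw [← neg_one_smul ℝ β, bkt_smul_right, neg_one_smul]

theorem bkt_sub_left (α α' β : Fin r → R) : bkt f (α - α') β = bkt f α β - bkt f α' β := by
  rw [sub_eq_add_neg, bkt_add_left, bkt_neg_left, sub_eq_add_neg]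

theorem bkt_sub_right (α β β' : Fin r → R) : bkt f α (β - β') = bkt f α β - bkt f α β' := by
  rw [sub_eq_add_neg, bkt_add_right, bkt_neg_right, sub_eq_add_neg]

theorem bkt_zero_left (β : Fin r → R) : bkt f 0 β = 0 := by
  ext a
  simp [bkt]

theorem bkt_zero_right (α : Fin r → R) : bkt f α 0 = 0 := by
  ext a
  simp [bkt]

theorem bkt_sum_left {ι : Type*} (s : Finset ι) (α : ι → Fin r → R) (β : Fin r → R) :
    bkt f (∑ i ∈ s, α i) β = ∑ i ∈ s, bkt f (α i) β := by
  classical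
  induction s using Finset.induction_on with
  | empty => simp [bkt_zero_left]
  | insert a s ha ih => rw [Finset.sum_insert ha, Finset.sum_insert ha, bkt_add_left, ih]

theorem bkt_sum_right {ι : Type*} (s : Finset ι) (α : Fin r → R) (β : ι → Fin r → R) :
    bkt f α (∑ i ∈ s, β i) = ∑ i ∈ s, bkt f α (β i) := by
  classical
  induction s using Finset.induction_on with
  | empty => simp [bkt_zero_right]
  | insert a s ha ih => rw [Finset.sum_insert ha, Finset.sum_insert ha, bkt_add_right, ih]

theorem map_bkt {R' : Type*} [Ring R'] [Algebra ℝ R'] (Φ : R →ₐ[ℝ] R') (α β : Fin r → R)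
    (a : Fin r) : Φ (bkt f α β a) = bkt f (fun i => Φ (α i)) (fun i => Φ (β i)) a := by
  simp only [bkt, map_sum, map_smul, map_mul]

end Brackets

namespace Patch

variable {n : ℕ} {X : Patch n} {r : ℕ} {f : Fin r → Fin r → Fin r → ℝ}

theorem bkt_mem {d e : ℤ × ℤ} {α β : Fin r → X.Fn} (hα : ∀ i, α i ∈ X.homog d)
    (hβ : ∀ i, β i ∈ X.homog e) (a : Fin r) : bkt f α β a ∈ X.homog (d + e) :=
  sum_mem fun i _ => sum_mem fun j _ => Submodule.smul_mem _ _ (mul_mem_homog (hα i) (hβ j))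

theorem bkt_comm (hf : IsLieConst f) {d e : ℤ × ℤ} {α β : Fin r → X.Fn}
    (hα : ∀ i, α i ∈ X.homog d) (hβ : ∀ i, β i ∈ X.homog e) :
    bkt f α β = -(sgn d e • bkt f β α) := by
  ext a
  simp only [bkt, Pi.neg_apply, Pi.smul_apply, Finset.smul_sum]
  rw [Finset.sum_comm, ← Finset.sum_neg_distrib]
  refine Finset.sum_congr rfl fun i _ => ?_
  rw [← Finset.sum_neg_distrib]
  refine Finset.sum_congr rfl fun j _ => ?_
  rw [homog_comm (hα j) (hβ i), hf.anti j i a, neg_smul, smul_comm]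

theorem bkt_comm_odd (hf : IsLieConst f) {d e : ℤ × ℤ} {α β : Fin r → X.Fn}
    (hα : ∀ i, α i ∈ X.homog d) (hβ : ∀ i, β i ∈ X.homog e) (h : Odd (d.1 * e.1 + d.2 * e.2)) :
    bkt f α β = bkt f β α := by
  rw [bkt_comm hf hα hβ, sgn_odd h, neg_one_smul, neg_neg]

theorem bkt_comm_even (hf : IsLieConst f) {d e : ℤ × ℤ} {α β : Fin r → X.Fn}
    (hα : ∀ i, α i ∈ X.homog d) (hβ : ∀ i, β i ∈ X.homog e) (h : Even (d.1 * e.1 + d.2 * e.2)) :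
    bkt f α β = -bkt f β α := by
  rw [bkt_comm hf hα hβ, sgn_even h, one_smul]

theorem bkt_self_even (hf : IsLieConst f) {d : ℤ × ℤ} {α : Fin r → X.Fn}
    (hα : ∀ i, α i ∈ X.homog d) (h : Even (d.1 * d.1 + d.2 * d.2)) : bkt f α α = 0 := by
  have h1 := bkt_comm_even hf hα hα h
  rw [eq_neg_iff_add_eq_zero, ← two_smul ℝ] at h1
  exact (smul_eq_zero.mp h1).resolve_left two_ne_zero

/-- The graded Jacobi identity. -/
theorem bkt_jacobi (hf : IsLieConst f) {d e : ℤ × ℤ} {α β : Fin r → X.Fn} (γ : Fin r → X.Fn)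
    (hα : ∀ i, α i ∈ X.homog d) (hβ : ∀ i, β i ∈ X.homog e) :
    bkt f α (bkt f β γ) = bkt f (bkt f α β) γ + sgn d e • bkt f β (bkt f α γ) := by
  ext a
  have h1 : bkt f α (bkt f β γ) a =
      ∑ i, ∑ j, ∑ k, (∑ m, f j k m * f i m a) • (α i * β j * γ k) := by
    simp only [bkt, Finset.mul_sum, Finset.smul_sum, Finset.sum_smul, mul_smul_comm, smul_smul,
      mul_assoc]
    refine Finset.sum_congr rfl fun i _ => ?_
    rw [Finset.sum_comm]
    refine Finset.sum_congr rfl fun j _ => ?_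
    rw [Finset.sum_comm]
    simp only [mul_comm]
  have h2 : bkt f (bkt f α β) γ a =
      ∑ i, ∑ j, ∑ k, (∑ m, f i j m * f m k a) • (α i * β j * γ k) := by
    simp only [bkt, Finset.sum_mul, Finset.smul_sum, Finset.sum_smul, smul_mul_assoc, smul_smul]
    calc _ = ∑ m, ∑ i, ∑ k, ∑ j, (f m k a * f i j m) • (α i * β j * γ k) :=
          Finset.sum_congr rfl fun m _ => Finset.sum_comm
      _ = ∑ i, ∑ m, ∑ k, ∑ j, (f m k a * f i j m) • (α i * β j * γ k) := Finset.sum_comm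
      _ = ∑ i, ∑ m, ∑ j, ∑ k, (f m k a * f i j m) • (α i * β j * γ k) :=
          Finset.sum_congr rfl fun i _ => Finset.sum_congr rfl fun m _ => Finset.sum_comm
      _ = ∑ i, ∑ j, ∑ m, ∑ k, (f m k a * f i j m) • (α i * β j * γ k) :=
          Finset.sum_congr rfl fun i _ => Finset.sum_comm
      _ = ∑ i, ∑ j, ∑ k, ∑ m, (f m k a * f i j m) • (α i * β j * γ k) :=
          Finset.sum_congr rfl fun i _ => Finset.sum_congr rfl fun m _ => Finset.sum_comm
      _ = _ := by simp only [mul_comm]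
  have h3 : sgn d e • bkt f β (bkt f α γ) a =
      ∑ i, ∑ j, ∑ k, (∑ m, f i k m * f j m a) • (α i * β j * γ k) := by
    have : bkt f β (bkt f α γ) a =
        ∑ j, ∑ i, ∑ k, (∑ m, f i k m * f j m a) • (β j * α i * γ k) := by
      simp only [bkt, Finset.mul_sum, Finset.smul_sum, Finset.sum_smul, mul_smul_comm, smul_smul,
        mul_assoc]
      refine Finset.sum_congr rfl fun i _ => ?_
      rw [Finset.sum_comm]
      refine Finset.sum_congr rfl fun j _ => ?_
      rw [Finset.sum_comm]
      simp only [mul_comm]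
    rw [this, Finset.sum_comm, Finset.smul_sum]
    refine Finset.sum_congr rfl fun i _ => ?_
    rw [Finset.smul_sum]
    refine Finset.sum_congr rfl fun j _ => ?_
    rw [Finset.smul_sum]
    refine Finset.sum_congr rfl fun k _ => ?_
    rw [homog_comm (hα i) (hβ j), smul_mul_assoc, smul_comm]
  rw [Pi.add_apply, Pi.smul_apply, h1, h2, h3]
  simp only [← Finset.sum_add_distrib, ← add_smul]
  refine Finset.sum_congr rfl fun i _ => Finset.sum_congr rfl fun j _ =>
    Finset.sum_congr rfl fun k _ => ?_
  rw [hf.jacobi, Finset.sum_add_distrib]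

theorem bkt_jacobi_even (hf : IsLieConst f) {d e : ℤ × ℤ} {α β : Fin r → X.Fn} (γ : Fin r → X.Fn)
    (hα : ∀ i, α i ∈ X.homog d) (hβ : ∀ i, β i ∈ X.homog e) (h : Even (d.1 * e.1 + d.2 * e.2)) :
    bkt f α (bkt f β γ) = bkt f (bkt f α β) γ + bkt f β (bkt f α γ) := by
  rw [bkt_jacobi hf γ hα hβ, sgn_even h, one_smul]

theorem bkt_jacobi_odd (hf : IsLieConst f) {d e : ℤ × ℤ} {α β : Fin r → X.Fn} (γ : Fin r → X.Fn)
    (hα : ∀ i, α i ∈ X.homog d) (hβ : ∀ i, β i ∈ X.homog e) (h : Odd (d.1 * e.1 + d.2 * e.2)) :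
    bkt f α (bkt f β γ) = bkt f (bkt f α β) γ - bkt f β (bkt f α γ) := by
  rw [bkt_jacobi hf γ hα hβ, sgn_odd h, neg_one_smul, sub_eq_add_neg]

theorem IsVF.map_bkt {hX : IsOpen X.dom} {d e : ℤ × ℤ} {V : X.Fn →ₗ[ℝ] X.Fn} (hV : IsVF hX d V)
    {α : Fin r → X.Fn} (β : Fin r → X.Fn) (hα : ∀ i, α i ∈ X.homog e) :
    V.compLeft (Fin r) (bkt f α β) =
      bkt f (V.compLeft _ α) β + sgn d e • bkt f α (V.compLeft _ β) := by
  ext a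
  simp only [bkt, LinearMap.compLeft_apply, Function.comp_apply, map_sum, map_smul,
    hV.leibniz (hα _), Pi.add_apply, Pi.smul_apply, smul_add, Finset.sum_add_distrib,
    Finset.smul_sum, smul_comm (sgn d e)]

theorem IsVF.map_bkt_even {hX : IsOpen X.dom} {d e : ℤ × ℤ} {V : X.Fn →ₗ[ℝ] X.Fn}
    (hV : IsVF hX d V) {α : Fin r → X.Fn} (β : Fin r → X.Fn) (hα : ∀ i, α i ∈ X.homog e)
    (h : Even (d.1 * e.1 + d.2 * e.2)) :
    V.compLeft (Fin r) (bkt f α β) = bkt f (V.compLeft _ α) β + bkt f α (V.compLeft _ β) := by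
  rw [hV.map_bkt β hα, sgn_even h, one_smul]

theorem IsVF.map_bkt_odd {hX : IsOpen X.dom} {d e : ℤ × ℤ} {V : X.Fn →ₗ[ℝ] X.Fn}
    (hV : IsVF hX d V) {α : Fin r → X.Fn} (β : Fin r → X.Fn) (hα : ∀ i, α i ∈ X.homog e)
    (h : Odd (d.1 * e.1 + d.2 * e.2)) :
    V.compLeft (Fin r) (bkt f α β) = bkt f (V.compLeft _ α) β - bkt f α (V.compLeft _ β) := by
  rw [hV.map_bkt β hα, sgn_odd h, neg_one_smul, sub_eq_add_neg]

/-! ### Horizontal forms with values in the Lie algebra -/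

/-- Multiplication of the components with `dx^μ`. -/
def mulDx (r : ℕ) (μ : Fin n) : (Fin r → X.Fn) →ₗ[ℝ] (Fin r → X.Fn) :=
  (LinearMap.mulRight ℝ (X.dx μ)).compLeft (Fin r)

theorem mulDx_apply (μ : Fin n) (α : Fin r → X.Fn) (a : Fin r) :
    mulDx r μ α a = α a * X.dx μ := rfl

theorem bkt_mulDx_right (μ : Fin n) (α β : Fin r → X.Fn) :
    bkt f α (mulDx r μ β) = mulDx r μ (bkt f α β) := by
  ext a
  simp only [bkt, mulDx_apply, Finset.sum_mul, smul_mul_assoc, mul_assoc]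

/-- Moving `dx^μ` past `β` costs no sign because `β` has horizontal degree zero. -/
theorem bkt_mulDx_left (μ : Fin n) (α : Fin r → X.Fn) {β : Fin r → X.Fn} {e : ℤ × ℤ}
    (hβ : ∀ i, β i ∈ X.homog e) (he : e.1 = 0) :
    bkt f (mulDx r μ α) β = mulDx r μ (bkt f α β) := by
  ext a
  simp only [bkt, mulDx_apply, Finset.sum_mul, smul_mul_assoc, mul_assoc,
    dx_comm_of_mem (hβ _) he]

/-- With `dx^μ` on the right, the sign of the Leibniz rule falls on the vanishing term. The rule
therefore holds for inhomogeneous `w` too. -/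
theorem leibniz_right_dx {hX : IsOpen X.dom} {d : ℤ × ℤ} {V : X.Fn →ₗ[ℝ] X.Fn}
    (hV : IsVF hX d V) (hdx : ∀ μ, V (X.dx μ) = 0) (μ : Fin n) (w : X.Fn) :
    V (w * X.dx μ) = V w * X.dx μ := by
  induction w using fn_induction with
  | add a b ha hb => rw [add_mul, map_add, map_add, add_mul, ha, hb]
  | mono F l =>
    rw [hV.leibniz (mono_mem_homog F l), hdx, mul_zero, smul_zero, add_zero]

theorem compLeft_mulDx {hX : IsOpen X.dom} {d : ℤ × ℤ} {V : X.Fn →ₗ[ℝ] X.Fn}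
    (hV : IsVF hX d V) (hdx : ∀ μ, V (X.dx μ) = 0) (μ : Fin n) (α : Fin r → X.Fn) :
    V.compLeft (Fin r) (mulDx r μ α) = mulDx r μ (V.compLeft _ α) := by
  ext a
  exact leibniz_right_dx hV hdx μ (α a)

theorem IsField.L_eq {D : Fin n → X.VectorField (0, 0)} (hD : IsTotalDerivative D)
    {L : X.VectorField (1, 0)} (hL : IsFieldHorizontalDifferential L) {y : X.Fn} (hy : IsField y) :
    L y = ∑ μ, D μ y * X.dx μ := by
  obtain ⟨b, rfl⟩ | ⟨c, rfl⟩ := hy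
  · simp only [hL.base, hD.base]
  · simp only [hL.gen, hD.gen]

end Patch

end

section

open Patch

/-! ## The universal side -/

theorem continuous_xPoint {n : ℕ} {B : Type} :
    Continuous (xPoint : (BaseCoord n B → ℝ) → EuclideanSpace ℝ (Fin n)) :=
  (PiLp.continuous_toLp 2 _).comp (continuous_pi fun _ => continuous_apply _)

theorem continuous_uPoint {n N : ℕ} :
    Continuous (uPoint : (BaseCoord n (Fin N) → ℝ) → EuclideanSpace ℝ (Fin N)) :=
  (PiLp.continuous_toLp 2 _).comp (continuous_pi fun _ => continuous_apply _)

theorem isOpen_universalPatch_dom (r : ℕ) {n : ℕ} {U : Set (EuclideanSpace ℝ (Fin n))}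
    (hU : IsOpen U) : IsOpen (universalPatch r n U).dom := hU.preimage continuous_xPoint

theorem isOpen_mappingPatch_dom {n N : ℕ} {U : Set (EuclideanSpace ℝ (Fin n))}
    {V : Set (EuclideanSpace ℝ (Fin N))} (hU : IsOpen U) (hV : IsOpen V) :
    IsOpen (mappingPatch n N U V).dom :=
  (hU.preimage continuous_xPoint).inter (hV.preimage continuous_uPoint)

theorem contDiffOn_toLp {m : ℕ} {h : EuclideanSpace ℝ (Fin m) → ℝ}
    {U : Set (EuclideanSpace ℝ (Fin m))} (hh : ContDiffOn ℝ ∞ h U) :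
    ContDiffOn ℝ ∞ (fun y : Fin m → ℝ => h (WithLp.toLp 2 y)) {y | WithLp.toLp 2 y ∈ U} :=
  hh.comp (PiLp.contDiff_toLp (p := 2)).contDiffOn fun _ h => h

theorem isLocal_xPoint {n : ℕ} {B : Type} {dom : Set (BaseCoord n B → ℝ)}
    {U : Set (EuclideanSpace ℝ (Fin n))} (hdom : ∀ p ∈ dom, xPoint p ∈ U)
    {h : EuclideanSpace ℝ (Fin n) → ℝ} (hh : ContDiffOn ℝ ∞ h U) :
    IsLocal dom fun p => h (xPoint p.1) :=
  IsLocal.comp (contDiffOn_toLp hh) (fun μ => (coordLoc (.x μ) : LocFun dom))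
    fun p => by exact hdom p.1 p.2

theorem isLocal_uPoint {n N : ℕ} {dom : Set (BaseCoord n (Fin N) → ℝ)}
    {V : Set (EuclideanSpace ℝ (Fin N))} (hdom : ∀ p ∈ dom, uPoint p ∈ V)
    {h : EuclideanSpace ℝ (Fin N) → ℝ} (hh : ContDiffOn ℝ ∞ h V) :
    IsLocal dom fun p => h (uPoint p.1) :=
  IsLocal.comp (contDiffOn_toLp hh) (fun j => (coordLoc (.jet j 0) : LocFun dom))
    fun p => by exact hdom p.1 p.2

section ChainRule

open Classical in
/-- The chain rule for smooth functions of finitely many local functions. -/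
theorem Patch.IsVF.chain_comp {n : ℕ} {X : Patch n} {hX : IsOpen X.dom} {d : ℤ × ℤ}
    {f : X.Fn →ₗ[ℝ] X.Fn} (hf : IsVF hX d f) {ι : Type*} [Fintype ι] {g : (ι → ℝ) → ℝ}
    {S : Set (ι → ℝ)} (hS : IsOpen S) (hg : ContDiffOn ℝ ∞ g S) (t : ι → LocFun X.dom)
    (ht : ∀ p, (fun i => (t i).1 p) ∈ S) {F : LocFun X.dom}
    (hF : ∀ p, F.1 p = g fun i => (t i).1 p) (G : ι → LocFun X.dom)
    (hG : ∀ i p, (G i).1 p = fderiv ℝ g (fun i => (t i).1 p) (Pi.single i 1)) :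
    f (X.incl F) = ∑ i, X.incl (G i) * f (X.incl (t i)) := by
  choose s hs using fun i => exists_pd_support hX (t i)
  have hpd : ∀ j, pd hX j F = ∑ i, G i * pd hX j (t i) := by
    intro j
    ext p
    have h := pd_comp hX t hF j p
      ((hg.contDiffAt (hS.mem_nhds (ht p))).differentiableAt (by simp))
    rw [h]
    simp only [← hG]
    change _ = evalLoc p (∑ i, G i * pd hX j (t i))
    rw [map_sum]
    rfl
  have hsupp : ∀ i, ∀ j ∉ Finset.univ.biUnion s, pd hX j (t i) = 0 := fun i j hj =>
    hs i j fun h => hj (Finset.mem_biUnion.2 ⟨i, Finset.mem_univ i, h⟩)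
  rw [hf.chain F (Finset.univ.biUnion s)]
  · simp only [hf.chain _ _ (hsupp _), hpd, incl_sum, incl_mul, Finset.sum_mul, Finset.mul_sum,
      mul_assoc]
    exact Finset.sum_comm
  · intro j hj
    rw [hpd]
    exact Finset.sum_eq_zero fun i _ => by rw [hsupp i j hj, mul_zero]

theorem fderiv_toLp {m : ℕ} {h : EuclideanSpace ℝ (Fin m) → ℝ} {y : Fin m → ℝ}
    (hh : DifferentiableAt ℝ h (WithLp.toLp 2 y)) (v : Fin m → ℝ) :
    fderiv ℝ (fun y : Fin m → ℝ => h (WithLp.toLp 2 y)) y v =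
      fderiv ℝ h (WithLp.toLp 2 y) (WithLp.toLp 2 v) := by
  have h1 := hh.hasFDerivAt.comp y (PiLp.hasFDerivAt_toLp (p := 2) (𝕜 := ℝ) y)
  exact congrArg (fun L : (Fin m → ℝ) →L[ℝ] ℝ => L v) h1.fderiv

/-- The partial derivative of a function on Euclidean space. -/
def pderiv {m : ℕ} (i : Fin m) (h : EuclideanSpace ℝ (Fin m) → ℝ) (x : EuclideanSpace ℝ (Fin m)) :
    ℝ := fderiv ℝ h x (EuclideanSpace.single i 1)

theorem contDiffOn_pderiv {m : ℕ} {h : EuclideanSpace ℝ (Fin m) → ℝ}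
    {U : Set (EuclideanSpace ℝ (Fin m))} (hU : IsOpen U) (hh : ContDiffOn ℝ ∞ h U) (i : Fin m) :
    ContDiffOn ℝ ∞ (GaugeQK.pderiv i h) U :=
  (hh.fderiv_of_isOpen hU (m := ∞) (by simp)).clm_apply contDiffOn_const

variable {n : ℕ} {X : Patch n}

open Classical in
theorem Patch.IsVF.chain_euclidean {hX : IsOpen X.dom} {d : ℤ × ℤ}
    {f : X.Fn →ₗ[ℝ] X.Fn} (hf : IsVF hX d f) {m : ℕ} {h : EuclideanSpace ℝ (Fin m) → ℝ}
    {U : Set (EuclideanSpace ℝ (Fin m))} (hU : IsOpen U) (hh : ContDiffOn ℝ ∞ h U)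
    (i : Fin m → BaseCoord n X.B) (ht : ∀ p : X.dom, WithLp.toLp 2 (fun j => p.1 (i j)) ∈ U) :
    f (X.ofFun fun p => h (WithLp.toLp 2 fun j => p.1 (i j))) =
      ∑ j, (X.ofFun fun p => pderiv j h (WithLp.toLp 2 fun j => p.1 (i j))) * f (X.base (i j)) := by
  have hloc : ∀ {h : EuclideanSpace ℝ (Fin m) → ℝ}, ContDiffOn ℝ ∞ h U →
      IsLocal X.dom fun p => h (WithLp.toLp 2 fun j => p.1 (i j)) := fun hh =>
    IsLocal.comp (contDiffOn_toLp hh) (fun j => (coordLoc (i j) : LocFun X.dom))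
      fun p => by exact ht p
  rw [ofFun_of_isLocal (hloc hh), hf.chain_comp
    (hU.preimage (PiLp.continuous_toLp 2 _)) (contDiffOn_toLp hh)
    (fun j => (coordLoc (i j) : LocFun X.dom)) (fun p => by exact ht p) (fun _ => rfl)
    (fun j => ⟨_, hloc (contDiffOn_pderiv hU hh j)⟩)]
  · simp only [base_eq, ofFun_of_isLocal (hloc (contDiffOn_pderiv hU hh _))]
  · intro j p
    refine Eq.trans ?_ (fderiv_toLp (y := fun k => p.1 (i k))
      ((hh.contDiffAt (hU.mem_nhds (ht p))).differentiableAt (by simp)) _).symm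
    change fderiv ℝ h _ (EuclideanSpace.single j 1) = fderiv ℝ h _ _
    congr 1
    ext k
    simp [Pi.single_apply]

theorem Patch.IsVF.map_ofFun_xPoint {hX : IsOpen X.dom} {d : ℤ × ℤ}
    {f : X.Fn →ₗ[ℝ] X.Fn} (hf : IsVF hX d f) {h : EuclideanSpace ℝ (Fin n) → ℝ}
    {U : Set (EuclideanSpace ℝ (Fin n))} (hU : IsOpen U) (hh : ContDiffOn ℝ ∞ h U)
    (ht : ∀ p ∈ X.dom, xPoint p ∈ U) :
    f (X.ofFun fun p => h (xPoint p.1)) =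
      ∑ μ, (X.ofFun fun p => pderiv μ h (xPoint p.1)) * f (X.base (.x μ)) :=
  hf.chain_euclidean hU hh (fun μ => .x μ) fun p => ht p.1 p.2

end ChainRule

section Universal

variable {r n : ℕ} {U : Set (EuclideanSpace ℝ (Fin n))}

theorem theta_mem (a : Fin r) : theta r n U a ∈ (universalPatch r n U).homog (0, 1) :=
  gen_mem (X := universalPatch r n U) (GenCoord.jet (.theta a) 0)

theorem phi_mem (a : Fin r) : phi r n U a ∈ (universalPatch r n U).homog (0, 2) :=
  gen_mem (X := universalPatch r n U) (GenCoord.jet (.phi a) 0)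

theorem upsilon_mem (μ : Fin n) (a : Fin r) :
    upsilon r n U μ a ∈ (universalPatch r n U).homog (0, 1) :=
  gen_mem (X := universalPatch r n U) (GenCoord.jet (.upsilon a μ) 0)

theorem conn_mem (μ : Fin n) (a : Fin r) : conn r n U μ a ∈ (universalPatch r n U).homog 0 :=
  base_mem (X := universalPatch r n U) (BaseCoord.jet (a, μ) 0)

theorem connForm_eq : connForm r n U = ∑ μ, mulDx r μ (conn r n U μ) := by
  ext a
  rw [Finset.sum_apply]
  rfl

theorem upsilonForm_eq : upsilonForm r n U = ∑ μ, mulDx r μ (upsilon r n U μ) := by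
  ext a
  rw [Finset.sum_apply]
  rfl

theorem connForm_mem (a : Fin r) : connForm r n U a ∈ (universalPatch r n U).homog (1, 0) :=
  sum_mem fun μ _ => homog_congr (mul_mem_homog (conn_mem μ a) (dx_mem μ)) (zero_add _)

theorem upsilonForm_mem (a : Fin r) : upsilonForm r n U a ∈ (universalPatch r n U).homog (1, 1) :=
  sum_mem fun μ _ => homog_congr (mul_mem_homog (upsilon_mem μ a) (dx_mem μ)) rfl

theorem isField_theta (a : Fin r) : IsField (theta r n U a) := Or.inr ⟨_, rfl⟩

theorem isField_phi (a : Fin r) : IsField (phi r n U a) := Or.inr ⟨_, rfl⟩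

theorem isField_upsilon (μ : Fin n) (a : Fin r) : IsField (upsilon r n U μ a) := Or.inr ⟨_, rfl⟩

theorem isField_conn (μ : Fin n) (a : Fin r) : IsField (conn r n U μ a) := Or.inl ⟨_, rfl⟩

theorem isField_universal {p : (universalPatch r n U).Fn → Prop} (hθ : ∀ a, p (theta r n U a))
    (hφ : ∀ a, p (phi r n U a)) (hA : ∀ μ a, p (conn r n U μ a))
    (hυ : ∀ μ a, p (upsilon r n U μ a)) (y : (universalPatch r n U).Fn) (hy : IsField y) : p y := by
  obtain ⟨⟨a, μ⟩, rfl⟩ | ⟨a | a | ⟨a, μ⟩, rfl⟩ := hy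
  · exact hA μ a
  · exact hθ a
  · exact hφ a
  · exact hυ μ a

variable {f : Fin r → Fin r → Fin r → ℝ} {𝔏 : Type*}
  {comp : 𝔏 → Fin r → EuclideanSpace ℝ (Fin n) → ℝ}
  {S S' : (universalPatch r n U).Operators 𝔏}

/-- The component `λ^a` of a gauge parameter as a function on the patch. -/
def univParam (U : Set (EuclideanSpace ℝ (Fin n))) (comp : 𝔏 → Fin r → EuclideanSpace ℝ (Fin n) → ℝ)
    (l : 𝔏) (a : Fin r) : (universalPatch r n U).Fn :=
  (universalPatch r n U).ofFun fun p => comp l a (xPoint p.1)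

theorem ofFun_mem {X : Patch n} (F : X.dom → ℝ) : X.ofFun F ∈ X.homog 0 := by
  rw [Patch.ofFun]
  split_ifs
  · exact incl_mem _
  · exact zero_mem _

theorem univParam_mem (l : 𝔏) (a : Fin r) :
    univParam U comp l a ∈ (universalPatch r n U).homog 0 := ofFun_mem _

theorem curvature_mem (D : Fin n → (universalPatch r n U).VectorField (0, 0))
    (μ ν : Fin n) (a : Fin r) :
    D ν (conn r n U μ a) - D μ (conn r n U ν a) + bkt f (conn r n U ν) (conn r n U μ) a ∈
      (universalPatch r n U).homog 0 :=
  add_mem (sub_mem (homog_congr ((D ν).map_homog _ _ (conn_mem μ a)) (add_zero _))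
    (homog_congr ((D μ).map_homog _ _ (conn_mem ν a)) (add_zero _)))
    (homog_congr (bkt_mem (conn_mem ν) (conn_mem μ) a) (add_zero _))

/-- Existence is a matter of bidegrees only: any values of the right bidegree on the fields extend.
No property of `f` or `comp` is used; these enter with the relations between the operators. -/
theorem exists_isUniversalStructure (hU : IsOpen U) (f : Fin r → Fin r → Fin r → ℝ)
    (comp : 𝔏 → Fin r → EuclideanSpace ℝ (Fin n) → ℝ) :
    ∃ S : (universalPatch r n U).Operators 𝔏, IsUniversalStructure f comp S := by
  have hX := isOpen_universalPatch_dom r hU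
  obtain ⟨D, hD⟩ := exists_isTotalDerivative hX
  obtain ⟨L, hL, hLc⟩ := exists_isFieldHorizontalDifferential hX hD
  have hDm : ∀ {μ d w}, w ∈ (universalPatch r n U).homog d → D μ w ∈ (universalPatch r n U).homog d :=
    fun {μ d w} hw => homog_congr ((D μ).map_homog _ _ hw) (add_zero d)
  obtain ⟨Q, hQ, hQb, hQg⟩ := exists_isProl hX hD (d := (0, 1))
    (fun b => upsilon r n U b.2 b.1 + (D b.2 (theta r n U b.1)
      + bkt f (conn r n U b.2) (theta r n U) b.1))
    (fun c => (match c with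
      | .theta a => phi r n U a - (1 / 2 : ℝ) • bkt f (theta r n U) (theta r n U) a
      | .phi a => -bkt f (theta r n U) (phi r n U) a
      | .upsilon a μ => -bkt f (theta r n U) (upsilon r n U μ) a
        - (D μ (phi r n U a) + bkt f (conn r n U μ) (phi r n U) a) :
          (universalPatch r n U).Fn))
    (fun b => add_mem (upsilon_mem _ _) (add_mem (hDm (theta_mem _))
      (homog_congr (bkt_mem (conn_mem _) theta_mem _) (zero_add _))))
    (by
      rintro (a | a | ⟨a, μ⟩)
      · exact sub_mem (phi_mem a) (Submodule.smul_mem _ _ (bkt_mem theta_mem theta_mem a))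
      · exact neg_mem (homog_congr (bkt_mem theta_mem phi_mem a) (add_comm _ _))
      · exact sub_mem (neg_mem (bkt_mem theta_mem (upsilon_mem μ) a))
          (add_mem (hDm (phi_mem a)) (homog_congr (bkt_mem (conn_mem μ) phi_mem a) (zero_add _))))
  obtain ⟨K, hK, hKb, hKg⟩ := exists_isProl hX hD (d := (1, -1)) (fun _ => 0)
    (fun c => (match c with
      | .theta a => connForm r n U a
      | .phi a => -upsilonForm r n U a
      | .upsilon a μ => ∑ ν, (D ν (conn r n U μ a) - D μ (conn r n U ν a)
          + bkt f (conn r n U ν) (conn r n U μ) a) * (universalPatch r n U).dx ν :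
          (universalPatch r n U).Fn))
    (fun _ => zero_mem _)
    (by
      rintro (a | a | ⟨a, μ⟩)
      · exact connForm_mem a
      · exact neg_mem (upsilonForm_mem a)
      · exact sum_mem fun ν _ => homog_congr
          (mul_mem_homog (curvature_mem D μ ν a) (dx_mem ν)) (zero_add _))
  have hι := fun l => exists_isProl hX hD (d := (0, -1)) (fun _ => 0)
    (fun c => (match c with
      | .theta a => univParam U comp l a
      | _ => 0 : (universalPatch r n U).Fn))
    (fun _ => zero_mem _)
    (by
      rintro (a | a | ⟨a, μ⟩)
      · exact univParam_mem l a
      · exact zero_mem _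
      · exact zero_mem _)
  choose ι hι hιb hιg using hι
  have hδ := fun l => (hQ.gcomm (hι l)).congr_deg (e := (0, 0)) rfl
  refine ⟨⟨D, hQ.toVectorField, hK.toVectorField, L, fun l => (hι l).toVectorField,
    fun l => (hδ l).toVectorField⟩, ?_⟩
  exact
    { total := hD
      prolonged := ⟨hQ.comm, hK.comm, hLc, fun l => (hι l).comm, fun l => (hδ l).comm⟩
      L_eq := hL
      δ_eq := fun l w => by
        change Patch.gcomm (0, 1) (0, -1) Q (ι l) w = Q (ι l w) + ι l (Q w)
        rw [gcomm_apply, sgn_odd (by simp), neg_one_smul, sub_neg_eq_add]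
      Q_x := hQ.x
      Q_dx := hQ.dx
      Q_theta := fun a => hQg (.theta a)
      Q_phi := fun a => hQg (.phi a)
      Q_conn := fun μ a => hQb (a, μ)
      Q_upsilon := fun μ a => hQg (.upsilon a μ)
      K_x := hK.x
      K_dx := hK.dx
      K_theta := fun a => hKg (.theta a)
      K_phi := fun a => hKg (.phi a)
      K_conn := fun μ a => hKb (a, μ)
      K_upsilon := fun μ a => hKg (.upsilon a μ)
      ι_x := fun l => (hι l).x
      ι_dx := fun l => (hι l).dx
      ι_theta := fun l a => hιg l (.theta a)
      ι_phi := fun l a => hιg l (.phi a)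
      ι_conn := fun l μ a => hιb l (a, μ)
      ι_upsilon := fun l μ a => hιg l (.upsilon a μ) }

namespace IsUniversalStructure

theorem isAdmissible (hX : IsOpen (universalPatch r n U).dom) (hS : IsUniversalStructure f comp S) :
    S.IsAdmissible hX where
  deg := by rintro (a | a | ⟨a, μ⟩) <;> rfl
  total := hS.total
  L_eq := hS.L_eq
  Q := ⟨S.Q.isVF hX, hS.prolonged.Q, hS.Q_x, hS.Q_dx⟩
  K := ⟨S.K.isVF hX, hS.prolonged.K, hS.K_x, hS.K_dx⟩
  L := ⟨S.L.isVF hX, hS.prolonged.L, hS.L_eq.x, hS.L_eq.dx⟩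
  ι l := ⟨(S.ι l).isVF hX, hS.prolonged.ι l, hS.ι_x l, hS.ι_dx l⟩
  δ_eq := hS.δ_eq

theorem unique (hX : IsOpen (universalPatch r n U).dom) (hS : IsUniversalStructure f comp S)
    (hS' : IsUniversalStructure f comp S') : S = S' := by
  obtain ⟨D, Q, K, L, ι, δ⟩ := S
  obtain ⟨D', Q', K', L', ι', δ'⟩ := S'
  obtain rfl : D = D' := hS.total.unique hX hS'.total
  obtain rfl : L = L' := hS.L_eq.unique hX hS'.L_eq
  have a := hS.isAdmissible hX
  have a' := hS'.isAdmissible hX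
  obtain rfl : Q = Q' := VectorField.ext <| a.Q.eq a.total a'.Q <| isField_universal
    (fun a => (hS.Q_theta a).trans (hS'.Q_theta a).symm)
    (fun a => (hS.Q_phi a).trans (hS'.Q_phi a).symm)
    (fun μ a => (hS.Q_conn μ a).trans (hS'.Q_conn μ a).symm)
    (fun μ a => (hS.Q_upsilon μ a).trans (hS'.Q_upsilon μ a).symm)
  obtain rfl : K = K' := VectorField.ext <| a.K.eq a.total a'.K <| isField_universal
    (fun a => (hS.K_theta a).trans (hS'.K_theta a).symm)
    (fun a => (hS.K_phi a).trans (hS'.K_phi a).symm)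
    (fun μ a => (hS.K_conn μ a).trans (hS'.K_conn μ a).symm)
    (fun μ a => (hS.K_upsilon μ a).trans (hS'.K_upsilon μ a).symm)
  obtain rfl : ι = ι' := funext fun l => VectorField.ext <| (a.ι l).eq a.total (a'.ι l) <|
    isField_universal (fun a => (hS.ι_theta l a).trans (hS'.ι_theta l a).symm)
    (fun a => (hS.ι_phi l a).trans (hS'.ι_phi l a).symm)
    (fun μ a => (hS.ι_conn l μ a).trans (hS'.ι_conn l μ a).symm)
    (fun μ a => (hS.ι_upsilon l μ a).trans (hS'.ι_upsilon l μ a).symm)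
  obtain rfl : δ = δ' := funext fun l => VectorField.ext <| LinearMap.ext fun w =>
    (hS.δ_eq l w).trans (hS'.δ_eq l w).symm
  rfl

end IsUniversalStructure

end Universal

end

/-! ### The `QK_{vg}`-relations on the universal side -/

section

open Patch

section Universal

variable {r n : ℕ} {U : Set (EuclideanSpace ℝ (Fin n))}
  {f : Fin r → Fin r → Fin r → ℝ} {𝔏 : Type*}
  {comp : 𝔏 → Fin r → EuclideanSpace ℝ (Fin n) → ℝ}
  {S : (universalPatch r n U).Operators 𝔏} {hX : IsOpen (universalPatch r n U).dom}

theorem ofFun_congr {X : Patch n} {F F' : X.dom → ℝ} (h : ∀ p, F p = F' p) :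
    X.ofFun F = X.ofFun F' := congrArg _ (funext h)

theorem vec_D_bkt {X : Patch n} (hX : IsOpen X.dom) (D : Fin n → X.VectorField (0, 0)) (μ : Fin n) {e : ℤ × ℤ}
    {α : Fin r → X.Fn}
    (β : Fin r → X.Fn) (hα : ∀ i, α i ∈ X.homog e) :
    (D μ).toLin.compLeft (Fin r) (bkt f α β) =
      bkt f ((D μ).toLin.compLeft (Fin r) α) β + bkt f α ((D μ).toLin.compLeft (Fin r) β) :=
  ((D μ).isVF hX).map_bkt_even β hα (by simp)

theorem D_mem {X : Patch n} (D : Fin n → X.VectorField (0, 0)) (μ : Fin n) {e : ℤ × ℤ} {α : Fin r → X.Fn}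
    (hα : ∀ i, α i ∈ X.homog e) (i : Fin r) :
    (D μ).toLin.compLeft (Fin r) α i ∈ X.homog e :=
  homog_congr ((D μ).map_homog _ _ (hα i)) (add_zero e)

namespace IsUniversalStructure

variable (hS : IsUniversalStructure f comp S)
include hS

theorem vec_Q_theta : S.Q.toLin.compLeft (Fin r) (theta r n U) =
    phi r n U - (1 / 2 : ℝ) • bkt f (theta r n U) (theta r n U) := funext hS.Q_theta

theorem vec_Q_phi : S.Q.toLin.compLeft (Fin r) (phi r n U) =
    -bkt f (theta r n U) (phi r n U) := funext hS.Q_phi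

theorem vec_Q_conn (μ : Fin n) : S.Q.toLin.compLeft (Fin r) (conn r n U μ) =
    upsilon r n U μ + ((S.D μ).toLin.compLeft (Fin r) (theta r n U) +
      bkt f (conn r n U μ) (theta r n U)) := funext (hS.Q_conn μ)

theorem vec_Q_upsilon (μ : Fin n) : S.Q.toLin.compLeft (Fin r) (upsilon r n U μ) =
    -bkt f (theta r n U) (upsilon r n U μ) - ((S.D μ).toLin.compLeft (Fin r) (phi r n U) +
      bkt f (conn r n U μ) (phi r n U)) := funext (hS.Q_upsilon μ)

theorem vec_K_theta : S.K.toLin.compLeft (Fin r) (theta r n U) =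
    ∑ μ, mulDx r μ (conn r n U μ) := by
  rw [← connForm_eq]; exact funext hS.K_theta

theorem vec_K_phi : S.K.toLin.compLeft (Fin r) (phi r n U) =
    -∑ μ, mulDx r μ (upsilon r n U μ) := by
  rw [← upsilonForm_eq]; exact funext hS.K_phi

theorem vec_K_conn (μ : Fin n) : S.K.toLin.compLeft (Fin r) (conn r n U μ) = 0 :=
  funext (hS.K_conn μ)

theorem vec_K_upsilon (μ : Fin n) : S.K.toLin.compLeft (Fin r) (upsilon r n U μ) =
    ∑ ν, mulDx r ν ((S.D ν).toLin.compLeft (Fin r) (conn r n U μ) -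
      (S.D μ).toLin.compLeft (Fin r) (conn r n U ν) + bkt f (conn r n U ν) (conn r n U μ)) := by
  ext a
  rw [Finset.sum_apply]
  exact hS.K_upsilon μ a

theorem vec_comm_Q (μ : Fin n) (α : Fin r → (universalPatch r n U).Fn) :
    S.Q.toLin.compLeft (Fin r) ((S.D μ).toLin.compLeft (Fin r) α) =
      (S.D μ).toLin.compLeft (Fin r) (S.Q.toLin.compLeft (Fin r) α) :=
  funext fun _ => hS.prolonged.Q _ _

theorem vec_comm_K (μ : Fin n) (α : Fin r → (universalPatch r n U).Fn) :
    S.K.toLin.compLeft (Fin r) ((S.D μ).toLin.compLeft (Fin r) α) =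
      (S.D μ).toLin.compLeft (Fin r) (S.K.toLin.compLeft (Fin r) α) :=
  funext fun _ => hS.prolonged.K _ _

theorem vec_L {α : Fin r → (universalPatch r n U).Fn} (hα : ∀ a, IsField (α a)) :
    S.L.toLin.compLeft (Fin r) α = ∑ μ, mulDx r μ ((S.D μ).toLin.compLeft (Fin r) α) := by
  ext a
  rw [Finset.sum_apply]
  exact (hα a).L_eq hS.total hS.L_eq

section QQ

variable (hX)
include hX

/-- The bracket terms cancel in pairs as they stand, and only `∑ D_μ φ dx^μ` remains; neither
antisymmetry nor Jacobi enters. -/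
theorem Q_K_phi : S.Q.toLin.compLeft (Fin r) (S.K.toLin.compLeft (Fin r) (phi r n U)) +
    S.K.toLin.compLeft (Fin r) (S.Q.toLin.compLeft (Fin r) (phi r n U)) =
      S.L.toLin.compLeft (Fin r) (phi r n U) := by
  have hQ := (hS.isAdmissible hX).Q
  have hK := (hS.isAdmissible hX).K
  rw [hS.vec_L isField_phi, hS.vec_Q_phi, map_neg,
    hK.toIsVF.map_bkt_odd _ theta_mem (by simp), hS.vec_K_theta, hS.vec_K_phi, map_neg, map_sum]
  simp only [bkt_sum_left, bkt_sum_right, bkt_neg_right, compLeft_mulDx hQ.toIsVF hQ.dx,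
    hS.vec_Q_upsilon, map_add, map_sub, map_neg, Finset.sum_add_distrib, Finset.sum_sub_distrib,
    Finset.sum_neg_distrib, bkt_mulDx_left _ _ phi_mem rfl, bkt_mulDx_right]
  module

variable (hf : IsLieConst f)
include hf

theorem Q_Q_theta : S.Q.toLin.compLeft (Fin r) (S.Q.toLin.compLeft (Fin r) (theta r n U)) = 0 := by
  have hQ := (hS.isAdmissible hX).Q.toIsVF
  have hQθ : ∀ a, S.Q.toLin.compLeft (Fin r) (theta r n U) a ∈ (universalPatch r n U).homog (0, 2) :=
    fun a => homog_congr (hQ.map_homog (theta_mem a)) rfl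
  have c1 := bkt_comm_even hf hQθ theta_mem (by simp)
  have j1 := bkt_jacobi_odd hf (theta r n U) (theta_mem (r := r) (n := n) (U := U)) theta_mem (by simp)
  have j2 := bkt_comm_even hf (bkt_mem (f := f) (theta_mem (r := r) (n := n) (U := U)) theta_mem)
    theta_mem (by simp)
  rw [hS.vec_Q_theta] at c1
  rw [hS.vec_Q_theta, map_sub, map_smul, hQ.map_bkt_odd _ theta_mem (by simp), hS.vec_Q_theta,
    hS.vec_Q_phi, c1, bkt_sub_right, bkt_smul_right]
  -- What remains is `-[θ,[θ,θ]]/2`. For odd `θ`, Jacobi and antisymmetry say `3 [θ,[θ,θ]] = 0`,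
  -- whence the factor `1/6`.
  linear_combination (norm := module) (-(1 / 6 : ℝ)) • j1 - (1 / 6 : ℝ) • j2

theorem Q_Q_phi : S.Q.toLin.compLeft (Fin r) (S.Q.toLin.compLeft (Fin r) (phi r n U)) = 0 := by
  have hQ := (hS.isAdmissible hX).Q.toIsVF
  have c1 := bkt_self_even hf (phi_mem (r := r) (n := n) (U := U)) (by decide)
  have j1 := bkt_jacobi_odd hf (phi r n U) (theta_mem (r := r) (n := n) (U := U)) theta_mem (by simp)
  rw [hS.vec_Q_phi, map_neg, hQ.map_bkt_odd _ theta_mem (by simp), hS.vec_Q_theta,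
    hS.vec_Q_phi, bkt_sub_left, bkt_smul_left, bkt_neg_right, c1]
  -- Jacobi for two copies of the odd `θ` reads `2 [θ,[θ,φ]] = [[θ,θ],φ]`.
  linear_combination (norm := module) (-(1 / 2 : ℝ)) • j1

theorem Q_Q_conn (μ : Fin n) :
    S.Q.toLin.compLeft (Fin r) (S.Q.toLin.compLeft (Fin r) (conn r n U μ)) = 0 := by
  have hQ := (hS.isAdmissible hX).Q.toIsVF
  have c1 := bkt_comm_odd hf (upsilon_mem (r := r) (n := n) (U := U) μ) theta_mem (by simp)
  have c2 := bkt_comm_odd hf (D_mem S.D μ theta_mem) theta_mem (by simp)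
  have c3 := bkt_comm_odd hf (bkt_mem (f := f) (conn_mem (r := r) (n := n) (U := U) μ) theta_mem)
    theta_mem (by simp)
  have j1 := bkt_jacobi_even hf (theta r n U) (conn_mem (r := r) (n := n) (U := U) μ) theta_mem
    (by simp)
  rw [hS.vec_Q_conn, map_add, map_add, hQ.map_bkt_even _ (conn_mem μ) (by simp), hS.vec_comm_Q,
    hS.vec_Q_theta, hS.vec_Q_upsilon, hS.vec_Q_conn, map_sub, map_smul,
    vec_D_bkt hX S.D μ _ theta_mem]
  simp only [bkt_add_left, bkt_sub_right, bkt_smul_right]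
  rw [c1, c2]
  -- The terms with `υ`, `φ` and `D_μ θ` have cancelled. The rest is Jacobi for `A_μ, θ, θ`, which
  -- gives `[A_μ,[θ,θ]] = 2 [[A_μ,θ],θ]`.
  linear_combination (norm := module) (-(1 / 2 : ℝ)) • j1 + (1 / 2 : ℝ) • c3

theorem Q_Q_upsilon (μ : Fin n) :
    S.Q.toLin.compLeft (Fin r) (S.Q.toLin.compLeft (Fin r) (upsilon r n U μ)) = 0 := by
  have hQ := (hS.isAdmissible hX).Q.toIsVF
  have c1 := bkt_comm_even hf (upsilon_mem (r := r) (n := n) (U := U) μ) phi_mem (by decide)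
  have j1 := bkt_jacobi_odd hf (upsilon r n U μ) (theta_mem (r := r) (n := n) (U := U)) theta_mem
    (by simp)
  have j2 := bkt_jacobi_even hf (phi r n U) (conn_mem (r := r) (n := n) (U := U) μ) theta_mem
    (by simp)
  rw [hS.vec_Q_upsilon, map_sub, map_add, map_neg, hQ.map_bkt_odd _ theta_mem (by simp),
    hQ.map_bkt_even _ (conn_mem μ) (by simp), hS.vec_comm_Q,
    hS.vec_Q_theta, hS.vec_Q_upsilon, hS.vec_Q_conn, hS.vec_Q_phi, map_neg,
    vec_D_bkt hX S.D μ _ theta_mem]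
  simp only [bkt_add_left, bkt_sub_right, bkt_sub_left, bkt_smul_left,
    bkt_neg_right, bkt_add_right]
  rw [c1]
  linear_combination (norm := module) (-(1 / 2 : ℝ)) • j1 + j2

theorem Q_K_theta : S.Q.toLin.compLeft (Fin r) (S.K.toLin.compLeft (Fin r) (theta r n U)) +
    S.K.toLin.compLeft (Fin r) (S.Q.toLin.compLeft (Fin r) (theta r n U)) =
      S.L.toLin.compLeft (Fin r) (theta r n U) := by
  have hQ := (hS.isAdmissible hX).Q
  have hK := (hS.isAdmissible hX).K
  have hKθ : ∀ a, S.K.toLin.compLeft (Fin r) (theta r n U) a ∈ (universalPatch r n U).homog (1, 0) :=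
    fun a => homog_congr (hK.map_homog (theta_mem a)) rfl
  have c1 := bkt_comm_even hf theta_mem hKθ (by simp)
  rw [hS.vec_L isField_theta, hS.vec_Q_theta, map_sub, map_smul,
    hK.toIsVF.map_bkt_odd _ theta_mem (by simp), c1, hS.vec_K_theta, hS.vec_K_phi, map_sum]
  simp only [bkt_sum_left, compLeft_mulDx hQ.toIsVF hQ.dx, hS.vec_Q_conn, map_add,
    Finset.sum_add_distrib, bkt_mulDx_left _ _ theta_mem rfl]
  module

theorem Q_K_conn (μ : Fin n) :
    S.Q.toLin.compLeft (Fin r) (S.K.toLin.compLeft (Fin r) (conn r n U μ)) +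
    S.K.toLin.compLeft (Fin r) (S.Q.toLin.compLeft (Fin r) (conn r n U μ)) =
      S.L.toLin.compLeft (Fin r) (conn r n U μ) := by
  have hK := (hS.isAdmissible hX).K
  rw [hS.vec_L (isField_conn μ), hS.vec_K_conn, map_zero, zero_add, hS.vec_Q_conn, map_add, map_add,
    hS.vec_comm_K, hK.toIsVF.map_bkt_even _ (conn_mem μ) (by simp), hS.vec_K_conn, bkt_zero_left,
    zero_add, hS.vec_K_theta, hS.vec_K_upsilon, map_sum, bkt_sum_right, ← Finset.sum_add_distrib,
    ← Finset.sum_add_distrib]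
  refine Finset.sum_congr rfl fun ν _ => ?_
  rw [bkt_mulDx_right, compLeft_mulDx ((S.D μ).isVF hX) (hS.total.dx μ), ← map_add, ← map_add,
    bkt_comm_even hf (conn_mem μ) (conn_mem ν) (by simp)]
  congr 1
  module

/-- Since `QA_ν` is `υ_ν` plus the covariant derivative of `θ`, `Q F_{νμ}` is the covariant curl of
`υ` plus `[F_{νμ}, θ]`: second derivatives of `θ` cancel because total derivatives commute, and
Jacobi collects the quadratic terms in `A`. The `[F, θ]` part cancels against `K[θ, υ_μ]`, and the
covariant derivative in `Qυ_μ` removes the part of the curl that differs from `D_ν υ_μ`. -/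
theorem Q_K_upsilon (μ : Fin n) :
    S.Q.toLin.compLeft (Fin r) (S.K.toLin.compLeft (Fin r) (upsilon r n U μ)) +
    S.K.toLin.compLeft (Fin r) (S.Q.toLin.compLeft (Fin r) (upsilon r n U μ)) =
      S.L.toLin.compLeft (Fin r) (upsilon r n U μ) := by
  have hQ := (hS.isAdmissible hX).Q
  have hK := (hS.isAdmissible hX).K
  rw [hS.vec_L (isField_upsilon μ), hS.vec_K_upsilon, hS.vec_Q_upsilon, map_sub, map_add, map_neg,
    hS.vec_comm_K, hK.toIsVF.map_bkt_even _ (conn_mem μ) (by simp), hS.vec_K_conn, bkt_zero_left,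
    zero_add, hK.toIsVF.map_bkt_odd _ theta_mem (by simp), hS.vec_K_theta, hS.vec_K_phi,
    hS.vec_K_upsilon]
  simp only [map_neg, map_sum, bkt_sum_right, bkt_sum_left, bkt_neg_right,
    compLeft_mulDx hQ.toIsVF hQ.dx, compLeft_mulDx ((S.D μ).isVF hX) (hS.total.dx μ),
    bkt_mulDx_left _ _ (upsilon_mem μ) rfl, bkt_mulDx_right]
  rw [← Finset.sum_sub_distrib, ← Finset.sum_neg_distrib, ← Finset.sum_neg_distrib,
    ← Finset.sum_neg_distrib, ← Finset.sum_add_distrib, ← Finset.sum_sub_distrib,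
    ← Finset.sum_add_distrib]
  refine Finset.sum_congr rfl fun ν _ => ?_
  simp only [← map_sub, ← map_neg, ← map_add]
  congr 1
  have hcomm : (S.D ν).toLin.compLeft (Fin r) ((S.D μ).toLin.compLeft (Fin r) (theta r n U)) =
      (S.D μ).toLin.compLeft (Fin r) ((S.D ν).toLin.compLeft (Fin r) (theta r n U)) :=
    funext fun _ => hS.total.comm hX _ _ _
  simp only [map_add, map_sub, map_neg, hS.vec_comm_Q, hS.vec_Q_conn, hQ.toIsVF.map_bkt_even _ (conn_mem ν)
    (by simp), vec_D_bkt hX S.D _ _ (conn_mem _), bkt_add_left, bkt_add_right, bkt_sub_right, hcomm]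
  have c1 := bkt_comm_even hf (upsilon_mem (r := r) (n := n) (U := U) ν) (conn_mem μ) (by simp)
  have c2 := bkt_comm_even hf (D_mem S.D ν theta_mem) (conn_mem μ) (by simp)
  have c3 := bkt_comm_even hf theta_mem (D_mem S.D ν (conn_mem μ)) (by simp)
  have c4 := bkt_comm_even hf theta_mem (D_mem S.D μ (conn_mem ν)) (by simp)
  have c5 := bkt_comm_even hf (bkt_mem (f := f) (conn_mem (r := r) (n := n) (U := U) ν) theta_mem)
    (conn_mem μ) (by simp)
  have j1 := bkt_jacobi_even hf (conn r n U μ) (theta_mem (r := r) (n := n) (U := U)) (conn_mem ν)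
    (by simp)
  have c6 := bkt_comm_even hf theta_mem (conn_mem (r := r) (n := n) (U := U) ν) (by simp)
  have c7 := bkt_comm_even hf theta_mem (conn_mem (r := r) (n := n) (U := U) μ) (by simp)
  rw [c6, c7, bkt_neg_left, bkt_neg_right] at j1
  rw [c1, c2, c3, c4]
  linear_combination (norm := module) j1

end QQ

section QKvg

variable [AddCommGroup 𝔏] [Module ℝ 𝔏] {br : 𝔏 → 𝔏 → 𝔏 → Prop}

theorem isQKvg (hX : IsOpen (universalPatch r n U).dom) (hU : IsOpen U) (hf : IsLieConst f)
    (hcomp : ∀ (c : ℝ) l₁ l₂ a, ∀ x ∈ U, comp (c • l₁ + l₂) a x = c * comp l₁ a x + comp l₂ a x)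
    (hsm : ∀ l a, ContDiffOn ℝ ∞ (comp l a) U)
    (hbr : ∀ l₁ l₂ l₃, br l₁ l₂ l₃ → ∀ a, ∀ x ∈ U,
      comp l₃ a x = ∑ i, ∑ j, f i j a * (comp l₁ i x * comp l₂ j x)) : S.IsQKvg br := by
  obtain ⟨E, hE⟩ := exists_isExplicit hX
  have hA := hS.isAdmissible hX
  have hloc : ∀ l a, IsLocal (universalPatch r n U).dom fun p => comp l a (xPoint p.1) :=
    fun l a => isLocal_xPoint (fun _ h => h) (hsm l a)
  -- A gauge parameter depends on the `x^μ` only, and `Q` kills these.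
  have hQP : ∀ l a, S.Q (univParam U comp l a) = 0 := by
    intro l a
    refine (hA.Q.toIsVF.map_ofFun_xPoint hU (hsm l a) fun _ h => h).trans ?_
    exact Finset.sum_eq_zero fun μ _ => by rw [hA.Q.x, mul_zero]
  have hUP : ∀ l a, univParam U comp l a = (universalPatch r n U).incl ⟨_, hloc l a⟩ :=
    fun l a => ofFun_of_isLocal _
  -- `K` and the contractions kill all coordinates of bidegree zero, hence by the chain rule all
  -- local functions.
  have hbase : ∀ {d : ℤ × ℤ} {V : (universalPatch r n U).Fn →ₗ[ℝ] (universalPatch r n U).Fn},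
      IsProl hX S.D d V → (∀ b, V ((universalPatch r n U).base (.jet b 0)) = 0) → ∀ F,
      V ((universalPatch r n U).incl F) = 0 := by
    intro d V hV hb F
    refine hV.toIsVF.apply_incl_eq_zero ?_ F
    rintro (μ | ⟨b, I⟩)
    · exact hV.x μ
    · rw [base_jet_eq hX hS.total, map_iterD hX hX hS.total hS.total hV.comm, hb]
      exact iterD_induction hX hS.total (p := fun w => w = 0) (fun μ w h => by rw [h, map_zero]) I rfl
  have hKincl := hbase hA.K fun b => hS.K_conn b.2 b.1
  have hιincl := fun l => hbase (hA.ι l) fun b => hS.ι_conn l b.2 b.1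
  have hιP : ∀ l₁ l₂ a, S.ι l₁ (univParam U comp l₂ a) = 0 := fun l₁ l₂ a => by
    rw [hUP]; exact hιincl l₁ _
  have hιdx : ∀ l μ w, S.ι l w = 0 → S.ι l (w * (universalPatch r n U).dx μ) = 0 := by
    intro l μ w h
    rw [leibniz_right_dx (hA.ι l).toIsVF (hA.ι l).dx, h, zero_mul]
  have hEf := fun y (hy : IsField y) => hy.E_eq_zero hE
  refine hA.isQKvg hE ?_ ?_ ?_ ?_ ?_ ?_ ?_
  · exact isField_universal (fun a => congrFun (hS.Q_Q_theta hX hf) a)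
      (fun a => congrFun (hS.Q_Q_phi hX hf) a) (fun μ a => congrFun (hS.Q_Q_conn hX hf μ) a)
      (fun μ a => congrFun (hS.Q_Q_upsilon hX hf μ) a)
  · exact isField_universal (fun a => congrFun (hS.Q_K_theta hX hf) a)
      (fun a => congrFun (hS.Q_K_phi hX) a) (fun μ a => congrFun (hS.Q_K_conn hX hf μ) a)
      (fun μ a => congrFun (hS.Q_K_upsilon hX hf μ) a)
  · refine isField_universal (fun a => ?_) (fun a => ?_) (fun μ a => ?_) (fun μ a => ?_)
    · rw [hS.K_theta, connForm, map_sum]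
      exact Finset.sum_eq_zero fun μ _ => hE.mul (hEf _ (isField_conn μ a)) (hE.dx μ)
    · rw [hS.K_phi, upsilonForm, map_neg, map_sum, neg_eq_zero]
      exact Finset.sum_eq_zero fun μ _ => hE.mul (hEf _ (isField_upsilon μ a)) (hE.dx μ)
    · rw [hS.K_conn, map_zero]
    · rw [hS.K_upsilon, map_sum]
      refine Finset.sum_eq_zero fun ν _ => hE.mul ?_ (hE.dx ν)
      rw [map_add, map_sub, hE.comm_eq_zero hS.total _ (hEf _ (isField_conn μ a)),
        hE.comm_eq_zero hS.total _ (hEf _ (isField_conn ν a)), sub_zero, zero_add]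
      simp only [bkt, map_sum, map_smul]
      refine Finset.sum_eq_zero fun i _ => Finset.sum_eq_zero fun j _ => ?_
      rw [hE.mul (hEf _ (isField_conn ν i)) (hEf _ (isField_conn μ j)), smul_zero]
  · intro c l₁ l₂
    refine isField_universal (fun a => ?_) (fun a => ?_) (fun μ a => ?_) (fun μ a => ?_)
    · simp only [hS.ι_theta]
      change univParam U comp _ a = c • univParam U comp _ a + univParam U comp _ a
      rw [hUP, hUP, hUP, ← incl_smul, ← incl_add]
      congr 1
      ext p
      exact hcomp c l₁ l₂ a _ p.2
    · simp only [hS.ι_phi, smul_zero, add_zero]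
    · simp only [hS.ι_conn, smul_zero, add_zero]
    · simp only [hS.ι_upsilon, smul_zero, add_zero]
  · intro l₁ l₂ l₃ h₃
    have hθ := fun l => (funext (hS.ι_theta l) : (S.ι l).toLin.compLeft (Fin r) (theta r n U) =
      univParam U comp l)
    have hφ := fun l => (funext (hS.ι_phi l) : (S.ι l).toLin.compLeft (Fin r) (phi r n U) = 0)
    have hA' := fun l μ => (funext (hS.ι_conn l μ) :
      (S.ι l).toLin.compLeft (Fin r) (conn r n U μ) = 0)
    have hυ := fun l μ => (funext (hS.ι_upsilon l μ) :
      (S.ι l).toLin.compLeft (Fin r) (upsilon r n U μ) = 0)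
    have hlam : ∀ l l', (S.ι l).toLin.compLeft (Fin r) (univParam U comp l') = 0 :=
      fun l l' => funext (hιP l l')
    have hQlam : ∀ l, S.Q.toLin.compLeft (Fin r) (univParam U comp l) = 0 := by
      intro l
      ext a
      exact hQP l a
    have hDι : ∀ l μ (α : Fin r → (universalPatch r n U).Fn),
        (S.ι l).toLin.compLeft (Fin r) ((S.D μ).toLin.compLeft (Fin r) α) =
        (S.D μ).toLin.compLeft (Fin r) ((S.ι l).toLin.compLeft (Fin r) α) :=
      fun l μ α => funext fun _ => hS.prolonged.ι _ _ _
    have hι := fun l => (hA.ι l).toIsVF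
    -- The relation `[δ, ι] = ι`, with `δ` expanded into `Q` and `ι` and written for all components
    -- of a multiplet at once.
    have key : ∀ α : Fin r → (universalPatch r n U).Fn,
        (S.Q.toLin.compLeft (Fin r) ((S.ι l₁).toLin.compLeft (Fin r)
          ((S.ι l₂).toLin.compLeft (Fin r) α)) + (S.ι l₁).toLin.compLeft (Fin r)
          (S.Q.toLin.compLeft (Fin r) ((S.ι l₂).toLin.compLeft (Fin r) α))) -
        (S.ι l₂).toLin.compLeft (Fin r) (S.Q.toLin.compLeft (Fin r)
          ((S.ι l₁).toLin.compLeft (Fin r) α) + (S.ι l₁).toLin.compLeft (Fin r)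
            (S.Q.toLin.compLeft (Fin r) α)) = (S.ι l₃).toLin.compLeft (Fin r) α →
        ∀ a, S.δ l₁ (S.ι l₂ (α a)) - S.ι l₂ (S.δ l₁ (α a)) = S.ι l₃ (α a) := by
      intro α h a
      rw [hS.δ_eq, hS.δ_eq]
      exact congrFun h a
    have c1 := fun l => bkt_comm_even hf (theta_mem (r := r) (n := n) (U := U))
      (univParam_mem (comp := comp) l) (by simp)
    refine isField_universal (key _ ?_) (key _ ?_) (fun μ => key _ ?_) (fun μ => key _ ?_)
    -- Here `δ_{l₁} θ = -[λ₁, θ]`, from the quadratic term of `Qθ`. Contracting with `l₂` gives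
    -- `-[λ₁, λ₂]`, and the commutator changes its sign.
    · rw [hθ, hθ, hθ, hlam, hQlam, hQlam, map_zero, map_zero, zero_add, zero_add, hS.vec_Q_theta, map_sub,
        map_smul, (hι l₁).map_bkt_odd _ theta_mem (by simp), hφ, hθ, c1]
      have h2 := (hι l₂).map_bkt_even (f := f) (theta r n U)
        (univParam_mem (U := U) (comp := comp) l₁) (by simp)
      rw [hlam, bkt_zero_left, zero_add, hθ] at h2
      have h3 : bkt f (univParam U comp l₁) (univParam U comp l₂) = univParam U comp l₃ := by
        ext a
        rw [hUP]
        simp only [bkt, hUP, ← incl_mul, ← incl_smul, ← incl_sum]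
        congr 1
        ext p
        refine Eq.trans ?_ (hbr _ _ _ h₃ a _ p.2).symm
        change evalLoc p _ = _
        simp only [map_sum, map_smul, map_mul]
        rfl
      simp only [map_sub, map_smul, map_zero, map_neg, h2, h3]
      module
    -- For `φ`, and likewise for `A` and `υ` below, the contractions vanish on the field and `Q` of
    -- it is at most linear in `θ`. After one contraction no `θ` is left for the second.
    · have h1 := (hι l₁).map_bkt_odd (f := f) (phi r n U) (theta_mem (U := U)) (by simp)
      have h2 := (hι l₂).map_bkt_even (f := f) (phi r n U) (univParam_mem (U := U) (comp := comp) l₁)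
        (by simp)
      rw [hφ, hθ, bkt_zero_right, sub_zero] at h1
      rw [hφ, hlam, bkt_zero_right, bkt_zero_left, add_zero] at h2
      simp only [hφ, map_zero, map_neg, map_add, hS.vec_Q_phi, h1, h2, neg_zero, add_zero, sub_zero]
    · have h1 := (hι l₁).map_bkt_even (f := f) (theta r n U) (conn_mem (U := U) μ) (by simp)
      have h2 := (hι l₂).map_bkt_even (f := f) (univParam U comp l₁) (conn_mem (U := U) μ) (by simp)
      rw [hA', hθ, bkt_zero_left, zero_add] at h1
      rw [hA', hlam, bkt_zero_right, bkt_zero_left, add_zero] at h2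
      simp only [hA', map_zero, map_add, hS.vec_Q_conn, h1, h2, hDι, hυ, hθ, hlam, add_zero, sub_zero]
    · have h1 := (hι l₁).map_bkt_odd (f := f) (upsilon r n U μ) (theta_mem (U := U)) (by simp)
      have h2 := (hι l₂).map_bkt_even (f := f) (upsilon r n U μ)
        (univParam_mem (U := U) (comp := comp) l₁) (by simp)
      have h3 := (hι l₁).map_bkt_even (f := f) (phi r n U) (conn_mem (U := U) μ) (by simp)
      rw [hA', hφ, bkt_zero_left, bkt_zero_right, zero_add] at h3
      rw [hυ, hθ, bkt_zero_right, sub_zero] at h1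
      rw [hυ, hlam, bkt_zero_right, bkt_zero_left, add_zero] at h2
      simp only [hυ, map_zero, map_neg, map_add, map_sub, hS.vec_Q_upsilon, h1, h2, h3, hDι, hφ,
        neg_zero, add_zero, sub_zero]
  · intro l₁ l₂
    refine isField_universal (fun a => ?_) (fun a => ?_) (fun μ a => ?_) (fun μ a => ?_)
    · rw [hS.ι_theta]; exact hιP l₁ l₂ a
    · rw [hS.ι_phi, map_zero]
    · rw [hS.ι_conn, map_zero]
    · rw [hS.ι_upsilon, map_zero]
  · intro l
    refine isField_universal (fun a => ?_) (fun a => ?_) (fun μ a => ?_) (fun μ a => ?_)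
    · rw [hS.K_theta, connForm, map_sum, hS.ι_theta]
      change _ + S.K (univParam U comp l a) = 0
      rw [hUP, hKincl, add_zero]
      exact Finset.sum_eq_zero fun μ _ => hιdx l μ _ (hS.ι_conn l μ a)
    · rw [hS.K_phi, hS.ι_phi, map_zero, add_zero, upsilonForm, map_neg, map_sum, neg_eq_zero]
      exact Finset.sum_eq_zero fun μ _ => hιdx l μ _ (hS.ι_upsilon l μ a)
    · rw [hS.K_conn, hS.ι_conn, map_zero, map_zero, add_zero]
    · rw [hS.K_upsilon, hS.ι_upsilon, map_zero, add_zero, map_sum]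
      refine Finset.sum_eq_zero fun ν _ => hιdx l ν _ ?_
      rw [map_add, map_sub, hS.prolonged.ι, hS.prolonged.ι, hS.ι_conn, hS.ι_conn, map_zero, map_zero,
        sub_zero, zero_add]
      simp only [bkt, map_sum, map_smul]
      refine Finset.sum_eq_zero fun i _ => Finset.sum_eq_zero fun j _ => ?_
      rw [(S.ι l).leibniz _ _ (conn_mem ν i), hS.ι_conn, hS.ι_conn, zero_mul, mul_zero, smul_zero,
        add_zero, smul_zero]

end QKvg

end IsUniversalStructure

end Universal

end

/-! ### h-simplicity on the universal side -/

section

open Patch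

theorem Patch.evalAt_ofFun {n : ℕ} {X : Patch n} {F : X.dom → ℝ} (hF : IsLocal X.dom F) (q : X.dom) :
    evalAt q (X.ofFun F) = algebraMap ℝ _ (F q) := by
  rw [ofFun_of_isLocal hF, evalAt_incl]

/-- The partial derivatives of the components of a gauge parameter are, near each point, components of
gauge parameters. -/
def HasLocalPartials {n r : ℕ} {𝔏 : Type*} (U : Set (EuclideanSpace ℝ (Fin n)))
    (comp : 𝔏 → Fin r → EuclideanSpace ℝ (Fin n) → ℝ) : Prop :=
  ∀ l, ∀ x ∈ U, ∃ W, IsOpen W ∧ x ∈ W ∧ ∃ l' : Fin n → 𝔏, ∀ μ a, ∀ y ∈ W, y ∈ U →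
    comp (l' μ) a y = GaugeQK.pderiv μ (comp l a) y

theorem evalAt_explicit_ofFun_xPoint {n : ℕ} {X : Patch n} {hX : IsOpen X.dom}
    {E : X.Fn →ₗ[ℝ] X.Fn} (hE : IsExplicit hX E) {U : Set (EuclideanSpace ℝ (Fin n))} (hU : IsOpen U)
    (hdom : ∀ p ∈ X.dom, xPoint p ∈ U) {h : EuclideanSpace ℝ (Fin n) → ℝ} (hh : ContDiffOn ℝ ∞ h U)
    (q : X.dom) : evalAt q (E (X.ofFun fun p => h (xPoint p.1))) =
      ∑ μ, algebraMap ℝ _ (GaugeQK.pderiv μ h (xPoint q.1)) * evalAt q (X.dx μ) := by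
  rw [hE.toIsVF.map_ofFun_xPoint hU hh hdom, map_sum]
  refine Finset.sum_congr rfl fun μ _ => ?_
  rw [map_mul, evalAt_ofFun (isLocal_xPoint hdom (contDiffOn_pderiv hU hh μ)), hE.x]

section Universal

variable {r n : ℕ} {U : Set (EuclideanSpace ℝ (Fin n))}
  {f : Fin r → Fin r → Fin r → ℝ} {𝔏 : Type*} [AddCommGroup 𝔏] [Module ℝ 𝔏]
  {br : 𝔏 → 𝔏 → 𝔏 → Prop} {comp : 𝔏 → Fin r → EuclideanSpace ℝ (Fin n) → ℝ}
  {S : (universalPatch r n U).Operators 𝔏}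

/-- The only field with a nonzero contraction is `θ`, and `E λ^a = ∑ dx^μ ∂_μ λ^a`. Near a given
point the derivatives `∂_μ λ` are gauge parameters `λ'_μ`, so the right side is `∑ dx^μ ι_{λ'_μ}
θ^a`. -/
theorem IsUniversalStructure.isHSimple (hS : IsUniversalStructure f comp S)
    (hX : IsOpen (universalPatch r n U).dom) (hU : IsOpen U)
    (hsm : ∀ l a, ContDiffOn ℝ ∞ (comp l a) U) (hp : HasLocalPartials U comp)
    (hqk : S.IsQKvg br) : S.IsHSimple := by
  obtain ⟨E, hE⟩ := exists_isExplicit hX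
  refine (hS.isAdmissible hX).isHSimple hqk hE fun l p => ?_
  obtain ⟨W, hW, hpW, l', hl'⟩ := hp l (xPoint p.1) p.2
  refine ⟨xPoint ⁻¹' W, hW.preimage continuous_xPoint, hpW, l', isField_universal
    (fun a q hq => ?_) (fun a q hq => ?_) (fun μ a q hq => ?_) (fun μ a q hq => ?_)⟩
  · rw [hS.ι_theta, evalAt_explicit_ofFun_xPoint hE hU (fun _ h => h) (hsm l a), map_sum]
    refine Finset.sum_congr rfl fun μ _ => ?_
    rw [map_mul, hS.ι_theta, evalAt_ofFun (isLocal_xPoint (fun _ h => h) (hsm _ _)),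
      hl' μ a _ hq q.2, Algebra.commutes]
  · simp [hS.ι_phi]
  · simp [hS.ι_conn]
  · simp [hS.ι_upsilon]

end Universal

end

section

open Patch

/-! ## The mapping space side -/

section Mapping

variable {n N r : ℕ} {U : Set (EuclideanSpace ℝ (Fin n))} {V : Set (EuclideanSpace ℝ (Fin N))}
  {𝔏 : Type*} {comp : 𝔏 → Fin r → EuclideanSpace ℝ (Fin n) → ℝ}
  {vert : Fin r → Fin N → EuclideanSpace ℝ (Fin N) → ℝ} {S S' : (mappingPatch n N U V).Operators 𝔏}

theorem deltaU_mem (j : Fin N) : deltaU n N U V j ∈ (mappingPatch n N U V).homog (0, 1) :=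
  gen_mem (X := mappingPatch n N U V) (GenCoord.jet j 0)

theorem uFirst_mem (j : Fin N) (μ : Fin n) :
    uFirst n N U V j μ ∈ (mappingPatch n N U V).homog 0 :=
  base_mem (X := mappingPatch n N U V) (BaseCoord.jet j {μ})

/-- A function of the base coordinates as a function on the patch. -/
def xFun (h : EuclideanSpace ℝ (Fin n) → ℝ) : (mappingPatch n N U V).Fn :=
  (mappingPatch n N U V).ofFun fun p => h (xPoint p.1)

/-- A function of the fibre coordinates as a function on the patch. -/
def uFun (h : EuclideanSpace ℝ (Fin N) → ℝ) : (mappingPatch n N U V).Fn :=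
  (mappingPatch n N U V).ofFun fun p => h (uPoint p.1)

/-- The base coordinates of a point of the patch. -/
def xPt (q : (mappingPatch n N U V).dom) : EuclideanSpace ℝ (Fin n) := xPoint q.1

/-- The fibre coordinates of a point of the patch. -/
def uPt (q : (mappingPatch n N U V).dom) : EuclideanSpace ℝ (Fin N) := uPoint q.1

theorem xPt_mem (q : (mappingPatch n N U V).dom) : xPt q ∈ U := q.2.1

theorem uPt_mem (q : (mappingPatch n N U V).dom) : uPt q ∈ V := q.2.2

theorem xFun_mem (h : EuclideanSpace ℝ (Fin n) → ℝ) :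
    (xFun h : (mappingPatch n N U V).Fn) ∈ (mappingPatch n N U V).homog 0 := ofFun_mem _

theorem uFun_mem (h : EuclideanSpace ℝ (Fin N) → ℝ) :
    (uFun h : (mappingPatch n N U V).Fn) ∈ (mappingPatch n N U V).homog 0 := ofFun_mem _

theorem isLocal_xFun {h : EuclideanSpace ℝ (Fin n) → ℝ} (hh : ContDiffOn ℝ ∞ h U) :
    IsLocal (mappingPatch n N U V).dom fun p => h (xPt p) := isLocal_xPoint (fun _ h => h.1) hh

theorem isLocal_uFun {h : EuclideanSpace ℝ (Fin N) → ℝ} (hh : ContDiffOn ℝ ∞ h V) :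
    IsLocal (mappingPatch n N U V).dom fun p => h (uPt p) := isLocal_uPoint (fun _ h => h.2) hh

theorem evalAt_xFun {h : EuclideanSpace ℝ (Fin n) → ℝ} (hh : ContDiffOn ℝ ∞ h U)
    (q : (mappingPatch n N U V).dom) : evalAt q (xFun h) = algebraMap ℝ _ (h (xPt q)) :=
  evalAt_ofFun (isLocal_xFun hh) q

theorem evalAt_uFun {h : EuclideanSpace ℝ (Fin N) → ℝ} (hh : ContDiffOn ℝ ∞ h V)
    (q : (mappingPatch n N U V).dom) : evalAt q (uFun h) = algebraMap ℝ _ (h (uPt q)) :=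
  evalAt_ofFun (isLocal_uFun hh) q

theorem Patch.IsVF.map_xFun {hX : IsOpen (mappingPatch n N U V).dom} {d : ℤ × ℤ}
    {f : (mappingPatch n N U V).Fn →ₗ[ℝ] (mappingPatch n N U V).Fn} (hf : IsVF hX d f)
    {h : EuclideanSpace ℝ (Fin n) → ℝ} (hU : IsOpen U) (hh : ContDiffOn ℝ ∞ h U) :
    f (xFun h) = ∑ μ, xFun (GaugeQK.pderiv μ h) * f ((mappingPatch n N U V).base (.x μ)) :=
  hf.map_ofFun_xPoint hU hh fun _ h => h.1

theorem Patch.IsVF.map_uFun {hX : IsOpen (mappingPatch n N U V).dom} {d : ℤ × ℤ}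
    {f : (mappingPatch n N U V).Fn →ₗ[ℝ] (mappingPatch n N U V).Fn} (hf : IsVF hX d f)
    {h : EuclideanSpace ℝ (Fin N) → ℝ} (hV : IsOpen V) (hh : ContDiffOn ℝ ∞ h V) :
    f (uFun h) = ∑ j, uFun (GaugeQK.pderiv j h) * f (uCoord n N U V j) :=
  hf.chain_euclidean hV hh (fun j => .jet j 0) fun p => p.2.2

theorem isField_mapping {p : (mappingPatch n N U V).Fn → Prop} (hu : ∀ j, p (uCoord n N U V j))
    (hδ : ∀ j, p (deltaU n N U V j)) (y : (mappingPatch n N U V).Fn) (hy : IsField y) : p y := by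
  obtain ⟨j, rfl⟩ | ⟨j, rfl⟩ := hy
  · exact hu j
  · exact hδ j

theorem Patch.IsTotalDerivative.uCoord {D : Fin n → (mappingPatch n N U V).VectorField (0, 0)}
    (hD : IsTotalDerivative D) (μ : Fin n) (j : Fin N) :
    D μ (uCoord n N U V j) = uFirst n N U V j μ := hD.base μ j 0

theorem exists_isCanonicalStructure (hU : IsOpen U) (hV : IsOpen V)
    (comp : 𝔏 → Fin r → EuclideanSpace ℝ (Fin n) → ℝ)
    (vert : Fin r → Fin N → EuclideanSpace ℝ (Fin N) → ℝ) :
    ∃ S : (mappingPatch n N U V).Operators 𝔏, IsCanonicalStructure comp vert S := by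
  have hX := isOpen_mappingPatch_dom hU hV
  obtain ⟨D, hD⟩ := exists_isTotalDerivative hX
  obtain ⟨L, hL, hLc⟩ := exists_isFieldHorizontalDifferential hX hD
  obtain ⟨Q, hQ, hQb, hQg⟩ := exists_isProl hX hD (d := (0, 1)) (fun j => deltaU n N U V j)
    (fun _ => 0) deltaU_mem fun _ => zero_mem _
  obtain ⟨K, hK, hKb, hKg⟩ := exists_isProl hX hD (d := (1, -1)) (fun _ => 0)
    (fun j => ∑ μ, uFirst n N U V j μ * (mappingPatch n N U V).dx μ) (fun _ => zero_mem _)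
    fun j => sum_mem fun μ _ => homog_congr (mul_mem_homog (uFirst_mem j μ) (dx_mem μ)) (zero_add _)
  have hι := fun l => exists_isProl hX hD (d := (0, -1)) (fun _ => 0)
    (fun j => (mappingPatch n N U V).ofFun fun p => ∑ a, comp l a (xPoint p.1) * vert a j (uPoint p.1))
    (fun _ => zero_mem _) fun j => ofFun_mem _
  choose ι hι hιb hιg using hι
  have hδ := fun l => (hQ.gcomm (hι l)).congr_deg (e := (0, 0)) rfl
  refine ⟨⟨D, hQ.toVectorField, hK.toVectorField, L, fun l => (hι l).toVectorField,
    fun l => (hδ l).toVectorField⟩, ?_⟩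
  exact
    { total := hD
      prolonged := ⟨hQ.comm, hK.comm, hLc, fun l => (hι l).comm, fun l => (hδ l).comm⟩
      L_eq := hL
      δ_eq := fun l w => by
        change Patch.gcomm (0, 1) (0, -1) Q (ι l) w = Q (ι l w) + ι l (Q w)
        rw [gcomm_apply, sgn_odd (by simp), neg_one_smul, sub_neg_eq_add]
      Q_x := hQ.x
      Q_dx := hQ.dx
      Q_u := hQb
      Q_deltaU := hQg
      K_x := hK.x
      K_dx := hK.dx
      K_u := hKb
      K_deltaU := hKg
      ι_x := fun l => (hι l).x
      ι_dx := fun l => (hι l).dx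
      ι_u := fun l j => hιb l j
      ι_deltaU := fun l j => hιg l j }

namespace IsCanonicalStructure

theorem isAdmissible (hX : IsOpen (mappingPatch n N U V).dom) (hS : IsCanonicalStructure comp vert S) :
    S.IsAdmissible hX where
  deg _ := rfl
  total := hS.total
  L_eq := hS.L_eq
  Q := ⟨S.Q.isVF hX, hS.prolonged.Q, hS.Q_x, hS.Q_dx⟩
  K := ⟨S.K.isVF hX, hS.prolonged.K, hS.K_x, hS.K_dx⟩
  L := ⟨S.L.isVF hX, hS.prolonged.L, hS.L_eq.x, hS.L_eq.dx⟩
  ι l := ⟨(S.ι l).isVF hX, hS.prolonged.ι l, hS.ι_x l, hS.ι_dx l⟩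
  δ_eq := hS.δ_eq

theorem unique (hX : IsOpen (mappingPatch n N U V).dom) (hS : IsCanonicalStructure comp vert S)
    (hS' : IsCanonicalStructure comp vert S') : S = S' := by
  obtain ⟨D, Q, K, L, ι, δ⟩ := S
  obtain ⟨D', Q', K', L', ι', δ'⟩ := S'
  obtain rfl : D = D' := hS.total.unique hX hS'.total
  obtain rfl : L = L' := hS.L_eq.unique hX hS'.L_eq
  have a := hS.isAdmissible hX
  have a' := hS'.isAdmissible hX
  obtain rfl : Q = Q' := VectorField.ext <| a.Q.eq a.total a'.Q <| isField_mapping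
    (fun a => (hS.Q_u a).trans (hS'.Q_u a).symm)
    (fun a => (hS.Q_deltaU a).trans (hS'.Q_deltaU a).symm)
  obtain rfl : K = K' := VectorField.ext <| a.K.eq a.total a'.K <| isField_mapping
    (fun a => (hS.K_u a).trans (hS'.K_u a).symm)
    (fun a => (hS.K_deltaU a).trans (hS'.K_deltaU a).symm)
  obtain rfl : ι = ι' := funext fun l => VectorField.ext <| (a.ι l).eq a.total (a'.ι l) <|
    isField_mapping (fun a => (hS.ι_u l a).trans (hS'.ι_u l a).symm)
    (fun a => (hS.ι_deltaU l a).trans (hS'.ι_deltaU l a).symm)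
  obtain rfl : δ = δ' := funext fun l => VectorField.ext <| LinearMap.ext fun w =>
    (hS.δ_eq l w).trans (hS'.δ_eq l w).symm
  rfl

section Contraction

variable (hS : IsCanonicalStructure comp vert S) (hX : IsOpen (mappingPatch n N U V).dom)
include hS hX

theorem apply_incl_eq_zero {d : ℤ × ℤ} {W : (mappingPatch n N U V).Fn →ₗ[ℝ] (mappingPatch n N U V).Fn}
    (hW : IsProl hX S.D d W) (hu : ∀ j, W (uCoord n N U V j) = 0)
    (F : LocFun (mappingPatch n N U V).dom) : W ((mappingPatch n N U V).incl F) = 0 := by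
  refine hW.toIsVF.apply_incl_eq_zero ?_ F
  rintro (μ | ⟨b, I⟩)
  · exact hW.x μ
  · rw [base_jet_eq hX hS.total, map_iterD hX hX hS.total hS.total hW.comm]
    exact iterD_induction hX hS.total (p := fun w => w = 0) (fun μ w h => by rw [h, map_zero]) I (hu b)

theorem K_incl (F : LocFun (mappingPatch n N U V).dom) : S.K ((mappingPatch n N U V).incl F) = 0 :=
  hS.apply_incl_eq_zero hX (hS.isAdmissible hX).K hS.K_u F

theorem ι_incl (l : 𝔏) (F : LocFun (mappingPatch n N U V).dom) :
    S.ι l ((mappingPatch n N U V).incl F) = 0 :=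
  hS.apply_incl_eq_zero hX ((hS.isAdmissible hX).ι l) (hS.ι_u l) F

theorem ι_ofFun (l : 𝔏) (F : (mappingPatch n N U V).dom → ℝ) :
    S.ι l ((mappingPatch n N U V).ofFun F) = 0 := by
  rw [Patch.ofFun]
  split_ifs
  · exact hS.ι_incl hX l _
  · exact map_zero _

theorem K_ofFun (F : (mappingPatch n N U V).dom → ℝ) :
    S.K ((mappingPatch n N U V).ofFun F) = 0 := by
  rw [Patch.ofFun]
  split_ifs
  · exact hS.K_incl hX _
  · exact map_zero _

theorem ι_xFun (l : 𝔏) (h : EuclideanSpace ℝ (Fin n) → ℝ) : S.ι l (xFun h) = 0 :=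
  hS.ι_ofFun hX l _

theorem ι_uFun (l : 𝔏) (h : EuclideanSpace ℝ (Fin N) → ℝ) : S.ι l (uFun h) = 0 :=
  hS.ι_ofFun hX l _

omit hX in
theorem Q_uFirst (j : Fin N) (μ : Fin n) : S.Q (uFirst n N U V j μ) = S.D μ (deltaU n N U V j) := by
  rw [← hS.total.uCoord, hS.prolonged.Q, hS.Q_u]

end Contraction

section Smooth

variable (hU : IsOpen U) (hV : IsOpen V) (hsm : ∀ l a, ContDiffOn ℝ ∞ (comp l a) U)
  (hvs : ∀ a j, ContDiffOn ℝ ∞ (vert a j) V)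
include hsm hvs

theorem ι_deltaU_eq (hS : IsCanonicalStructure comp vert S) (l : 𝔏) (j : Fin N) :
    S.ι l (deltaU n N U V j) = ∑ a, xFun (comp l a) * uFun (vert a j) := by
  have h : ∀ a, (fun p : (mappingPatch n N U V).dom => comp l a (xPt p) * vert a j (uPt p)) ∈
      LocFun (mappingPatch n N U V).dom := fun a =>
    mul_mem (S := Subalgebra ℝ ((mappingPatch n N U V).dom → ℝ)) (s := LocFun _)
      (isLocal_xFun (hsm l a)) (isLocal_uFun (hvs a j))
  have heq : (fun p : (mappingPatch n N U V).dom => ∑ a, comp l a (xPt p) * vert a j (uPt p)) =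
      ∑ a, fun p : (mappingPatch n N U V).dom => comp l a (xPt p) * vert a j (uPt p) := by
    ext p
    simp only [Finset.sum_apply]
  have hloc : IsLocal (mappingPatch n N U V).dom
      fun p => ∑ a, comp l a (xPt p) * vert a j (uPt p) := by
    rw [heq]
    exact sum_mem (S := LocFun (mappingPatch n N U V).dom) (t := Finset.univ) fun a _ => h a
  refine (hS.ι_deltaU l j).trans (ext_evalAt fun p => (evalAt_ofFun hloc p).trans ?_)
  rw [map_sum, map_sum]
  refine Finset.sum_congr rfl fun a _ => ?_
  rw [map_mul, map_mul, evalAt_xFun (hsm l a), evalAt_uFun (hvs a j)]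

theorem evalAt_ι_deltaU (hS : IsCanonicalStructure comp vert S) (l : 𝔏) (j : Fin N)
    (q : (mappingPatch n N U V).dom) : evalAt q (S.ι l (deltaU n N U V j)) =
      algebraMap ℝ _ (∑ a, comp l a (xPt q) * vert a j (uPt q)) := by
  rw [hS.ι_deltaU_eq hsm hvs, map_sum, map_sum]
  refine Finset.sum_congr rfl fun a _ => ?_
  rw [map_mul, map_mul, evalAt_xFun (hsm l a), evalAt_uFun (hvs a j)]

include hU hV in
theorem Q_ι_deltaU (hS : IsCanonicalStructure comp vert S) (l : 𝔏) (j : Fin N) :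
    S.Q (S.ι l (deltaU n N U V j)) =
      ∑ a, xFun (comp l a) * ∑ k, uFun (GaugeQK.pderiv k (vert a j)) * deltaU n N U V k := by
  have hQ := (hS.isAdmissible (isOpen_mappingPatch_dom hU hV)).Q
  rw [hS.ι_deltaU_eq hsm hvs, map_sum]
  refine Finset.sum_congr rfl fun a _ => ?_
  rw [S.Q.leibniz _ _ (xFun_mem _), hQ.map_xFun hU (hsm l a),
    hQ.map_uFun hV (hvs a j), sgn_zero_right, one_smul]
  simp only [hS.Q_x, hS.Q_u, mul_zero, Finset.sum_const_zero, zero_mul, zero_add]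

include hU hV in
theorem ι_Q_ι_deltaU (hS : IsCanonicalStructure comp vert S) (l l' : 𝔏) (j : Fin N) (q) :
    evalAt q (S.ι l' (S.Q (S.ι l (deltaU n N U V j)))) =
      algebraMap ℝ _ (∑ a, comp l a (xPt q) * ∑ k, GaugeQK.pderiv k (vert a j) (uPt q) *
        ∑ b, comp l' b (xPt q) * vert b k (uPt q)) := by
  have hX := isOpen_mappingPatch_dom hU hV
  rw [hS.Q_ι_deltaU hU hV hsm hvs, map_sum, map_sum, map_sum]
  refine Finset.sum_congr rfl fun a _ => ?_
  rw [(S.ι l').leibniz _ _ (xFun_mem _), hS.ι_xFun hX, zero_mul, zero_add, sgn_zero_right, one_smul,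
    map_mul, map_mul, evalAt_xFun (hsm l a), map_sum, map_sum, map_sum]
  congr 1
  refine Finset.sum_congr rfl fun k _ => ?_
  rw [(S.ι l').leibniz _ _ (uFun_mem _), hS.ι_uFun hX, zero_mul, zero_add, sgn_zero_right, one_smul,
    map_mul, map_mul, evalAt_uFun (contDiffOn_pderiv hV (hvs a j) k), hS.evalAt_ι_deltaU hsm hvs]

variable [AddCommGroup 𝔏] [Module ℝ 𝔏] {br : 𝔏 → 𝔏 → 𝔏 → Prop}

include hU hV in
-- Here `Q` is the vertical de Rham differential, so most relations are immediate on `u` and `δu`.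
-- The one with content is Cartan's formula for `[δ, ι]`, which on `δu^j` is the bracket of the
-- vector fields `∑ λ^a v_a`. As `λ` does not depend on `u`, this reduces to the bracket relation of
-- the `v_a`.
theorem isQKvg (hS : IsCanonicalStructure comp vert S) {f : Fin r → Fin r → Fin r → ℝ}
    (hcomp : ∀ (c : ℝ) l₁ l₂ a, ∀ x ∈ U, comp (c • l₁ + l₂) a x = c * comp l₁ a x + comp l₂ a x)
    (hbr : ∀ l₁ l₂ l₃, br l₁ l₂ l₃ → ∀ a, ∀ x ∈ U,
      comp l₃ a x = ∑ i, ∑ j, f i j a * (comp l₁ i x * comp l₂ j x))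
    (hvert : ∀ a b j, ∀ u ∈ V, ∑ k, (vert a k u * GaugeQK.pderiv k (vert b j) u -
      vert b k u * GaugeQK.pderiv k (vert a j) u) = ∑ c, f a b c * vert c j u) : S.IsQKvg br := by
  have hX := isOpen_mappingPatch_dom hU hV
  obtain ⟨E, hE⟩ := exists_isExplicit hX
  have hA := hS.isAdmissible hX
  have hιdx : ∀ l μ w, S.ι l w = 0 → S.ι l (w * (mappingPatch n N U V).dx μ) = 0 := by
    intro l μ w h
    rw [leibniz_right_dx (hA.ι l).toIsVF (hA.ι l).dx, h, zero_mul]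
  refine hA.isQKvg hE ?_ ?_ ?_ ?_ ?_ ?_ ?_
  · refine isField_mapping (fun j => ?_) fun j => ?_
    · rw [hS.Q_u, hS.Q_deltaU]
    · rw [hS.Q_deltaU, map_zero]
  · refine isField_mapping (fun j => ?_) fun j => ?_
    · rw [hS.K_u, map_zero, zero_add, hS.Q_u, hS.K_deltaU]
      exact (hS.L_eq.base j 0).symm
    · rw [hS.Q_deltaU, map_zero, add_zero, hS.K_deltaU, map_sum]
      refine Eq.trans ?_ (hS.L_eq.gen j 0).symm
      refine Finset.sum_congr rfl fun μ _ => ?_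
      rw [leibniz_right_dx hA.Q.toIsVF hA.Q.dx, hS.Q_uFirst]
      exact congrArg (· * _) (hS.total.gen μ j 0)
  · refine isField_mapping (fun j => ?_) fun j => ?_
    · rw [hS.K_u, map_zero]
    · rw [hS.K_deltaU, map_sum]
      exact Finset.sum_eq_zero fun μ _ => hE.mul (hE.base _ _) (hE.dx μ)
  · intro c l₁ l₂
    refine isField_mapping (fun j => ?_) fun j => ?_
    · simp only [hS.ι_u, smul_zero, add_zero]
    · refine ext_evalAt fun p => ?_
      rw [map_add, map_smul, hS.evalAt_ι_deltaU hsm hvs, hS.evalAt_ι_deltaU hsm hvs,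
        hS.evalAt_ι_deltaU hsm hvs, Algebra.smul_def, ← map_mul, ← map_add, Finset.mul_sum, ← Finset.sum_add_distrib]
      refine congrArg _ (Finset.sum_congr rfl fun a _ => ?_)
      rw [hcomp _ _ _ _ _ (xPt_mem p)]
      ring
  · intro l₁ l₂ l₃ h₃
    refine isField_mapping (fun j => ?_) fun j => ?_
    · rw [hS.ι_u, map_zero, hS.δ_eq, hS.ι_u, map_zero, hS.Q_u, hS.ι_deltaU, zero_add, hS.ι_ofFun hX,
        hS.ι_u, sub_zero]
    · refine ext_evalAt fun p => ?_
      rw [hS.δ_eq, hS.δ_eq, hS.Q_deltaU, map_zero, add_zero, map_sub, map_add,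
        hS.ι_Q_ι_deltaU hU hV hsm hvs, hS.ι_Q_ι_deltaU hU hV hsm hvs, hS.evalAt_ι_deltaU hsm hvs,
        hS.ι_deltaU l₂, hS.ι_ofFun hX, map_zero, map_zero, zero_add, ← map_sub]
      congr 1
      have h1 : ∀ l l' : 𝔏, (∑ a, comp l a (xPt p) * ∑ k, GaugeQK.pderiv k (vert a j) (uPt p) *
          ∑ b, comp l' b (xPt p) * vert b k (uPt p)) = ∑ a, ∑ b, comp l a (xPt p) *
            comp l' b (xPt p) * ∑ k, vert b k (uPt p) *
              GaugeQK.pderiv k (vert a j) (uPt p) := by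
        intro l l'
        refine Finset.sum_congr rfl fun a _ => ?_
        simp only [Finset.mul_sum]
        rw [Finset.sum_comm]
        refine Finset.sum_congr rfl fun b _ => Finset.sum_congr rfl fun k _ => ?_
        ring
      have h2 : ∑ c, comp l₃ c (xPt p) * vert c j (uPt p) =
          ∑ a, ∑ b, comp l₂ a (xPt p) * comp l₁ b (xPt p) *
            ∑ c, f b a c * vert c j (uPt p) := by
        simp only [hbr _ _ _ h₃ _ _ (xPt_mem p), Finset.sum_mul, Finset.mul_sum]
        rw [Finset.sum_comm]
        refine (Finset.sum_congr rfl fun i _ => Finset.sum_comm).trans ?_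
        rw [Finset.sum_comm]
        refine Finset.sum_congr rfl fun a _ => Finset.sum_congr rfl fun b _ =>
          Finset.sum_congr rfl fun c _ => ?_
        ring
      -- Exchanging the summation indices in the term with `λ₁` first gives all three sums the
      -- common coefficient `λ₂^a λ₁^b`. The bracket relation for the pair `b, a` then applies.
      rw [h1, h1, h2, Finset.sum_comm (f := fun a b => comp l₁ a _ * comp l₂ b _ * _),
        ← Finset.sum_sub_distrib]
      refine Finset.sum_congr rfl fun a _ => ?_
      rw [← Finset.sum_sub_distrib]
      refine Finset.sum_congr rfl fun b _ => ?_
      rw [← hvert b a j _ (uPt_mem p), Finset.sum_sub_distrib]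
      ring
  · intro l₁ l₂
    refine isField_mapping (fun j => ?_) fun j => ?_
    · rw [hS.ι_u, map_zero]
    · rw [hS.ι_deltaU, hS.ι_ofFun hX]
  · intro l
    refine isField_mapping (fun j => ?_) fun j => ?_
    · rw [hS.K_u, hS.ι_u, map_zero, map_zero, add_zero]
    · rw [hS.K_deltaU, hS.ι_deltaU, hS.K_ofFun hX, add_zero, map_sum]
      exact Finset.sum_eq_zero fun μ _ => hιdx l μ _ (by
        rw [← hS.total.uCoord, hS.prolonged.ι, hS.ι_u, map_zero])

include hU hV in
-- In `ι_λ δu^j = ∑ λ^a(x) v_a^j(u)` only `λ` depends explicitly on `x`, so `E` differentiates only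
-- `λ`, as on the universal side.
theorem isHSimple (hS : IsCanonicalStructure comp vert S) (hp : HasLocalPartials U comp)
    (hqk : S.IsQKvg br) : S.IsHSimple := by
  have hX := isOpen_mappingPatch_dom hU hV
  obtain ⟨E, hE⟩ := exists_isExplicit hX
  have hEu : ∀ k, E (uCoord n N U V k) = 0 := fun k => hE.base k 0
  refine (hS.isAdmissible hX).isHSimple hqk hE fun l p => ?_
  obtain ⟨W, hW, hpW, l', hl'⟩ := hp l (xPt p) (xPt_mem p)
  refine ⟨xPoint ⁻¹' W, hW.preimage continuous_xPoint, hpW, l', isField_mapping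
    (fun j q hq => ?_) (fun j q hq => ?_)⟩
  · simp [hS.ι_u]
  · have hEv : ∀ a, E (uFun (vert a j)) = 0 := fun a => by
      rw [hE.map_uFun hV (hvs a j)]
      exact Finset.sum_eq_zero fun k _ => by rw [hEu, mul_zero]
    have h1 : ∀ a, evalAt q (E (xFun (comp l a) * uFun (vert a j))) =
        ∑ μ, evalAt q ((mappingPatch n N U V).dx μ) * (algebraMap ℝ _ (comp (l' μ) a (xPt q)) *
          algebraMap ℝ _ (vert a j (uPt q))) := by
      intro a
      rw [hE.leibniz (xFun_mem _), hEv, mul_zero, smul_zero, add_zero, map_mul, hE.map_xFun hU (hsm l a),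
        map_sum, Finset.sum_mul, evalAt_uFun (hvs a j)]
      refine Finset.sum_congr rfl fun μ _ => ?_
      rw [hl' μ a (xPt q) hq (xPt_mem q), map_mul, evalAt_xFun (contDiffOn_pderiv hU (hsm l a) μ), hE.x,
        Algebra.commutes, mul_assoc]
    simp only [hS.ι_deltaU_eq hsm hvs, map_sum, map_mul, h1, evalAt_xFun (hsm _ _),
      evalAt_uFun (hvs _ _)]
    rw [Finset.sum_comm]
    simp only [Finset.mul_sum]

end Smooth

end IsCanonicalStructure

end Mapping

end

section

open Patch

/-! ## Morphisms -/

namespace Patch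

variable {n : ℕ} {X Y : Patch n} {Φ Ψ : X.Fn →ₐ[ℝ] Y.Fn}

theorem algHom_ext (hloc : ∀ F, Φ (X.incl F) = Ψ (X.incl F)) (hgen : ∀ v, Φ (X.gen v) = Ψ (X.gen v)) :
    Φ = Ψ := by
  refine AlgHom.ext fun w => ?_
  induction w using fn_induction with
  | add a b ha hb => rw [map_add, map_add, ha, hb]
  | mono F l =>
    rw [mono, map_mul, map_mul, hloc, map_list_prod, map_list_prod, List.map_map, List.map_map]
    congr 3
    exact funext hgen

theorem Covers.base {τ : Y.dom → X.dom} (h : Covers Φ τ) (i : BaseCoord n X.B) :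
    ∃ t : LocFun Y.dom, (∀ q, t.1 q = (τ q).1 i) ∧ Φ (X.base i) = Y.incl t := by
  rw [base_eq]
  exact h (coordLoc i)

/-- The underlying map can be read off from the images of the coordinates, because local functions
embed into the algebra. -/
theorem Covers.unique {τ τ' : Y.dom → X.dom} (h : Covers Φ τ) (h' : Covers Ψ τ')
    (hb : ∀ i, Φ (X.base i) = Ψ (X.base i)) : τ = τ' := by
  funext q
  ext i
  obtain ⟨t, ht, h1⟩ := h.base i
  obtain ⟨t', ht', h1'⟩ := h'.base i
  rw [← ht, ← ht', incl_injective (h1.symm.trans ((hb i).trans h1'))]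

/-- An abstract algebra homomorphism need not respect smooth functions of the coordinates. Covering
a map of spaces replaces the chain rule: on local functions the homomorphism is composition with
that map. -/
theorem IsMorphism.ext (h : IsMorphism Φ) (h' : IsMorphism Ψ)
    (hb : ∀ i, Φ (X.base i) = Ψ (X.base i)) (hgen : ∀ v, Φ (X.gen v) = Ψ (X.gen v)) : Φ = Ψ := by
  obtain ⟨τ, hτ⟩ := h.covers
  obtain ⟨τ', hτ'⟩ := h'.covers
  obtain rfl := hτ.unique hτ' hb
  refine algHom_ext (fun F => ?_) hgen
  obtain ⟨F', hF', h1⟩ := hτ F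
  obtain ⟨F'', hF'', h2⟩ := hτ' F
  rw [h1, h2]
  congr 1
  ext q
  rw [hF', hF'']

theorem IsMorphism.ext_of_fields (hX : IsOpen X.dom) (hY : IsOpen Y.dom)
    {D : Fin n → X.VectorField (0, 0)} {D' : Fin n → Y.VectorField (0, 0)}
    (hD : IsTotalDerivative D) (hD' : IsTotalDerivative D') (h : IsMorphism Φ) (h' : IsMorphism Ψ)
    (hΦ : ∀ μ w, Φ (D μ w) = D' μ (Φ w)) (hΨ : ∀ μ w, Ψ (D μ w) = D' μ (Ψ w))
    (hx : ∀ μ, Φ (X.base (.x μ)) = Ψ (X.base (.x μ))) (hdx : ∀ μ, Φ (X.dx μ) = Ψ (X.dx μ))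
    (hy : ∀ y, IsField y → Φ y = Ψ y) : Φ = Ψ := by
  refine h.ext h' ?_ ?_
  · rintro (μ | ⟨b, I⟩)
    · exact hx μ
    · rw [base_jet_eq hX hD, map_iterD hX hY hD hD' hΦ, map_iterD hX hY hD hD' hΨ,
        hy _ (Or.inl ⟨b, rfl⟩)]
  · rintro (μ | ⟨c, I⟩)
    · exact hdx μ
    · rw [gen_jet_eq hX hD, map_iterD hX hY hD hD' hΦ, map_iterD hX hY hD hD' hΨ,
        hy _ (Or.inr ⟨c, rfl⟩)]

/-- Composing a local function with the map given by the `t i` is again local, since only finitely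
many `t i` occur. The graded generators are handled by the universal property of the symmetric
algebra, using graded commutativity in the target. -/
theorem exists_isMorphism (t : BaseCoord n X.B → LocFun Y.dom)
    (ht : ∀ q, (fun i => (t i).1 q) ∈ X.dom) (gv : GenCoord n X.C → Y.Fn)
    (hgv : ∀ v, gv v ∈ Y.homog (X.gdeg v)) :
    ∃ Φ : X.Fn →ₐ[ℝ] Y.Fn, IsMorphism Φ ∧ Covers Φ (fun q => ⟨fun i => (t i).1 q, ht q⟩) ∧
      (∀ i, Φ (X.base i) = Y.incl (t i)) ∧ ∀ v, Φ (X.gen v) = gv v := by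
  let τ : Y.dom → X.dom := fun q => ⟨fun i => (t i).1 q, ht q⟩
  have hloc : ∀ F : LocFun X.dom, IsLocal Y.dom fun q => F.1 (τ q) := by
    intro F
    obtain ⟨s, g, hg, hF⟩ := F.2
    have heq : (fun q => F.1 (τ q)) = fun q => g fun i : s => (t i).1 q := funext fun q => hF (τ q)
    rw [heq]
    exact IsLocal.comp (dom := Y.dom) hg (fun i : s => t i) fun q => ⟨_, ht q, rfl⟩
  let φ : LocFun X.dom →ₐ[ℝ] LocFun Y.dom :=
    { toFun := fun F => ⟨_, hloc F⟩
      map_one' := rfl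
      map_mul' := fun _ _ => rfl
      map_zero' := rfl
      map_add' := fun _ _ => rfl
      commutes' := fun _ => rfl }
  let ιY : LocFun Y.dom →ₐ[ℝ] Y.Fn := Algebra.TensorProduct.includeLeft
  let ψ : GSym X.gdeg →ₐ[ℝ] Y.Fn := RingQuot.liftAlgHom ℝ ⟨FreeAlgebra.lift ℝ gv, by
    rintro _ _ ⟨v, v'⟩
    simp only [map_mul, map_smul, FreeAlgebra.lift_ι_apply]
    exact homog_comm (hgv v) (hgv v')⟩
  let Φ : X.Fn →ₐ[ℝ] Y.Fn := Algebra.TensorProduct.lift (ιY.comp φ) ψ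
    fun F s => incl_comm _ _
  have hΦ : ∀ F, Φ (X.incl F) = Y.incl (φ F) := fun F => by
    refine (Algebra.TensorProduct.lift_tmul _ _ _ _ _).trans ?_
    rw [map_one, mul_one]
    rfl
  have hgen : ∀ v, Φ (X.gen v) = gv v := fun v => by
    refine (Algebra.TensorProduct.lift_tmul _ _ _ _ _).trans ?_
    rw [map_one, one_mul]
    refine (RingQuot.liftAlgHom_mkAlgHom_apply _ _ _ _).trans ?_
    rw [FreeAlgebra.lift_ι_apply]
  have hcov : Covers Φ τ := fun F => ⟨φ F, fun _ => rfl, hΦ F⟩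
  refine ⟨Φ, ⟨fun e w hw => ?_, τ, hcov⟩, hcov, fun i => ?_, hgen⟩
  · induction hw using Submodule.span_induction with
    | zero => rw [map_zero]; exact zero_mem _
    | add a b _ _ ha hb => rw [map_add]; exact add_mem ha hb
    | smul c a _ ha => rw [map_smul]; exact Submodule.smul_mem _ _ ha
    | mem w hw =>
      obtain ⟨F, l, rfl, rfl⟩ := hw
      rw [map_mul, hΦ, map_list_prod, List.map_map]
      refine homog_congr (mul_mem_homog (incl_mem _) ?_) (zero_add _)
      induction l with
      | nil => exact one_mem_homog
      | cons v l ih =>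
        rw [List.map_cons, List.map_cons, List.prod_cons, List.sum_cons]
        exact mul_mem_homog (by rw [Function.comp_apply, hgen]; exact hgv v) ih
  · rw [base_eq, hΦ]
    rfl

open Classical in
/-- A morphism intertwines two vector fields if it does so on coordinates. -/
theorem IsMorphism.intertwines (hX : IsOpen X.dom) (hY : IsOpen Y.dom) (h : IsMorphism Φ) {d : ℤ × ℤ}
    {f : X.Fn →ₗ[ℝ] X.Fn} {g : Y.Fn →ₗ[ℝ] Y.Fn} (hf : IsVF hX d f) (hg : IsVF hY d g)
    (hb : ∀ i, Φ (f (X.base i)) = g (Φ (X.base i))) (hgen : ∀ v, Φ (f (X.gen v)) = g (Φ (X.gen v)))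
    (w : X.Fn) : Φ (f w) = g (Φ w) := by
  obtain ⟨τ, hτ⟩ := h.covers
  have h0 : Φ.toLinearMap ∘ₗ f = g ∘ₗ Φ.toLinearMap := by
    refine derivation_ext Φ (d := d) (fun e w hw η => ?_) (fun e w hw η => ?_) (fun F => ?_) hgen
    · simp only [LinearMap.comp_apply, AlgHom.toLinearMap_apply, hf.leibniz hw, map_add, map_smul,
        map_mul]
    · simp only [LinearMap.comp_apply, AlgHom.toLinearMap_apply, map_mul, hg.leibniz (h.map_homog e w hw)]
    -- Both sides are expanded by the chain rule: on the source for `F = k(y_i)`, on the target for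
    -- its pullback `k(t_i)`. The coefficients match because `Φ` acts on the partial derivatives of
    -- `F` by composition with the same map `τ`.
    · obtain ⟨s, k, hk, hF⟩ := F.2
      have hrep : IsRep s k F.1 := ⟨hk, hF⟩
      obtain ⟨F', hF', h1⟩ := hτ F
      choose t ht h2 using hτ.base
      choose P hP h3 using fun i => hτ (pd hX i F)
      have hs : ∀ i ∉ s, pd hX i F = 0 := fun i hi => by
        ext p
        rw [pd_apply, IsRep.pdFun_eq hX hrep, dif_neg hi]
        rfl
      simp only [LinearMap.comp_apply, AlgHom.toLinearMap_apply, hf.chain F s hs, map_sum, map_mul, h1,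
        h3, hb, h2]
      rw [hg.chain_comp (isOpen_restr_image hX s) hk (fun i : s => t i)
        (fun q => ⟨_, (τ q).2, by ext i; exact (ht _ _).symm⟩) (fun q => ?_) (fun i => P i) fun i q => ?_]
      · exact (Finset.sum_coe_sort s fun i => Y.incl (P i) * g (Y.incl (t i))).symm
      · rw [hF', hF]
        congr 1
        ext i
        exact (ht _ _).symm
      · rw [hP, pd_apply, IsRep.pdFun_eq hX hrep, dif_pos i.2]
        have : restr s (τ q).1 = fun i : s => (t i).1 q := by
          ext i
          exact (ht _ _).symm
        rw [this]
        congr!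
  exact LinearMap.congr_fun h0 w

theorem IsMorphism.intertwines_of_fields {hX : IsOpen X.dom} {hY : IsOpen Y.dom}
    {D : Fin n → X.VectorField (0, 0)} {D' : Fin n → Y.VectorField (0, 0)}
    (hD : IsTotalDerivative D) (hD' : IsTotalDerivative D') (h : IsMorphism Φ)
    (hΦ : ∀ μ w, Φ (D μ w) = D' μ (Φ w))
    (hx : ∀ μ, Φ (X.base (.x μ)) = Y.base (.x μ)) (hdx : ∀ μ, Φ (X.dx μ) = Y.dx μ) {d : ℤ × ℤ}
    {f : X.Fn →ₗ[ℝ] X.Fn} {g : Y.Fn →ₗ[ℝ] Y.Fn} (hf : IsProl hX D d f) (hg : IsProl hY D' d g)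
    (hy : ∀ y, IsField y → Φ (f y) = g (Φ y)) (w : X.Fn) : Φ (f w) = g (Φ w) := by
  refine h.intertwines hX hY hf.toIsVF hg.toIsVF ?_ ?_ w
  · rintro (μ | ⟨b, I⟩)
    · rw [hf.x, hx, hg.x, map_zero]
    · rw [base_jet_eq hX hD, map_iterD hX hX hD hD hf.comm, map_iterD hX hY hD hD' hΦ,
        map_iterD hX hY hD hD' hΦ, map_iterD hY hY hD' hD' hg.comm, hy _ (Or.inl ⟨b, rfl⟩)]
  · rintro (μ | ⟨c, I⟩)
    · change Φ (f (X.dx μ)) = g (Φ (X.dx μ))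
      rw [hf.dx, hdx, hg.dx, map_zero]
    · rw [gen_jet_eq hX hD, map_iterD hX hX hD hD hf.comm, map_iterD hX hY hD hD' hΦ,
        map_iterD hX hY hD hD' hΦ, map_iterD hY hY hD' hD' hg.comm, hy _ (Or.inr ⟨c, rfl⟩)]

/-- The morphism with prescribed values on the fields which fixes `x^μ` and `dx^μ` and commutes with
total derivatives. -/
theorem exists_isMorphism_of_fields (hX : IsOpen X.dom) (hY : IsOpen Y.dom)
    {D : Fin n → X.VectorField (0, 0)} {D' : Fin n → Y.VectorField (0, 0)}
    (hD : IsTotalDerivative D) (hD' : IsTotalDerivative D')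
    (hdeg : ∀ w ∈ Y.homog 0, ∃ F, w = Y.incl F)
    (bv : X.B → LocFun Y.dom) (gv : X.C → Y.Fn) (hgv : ∀ c, gv c ∈ Y.homog (X.deg c))
    (hdom : ∀ (q : Y.dom) (p : BaseCoord n X.B → ℝ), (∀ μ, p (.x μ) = q.1 (.x μ)) →
      (∀ b, p (.jet b 0) = (bv b).1 q) → p ∈ X.dom) :
    ∃ Φ : X.Fn →ₐ[ℝ] Y.Fn, IsMorphism Φ ∧ (∀ μ, Φ (X.base (.x μ)) = Y.base (.x μ)) ∧
      (∀ μ, Φ (X.dx μ) = Y.dx μ) ∧ (∀ b, Φ (X.base (.jet b 0)) = Y.incl (bv b)) ∧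
      (∀ c, Φ (X.gen (.jet c 0)) = gv c) ∧ ∀ μ w, Φ (D μ w) = D' μ (Φ w) := by
  -- The image of a jet `y_I` is forced to be `D_I` of the image of `y`. It has bidegree zero, hence
  -- is a local function by `hdeg`, and so defines a coordinate of the underlying map.
  choose T hT using fun b I => hdeg (iterD D' I (Y.incl (bv b))) (iterD_mem hY hD' I (incl_mem _))
  obtain ⟨Φ, hΦ, -, hb, hg⟩ := exists_isMorphism (X := X) (Y := Y)
    (fun i => match i with
      | .x μ => coordLoc (.x μ)
      | .jet b I => T b I)
    (fun q => hdom q _ (fun μ => rfl) fun b => by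
      have := hT b 0
      rw [iterD_zero] at this
      rw [incl_injective this])
    (fun v => (match v with
      | .dx μ => Y.dx μ
      | .jet c I => iterD D' I (gv c) : Y.Fn))
    (by
      rintro (μ | ⟨c, I⟩)
      · exact dx_mem μ
      · exact iterD_mem hY hD' I (hgv c))
  have hbx : ∀ μ, Φ (X.base (.x μ)) = Y.base (.x μ) := fun μ => (hb (.x μ)).trans (base_eq _).symm
  have hbj : ∀ b I, Φ (X.base (.jet b I)) = iterD D' I (Y.incl (bv b)) := fun b I =>
    (hb (.jet b I)).trans (hT b I).symm
  have hgx : ∀ μ, Φ (X.gen (.dx μ)) = Y.dx μ := fun μ => hg (.dx μ)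
  have hgj : ∀ c I, Φ (X.gen (.jet c I)) = iterD D' I (gv c) := fun c I => hg (.jet c I)
  refine ⟨Φ, hΦ, hbx, hgx, fun b => by rw [hbj, iterD_zero], fun c => by rw [hgj, iterD_zero],
    fun μ w => hΦ.intertwines hX hY ((D μ).isVF hX) ((D' μ).isVF hY) ?_ ?_ w⟩
  · rintro (ν | ⟨b, I⟩)
    · rw [hD.x, hbx, hD'.x]
      split_ifs
      · exact map_one Φ
      · exact map_zero Φ
    · rw [hD.base, hbj, hbj, iterD_cons hY hD']
  · rintro (ν | ⟨c, I⟩)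
    · rw [show D μ (X.gen (.dx ν)) = 0 from hD.dx μ ν, hgx, hD'.dx, map_zero]
    · rw [hD.gen, hgj, hgj, iterD_cons hY hD']

end Patch

end

section

open Patch

/-! ## The Weil homomorphism -/

namespace Patch

variable {n : ℕ} {X Y : Patch n}

theorem homog_eq_bot (hdeg : ∀ c, (X.deg c).1 = 0) {e : ℤ × ℤ} (he : e.1 < 0) {w : X.Fn}
    (hw : w ∈ X.homog e) : w = 0 := by
  refine Submodule.span_induction (p := fun w _ => w = 0) ?_ rfl (fun a b _ _ ha hb => by simp [ha, hb])
    (fun c a _ ha => by simp [ha]) hw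
  rintro w ⟨F, l, rfl, -⟩
  exfalso
  have h : ∀ l : List (GenCoord n X.C), 0 ≤ (l.map X.gdeg).sum.1 := by
    intro l
    induction l with
    | nil => exact le_rfl
    | cons v l ih =>
      rw [List.map_cons, List.sum_cons, Prod.fst_add]
      have : 0 ≤ (X.gdeg v).1 := by
        cases v with
        | dx μ => exact zero_le_one
        | jet c I => exact (hdeg c).ge
      omega
  exact absurd (h l) (not_le.2 he)

/-- All graded coordinates have positive total degree, so a monomial of bidegree zero contains none
of them. -/
theorem exists_incl_of_mem_homog_zero (hdeg : ∀ c, 0 < (X.deg c).1 + (X.deg c).2) :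
    ∀ w ∈ X.homog 0, ∃ F, w = X.incl F := by
  intro w hw
  refine Submodule.span_induction (p := fun w _ => ∃ F, w = X.incl F) ?_ ⟨0, ?_⟩ ?_ ?_ hw
  · rintro w ⟨F, l, hl, rfl⟩
    have h : ∀ l : List (GenCoord n X.C), (l.length : ℤ) ≤
        (l.map X.gdeg).sum.1 + (l.map X.gdeg).sum.2 := by
      intro l
      induction l with
      | nil => exact le_rfl
      | cons v l ih =>
        rw [List.map_cons, List.sum_cons, Prod.fst_add, Prod.snd_add, List.length_cons]
        have : 0 < (X.gdeg v).1 + (X.gdeg v).2 := by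
          cases v with
          | dx μ => exact zero_lt_one
          | jet c I => exact hdeg c
        push_cast
        omega
    have h0 := h l
    rw [hl] at h0
    obtain rfl : l = [] := List.eq_nil_of_length_eq_zero (by simpa using h0)
    exact ⟨F, by simp⟩
  · exact (TensorProduct.zero_tmul _ _).symm
  · rintro _ _ - - ⟨F, rfl⟩ ⟨F', rfl⟩
    exact ⟨F + F', (incl_add F F').symm⟩
  · rintro c _ - ⟨F, rfl⟩
    exact ⟨c • F, (incl_smul c F).symm⟩

/-- The components of a form `∑_μ w_μ dx^μ` are determined by the form. -/
theorem dx_coeff_ext (hX : IsOpen X.dom) (hdeg : ∀ c, (X.deg c).1 = 0) {k : ℤ} {w w' : Fin n → X.Fn}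
    (hw : ∀ μ, w μ ∈ X.homog (0, k)) (hw' : ∀ μ, w' μ ∈ X.homog (0, k))
    (h : ∑ μ, w μ * X.dx μ = ∑ μ, w' μ * X.dx μ) (ν : Fin n) : w ν = w' ν := by
  -- Contraction with `∂/∂x^ν` extracts the coefficient. It kills the coefficients themselves
  -- because their images would have negative horizontal degree (`homog_eq_bot`).
  obtain ⟨V, hV, -, hg⟩ := exists_isVF hX (d := (-1, 0)) (bv := fun _ => 0)
    (gv := fun v => (match v with
      | .dx μ => if μ = ν then 1 else 0
      | .jet _ _ => 0 : X.Fn)) (by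
        rintro (μ | ⟨c, I⟩)
        · change (if μ = ν then (1 : X.Fn) else 0) ∈ _
          split_ifs
          · exact one_mem_homog
          · exact zero_mem _
        · exact zero_mem _) (fun _ => zero_mem _)
  have key : ∀ w : Fin n → X.Fn, (∀ μ, w μ ∈ X.homog (0, k)) → V (∑ μ, w μ * X.dx μ) = w ν := by
    intro w hw
    rw [map_sum, Finset.sum_eq_single ν]
    · rw [hV.leibniz (hw ν), homog_eq_bot hdeg (by simp) (hV.map_homog (hw ν)), zero_mul, zero_add,
        Patch.dx, hg, sgn_even (by simp), one_smul]
      simp only [if_true, mul_one]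
    · intro μ _ hμ
      rw [hV.leibniz (hw μ), homog_eq_bot hdeg (by simp) (hV.map_homog (hw μ)), zero_mul, zero_add,
        Patch.dx, hg]
      simp only [if_neg hμ, mul_zero, smul_zero]
    · exact fun h => absurd (Finset.mem_univ ν) h
  rw [← key w hw, ← key w' hw', h]

theorem IsMorphism.intertwines_bkt {Φ : X.Fn →ₐ[ℝ] Y.Fn} (h : IsMorphism Φ) {hX : IsOpen X.dom}
    {hY : IsOpen Y.dom} {d e : ℤ × ℤ} {V : X.Fn →ₗ[ℝ] X.Fn} {V' : Y.Fn →ₗ[ℝ] Y.Fn} (hV : IsVF hX d V)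
    (hV' : IsVF hY d V') {r : ℕ} {f : Fin r → Fin r → Fin r → ℝ} {α β : Fin r → X.Fn}
    (hα : ∀ i, α i ∈ X.homog e) (h1 : ∀ i, Φ (V (α i)) = V' (Φ (α i)))
    (h2 : ∀ i, Φ (V (β i)) = V' (Φ (β i))) (a : Fin r) :
    Φ (V (bkt f α β a)) = V' (Φ (bkt f α β a)) := by
  simp only [bkt, map_sum, map_smul, map_mul]
  refine Finset.sum_congr rfl fun i _ => Finset.sum_congr rfl fun j _ => ?_
  rw [hV.leibniz (hα i), hV'.leibniz (h.map_homog _ _ (hα i)), map_add, map_smul, map_mul, map_mul, h1, h2]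

end Patch

section Weil

variable {n N r : ℕ} {U : Set (EuclideanSpace ℝ (Fin n))} {V : Set (EuclideanSpace ℝ (Fin N))}
  {𝔏 : Type*} {comp : 𝔏 → Fin r → EuclideanSpace ℝ (Fin n) → ℝ}
  {vert : Fin r → Fin N → EuclideanSpace ℝ (Fin N) → ℝ} {f : Fin r → Fin r → Fin r → ℝ}
  {cf : Fin r → Fin N → EuclideanSpace ℝ (Fin N) → ℝ}
  {S : (universalPatch r n U).Operators 𝔏} {S' : (mappingPatch n N U V).Operators 𝔏}
  {Φ Ψ : (universalPatch r n U).Fn →ₐ[ℝ] (mappingPatch n N U V).Fn}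

/-- The components of `A_h = ∑_μ A_{h,μ} dx^μ`. -/
def horComp (n : ℕ) (U : Set (EuclideanSpace ℝ (Fin n))) (V : Set (EuclideanSpace ℝ (Fin N)))
    (cf : Fin r → Fin N → EuclideanSpace ℝ (Fin N) → ℝ) (μ : Fin n) (a : Fin r) :
    (mappingPatch n N U V).Fn :=
  ∑ j, uFun (cf a j) * uFirst n N U V j μ

/-- The components of `-R_m`. -/
def mixedComp (f : Fin r → Fin r → Fin r → ℝ) (cf : Fin r → Fin N → EuclideanSpace ℝ (Fin N) → ℝ)
    (S' : (mappingPatch n N U V).Operators 𝔏) (μ : Fin n) (a : Fin r) : (mappingPatch n N U V).Fn :=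
  S'.Q (horComp n U V cf μ a) - S'.D μ (vertConn n U V cf a)
    - bkt f (horComp n U V cf μ) (vertConn n U V cf) a

theorem vertConn_eq (a : Fin r) :
    vertConn n U V cf a = ∑ j, uFun (cf a j) * deltaU n N U V j := rfl

theorem vertConn_mem (a : Fin r) : vertConn n U V cf a ∈ (mappingPatch n N U V).homog (0, 1) :=
  sum_mem fun j _ => homog_congr (mul_mem_homog (uFun_mem _) (deltaU_mem j)) (zero_add _)

theorem horComp_mem (μ : Fin n) (a : Fin r) :
    horComp n U V cf μ a ∈ (mappingPatch n N U V).homog 0 :=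
  sum_mem fun j _ => homog_congr (mul_mem_homog (uFun_mem _) (uFirst_mem j μ)) (zero_add _)

theorem horConn_eq : horConn n U V cf = ∑ μ, mulDx r μ (horComp n U V cf μ) := by
  ext a
  simp only [horConn, Finset.sum_apply, mulDx_apply, horComp, Finset.sum_mul]
  exact Finset.sum_comm

theorem vertCurv_mem (a : Fin r) : vertCurv f cf S' a ∈ (mappingPatch n N U V).homog (0, 2) :=
  add_mem (homog_congr (S'.Q.map_homog _ _ (vertConn_mem a)) rfl)
    (Submodule.smul_mem _ _ (homog_congr (bkt_mem vertConn_mem vertConn_mem a) rfl))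

theorem mixedComp_mem (μ : Fin n) (a : Fin r) :
    mixedComp f cf S' μ a ∈ (mappingPatch n N U V).homog (0, 1) :=
  sub_mem (sub_mem (homog_congr (S'.Q.map_homog _ _ (horComp_mem μ a)) (zero_add _))
    (homog_congr ((S'.D μ).map_homog _ _ (vertConn_mem a)) (add_zero _)))
    (homog_congr (bkt_mem (horComp_mem μ) vertConn_mem a) (zero_add _))

theorem neg_mixedCurv_eq (hX : IsOpen (mappingPatch n N U V).dom)
    (hS' : IsCanonicalStructure comp vert S') (a : Fin r) :
    -mixedCurv f cf S' a = ∑ μ, mixedComp f cf S' μ a * (mappingPatch n N U V).dx μ := by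
  have hA := hS'.isAdmissible hX
  rw [mixedCurv, horConn_eq, bkt_sum_left, Operators.dh]
  simp only [Finset.sum_apply, map_sum, mulDx_apply, leibniz_right_dx hA.Q.toIsVF hA.Q.dx,
    bkt_mulDx_left _ _ vertConn_mem rfl, mixedComp, sub_mul, Finset.sum_sub_distrib]
  have : ∀ μ, (mappingPatch n N U V).dx μ * S'.D μ (vertConn n U V cf a) =
      S'.D μ (vertConn n U V cf a) * (mappingPatch n N U V).dx μ := fun μ =>
    dx_comm_of_mem ((S'.D μ).map_homog _ _ (vertConn_mem a)) rfl μ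
  simp only [this]
  abel

/-- The prescribed one-forms for `A` and `υ` are split into their coefficients of `dx^μ`, which
serve as the values on the fields. No condition beyond `x ∈ U` restricts the target, as `A_μ` and
its jets range over all reals. -/
theorem exists_isWeilHom (hU : IsOpen U) (hV : IsOpen V)
    (hS : IsUniversalStructure f comp S) (hS' : IsCanonicalStructure comp vert S') :
    ∃ Φ, IsWeilHom f cf S S' Φ := by
  have hX := isOpen_universalPatch_dom r hU
  have hY := isOpen_mappingPatch_dom hU hV
  have h0 := exists_incl_of_mem_homog_zero (X := mappingPatch n N U V) fun _ => zero_lt_one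
  choose bv hbv using fun b : Fin r × Fin n => h0 _ (horComp_mem (cf := cf) b.2 b.1)
  obtain ⟨Φ, hΦ, hx, hdx, hb, hg, hD⟩ := exists_isMorphism_of_fields hX hY hS.total hS'.total h0
    bv (fun c => (match c with
      | .theta a => vertConn n U V cf a
      | .phi a => vertCurv f cf S' a
      | .upsilon a μ => mixedComp f cf S' μ a : (mappingPatch n N U V).Fn)) (by
        rintro (a | a | ⟨a, μ⟩)
        · exact vertConn_mem a
        · exact vertCurv_mem a
        · exact mixedComp_mem μ a)
    (fun q p hp _ => by
      have : xPoint p = xPt q := by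
        ext μ
        exact hp μ
      change xPoint p ∈ U
      rw [this]
      exact xPt_mem q)
  refine ⟨Φ, hΦ, hx, hdx, fun a => hg (.theta a), fun a => hg (.phi a), fun a => ?_, fun a => ?_, hD⟩
  · rw [connForm, map_sum, horConn_eq, Finset.sum_apply]
    refine Finset.sum_congr rfl fun μ _ => ?_
    rw [map_mul, hdx, mulDx_apply, hbv (a, μ)]
    exact congrArg (· * _) (hb (a, μ))
  · rw [upsilonForm, map_sum, neg_mixedCurv_eq hY hS']
    refine Finset.sum_congr rfl fun μ _ => ?_
    rw [map_mul, hdx]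
    exact congrArg (· * _) (hg (.upsilon a μ))

namespace IsWeilHom

/-- The definition prescribes only the form `A`. Since the homomorphism preserves bidegrees and
fixes `dx^μ`, comparing coefficients determines it on each `A_μ`. -/
theorem conn_eq (hY : IsOpen (mappingPatch n N U V).dom) (h : IsWeilHom f cf S S' Φ) (μ : Fin n)
    (a : Fin r) : Φ (GaugeQK.conn r n U μ a) = horComp n U V cf μ a := by
  refine dx_coeff_ext hY (fun _ => rfl) (k := 0) (w := fun μ => Φ (GaugeQK.conn r n U μ a))
    (w' := fun μ => horComp n U V cf μ a)
    (fun μ => h.morphism.map_homog _ _ (conn_mem μ a)) (fun μ => horComp_mem μ a) ?_ μ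
  have := h.conn a
  rw [connForm, map_sum, horConn_eq, Finset.sum_apply] at this
  simpa only [map_mul, h.dx, mulDx_apply] using this

theorem upsilon_eq (hY : IsOpen (mappingPatch n N U V).dom) (hS' : IsCanonicalStructure comp vert S')
    (h : IsWeilHom f cf S S' Φ) (μ : Fin n) (a : Fin r) :
    Φ (GaugeQK.upsilon r n U μ a) = mixedComp f cf S' μ a := by
  refine dx_coeff_ext hY (fun _ => rfl) (k := 1) (w := fun μ => Φ (GaugeQK.upsilon r n U μ a))
    (w' := fun μ => mixedComp f cf S' μ a)
    (fun μ => h.morphism.map_homog _ _ (upsilon_mem μ a)) (fun μ => mixedComp_mem μ a) ?_ μ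
  have := h.upsilon a
  rw [upsilonForm, map_sum, neg_mixedCurv_eq hY hS'] at this
  simpa only [map_mul, h.dx] using this

theorem unique (hX : IsOpen (universalPatch r n U).dom) (hY : IsOpen (mappingPatch n N U V).dom)
    (hS : IsUniversalStructure f comp S) (hS' : IsCanonicalStructure comp vert S')
    (h : IsWeilHom f cf S S' Φ) (h' : IsWeilHom f cf S S' Ψ) : Φ = Ψ := by
  refine h.morphism.ext_of_fields hX hY hS.total hS'.total h'.morphism h.total h'.total
    (fun μ => (h.x μ).trans (h'.x μ).symm) (fun μ => (h.dx μ).trans (h'.dx μ).symm)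
    (isField_universal (fun a => (h.theta a).trans (h'.theta a).symm)
      (fun a => (h.phi a).trans (h'.phi a).symm)
      (fun μ a => (h.conn_eq hY μ a).trans (h'.conn_eq hY μ a).symm)
      fun μ a => (h.upsilon_eq hY hS' μ a).trans (h'.upsilon_eq hY hS' μ a).symm)

theorem map_vertConn (h : IsWeilHom f cf S S' Φ) (α : Fin r → (universalPatch r n U).Fn) (a : Fin r) :
    Φ (bkt f α (GaugeQK.theta r n U) a) = bkt f (fun i => Φ (α i)) (vertConn n U V cf) a := by
  rw [map_bkt]
  simp only [h.theta]

theorem map_dh (h : IsWeilHom f cf S S' Φ) (w : (universalPatch r n U).Fn) :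
    Φ (S.dh w) = S'.dh (Φ w) := by
  simp only [Operators.dh, map_sum, map_mul, h.dx, h.total]

theorem map_universalConnection (h : IsWeilHom f cf S S' Φ) (a : Fin r) :
    Φ (universalConnection a) = vertConn n U V cf a + horConn n U V cf a := by
  rw [universalConnection, map_add, h.theta, h.conn]

theorem map_universalCurvature (h : IsWeilHom f cf S S' Φ) (a : Fin r) :
    Φ (universalCurvature f S a) =
      vertCurv f cf S' a + mixedCurv f cf S' a + horCurv f cf S' a := by
  rw [universalCurvature, map_add, map_sub, h.phi, h.upsilon, sub_neg_eq_add, connCurvature, map_add,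
    h.map_dh, h.conn, map_smul, map_bkt]
  simp only [h.conn]
  rfl

/-- The generators `φ` and `υ` can be expressed through `θ` and `A`. -/
theorem intertwines_fields (hX : IsOpen (universalPatch r n U).dom)
    (hY : IsOpen (mappingPatch n N U V).dom)
    (hS : IsUniversalStructure f comp S) (hS' : IsCanonicalStructure comp vert S')
    (h : IsWeilHom f cf S S' Φ) {d : ℤ × ℤ}
    {W : (universalPatch r n U).Fn →ₗ[ℝ] (universalPatch r n U).Fn}
    {W' : (mappingPatch n N U V).Fn →ₗ[ℝ] (mappingPatch n N U V).Fn}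
    (hW : IsProl hX S.D d W) (hW' : IsProl hY S'.D d W')
    (hθ : ∀ a, Φ (W (GaugeQK.theta r n U a)) = W' (Φ (GaugeQK.theta r n U a)))
    (hA : ∀ μ a, Φ (W (GaugeQK.conn r n U μ a)) = W' (Φ (GaugeQK.conn r n U μ a)))
    (hQ : ∀ w, Φ (W w) = W' (Φ w) → Φ (W (S.Q w)) = W' (Φ (S.Q w))) (w) : Φ (W w) = W' (Φ w) := by
  refine h.morphism.intertwines_of_fields hS.total hS'.total h.total h.x h.dx hW hW'
    (isField_universal hθ (fun a => ?_) hA fun μ a => ?_) w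
  · have e : GaugeQK.phi r n U a = S.Q (GaugeQK.theta r n U a) +
        (1 / 2 : ℝ) • bkt f (GaugeQK.theta r n U) (GaugeQK.theta r n U) a := by
      rw [hS.Q_theta, sub_add_cancel]
    rw [e, map_add, map_add, map_add, map_add, map_smul, map_smul, map_smul, map_smul, hQ _ (hθ a),
      h.morphism.intertwines_bkt hW.toIsVF hW'.toIsVF theta_mem hθ hθ]
  · have e : GaugeQK.upsilon r n U μ a = S.Q (GaugeQK.conn r n U μ a) -
        (S.D μ (GaugeQK.theta r n U a) + bkt f (GaugeQK.conn r n U μ) (GaugeQK.theta r n U) a) := by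
      rw [hS.Q_conn, add_sub_cancel_right]
    rw [e, map_sub, map_sub, map_sub, map_sub, hQ _ (hA μ a), map_add, map_add, map_add, map_add,
      h.morphism.intertwines_bkt hW.toIsVF hW'.toIsVF (conn_mem μ) (hA μ) hθ, hW.comm, h.total, hθ,
      h.total, hW'.comm]

section Intertwine

variable (hX : IsOpen (universalPatch r n U).dom) (hY : IsOpen (mappingPatch n N U V).dom)
  (hS : IsUniversalStructure f comp S) (hS' : IsCanonicalStructure comp vert S')
  (h : IsWeilHom f cf S S' Φ) (hQQ : ∀ w, S.Q (S.Q w) = 0) (hQQ' : ∀ w, S'.Q (S'.Q w) = 0)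
include hX hY hS hS' h hQQ hQQ'

/-- On `θ` and `A` the claim is the definition of `R_v` and `R_m`. On `φ` and `υ` it then follows
from `Q² = 0` on both sides, so the Bianchi identities are never written out. -/
theorem intertwines_Q (w : (universalPatch r n U).Fn) : Φ (S.Q w) = S'.Q (Φ w) := by
  refine h.intertwines_fields hX hY hS hS' (hS.isAdmissible hX).Q (hS'.isAdmissible hY).Q
    (fun a => ?_) (fun μ a => ?_) (fun w hw => ?_) w
  · rw [hS.Q_theta, map_sub, map_smul, h.map_vertConn, h.phi, h.theta, vertCurv]
    simp only [h.theta, add_sub_cancel_right]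
  · rw [hS.Q_conn, map_add, map_add, h.map_vertConn, h.upsilon_eq hY hS', h.total, h.theta,
      h.conn_eq hY, mixedComp]
    simp only [h.conn_eq hY]
    abel
  · rw [hQQ, map_zero, hw, hQQ']

end Intertwine

end IsWeilHom

end Weil

end

/-! ### The Weil homomorphism and the operators `L`, `K`, `ι_λ` -/

section

open Patch

theorem Patch.IsFieldHorizontalDifferential.apply_of_mem {n : ℕ} {X : Patch n} {hX : IsOpen X.dom}
    {D : Fin n → X.VectorField (0, 0)} (hdeg : ∀ c, (X.deg c).1 = 0) {L : X.VectorField (1, 0)}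
    (hL : IsFieldHorizontalDifferential L) (hD : IsTotalDerivative D) {E : X.Fn →ₗ[ℝ] X.Fn}
    (hE : IsExplicit hX E) {k : ℤ × ℤ} (hk : k.1 = 0) {w : X.Fn} (hw : w ∈ X.homog k) (hEw : E w = 0) :
    L w = ∑ μ, D μ w * X.dx μ := by
  rw [hL.eq_sub hdeg hD hE, hEw, sub_zero, dhMap_apply]
  exact Finset.sum_congr rfl fun μ _ =>
    dx_comm_of_mem (homog_congr ((D μ).map_homog _ _ hw) (add_zero _)) hk μ

section Weil

variable {n N r : ℕ} {U : Set (EuclideanSpace ℝ (Fin n))} {V : Set (EuclideanSpace ℝ (Fin N))}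
  {𝔏 : Type*} {comp : 𝔏 → Fin r → EuclideanSpace ℝ (Fin n) → ℝ}
  {vert : Fin r → Fin N → EuclideanSpace ℝ (Fin N) → ℝ} {f : Fin r → Fin r → Fin r → ℝ}
  {cf : Fin r → Fin N → EuclideanSpace ℝ (Fin N) → ℝ}
  {S : (universalPatch r n U).Operators 𝔏} {S' : (mappingPatch n N U V).Operators 𝔏}
  {Φ : (universalPatch r n U).Fn →ₐ[ℝ] (mappingPatch n N U V).Fn}

theorem explicit_vertConn {hY : IsOpen (mappingPatch n N U V).dom} (hV : IsOpen V)
    (hcf : ∀ a j, ContDiffOn ℝ ∞ (cf a j) V)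
    {E : (mappingPatch n N U V).Fn →ₗ[ℝ] (mappingPatch n N U V).Fn}
    (hE : IsExplicit hY E) (a : Fin r) : E (vertConn n U V cf a) = 0 := by
  have hEu : ∀ k, E (uCoord n N U V k) = 0 := fun k => hE.base k 0
  rw [vertConn_eq, map_sum]
  refine Finset.sum_eq_zero fun j _ => hE.mul ?_ (hE.gen _)
  rw [hE.map_uFun hV (hcf a j)]
  exact Finset.sum_eq_zero fun k _ => by rw [hEu, mul_zero]

theorem explicit_horComp {hY : IsOpen (mappingPatch n N U V).dom} (hV : IsOpen V)
    (hcf : ∀ a j, ContDiffOn ℝ ∞ (cf a j) V)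
    {E : (mappingPatch n N U V).Fn →ₗ[ℝ] (mappingPatch n N U V).Fn}
    (hE : IsExplicit hY E) (μ : Fin n) (a : Fin r) : E (horComp n U V cf μ a) = 0 := by
  have hEu : ∀ k, E (uCoord n N U V k) = 0 := fun k => hE.base k 0
  rw [horComp, map_sum]
  refine Finset.sum_eq_zero fun j _ => hE.mul ?_ (hE.base _ _)
  rw [hE.map_uFun hV (hcf a j)]
  exact Finset.sum_eq_zero fun k _ => by rw [hEu, mul_zero]

theorem exists_horComp_eq_incl (μ : Fin n) (a : Fin r) :
    ∃ F, horComp n U V cf μ a = (mappingPatch n N U V).incl F :=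
  exists_incl_of_mem_homog_zero (X := mappingPatch n N U V) (fun _ => zero_lt_one) _ (horComp_mem μ a)

namespace IsWeilHom

variable (hX : IsOpen (universalPatch r n U).dom) (hY : IsOpen (mappingPatch n N U V).dom)
  (hS : IsUniversalStructure f comp S) (hS' : IsCanonicalStructure comp vert S')
  (h : IsWeilHom f cf S S' Φ)

theorem map_xFun (h : IsWeilHom f cf S S' Φ) {k : EuclideanSpace ℝ (Fin n) → ℝ}
    (hk : ContDiffOn ℝ ∞ k U) :
    Φ ((universalPatch r n U).ofFun fun p => k (xPoint p.1)) = xFun k := by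
  obtain ⟨τ, hτ⟩ := h.morphism.covers
  have hl : IsLocal (universalPatch r n U).dom fun p => k (xPoint p.1) :=
    isLocal_xPoint (fun _ h => h) hk
  obtain ⟨F', hF', h1⟩ := hτ ⟨_, hl⟩
  rw [ofFun_of_isLocal hl, h1]
  refine Eq.trans ?_ (ofFun_of_isLocal (isLocal_xFun hk)).symm
  congr 1
  ext q
  rw [hF']
  change k (xPoint (τ q).1) = k (xPoint q.1)
  congr 1
  ext μ
  obtain ⟨t, ht, h2⟩ := hτ.base (.x μ)
  rw [h.x, base_eq] at h2
  exact (ht q).symm.trans (congrArg (fun F : LocFun (mappingPatch n N U V).dom => F.1 q)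
    (incl_injective h2).symm)

variable [AddCommGroup 𝔏] [Module ℝ 𝔏] {br : 𝔏 → 𝔏 → 𝔏 → Prop}
  (hqk : S.IsQKvg br) (hqk' : S'.IsQKvg br)

include hX hS hS' h hqk hqk' hY

theorem intertwines_Q' (w : (universalPatch r n U).Fn) : Φ (S.Q w) = S'.Q (Φ w) :=
  h.intertwines_Q hX hY hS hS' hqk.Q_Q hqk'.Q_Q w

/-- The coefficients `A_j(u)` do not depend explicitly on `x`, so on `A_v` and `A_h` the operator
`L` is the horizontal differential, which is preserved. Commutation of `L` with `Q` carries the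
claim to `φ` and `υ`. -/
theorem intertwines_L (hV : IsOpen V) (hcf : ∀ a j, ContDiffOn ℝ ∞ (cf a j) V)
    (w : (universalPatch r n U).Fn) : Φ (S.L w) = S'.L (Φ w) := by
  obtain ⟨E, hE⟩ := exists_isExplicit hY
  have hQ := h.intertwines_Q' hX hY hS hS' hqk hqk'
  refine h.intertwines_fields hX hY hS hS' (hS.isAdmissible hX).L (hS'.isAdmissible hY).L
    (fun a => ?_) (fun μ a => ?_) (fun w hw => ?_) w
  · rw [(isField_theta a).L_eq hS.total hS.L_eq, h.theta,
      hS'.L_eq.apply_of_mem (fun _ => rfl) hS'.total hE rfl (vertConn_mem a)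
        (explicit_vertConn hV hcf hE a), map_sum]
    simp only [map_mul, h.total, h.theta, h.dx]
  · rw [(isField_conn μ a).L_eq hS.total hS.L_eq, h.conn_eq hY,
      hS'.L_eq.apply_of_mem (fun _ => rfl) hS'.total hE rfl (horComp_mem μ a)
        (explicit_horComp hV hcf hE μ a), map_sum]
    simp only [map_mul, h.total, h.conn_eq hY, h.dx]
  · rw [← sub_eq_zero.1 (hqk.Q_L w), hQ, hw, hQ, sub_eq_zero.1 (hqk'.Q_L (Φ w))]

/-- On `θ` the claim is `K A_v = A_h`; on `A` both sides vanish. The step to `φ` and `υ` uses `K Q =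
L - Q K`, which is why `L` has to come first. -/
theorem intertwines_K (hV : IsOpen V) (hcf : ∀ a j, ContDiffOn ℝ ∞ (cf a j) V)
    (w : (universalPatch r n U).Fn) : Φ (S.K w) = S'.K (Φ w) := by
  have hQ := h.intertwines_Q' hX hY hS hS' hqk hqk'
  have hL := h.intertwines_L hX hY hS hS' hqk hqk' hV hcf
  refine h.intertwines_fields hX hY hS hS' (hS.isAdmissible hX).K (hS'.isAdmissible hY).K
    (fun a => ?_) (fun μ a => ?_) (fun w hw => ?_) w
  · rw [hS.K_theta, h.conn, h.theta, vertConn_eq, map_sum, horConn]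
    refine Finset.sum_congr rfl fun j _ => ?_
    rw [S'.K.leibniz _ _ (uFun_mem _), show S'.K (uFun (cf a j)) = 0 from hS'.K_ofFun hY _, zero_mul,
      zero_add, sgn_zero_right, one_smul, hS'.K_deltaU, Finset.mul_sum]
    simp only [mul_assoc]
    rfl
  · obtain ⟨F, hF⟩ := exists_horComp_eq_incl (n := n) (U := U) (V := V) (cf := cf) μ a
    rw [hS.K_conn, map_zero, h.conn_eq hY, hF, hS'.K_incl hY]
  · rw [eq_sub_of_add_eq' (hqk.Q_K w), map_sub, hL, hQ, hw, hQ, ← hqk'.Q_K (Φ w), add_sub_cancel_left]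

section Contraction

variable (hU : IsOpen U) (hV : IsOpen V) (hsm : ∀ l a, ContDiffOn ℝ ∞ (comp l a) U)
  (hvs : ∀ a j, ContDiffOn ℝ ∞ (vert a j) V) (hcf : ∀ a j, ContDiffOn ℝ ∞ (cf a j) V)
  (hf : IsLieConst f)
  (hdual : ∀ a b, ∀ u ∈ V, ∑ j, cf a j u * vert b j u = if a = b then 1 else 0)
  (hcurv : ∀ a b j, ∀ u ∈ V, ∑ k, vert b k u * (GaugeQK.pderiv k (cf a j) u - GaugeQK.pderiv j (cf a k) u)
    = -∑ c, f b c a * cf c j u)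

omit [AddCommGroup 𝔏] [Module ℝ 𝔏] hX hS h hqk hqk' in
include hsm hvs hcf hdual in
-- This is `A(v_ξ) = ξ` in coordinates, with `ξ = λ(x)`.
theorem ι_vertConn (l : 𝔏) (a : Fin r) : S'.ι l (vertConn n U V cf a) = xFun (comp l a) := by
  refine ext_evalAt fun q => ?_
  rw [evalAt_xFun (hsm l a), vertConn_eq, map_sum, map_sum]
  have h1 : ∀ j, evalAt q (S'.ι l (uFun (cf a j) * deltaU n N U V j)) =
      algebraMap ℝ _ (cf a j (uPt q) * ∑ b, comp l b (xPt q) * vert b j (uPt q)) := by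
    intro j
    rw [(S'.ι l).leibniz _ _ (uFun_mem _), hS'.ι_uFun hY, zero_mul, zero_add, sgn_zero_right, one_smul,
      map_mul, map_mul, evalAt_uFun (hcf a j), hS'.evalAt_ι_deltaU hsm hvs]
  simp only [h1]
  rw [← map_sum]
  congr 1
  simp only [Finset.mul_sum]
  rw [Finset.sum_comm]
  have h2 : ∀ b, ∑ j, cf a j (uPt q) * (comp l b (xPt q) * vert b j (uPt q)) =
      comp l b (xPt q) * if a = b then 1 else 0 := by
    intro b
    rw [← hdual a b _ (uPt_mem q), Finset.mul_sum]
    exact Finset.sum_congr rfl fun j _ => by ring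
  simp only [h2]
  simp

omit [AddCommGroup 𝔏] [Module ℝ 𝔏] hX hS h hqk hqk' in
include hV hsm hvs hcf hcurv in
-- Since `Q A_v` is the pullback of `dA`, contracting it with the vertical field `ξ` leaves, in
-- front of `δu^j`, the sum `∑_k (∂_k A_j - ∂_j A_k) ξ^k`. By `hcurv` this is `-[λ, A_j]`, the
-- statement that the curvature is horizontal.
theorem ι_Q_vertConn (l : 𝔏) (a : Fin r) :
    S'.ι l (S'.Q (vertConn n U V cf a)) =
      -bkt f (fun b => (xFun (comp l b) : (mappingPatch n N U V).Fn)) (vertConn n U V cf) a := by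
  have hA := hS'.isAdmissible hY
  set ξ : Fin N → (mappingPatch n N U V).Fn := fun j => S'.ι l (deltaU n N U V j) with hξ
  have hξm : ∀ j, ξ j ∈ (mappingPatch n N U V).homog 0 := fun j =>
    homog_congr ((S'.ι l).map_homog _ _ (deltaU_mem j)) rfl
  have h1 : ∀ j, S'.ι l (S'.Q (uFun (cf a j) * deltaU n N U V j)) =
      ∑ k, (uFun (GaugeQK.pderiv k (cf a j)) * ξ k * deltaU n N U V j -
        uFun (GaugeQK.pderiv k (cf a j)) * ξ j * deltaU n N U V k) := by
    intro j
    rw [S'.Q.leibniz _ _ (uFun_mem _), hS'.Q_deltaU, mul_zero, smul_zero, add_zero,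
      hA.Q.map_uFun hV (hcf a j), Finset.sum_mul, map_sum]
    refine Finset.sum_congr rfl fun k _ => ?_
    rw [hS'.Q_u, mul_assoc, (S'.ι l).leibniz _ _ (uFun_mem _), hS'.ι_uFun hY, zero_mul, zero_add,
      sgn_zero_right, one_smul, (S'.ι l).leibniz _ _ (deltaU_mem k), sgn_odd (by simp), neg_one_smul,
      mul_add, mul_neg, ← sub_eq_add_neg, mul_assoc, mul_assoc]
    congr 2
    exact (homog_comm (deltaU_mem k) (hξm j)).trans (by rw [sgn_zero_right, one_smul])
  have h2 : ∀ j, ∑ k, ((uFun (GaugeQK.pderiv k (cf a j)) - uFun (GaugeQK.pderiv j (cf a k))) * ξ k) =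
      -∑ b, ∑ c, f b c a • (xFun (comp l b) * uFun (cf c j) : (mappingPatch n N U V).Fn) := by
    intro j
    refine ext_evalAt fun q => ?_
    have e1 : ∀ k, evalAt q ((uFun (GaugeQK.pderiv k (cf a j)) - uFun (GaugeQK.pderiv j (cf a k))) * ξ k)
        = algebraMap ℝ _ ((GaugeQK.pderiv k (cf a j) (uPt q) - GaugeQK.pderiv j (cf a k) (uPt q)) *
          ∑ b, comp l b (xPt q) * vert b k (uPt q)) := fun k => by
      rw [map_mul, map_sub, evalAt_uFun (contDiffOn_pderiv hV (hcf a j) k),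
        evalAt_uFun (contDiffOn_pderiv hV (hcf a k) j), hξ, hS'.evalAt_ι_deltaU hsm hvs, ← map_sub,
        ← map_mul]
    have e2 : ∀ b c, evalAt q (f b c a • (xFun (comp l b) * uFun (cf c j) : (mappingPatch n N U V).Fn)) =
        algebraMap ℝ _ (f b c a * (comp l b (xPt q) * cf c j (uPt q))) := fun b c => by
      rw [map_smul, map_mul, evalAt_xFun (hsm l b), evalAt_uFun (hcf c j), Algebra.smul_def, ← map_mul,
        ← map_mul]
    simp only [map_sum, map_neg, e1, e2]
    simp only [← map_sum, ← map_neg]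
    congr 1
    simp only [Finset.mul_sum]
    rw [Finset.sum_comm, ← Finset.sum_neg_distrib]
    refine Finset.sum_congr rfl fun b _ => ?_
    have := hcurv a b j _ (uPt_mem q)
    calc _ = comp l b (xPt q) * ∑ k, vert b k (uPt q) *
          (GaugeQK.pderiv k (cf a j) (uPt q) - GaugeQK.pderiv j (cf a k) (uPt q)) := by
          rw [Finset.mul_sum]
          exact Finset.sum_congr rfl fun k _ => by ring
      _ = _ := by
          rw [this, mul_neg, Finset.mul_sum]
          exact congrArg _ (Finset.sum_congr rfl fun c _ => by ring)
  rw [vertConn_eq, map_sum, map_sum]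
  simp only [h1, Finset.sum_sub_distrib]
  rw [Finset.sum_comm (f := fun j k => uFun (GaugeQK.pderiv k (cf a j)) * ξ j * deltaU n N U V k),
    ← Finset.sum_sub_distrib]
  have h3 : ∀ j, ∑ k, uFun (GaugeQK.pderiv k (cf a j)) * ξ k * deltaU n N U V j -
      ∑ k, uFun (GaugeQK.pderiv j (cf a k)) * ξ k * deltaU n N U V j =
      (-∑ b, ∑ c, f b c a • (xFun (comp l b) * uFun (cf c j) : (mappingPatch n N U V).Fn)) *
        deltaU n N U V j := by
    intro j
    rw [← h2, ← Finset.sum_sub_distrib, Finset.sum_mul]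
    exact Finset.sum_congr rfl fun k _ => by rw [sub_mul, sub_mul]
  simp only [h3, neg_mul, Finset.sum_neg_distrib, Finset.sum_mul]
  rw [Finset.sum_comm]
  refine congrArg _ (Finset.sum_congr rfl fun b _ => ?_)
  rw [Finset.sum_comm]
  refine Finset.sum_congr rfl fun c _ => ?_
  rw [vertConn_eq, Finset.mul_sum, Finset.smul_sum]
  exact Finset.sum_congr rfl fun j _ => by rw [smul_mul_assoc, mul_assoc]

omit [AddCommGroup 𝔏] [Module ℝ 𝔏] hX hS h hqk hqk' in
include hV hsm hvs hcf hcurv hf hdual in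
-- Contracting `[A_v, A_v]/2` gives `[λ, A_v]`, both factors contributing equally, and this cancels
-- the contraction of `Q A_v`.
theorem ι_vertCurv (l : 𝔏) (a : Fin r) : S'.ι l (vertCurv f cf S' a) = 0 := by
  have hA := hS'.isAdmissible hY
  have h1 := (hA.ι l).map_bkt_odd (f := f) (vertConn n U V cf) (vertConn_mem (n := n) (U := U) (cf := cf))
    (by simp)
  have h2 : (S'.ι l).toLin.compLeft (Fin r) (vertConn n U V cf) =
      fun b => (xFun (comp l b) : (mappingPatch n N U V).Fn) :=
    funext fun b => ι_vertConn hY hS' hsm hvs hcf hdual l b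
  rw [h2, bkt_comm_even hf (α := vertConn n U V cf) vertConn_mem (fun b => xFun_mem (comp l b)) (by simp),
    sub_neg_eq_add] at h1
  have h3 := congrFun h1 a
  rw [LinearMap.compLeft_apply, Function.comp_apply] at h3
  rw [vertCurv, map_add, map_smul, h3, ι_Q_vertConn hY hS' hV hsm hvs hcf hcurv, Pi.add_apply,
    ← two_smul ℝ, smul_smul]
  norm_num

include hV hsm hvs hcf hcurv hf hdual

/-- A direct computation is avoided: as `υ = -Kφ` and `K` is intertwined, `-R_m = -K R_v`. The
contraction anticommutes with `K` and kills `R_v`. Comparing coefficients of `dx^μ` gives the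
components. -/
theorem ι_mixedComp (l : 𝔏) (μ : Fin n) (a : Fin r) : S'.ι l (mixedComp f cf S' μ a) = 0 := by
  have hA := hS'.isAdmissible hY
  refine dx_coeff_ext hY (fun _ => rfl) (k := 0) (w := fun μ => S'.ι l (mixedComp f cf S' μ a))
    (w' := fun _ => 0) (fun μ => homog_congr ((S'.ι l).map_homog _ _ (mixedComp_mem μ a)) rfl)
    (fun _ => zero_mem _) ?_ μ
  have h1 : S'.ι l (Φ (upsilonForm r n U a)) = 0 := by
    have e : upsilonForm r n U a = -S.K (GaugeQK.phi r n U a) := by rw [hS.K_phi, neg_neg]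
    rw [e, map_neg, map_neg, h.intertwines_K hX hY hS hS' hqk hqk' hV hcf, h.phi,
      eq_neg_of_add_eq_zero_left (hqk'.ι_K l _), ι_vertCurv hY hS' hV hsm hvs hcf hf hdual hcurv, map_zero,
      neg_zero, neg_zero]
  rw [h.upsilon, neg_mixedCurv_eq hY hS', map_sum] at h1
  simpa only [leibniz_right_dx (hA.ι l).toIsVF (hA.ι l).dx, zero_mul, Finset.sum_const_zero] using h1

theorem intertwines_ι (l : 𝔏) (w : (universalPatch r n U).Fn) : Φ (S.ι l w) = S'.ι l (Φ w) := by
  refine h.morphism.intertwines_of_fields hS.total hS'.total h.total h.x h.dx ((hS.isAdmissible hX).ι l)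
    ((hS'.isAdmissible hY).ι l)
    (isField_universal (fun a => ?_) (fun a => ?_) (fun μ a => ?_) fun μ a => ?_) w
  · rw [hS.ι_theta, h.map_xFun (hsm l a), h.theta, ι_vertConn hY hS' hsm hvs hcf hdual]
  · rw [hS.ι_phi, map_zero, h.phi, ι_vertCurv hY hS' hV hsm hvs hcf hf hdual hcurv]
  · obtain ⟨F, hF⟩ := exists_horComp_eq_incl (n := n) (U := U) (V := V) (cf := cf) μ a
    rw [hS.ι_conn, map_zero, h.conn_eq hY, hF, hS'.ι_incl hY]
  · rw [hS.ι_upsilon, map_zero, h.upsilon_eq hY hS',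
      h.ι_mixedComp hX hY hS hS' hqk hqk' hV hsm hvs hcf hf hdual hcurv]

theorem intertwines : Intertwines S S' Φ := by
  have hQ := h.intertwines_Q' hX hY hS hS' hqk hqk'
  have hι := h.intertwines_ι hX hY hS hS' hqk hqk' hV hsm hvs hcf hf hdual hcurv
  exact ⟨hQ, h.intertwines_K hX hY hS hS' hqk hqk' hV hcf, h.intertwines_L hX hY hS hS' hqk hqk' hV hcf,
    hι, fun l w => by rw [hS.δ_eq, hS'.δ_eq, map_add, hQ, hι, hι, hQ]⟩

end Contraction

end IsWeilHom

end Weil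

end

section

open Patch

/-! ## Changes of fibre coordinates -/

namespace Patch

variable {n : ℕ} {X Y Z : Patch n}

theorem Covers.comp {Φ : X.Fn →ₐ[ℝ] Y.Fn} {Ψ : Y.Fn →ₐ[ℝ] Z.Fn} {τ : Y.dom → X.dom} {σ : Z.dom → Y.dom}
    (h : Covers Φ τ) (h' : Covers Ψ σ) : Covers (Ψ.comp Φ) (τ ∘ σ) := by
  intro F
  obtain ⟨F', hF', h1⟩ := h F
  obtain ⟨F'', hF'', h2⟩ := h' F'
  exact ⟨F'', fun q => (hF'' q).trans (hF' _), by rw [AlgHom.comp_apply, h1, h2]⟩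

theorem IsMorphism.comp {Φ : X.Fn →ₐ[ℝ] Y.Fn} {Ψ : Y.Fn →ₐ[ℝ] Z.Fn} (h : IsMorphism Φ)
    (h' : IsMorphism Ψ) : IsMorphism (Ψ.comp Φ) where
  map_homog e w hw := h'.map_homog e _ (h.map_homog e w hw)
  covers := by
    obtain ⟨τ, hτ⟩ := h.covers
    obtain ⟨σ, hσ⟩ := h'.covers
    exact ⟨_, hτ.comp hσ⟩

theorem Covers.map_ofFun {Φ : X.Fn →ₐ[ℝ] Y.Fn} {τ : Y.dom → X.dom} (h : Covers Φ τ) {F : X.dom → ℝ}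
    (hF : IsLocal X.dom F) : Φ (X.ofFun F) = Y.ofFun fun q => F (τ q) := by
  obtain ⟨F', hF', h1⟩ := h ⟨F, hF⟩
  have e : (fun q => F (τ q)) = F'.1 := funext fun q => (hF' q).symm
  rw [ofFun_of_isLocal hF, h1, e, ofFun_of_isLocal F'.2]

theorem Covers.apply_eq {Φ : X.Fn →ₐ[ℝ] Y.Fn} {τ : Y.dom → X.dom} (h : Covers Φ τ)
    {i : BaseCoord n X.B} {F : Y.dom → ℝ} (hF : IsLocal Y.dom F) (hb : Φ (X.base i) = Y.ofFun F)
    (q : Y.dom) : (τ q).1 i = F q := by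
  obtain ⟨t, ht, h1⟩ := h.base i
  rw [hb, ofFun_of_isLocal hF] at h1
  rw [← ht, ← incl_injective h1]

end Patch

section FibreChange

variable {n N r : ℕ} {U : Set (EuclideanSpace ℝ (Fin n))} {V V' : Set (EuclideanSpace ℝ (Fin N))}
  {𝔏 : Type*} {comp : 𝔏 → Fin r → EuclideanSpace ℝ (Fin n) → ℝ}
  {vert vert' : Fin r → Fin N → EuclideanSpace ℝ (Fin N) → ℝ} {f : Fin r → Fin r → Fin r → ℝ}
  {cf cf' : Fin r → Fin N → EuclideanSpace ℝ (Fin N) → ℝ}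
  {S₀ : (universalPatch r n U).Operators 𝔏}
  {S : (mappingPatch n N U V).Operators 𝔏} {S' : (mappingPatch n N U V').Operators 𝔏}
  {T T' : (mappingPatch n N U V').Fn →ₐ[ℝ] (mappingPatch n N U V).Fn}
  {t : EuclideanSpace ℝ (Fin N) → EuclideanSpace ℝ (Fin N)}

theorem contDiffOn_coord {E : Type*} [NormedAddCommGroup E] [NormedSpace ℝ E]
    {t : E → EuclideanSpace ℝ (Fin N)} {s : Set E} (ht : ContDiffOn ℝ ∞ t s) (j : Fin N) :
    ContDiffOn ℝ ∞ (fun y => t y j) s :=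
  (contDiffOn_euclidean.1 ht) j

/-- The value on `δu'^j` is forced to be `Q t^j(u)`. Compatibility with `Q` on `δu'^j` is then `Q² =
0`. -/
theorem exists_isFibreChange (hU : IsOpen U) (hV : IsOpen V) (hV' : IsOpen V')
    (hS : IsCanonicalStructure comp vert S) (hS' : IsCanonicalStructure comp vert' S')
    (hQQ : ∀ w, S.Q (S.Q w) = 0) (ht : ContDiffOn ℝ ∞ t V) (htV : ∀ y ∈ V, t y ∈ V') :
    ∃ T, IsFibreChange t S' S T := by
  have hX := isOpen_mappingPatch_dom hU hV'
  have hY := isOpen_mappingPatch_dom hU hV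
  let bv : Fin N → LocFun (mappingPatch n N U V).dom := fun j => ⟨_, isLocal_uFun (contDiffOn_coord ht j)⟩
  obtain ⟨T, hT, hx, hdx, hb, hg, hD⟩ := exists_isMorphism_of_fields hX hY hS'.total hS.total
    (exists_incl_of_mem_homog_zero (X := mappingPatch n N U V) fun _ => zero_lt_one) bv
    (fun j => S.Q ((mappingPatch n N U V).incl (bv j)))
    (fun j => homog_congr (S.Q.map_homog _ _ (incl_mem _)) rfl) (fun q p hp hp' => by
      have h1 : xPoint p = xPt q := by
        ext μ
        exact hp μ
      have h2 : uPoint p = t (uPt q) := by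
        ext j
        exact hp' j
      change xPoint p ∈ U ∧ uPoint p ∈ V'
      rw [h1, h2]
      exact ⟨xPt_mem q, htV _ (uPt_mem q)⟩)
  refine ⟨T, hT, hx, hdx, fun j => (hb j).trans (ofFun_of_isLocal _).symm, hD, ?_⟩
  refine hT.intertwines_of_fields hS'.total hS.total hD hx hdx (hS'.isAdmissible hX).Q
    (hS.isAdmissible hY).Q (isField_mapping (fun j => ?_) fun j => ?_)
  · rw [hS'.Q_u, show T (deltaU n N U V' j) = _ from hg j, show T (uCoord n N U V' j) = _ from hb j]
  · rw [hS'.Q_deltaU, show T (deltaU n N U V' j) = _ from hg j, hQQ, map_zero]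

namespace IsFibreChange

theorem map_deltaU (hS' : IsCanonicalStructure comp vert' S') (h : IsFibreChange t S' S T) (j : Fin N) :
    T (deltaU n N U V' j) = S.Q (uFun fun y => t y j) := by
  rw [← hS'.Q_u, h.vertical, h.u]
  rfl

theorem unique (hU : IsOpen U) (hV : IsOpen V) (hV' : IsOpen V')
    (hS : IsCanonicalStructure comp vert S) (hS' : IsCanonicalStructure comp vert' S')
    (h : IsFibreChange t S' S T) (h' : IsFibreChange t S' S T') : T = T' :=
  h.morphism.ext_of_fields (isOpen_mappingPatch_dom hU hV') (isOpen_mappingPatch_dom hU hV) hS'.total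
    hS.total h'.morphism h.total h'.total (fun μ => (h.x μ).trans (h'.x μ).symm)
    (fun μ => (h.dx μ).trans (h'.dx μ).symm)
    (isField_mapping (fun j => (h.u j).trans (h'.u j).symm)
      fun j => (h.map_deltaU hS' j).trans (h'.map_deltaU hS' j).symm)

variable (hU : IsOpen U) (hV : IsOpen V) (hV' : IsOpen V')
  (hS : IsCanonicalStructure comp vert S) (hS' : IsCanonicalStructure comp vert' S')
  (ht : ContDiffOn ℝ ∞ t V) (htV : ∀ y ∈ V, t y ∈ V') (h : IsFibreChange t S' S T)

section Functions

include h

theorem xPt_eq {τ : (mappingPatch n N U V).dom → (mappingPatch n N U V').dom} (hτ : Covers T τ)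
    (q : (mappingPatch n N U V).dom) : xPt (τ q) = xPt q := by
  ext μ
  exact hτ.apply_eq (coordLoc (BaseCoord.x μ) : LocFun (mappingPatch n N U V).dom).2 (h.x μ) q

include ht

theorem uPt_eq {τ : (mappingPatch n N U V).dom → (mappingPatch n N U V').dom} (hτ : Covers T τ)
    (q : (mappingPatch n N U V).dom) : uPt (τ q) = t (uPt q) := by
  ext j
  exact hτ.apply_eq (isLocal_uFun (contDiffOn_coord ht j)) (h.u j) q

omit ht in
theorem map_xFun {k : EuclideanSpace ℝ (Fin n) → ℝ} (hk : ContDiffOn ℝ ∞ k U) :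
    T (xFun k) = xFun k := by
  obtain ⟨τ, hτ⟩ := h.morphism.covers
  refine (hτ.map_ofFun (isLocal_xFun hk)).trans (ofFun_congr fun q => ?_)
  rw [h.xPt_eq hτ]
  rfl

theorem map_uFun {k : EuclideanSpace ℝ (Fin N) → ℝ} (hk : ContDiffOn ℝ ∞ k V') :
    T (uFun k) = uFun fun y => k (t y) := by
  obtain ⟨τ, hτ⟩ := h.morphism.covers
  refine (hτ.map_ofFun (isLocal_uFun hk)).trans (ofFun_congr fun q => ?_)
  rw [h.uPt_eq ht hτ]
  rfl

include hS hS' hU hV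

theorem map_deltaU_eq (j : Fin N) : T (deltaU n N U V' j) =
    ∑ k, uFun (GaugeQK.pderiv k fun y => t y j) * deltaU n N U V k := by
  rw [h.map_deltaU hS', (S.Q.isVF (isOpen_mappingPatch_dom hU hV)).map_uFun hV (contDiffOn_coord ht j)]
  simp only [hS.Q_u]

theorem map_uFirst_eq (j : Fin N) (μ : Fin n) : T (uFirst n N U V' j μ) =
    ∑ k, uFun (GaugeQK.pderiv k fun y => t y j) * uFirst n N U V k μ := by
  rw [← hS'.total.uCoord, h.total, h.u]
  refine (((S.D μ).isVF (isOpen_mappingPatch_dom hU hV)).map_uFun hV (contDiffOn_coord ht j)).trans ?_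
  simp only [hS.total.uCoord]

end Functions

section Intertwine

variable (hsm : ∀ l a, ContDiffOn ℝ ∞ (comp l a) U)
  (hvs : ∀ a j, ContDiffOn ℝ ∞ (vert a j) V) (hvs' : ∀ a j, ContDiffOn ℝ ∞ (vert' a j) V')
  (hvt : ∀ a j, ∀ y ∈ V, ∑ k, GaugeQK.pderiv k (fun y => t y j) y * vert a k y = vert' a j (t y))
  [AddCommGroup 𝔏] [Module ℝ 𝔏] {br : 𝔏 → 𝔏 → 𝔏 → Prop}
  (hqk : S.IsQKvg br) (hqk' : S'.IsQKvg br)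

include hU hV hV' hS hS' ht h hqk hqk'

/-- It is enough to treat `u'^j`, whose image `t^j(u)` is free of explicit `x`; `δu'^j = Q u'^j`
follows because `L` commutes with `Q`. -/
theorem intertwines_L (w : (mappingPatch n N U V').Fn) : T (S'.L w) = S.L (T w) := by
  have hX := isOpen_mappingPatch_dom hU hV'
  have hY := isOpen_mappingPatch_dom hU hV
  obtain ⟨E, hE⟩ := exists_isExplicit hY
  have hu : ∀ j, T (S'.L (uCoord n N U V' j)) = S.L (T (uCoord n N U V' j)) := by
    intro j
    have hEu : E (uFun fun y => t y j) = 0 := by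
      rw [hE.map_uFun hV (contDiffOn_coord ht j)]
      exact Finset.sum_eq_zero fun k _ => by
        rw [show E (uCoord n N U V k) = 0 from hE.base k 0, mul_zero]
    have hTu : T (uCoord n N U V' j) = uFun fun y => t y j := h.u j
    have hLu : S'.L (uCoord n N U V' j) = ∑ μ, S'.D μ (uCoord n N U V' j) * (mappingPatch n N U V').dx μ :=
      IsField.L_eq hS'.total hS'.L_eq (Or.inl ⟨j, rfl⟩)
    rw [hLu, hTu,
      hS.L_eq.apply_of_mem (fun _ => rfl) hS.total hE rfl (uFun_mem _) hEu, map_sum]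
    simp only [map_mul, h.total, h.dx, hTu]
  refine h.morphism.intertwines_of_fields hS'.total hS.total h.total h.x h.dx (hS'.isAdmissible hX).L
    (hS.isAdmissible hY).L (isField_mapping hu fun j => ?_) w
  rw [← hS'.Q_u, ← sub_eq_zero.1 (hqk'.Q_L _), h.vertical, hu, h.vertical,
    sub_eq_zero.1 (hqk.Q_L _)]

/-- `K` kills all local functions, so nothing is to be shown on `u'^j`; `K Q = L - Q K` takes care
of `δu'^j`. -/
theorem intertwines_K (w : (mappingPatch n N U V').Fn) : T (S'.K w) = S.K (T w) := by
  have hX := isOpen_mappingPatch_dom hU hV'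
  have hY := isOpen_mappingPatch_dom hU hV
  have hu : ∀ j, T (S'.K (uCoord n N U V' j)) = S.K (T (uCoord n N U V' j)) := by
    intro j
    rw [hS'.K_u, map_zero, h.u, hS.K_ofFun hY]
  refine h.morphism.intertwines_of_fields hS'.total hS.total h.total h.x h.dx (hS'.isAdmissible hX).K
    (hS.isAdmissible hY).K (isField_mapping hu fun j => ?_) w
  rw [← hS'.Q_u, eq_sub_of_add_eq' (hqk'.Q_K _), map_sub, h.intertwines_L hU hV hV' hS hS' ht hqk hqk',
    h.vertical, hu, h.vertical, ← hqk.Q_K, add_sub_cancel_left]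

include hsm hvs hvs' hvt htV

omit [AddCommGroup 𝔏] [Module ℝ 𝔏] hqk hqk' in
-- On `δu'^j` this is `hvt`: the fundamental fields in the two charts are related by the derivative
-- of `t`.
theorem intertwines_ι (l : 𝔏) (w : (mappingPatch n N U V').Fn) : T (S'.ι l w) = S.ι l (T w) := by
  have hX := isOpen_mappingPatch_dom hU hV'
  have hY := isOpen_mappingPatch_dom hU hV
  refine h.morphism.intertwines_of_fields hS'.total hS.total h.total h.x h.dx
    ((hS'.isAdmissible hX).ι l) ((hS.isAdmissible hY).ι l) (isField_mapping (fun j => ?_) fun j => ?_) w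
  · rw [hS'.ι_u, map_zero, h.u, hS.ι_ofFun hY]
  · rw [hS'.ι_deltaU_eq hsm hvs', h.map_deltaU_eq hU hV hS hS' ht, map_sum, map_sum]
    refine ext_evalAt fun q => ?_
    have e1 : ∀ a, evalAt q (T (xFun (comp l a) * uFun (vert' a j))) =
        algebraMap ℝ _ (comp l a (xPt q) * vert' a j (t (uPt q))) := fun a => by
      rw [map_mul, h.map_xFun (hsm l a), h.map_uFun ht (hvs' a j), map_mul, evalAt_xFun (hsm l a),
        evalAt_uFun (h := fun y => vert' a j (t y)) ((hvs' a j).comp ht htV), map_mul]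
    have e2 : ∀ k, evalAt q (S.ι l (uFun (GaugeQK.pderiv k fun y => t y j) * deltaU n N U V k)) =
        algebraMap ℝ _ (GaugeQK.pderiv k (fun y => t y j) (uPt q) *
          ∑ a, comp l a (xPt q) * vert a k (uPt q)) := fun k => by
      rw [(S.ι l).leibniz _ _ (uFun_mem _), hS.ι_uFun hY, zero_mul, zero_add, sgn_zero_right, one_smul,
        map_mul, evalAt_uFun (contDiffOn_pderiv hV (contDiffOn_coord ht j) k),
        hS.evalAt_ι_deltaU hsm hvs, map_mul]
    simp only [map_sum, e1, e2]
    rw [← map_sum, ← map_sum]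
    congr 1
    simp only [Finset.mul_sum, ← hvt _ _ _ (uPt_mem q)]
    rw [Finset.sum_comm]
    exact Finset.sum_congr rfl fun k _ => Finset.sum_congr rfl fun a _ => by ring

theorem intertwines : Intertwines S' S T := by
  have hι := h.intertwines_ι hU hV hV' hS hS' ht htV hsm hvs hvs' hvt
  exact ⟨h.vertical, h.intertwines_K hU hV hV' hS hS' ht hqk hqk',
    h.intertwines_L hU hV hV' hS hS' ht hqk hqk', hι,
    fun l w => by rw [hS.δ_eq, hS'.δ_eq, map_add, h.vertical, hι, hι, h.vertical]⟩

end Intertwine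

section Weil

variable (hcf : ∀ a j, ContDiffOn ℝ ∞ (cf a j) V) (hcf' : ∀ a j, ContDiffOn ℝ ∞ (cf' a j) V')
  (hct : ∀ a k, ∀ y ∈ V, ∑ j, cf' a j (t y) * GaugeQK.pderiv k (fun y => t y j) y = cf a k y)

include hU hV hS hS' ht h hcf hcf' hct htV

omit hU hS hS' in
-- The transformation law `∑_j A'_j(t(u)) ∂_k t^j = A_k`, paired with an arbitrary family `w`: `w =
-- δu` serves for the vertical part and `w = u_μ` for the horizontal part.
theorem map_coeff (a : Fin r) (w : Fin N → (mappingPatch n N U V).Fn) :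
    ∑ j, T (uFun (cf' a j)) * ∑ k, uFun (GaugeQK.pderiv k fun y => t y j) * w k =
      ∑ k, uFun (cf a k) * w k := by
  have e : ∀ k, ∑ j, T (uFun (cf' a j)) * uFun (GaugeQK.pderiv k fun y => t y j) = uFun (cf a k) := by
    intro k
    refine ext_evalAt fun q => ?_
    rw [evalAt_uFun (hcf a k), ← hct a k _ (uPt_mem q), map_sum, map_sum]
    refine Finset.sum_congr rfl fun j _ => ?_
    rw [map_mul, h.map_uFun ht (hcf' a j), evalAt_uFun (h := fun y => cf' a j (t y)) ((hcf' a j).comp ht htV),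
      evalAt_uFun (contDiffOn_pderiv hV (contDiffOn_coord ht j) k), map_mul]
  simp only [← e, Finset.mul_sum, Finset.sum_mul, mul_assoc]
  exact Finset.sum_comm

theorem map_vertConn (a : Fin r) : T (vertConn n U V' cf' a) = vertConn n U V cf a := by
  rw [vertConn_eq, vertConn_eq, map_sum]
  simp only [map_mul, h.map_deltaU_eq hU hV hS hS' ht]
  exact h.map_coeff hV ht htV hcf hcf' hct a _

theorem map_horConn (a : Fin r) : T (horConn n U V' cf' a) = horConn n U V cf a := by
  rw [horConn_eq, horConn_eq, Finset.sum_apply, Finset.sum_apply, map_sum]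
  refine Finset.sum_congr rfl fun μ _ => ?_
  rw [mulDx_apply, mulDx_apply, map_mul, h.dx, horComp, horComp, map_sum]
  simp only [map_mul, h.map_uFirst_eq hU hV hS hS' ht]
  rw [h.map_coeff hV ht htV hcf hcf' hct a fun k => uFirst n N U V k μ]

/-- The composite has the defining properties of the Weil homomorphism over the smaller domain: `T`
preserves `A_v` and `A_h`, and the curvatures are built from these by `Q`, `d` and brackets, which
`T` respects. -/
theorem comp_isWeilHom {Φ' : (universalPatch r n U).Fn →ₐ[ℝ] (mappingPatch n N U V').Fn}
    (hΦ : IsWeilHom f cf' S₀ S' Φ') : IsWeilHom f cf S₀ S (T.comp Φ') := by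
  have hv : (fun a => T (vertConn n U V' cf' a)) = vertConn n U V cf :=
    funext (h.map_vertConn hU hV hS hS' ht htV hcf hcf' hct)
  have hh : (fun a => T (horConn n U V' cf' a)) = horConn n U V cf :=
    funext (h.map_horConn hU hV hS hS' ht htV hcf hcf' hct)
  have hdh : ∀ w, T (S'.dh w) = S.dh (T w) := fun w => by
    simp only [Operators.dh, map_sum, map_mul, h.dx, h.total]
  refine ⟨hΦ.morphism.comp h.morphism, fun μ => ?_, fun μ => ?_, fun a => ?_, fun a => ?_, fun a => ?_,
    fun a => ?_, fun μ w => ?_⟩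
  · rw [AlgHom.comp_apply, hΦ.x, h.x]
  · rw [AlgHom.comp_apply, hΦ.dx, h.dx]
  · rw [AlgHom.comp_apply, hΦ.theta]
    exact congrFun hv a
  · rw [AlgHom.comp_apply, hΦ.phi, vertCurv, map_add, map_smul, map_bkt, h.vertical, hv, vertCurv,
      ← congrFun hv a]
  · rw [AlgHom.comp_apply, hΦ.conn]
    exact congrFun hh a
  · rw [AlgHom.comp_apply, hΦ.upsilon, mixedCurv, map_neg, map_add, map_sub, map_bkt, h.vertical, hv, hh,
      hdh, mixedCurv, ← congrFun hv a, ← congrFun hh a]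
  · rw [AlgHom.comp_apply, hΦ.total, h.total, AlgHom.comp_apply]

end Weil

end IsFibreChange

end FibreChange

end

section

open Patch

/-! ## Jets -/

section PartialDerivatives

variable {n : ℕ} {O : Set (EuclideanSpace ℝ (Fin n))}

theorem pderiv_eqOn (hO : IsOpen O) {g h : EuclideanSpace ℝ (Fin n) → ℝ} (hgh : Set.EqOn g h O)
    (μ : Fin n) : Set.EqOn (pderiv μ g) (pderiv μ h) O := fun x hx => by
  rw [pderiv, pderiv, (hgh.eventuallyEq_of_mem (hO.mem_nhds hx)).fderiv_eq]

theorem pderiv_comm (hO : IsOpen O) {h : EuclideanSpace ℝ (Fin n) → ℝ} (hh : ContDiffOn ℝ ∞ h O)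
    (μ ν : Fin n) : Set.EqOn (pderiv μ (pderiv ν h)) (pderiv ν (pderiv μ h)) O := fun x hx => by
  have hx' := hO.mem_nhds hx
  have h2 : DifferentiableAt ℝ (fderiv ℝ h) x :=
    ((hh.fderiv_of_isOpen hO (m := ∞) (by simp)).contDiffAt hx').differentiableAt (by simp)
  have key : ∀ v w : EuclideanSpace ℝ (Fin n), fderiv ℝ (fun y => fderiv ℝ h y v) x w =
      fderiv ℝ (fderiv ℝ h) x w v := fun v w => by
    rw [fderiv_clm_apply h2 (differentiableAt_const v)]
    simp
  have hs : IsSymmSndFDerivAt ℝ h x := (hh.contDiffAt hx').isSymmSndFDerivAt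
    (by rw [minSmoothness_of_isRCLikeNormedField]; exact WithTop.coe_le_coe.2 le_top)
  change fderiv ℝ (fun y => fderiv ℝ h y _) x _ = fderiv ℝ (fun y => fderiv ℝ h y _) x _
  rw [key, key, hs.eq]

theorem contDiffOn_foldr_pderiv (hO : IsOpen O) {h : EuclideanSpace ℝ (Fin n) → ℝ}
    (hh : ContDiffOn ℝ ∞ h O) (l : List (Fin n)) : ContDiffOn ℝ ∞ (l.foldr pderiv h) O := by
  induction l with
  | nil => exact hh
  | cons μ l ih => exact contDiffOn_pderiv hO ih μ

/-- `partialDeriv` chooses an order on the multi-index; on an open set of smoothness the order is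
irrelevant. This is the counterpart of `iterD_cons`. -/
theorem foldr_pderiv_perm (hO : IsOpen O) {h : EuclideanSpace ℝ (Fin n) → ℝ}
    (hh : ContDiffOn ℝ ∞ h O) {l l' : List (Fin n)} (hl : l.Perm l') :
    Set.EqOn (l.foldr pderiv h) (l'.foldr pderiv h) O := by
  induction hl with
  | nil => exact fun _ _ => rfl
  | cons μ _ ih => exact pderiv_eqOn hO ih μ
  | swap μ ν l => exact pderiv_comm hO (contDiffOn_foldr_pderiv hO hh l) ν μ
  | trans _ _ ih ih' => exact ih.trans ih'

theorem partialDeriv_eq (I : Multiset (Fin n)) (h : EuclideanSpace ℝ (Fin n) → ℝ) :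
    partialDeriv I h = I.toList.foldr pderiv h := rfl

theorem partialDeriv_zero (h : EuclideanSpace ℝ (Fin n) → ℝ) : partialDeriv 0 h = h := by
  rw [partialDeriv_eq, Multiset.toList_zero, List.foldr_nil]

theorem contDiffOn_partialDeriv (hO : IsOpen O) {h : EuclideanSpace ℝ (Fin n) → ℝ}
    (hh : ContDiffOn ℝ ∞ h O) (I : Multiset (Fin n)) : ContDiffOn ℝ ∞ (partialDeriv I h) O :=
  contDiffOn_foldr_pderiv hO hh _

theorem partialDeriv_cons (hO : IsOpen O) {h : EuclideanSpace ℝ (Fin n) → ℝ}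
    (hh : ContDiffOn ℝ ∞ h O) (μ : Fin n) (I : Multiset (Fin n)) :
    Set.EqOn (partialDeriv (μ ::ₘ I) h) (pderiv μ (partialDeriv I h)) O := by
  have hp : (μ ::ₘ I).toList.Perm (μ :: I.toList) := by
    rw [← Multiset.coe_eq_coe, Multiset.coe_toList, ← Multiset.cons_coe, Multiset.coe_toList]
  exact foldr_pderiv_perm hO hh hp

end PartialDerivatives

/-- A vector field of degree `(0,0)` which restricts to `∂_μ` along a family of points, on the
coordinates, does so on all local functions. -/
theorem evalAt_vectorField_of_base {n : ℕ} {X : Patch n} (hX : IsOpen X.dom) {Z : X.Fn →ₗ[ℝ] X.Fn}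
    (hZ : IsVF hX (0, 0) Z) {O : Set (EuclideanSpace ℝ (Fin n))} (hO : IsOpen O)
    {J : EuclideanSpace ℝ (Fin n) → BaseCoord n X.B → ℝ} (hJ : ∀ i, ContDiffOn ℝ ∞ (fun x => J x i) O)
    (hJm : ∀ x ∈ O, J x ∈ X.dom) (μ : Fin n) {x : EuclideanSpace ℝ (Fin n)} (hx : x ∈ O)
    (hb : ∀ i, evalAt (⟨J x, hJm x hx⟩ : X.dom) (Z (X.base i)) =
      algebraMap ℝ _ (GaugeQK.pderiv μ (fun x => J x i) x))
    (F : LocFun X.dom) {g : EuclideanSpace ℝ (Fin n) → ℝ}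
    (hg : ∀ y (hy : y ∈ O), F.1 ⟨J y, hJm y hy⟩ = g y) :
    evalAt (⟨J x, hJm x hx⟩ : X.dom) (Z (X.incl F)) = algebraMap ℝ _ (GaugeQK.pderiv μ g x) := by
  classical
  obtain ⟨s, k, hk, hF⟩ := F.2
  have hrep : IsRep s k F.1 := ⟨hk, hF⟩
  have hs : ∀ i ∉ s, pd hX i F = 0 := fun i hi => by
    ext p
    rw [pd_apply, IsRep.pdFun_eq hX hrep, dif_neg hi]
    rfl
  -- On `O` the function `g` is `k` composed with finitely many jet components, so both sides can be
  -- computed by the ordinary chain rule.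
  have hgk : Set.EqOn g (fun x => k fun i : s => J x i) O := fun y hy => by
    rw [← hg y hy, hF]
    rfl
  have hJ' : ∀ i : s, HasFDerivAt (fun x => J x i) (fderiv ℝ (fun x => J x i) x) x :=
    fun i => (((hJ i.1).contDiffAt (hO.mem_nhds hx)).differentiableAt (by simp)).hasFDerivAt
  have hkx : HasFDerivAt k (fderiv ℝ k fun i : s => J x i) fun i : s => J x i :=
    ((hk.contDiffAt ((isOpen_restr_image hX s).mem_nhds
      ⟨_, hJm x hx, rfl⟩)).differentiableAt (by simp)).hasFDerivAt
  have h1 := (hkx.comp x (hasFDerivAt_pi.2 hJ')).fderiv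
  have h2 : GaugeQK.pderiv μ g x = ∑ i : s, GaugeQK.pderiv μ (fun x => J x i) x *
      fderiv ℝ k (fun i : s => J x i) (Pi.single i 1) := by
    rw [pderiv_eqOn hO hgk μ hx, GaugeQK.pderiv]
    refine (congrArg (fun L => L (EuclideanSpace.single μ 1)) h1).trans ?_
    rw [ContinuousLinearMap.comp_apply]
    set v := (ContinuousLinearMap.pi fun i : s => fderiv ℝ (fun x => J x i) x)
      (EuclideanSpace.single μ 1) with hv
    have : v = ∑ i, v i • (Pi.single i 1 : s → ℝ) := by
      ext i
      simp [Pi.single_apply]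
    rw [this, map_sum]
    simp only [map_smul, smul_eq_mul]
    exact Finset.sum_congr rfl fun i _ => rfl
  rw [hZ.chain F s hs, map_sum, h2, map_sum, ← Finset.sum_coe_sort s]
  refine Finset.sum_congr rfl fun i _ => ?_
  rw [map_mul, hb, evalAt_incl, pd_apply, IsRep.pdFun_eq hX hrep, dif_pos i.2,
    ← Algebra.commutes, ← map_mul]
  rfl

section Jets

variable {n N r : ℕ} {U O : Set (EuclideanSpace ℝ (Fin n))} {V : Set (EuclideanSpace ℝ (Fin N))}

/-- The coordinates of the infinite jet of a map between Euclidean spaces. -/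
def jetOf (u : EuclideanSpace ℝ (Fin n) → EuclideanSpace ℝ (Fin N)) (x : EuclideanSpace ℝ (Fin n)) :
    BaseCoord n (Fin N) → ℝ
  | .x μ => x μ
  | .jet j I => partialDeriv I (fun y => u y j) x

variable {u : EuclideanSpace ℝ (Fin n) → EuclideanSpace ℝ (Fin N)}

theorem uPoint_jetOf (x : EuclideanSpace ℝ (Fin n)) : uPoint (jetOf u x) = u x := by
  ext j
  exact congrFun (partialDeriv_zero fun y => u y j) x

theorem jetOf_mem (hOU : O ⊆ U) (huV : ∀ x ∈ O, u x ∈ V) {x : EuclideanSpace ℝ (Fin n)} (hx : x ∈ O) :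
    jetOf u x ∈ (mappingPatch n N U V).dom := by
  refine ⟨hOU hx, ?_⟩
  rw [uPoint_jetOf]
  exact huV x hx

/-- The jet of a map, as a point of the patch. -/
def jetPt (hOU : O ⊆ U) (huV : ∀ x ∈ O, u x ∈ V) (x : O) : (mappingPatch n N U V).dom :=
  ⟨jetOf u x, jetOf_mem hOU huV x.2⟩

variable (hO : IsOpen O) (hu : ContDiffOn ℝ ∞ u O)
include hO hu

theorem contDiffOn_jetOf (i : BaseCoord n (Fin N)) : ContDiffOn ℝ ∞ (fun x => jetOf u x i) O := by
  cases i with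
  | x μ => exact (contDiff_euclidean.1 contDiff_id μ).contDiffOn
  | jet j I => exact contDiffOn_partialDeriv hO (contDiffOn_coord hu j) I

variable (hY : IsOpen (mappingPatch n N U V).dom) {D : Fin n → (mappingPatch n N U V).VectorField (0, 0)}
  (hD : IsTotalDerivative D) (hOU : O ⊆ U) (huV : ∀ x ∈ O, u x ∈ V)
include hD

theorem evalAt_D_base (μ : Fin n) (i : BaseCoord n (Fin N)) (x : O) :
    evalAt (jetPt hOU huV x) (D μ ((mappingPatch n N U V).base i)) =
      algebraMap ℝ _ (GaugeQK.pderiv μ (fun x => jetOf u x i) x) := by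
  cases i with
  | x ν =>
    refine (congrArg _ (hD.x μ ν)).trans ?_
    have : GaugeQK.pderiv μ (fun x => jetOf u x (.x ν)) x.1 = if μ = ν then 1 else 0 := by
      have h1 : HasFDerivAt (fun x : EuclideanSpace ℝ (Fin n) => x ν)
        (EuclideanSpace.proj ν : EuclideanSpace ℝ (Fin n) →L[ℝ] ℝ) x.1 :=
        (EuclideanSpace.proj ν : EuclideanSpace ℝ (Fin n) →L[ℝ] ℝ).hasFDerivAt
      change fderiv ℝ (fun x : EuclideanSpace ℝ (Fin n) => x ν) x.1 _ = _
      rw [h1.fderiv]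
      simp [eq_comm]
    rw [this]
    split_ifs
    · rw [map_one, map_one]
    · rw [map_zero, map_zero]
  | jet j I =>
    refine (congrArg _ (hD.base μ j I)).trans ((congrArg _ (base_eq _)).trans
      ((evalAt_incl _ _).trans (congrArg _ ?_)))
    exact partialDeriv_cons hO (contDiffOn_coord hu j) μ I x.2

include hY in
/-- Total derivatives restrict to derivatives along jets of maps. -/
theorem evalAt_D_jet {w : (mappingPatch n N U V).Fn} (hw : w ∈ (mappingPatch n N U V).homog 0)
    {g : EuclideanSpace ℝ (Fin n) → ℝ}
    (hg : ∀ x : O, evalAt (jetPt hOU huV x) w = algebraMap ℝ _ (g x)) (μ : Fin n) (x : O) :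
    evalAt (jetPt hOU huV x) (D μ w) = algebraMap ℝ _ (GaugeQK.pderiv μ g x) := by
  obtain ⟨F, rfl⟩ := exists_incl_of_mem_homog_zero (X := mappingPatch n N U V) (fun _ => zero_lt_one) w hw
  exact evalAt_vectorField_of_base hY ((D μ).isVF hY) hO (contDiffOn_jetOf hO hu)
    (fun x hx => jetOf_mem hOU huV hx) μ x.2 (fun i => evalAt_D_base hO hu hD hOU huV μ i x) F
    fun y hy => algebraMap_gsym_injective ((evalAt_incl _ _).symm.trans (hg ⟨y, hy⟩))

include hY in
theorem evalAt_iterD_jet {w : (mappingPatch n N U V).Fn} (hw : w ∈ (mappingPatch n N U V).homog 0)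
    {g : EuclideanSpace ℝ (Fin n) → ℝ} (hgs : ContDiffOn ℝ ∞ g O)
    (hg : ∀ x : O, evalAt (jetPt hOU huV x) w = algebraMap ℝ _ (g x)) (I : Multiset (Fin n)) (x : O) :
    evalAt (jetPt hOU huV x) (iterD D I w) = algebraMap ℝ _ (partialDeriv I g x) := by
  induction I using Multiset.induction_on generalizing x with
  | empty => rw [iterD_zero, partialDeriv_zero, hg]
  | cons μ I ih =>
    rw [iterD_cons hY hD, evalAt_D_jet hO hu hY hD hOU huV (iterD_mem hY hD I hw) ih,
      partialDeriv_cons hO hgs μ I x.2]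

variable {𝔏 : Type*} {comp : 𝔏 → Fin r → EuclideanSpace ℝ (Fin n) → ℝ}
  {vert : Fin r → Fin N → EuclideanSpace ℝ (Fin N) → ℝ} {f : Fin r → Fin r → Fin r → ℝ}
  {cf : Fin r → Fin N → EuclideanSpace ℝ (Fin N) → ℝ}
  {S : (universalPatch r n U).Operators 𝔏} {S' : (mappingPatch n N U V).Operators 𝔏}
  {Φ : (universalPatch r n U).Fn →ₐ[ℝ] (mappingPatch n N U V).Fn}

omit hD in
/-- The morphism of jet spaces covered by the Weil homomorphism maps the jet of `u` to the jet of the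
pullback of the connection form. -/
theorem IsWeilHom.covers_jet (hX : IsOpen (universalPatch r n U).dom)
    (hY : IsOpen (mappingPatch n N U V).dom) (hOU : O ⊆ U) (huV : ∀ x ∈ O, u x ∈ V)
    (hcf : ∀ a j, ContDiffOn ℝ ∞ (cf a j) V)
    (hS : IsUniversalStructure f comp S) (hS' : IsCanonicalStructure comp vert S')
    (h : IsWeilHom f cf S S' Φ) {τ : (mappingPatch n N U V).dom → (universalPatch r n U).dom}
    (hτ : Covers Φ τ) {g : Fin r → Fin n → EuclideanSpace ℝ (Fin n) → ℝ}
    (hg : ∀ a μ, ∀ x ∈ O, g a μ x = ∑ j, cf a j (u x) * GaugeQK.pderiv μ (fun y => u y j) x) (x : O)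
    (a : Fin r) (μ : Fin n) (I : Multiset (Fin n)) :
    (τ (jetPt hOU huV x)).1 (.jet (a, μ) I) = partialDeriv I (g a μ) x := by
  have hgs : ContDiffOn ℝ ∞ (g a μ) O := by
    refine ContDiffOn.congr (f := fun x => ∑ j, cf a j (u x) * GaugeQK.pderiv μ (fun y => u y j) x)
      ?_ (hg a μ)
    exact ContDiffOn.sum fun j _ => ((hcf a j).comp hu huV).mul
      (contDiffOn_pderiv hO (contDiffOn_coord hu j) μ)
  have h1 : ∀ x : O, evalAt (jetPt hOU huV x) (horComp n U V cf μ a) = algebraMap ℝ _ (g a μ x) := by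
    intro x
    rw [horComp, map_sum, hg a μ x x.2, map_sum]
    refine Finset.sum_congr rfl fun j _ => ?_
    rw [map_mul, map_mul, evalAt_uFun (hcf a j), ← hS'.total.uCoord]
    refine congrArg₂ _ (congrArg _ (congrArg _ (uPoint_jetOf (u := u) x.1))) ?_
    refine (evalAt_D_base hO hu hS'.total hOU huV μ (.jet j 0) x).trans (congrArg _ ?_)
    exact pderiv_eqOn hO (fun x _ => congrFun (partialDeriv_zero fun y => u y j) x) μ x.2
  obtain ⟨t, ht, h2⟩ := hτ.base (.jet (a, μ) I)
  -- The homomorphism commutes with total derivatives, so a jet of `A_μ` goes to `D_I` of the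
  -- component of `A_h`. Along the jet of a map this becomes `∂_I` of the pulled back coefficient.
  have h3 : Φ ((universalPatch r n U).base (.jet (a, μ) I)) = iterD S'.D I (horComp n U V cf μ a) := by
    have e := base_jet_eq (X := universalPatch r n U) hX hS.total (a, μ) I
    refine (congrArg Φ e).trans ?_
    refine (map_iterD hX hY hS.total hS'.total (f := Φ.toLinearMap) h.total I _).trans ?_
    exact congrArg _ (h.conn_eq hY μ a)
  have h4 := evalAt_iterD_jet hO hu hY hS'.total hOU huV (horComp_mem μ a) hgs h1 I x
  rw [← h3, h2, evalAt_incl] at h4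
  rw [← ht, algebraMap_gsym_injective h4]

end Jets

end

section

open VectorField

/-! ## Calculus of related vector fields -/

section Calculus

open Filter Topology

variable {E F W : Type*} [NormedAddCommGroup E] [NormedSpace ℝ E] [NormedAddCommGroup F]
  [NormedSpace ℝ F] [NormedAddCommGroup W] [NormedSpace ℝ W]

theorem minSmoothness_le_infty (k : ℕ) : minSmoothness ℝ k ≤ ∞ := by
  rw [minSmoothness_of_isRCLikeNormedField]
  exact WithTop.coe_le_coe.2 le_top

/-- The Lie bracket is compatible with related vector fields. -/
theorem fderiv_apply_lieBracket_of_related {σ : F → E} {X Y : F → F} {Z Z' : E → E} {h : F}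
    (hσ : ContDiffAt ℝ ∞ σ h) (hX : DifferentiableAt ℝ X h) (hY : DifferentiableAt ℝ Y h)
    (hZ : DifferentiableAt ℝ Z (σ h)) (hZ' : DifferentiableAt ℝ Z' (σ h))
    (hXZ : ∀ᶠ x in 𝓝 h, fderiv ℝ σ x (X x) = Z (σ x))
    (hYZ : ∀ᶠ x in 𝓝 h, fderiv ℝ σ x (Y x) = Z' (σ x)) :
    fderiv ℝ σ h (lieBracket ℝ X Y h) = lieBracket ℝ Z Z' (σ h) := by
  have hd : DifferentiableAt ℝ σ h := hσ.differentiableAt (by simp)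
  rw [fderiv_apply_lieBracket hσ (minSmoothness_le_infty 2) hY hX, EventuallyEq.fderiv_eq hXZ,
    EventuallyEq.fderiv_eq hYZ]
  change fderiv ℝ (Z' ∘ σ) h (X h) - fderiv ℝ (Z ∘ σ) h (Y h) = _
  rw [fderiv_comp _ hZ' hd, fderiv_comp _ hZ hd, ContinuousLinearMap.comp_apply,
    ContinuousLinearMap.comp_apply, hXZ.self_of_nhds, hYZ.self_of_nhds]
  rfl

/-- Let `α` be a form with values in `W`, and `a` a local action. The exterior derivative of `α`
vanishes on a fundamental vector of the action on which `α` is constant, together with a vector `w`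
whose translates are killed by `α`. -/
theorem fderiv_form_symm_of_ker {a : E × F → E} {α : E → E →L[ℝ] W} {y w : E} {h η : F} {ξ : W}
    (ha : ContDiffAt ℝ ∞ a (y, h)) (hα : DifferentiableAt ℝ α y)
    (ha0 : ∀ᶠ z in 𝓝 y, a (z, h) = z)
    (hker : ∀ᶠ x in 𝓝 h, α (a (y, x)) (fderiv ℝ a (y, x) (w, 0)) = 0)
    (hconst : ∀ᶠ z in 𝓝 y, α z (fderiv ℝ a (z, h) (0, η)) = ξ) :
    fderiv ℝ α y (fderiv ℝ a (y, h) (0, η)) w = fderiv ℝ α y w (fderiv ℝ a (y, h) (0, η)) := by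
  have hd : HasFDerivAt a (fderiv ℝ a (y, h)) (y, h) := (ha.differentiableAt (by simp)).hasFDerivAt
  have hd2 : HasFDerivAt (fderiv ℝ a) (fderiv ℝ (fderiv ℝ a) (y, h)) (y, h) :=
    ((ha.fderiv_right (m := ∞) (by simp)).differentiableAt (by simp)).hasFDerivAt
  have hs : IsSymmSndFDerivAt ℝ a (y, h) := ha.isSymmSndFDerivAt (minSmoothness_le_infty 2)
  have hay : a (y, h) = y := ha0.self_of_nhds
  have hl : HasFDerivAt (fun z : E => (z, h)) (ContinuousLinearMap.inl ℝ E F) y :=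
    hasFDerivAt_prodMk_left y h
  have hr : HasFDerivAt (fun x : F => (y, x)) (ContinuousLinearMap.inr ℝ E F) h :=
    hasFDerivAt_prodMk_right y h
  -- At the parameter `h` the local action is the identity near `y`.
  have hw : fderiv ℝ a (y, h) (w, 0) = w := by
    have h1 := (hd.comp y hl).congr_of_eventuallyEq (f₁ := fun z => z)
      (ha0.mono fun z hz => hz.symm)
    have h2 := h1.unique (hasFDerivAt_id y)
    simpa using congrArg (fun L => L w) h2
  have hα' : HasFDerivAt α (fderiv ℝ α y) (a (y, h)) := by
    rw [hay]
    exact hα.hasFDerivAt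
  -- Differentiating `hker` in the group direction `η` gives `dα(v)(w)` plus `α` of a mixed second
  -- derivative of `a`, where `v` is the fundamental vector.
  have e1 := ((hα'.comp h (hd.comp h hr)).clm_apply
    ((hd2.comp h hr).clm_apply (hasFDerivAt_const (w, (0 : F)) h))).congr_of_eventuallyEq
    (f₁ := fun _ => (0 : W)) (hker.mono fun z hz => hz.symm)
  have e1' := congrArg (fun L => L η) (e1.unique (hasFDerivAt_const (0 : W) h))
  -- Differentiating `hconst` in the direction `w` gives `dα(w)(v)` plus `α` of the mixed second
  -- derivative in the other order. The symmetry `hs` identifies the two.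
  have e2 := (hα.hasFDerivAt.clm_apply
    ((hd2.comp y hl).clm_apply (hasFDerivAt_const ((0 : E), η) y))).congr_of_eventuallyEq
    (f₁ := fun _ => ξ) (hconst.mono fun z hz => hz.symm)
  have e2' := congrArg (fun L => L w) (e2.unique (hasFDerivAt_const ξ y))
  simp [hw, hay] at e1' e2'
  rw [hs (0, η) (w, 0)] at e1'
  rw [← add_right_inj, e1', e2']

end Calculus

end

section

open Filter Topology

/-! ## Charts -/

section Charts

variable {E : Type*} [NormedAddCommGroup E] [NormedSpace ℝ E] {Q : Type*} [TopologicalSpace Q]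
  [ChartedSpace E Q] {k : OpenPartialHomeomorph Q E}
  (hk : k ∈ IsManifold.maximalAtlas 𝓘(ℝ, E) ∞ Q)
include hk

theorem mdifferentiable_of_mem_maximalAtlas : k.MDifferentiable 𝓘(ℝ, E) 𝓘(ℝ, E) :=
  ⟨(contMDiffOn_of_mem_maximalAtlas hk).mdifferentiableOn (by simp),
    (contMDiffOn_symm_of_mem_maximalAtlas hk).mdifferentiableOn (by simp)⟩

theorem mfderiv_symm_mfderiv {p : Q} (hp : p ∈ k.source) (v : TangentSpace 𝓘(ℝ, E) p) :
    mfderiv 𝓘(ℝ, E) 𝓘(ℝ, E) k.symm (k p) (mfderiv 𝓘(ℝ, E) 𝓘(ℝ, E) k p v) = v :=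
  congrArg (fun L => L v) ((mdifferentiable_of_mem_maximalAtlas hk).symm_comp_deriv hp)

end Charts

section LocalBundle

variable {EG : Type*} [NormedAddCommGroup EG] [NormedSpace ℝ EG]
  {G : Type*} [TopologicalSpace G] [ChartedSpace EG G] [Group G]
  {ES : Type*} [NormedAddCommGroup ES] [NormedSpace ℝ ES]
  {Sg : Type*} [TopologicalSpace Sg] [ChartedSpace ES Sg]
  {N : ℕ} {P : Type*} [TopologicalSpace P] [ChartedSpace (EuclideanSpace ℝ (Fin N)) P]
  [IsManifold 𝓘(ℝ, EuclideanSpace ℝ (Fin N)) ∞ P]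
  (B : PrincipalBundle (EG := EG) (ES := ES) (N := N) G P Sg) (A : Connection B)
  (k : OpenPartialHomeomorph P (EuclideanSpace ℝ (Fin N)))

/-- A connection form in a chart. -/
def localForm {B : PrincipalBundle (EG := EG) (ES := ES) (N := N) G P Sg} (A : Connection B)
    (y : EuclideanSpace ℝ (Fin N)) : EuclideanSpace ℝ (Fin N) →L[ℝ] EG :=
  (A.form (k.symm y)).comp
    (mfderiv 𝓘(ℝ, EuclideanSpace ℝ (Fin N)) 𝓘(ℝ, EuclideanSpace ℝ (Fin N)) k.symm y)

/-- A fundamental vector field in a chart. -/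
def vertField (ξ : EG) (y : EuclideanSpace ℝ (Fin N)) : EuclideanSpace ℝ (Fin N) :=
  mfderiv 𝓘(ℝ, EuclideanSpace ℝ (Fin N)) 𝓘(ℝ, EuclideanSpace ℝ (Fin N)) k (k.symm y)
    (B.fundamental (k.symm y) ξ)

/-- The action, in a chart of the bundle and the preferred chart at `1` of the group. -/
def localAct (q : EuclideanSpace ℝ (Fin N) × EG) : EuclideanSpace ℝ (Fin N) :=
  k (B.act (k.symm q.1) ((extChartAt 𝓘(ℝ, EG) (1 : G)).symm q.2))

variable {B k}

omit [IsManifold (𝓡 N) ∞ P] in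
theorem PrincipalBundle.mdifferentiable_act (p : P) : MDifferentiable 𝓘(ℝ, EG)
    𝓘(ℝ, EuclideanSpace ℝ (Fin N)) (fun g : G => B.act p g) :=
  (B.contMDiff_act.comp (contMDiff_const.prodMk contMDiff_id)).mdifferentiable (by simp)

omit [IsManifold (𝓡 N) ∞ P] in
theorem PrincipalBundle.mdifferentiable_act_right (g : G) :
    MDifferentiable 𝓘(ℝ, EuclideanSpace ℝ (Fin N)) 𝓘(ℝ, EuclideanSpace ℝ (Fin N))
    (fun p : P => B.act p g) :=
  (B.contMDiff_act.comp (contMDiff_id.prodMk contMDiff_const)).mdifferentiable (by simp)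

variable [LieGroup 𝓘(ℝ, EG) ∞ G]
  (hk : k ∈ IsManifold.maximalAtlas 𝓘(ℝ, EuclideanSpace ℝ (Fin N)) ∞ P)
include hk

omit [IsManifold (𝓡 N) ∞ P] in
theorem contDiffAt_localAct {y : EuclideanSpace ℝ (Fin N)} (hy : y ∈ k.target) {h : EG}
    (hh : h ∈ (extChartAt 𝓘(ℝ, EG) (1 : G)).target)
    (hp : B.act (k.symm y) ((extChartAt 𝓘(ℝ, EG) (1 : G)).symm h) ∈ k.source) :
    ContDiffAt ℝ ∞ (localAct B k) (y, h) := by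
  rw [← contMDiffAt_iff_contDiffAt]
  have h1 : ContMDiffAt 𝓘(ℝ, EuclideanSpace ℝ (Fin N) × EG)
      𝓘(ℝ, EuclideanSpace ℝ (Fin N)) ∞
      (fun q : EuclideanSpace ℝ (Fin N) × EG => k.symm q.1) (y, h) :=
    (contMDiffAt_symm_of_mem_maximalAtlas hk hy).comp (y, h) contDiffAt_fst.contMDiffAt
  have h2 : ContMDiffAt 𝓘(ℝ, EuclideanSpace ℝ (Fin N) × EG) 𝓘(ℝ, EG) ∞
      (fun q : EuclideanSpace ℝ (Fin N) × EG => (extChartAt 𝓘(ℝ, EG) (1 : G)).symm q.2) (y, h) :=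
    ((contMDiffOn_extChartAt_symm (1 : G)).contMDiffAt
      ((isOpen_extChartAt_target (1 : G)).mem_nhds hh)).comp (y, h) contDiffAt_snd.contMDiffAt
  exact (contMDiffAt_of_mem_maximalAtlas hk hp).comp (y, h)
    (B.contMDiff_act.contMDiffAt.comp (y, h) (h1.prodMk h2))

omit [IsManifold (𝓡 N) ∞ P] in
theorem fderiv_localAct_left {y : EuclideanSpace ℝ (Fin N)} (hy : y ∈ k.target) {h : EG}
    (hh : h ∈ (extChartAt 𝓘(ℝ, EG) (1 : G)).target)
    (hp : B.act (k.symm y) ((extChartAt 𝓘(ℝ, EG) (1 : G)).symm h) ∈ k.source)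
    (w : EuclideanSpace ℝ (Fin N)) :
    fderiv ℝ (localAct B k) (y, h) (w, 0) =
      mfderiv 𝓘(ℝ, EuclideanSpace ℝ (Fin N)) 𝓘(ℝ, EuclideanSpace ℝ (Fin N)) k
        (B.act (k.symm y) ((extChartAt 𝓘(ℝ, EG) (1 : G)).symm h))
        (mfderiv 𝓘(ℝ, EuclideanSpace ℝ (Fin N)) 𝓘(ℝ, EuclideanSpace ℝ (Fin N))
          (fun q => B.act q ((extChartAt 𝓘(ℝ, EG) (1 : G)).symm h)) (k.symm y)
          (mfderiv 𝓘(ℝ, EuclideanSpace ℝ (Fin N)) 𝓘(ℝ, EuclideanSpace ℝ (Fin N)) k.symm y w)) := by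
  have hd := ((contDiffAt_localAct (B := B) hk hy hh hp).differentiableAt (by simp)).hasFDerivAt
  have h1 := (hd.comp y (hasFDerivAt_prodMk_left (𝕜 := ℝ) y h)).fderiv
  have h2 := congrArg (fun L => L w) h1
  refine Eq.trans (by simp) (h2.symm.trans ?_)
  rw [← mfderiv_eq_fderiv]
  set g := (extChartAt 𝓘(ℝ, EG) (1 : G)).symm h
  have hs := (mdifferentiable_of_mem_maximalAtlas hk).mdifferentiableAt_symm hy
  have hg := B.mdifferentiable_act_right g (k.symm y)
  refine (mfderiv_comp_apply (g := k) (f := fun y => B.act (k.symm y) g) y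
    ((mdifferentiable_of_mem_maximalAtlas hk).mdifferentiableAt hp) (hg.comp y hs) w).trans ?_
  exact congrArg _ (mfderiv_comp_apply (g := fun q => B.act q g) (f := k.symm) y hg hs w)

omit [IsManifold (𝓡 N) ∞ P] in
theorem fderiv_localAct_right {y : EuclideanSpace ℝ (Fin N)} (hy : y ∈ k.target) {h : EG}
    (hh : h ∈ (extChartAt 𝓘(ℝ, EG) (1 : G)).target)
    (hp : B.act (k.symm y) ((extChartAt 𝓘(ℝ, EG) (1 : G)).symm h) ∈ k.source) (η : EG) :
    fderiv ℝ (localAct B k) (y, h) (0, η) =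
      mfderiv 𝓘(ℝ, EuclideanSpace ℝ (Fin N)) 𝓘(ℝ, EuclideanSpace ℝ (Fin N)) k
        (B.act (k.symm y) ((extChartAt 𝓘(ℝ, EG) (1 : G)).symm h))
        (mfderiv 𝓘(ℝ, EG) 𝓘(ℝ, EuclideanSpace ℝ (Fin N)) (fun g => B.act (k.symm y) g)
          ((extChartAt 𝓘(ℝ, EG) (1 : G)).symm h)
          (mfderiv 𝓘(ℝ, EG) 𝓘(ℝ, EG) (extChartAt 𝓘(ℝ, EG) (1 : G)).symm h η)) := by
  have hd := ((contDiffAt_localAct (B := B) hk hy hh hp).differentiableAt (by simp)).hasFDerivAt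
  have h1 := (hd.comp h (hasFDerivAt_prodMk_right (𝕜 := ℝ) y h)).fderiv
  have h2 := congrArg (fun L => L η) h1
  refine Eq.trans (by simp) (h2.symm.trans ?_)
  rw [← mfderiv_eq_fderiv]
  have hs : MDifferentiableAt 𝓘(ℝ, EG) 𝓘(ℝ, EG) (extChartAt 𝓘(ℝ, EG) (1 : G)).symm h :=
    ((contMDiffOn_extChartAt_symm (n := ∞) (1 : G)).contMDiffAt
      ((isOpen_extChartAt_target (1 : G)).mem_nhds hh)).mdifferentiableAt (by simp)
  have hg := B.mdifferentiable_act (k.symm y) ((extChartAt 𝓘(ℝ, EG) (1 : G)).symm h)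
  refine (mfderiv_comp_apply (g := k)
    (f := fun h => B.act (k.symm y) ((extChartAt 𝓘(ℝ, EG) (1 : G)).symm h)) h
    ((mdifferentiable_of_mem_maximalAtlas hk).mdifferentiableAt hp) (hg.comp h hs) η).trans ?_
  exact congrArg _ (mfderiv_comp_apply (g := fun g => B.act (k.symm y) g)
    (f := (extChartAt 𝓘(ℝ, EG) (1 : G)).symm) h hg hs η)

end LocalBundle

end

/-! ### Connection forms and fundamental vector fields in a chart -/

section

open Filter Topology VectorField

section LocalBundle

variable {EG : Type*} [NormedAddCommGroup EG] [NormedSpace ℝ EG]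
  {G : Type*} [TopologicalSpace G] [ChartedSpace EG G] [Group G]
  {ES : Type*} [NormedAddCommGroup ES] [NormedSpace ℝ ES]
  {Sg : Type*} [TopologicalSpace Sg] [ChartedSpace ES Sg]
  {N : ℕ} {P : Type*} [TopologicalSpace P] [ChartedSpace (EuclideanSpace ℝ (Fin N)) P]
  [IsManifold 𝓘(ℝ, EuclideanSpace ℝ (Fin N)) ∞ P]
  {B : PrincipalBundle (EG := EG) (ES := ES) (N := N) G P Sg} (A : Connection B)
  {k : OpenPartialHomeomorph P (EuclideanSpace ℝ (Fin N))}

variable (G) in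
theorem extChartAt_symm_one :
    (extChartAt 𝓘(ℝ, EG) (1 : G)).symm (extChartAt 𝓘(ℝ, EG) (1 : G) 1) = 1 :=
  extChartAt_to_inv 1

omit [IsManifold 𝓘(ℝ, EuclideanSpace ℝ (Fin N)) ∞ P] in
theorem act_chart_one (p : P) :
    B.act p ((extChartAt 𝓘(ℝ, EG) (1 : G)).symm (extChartAt 𝓘(ℝ, EG) (1 : G) 1)) = p := by
  rw [extChartAt_symm_one, B.act_one]

variable {y : EuclideanSpace ℝ (Fin N)} (hy : y ∈ k.target)
include hy

omit [IsManifold 𝓘(ℝ, EuclideanSpace ℝ (Fin N)) ∞ P] in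
theorem act_chart_one_mem : B.act (k.symm y)
    ((extChartAt 𝓘(ℝ, EG) (1 : G)).symm (extChartAt 𝓘(ℝ, EG) (1 : G) 1)) ∈ k.source := by
  rw [act_chart_one]
  exact k.map_target hy

omit [IsManifold 𝓘(ℝ, EuclideanSpace ℝ (Fin N)) ∞ P] in
theorem localAct_one : localAct B k (y, extChartAt 𝓘(ℝ, EG) (1 : G) 1) = y := by
  rw [localAct, act_chart_one]
  exact k.right_inv hy

variable (hk : k ∈ IsManifold.maximalAtlas 𝓘(ℝ, EuclideanSpace ℝ (Fin N)) ∞ P)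
include hk

theorem localForm_vertField (ξ : EG) : localForm k A y (vertField B k ξ y) = ξ := by
  have h1 := mfderiv_symm_mfderiv hk (k.map_target hy) (B.fundamental (k.symm y) ξ)
  rw [k.right_inv hy] at h1
  exact (congrArg (A.form (k.symm y)) h1).trans (A.form_fundamental _ _)

/-- The form is smooth as a function on the tangent bundle. It is composed with the tangent map of
`k.symm` applied to constant vector fields; in finite dimension smoothness on each constant vector
gives smoothness as a map into linear maps. -/
theorem contDiffAt_localForm : ContDiffAt ℝ ∞ (localForm k A) y := by
  have h0 : ContDiffOn ℝ ∞ (localForm k A) k.target := by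
    rw [contDiffOn_clm_apply]
    intro w
    have h1 := (contMDiffOn_symm_of_mem_maximalAtlas hk).contMDiffOn_tangentMapWithin (m := ∞)
      (by simp) k.open_target.uniqueMDiffOn
    have h2 : ContMDiffOn 𝓘(ℝ, EuclideanSpace ℝ (Fin N)) 𝓘(ℝ, EuclideanSpace ℝ (Fin N)).tangent ∞
        (fun y => (⟨y, w⟩ : TangentBundle 𝓘(ℝ, EuclideanSpace ℝ (Fin N)) (EuclideanSpace ℝ (Fin N))))
        k.target := (contMDiffOn_vectorSpace_iff_contDiffOn (V := fun _ => w)).2 contDiffOn_const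
    rw [← contMDiffOn_iff_contDiffOn]
    refine ((A.contMDiff_form.comp_contMDiffOn (h1.comp h2 fun y hy => hy))).congr fun y hy => ?_
    change A.form _ (mfderiv _ _ k.symm y w) = A.form _ (mfderivWithin _ _ k.symm k.target y w)
    rw [mfderivWithin_of_isOpen k.open_target hy]
  exact h0.contDiffAt (k.open_target.mem_nhds hy)

variable [LieGroup 𝓘(ℝ, EG) ∞ G]

/-- Equivariance of the connection, in charts. Its consequence needed later is that the translates
of a horizontal vector stay in the kernel of the form. -/
theorem localForm_fderiv_localAct {h : EG} (hh : h ∈ (extChartAt 𝓘(ℝ, EG) (1 : G)).target)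
    (hp : B.act (k.symm y) ((extChartAt 𝓘(ℝ, EG) (1 : G)).symm h) ∈ k.source)
    (w : EuclideanSpace ℝ (Fin N)) :
    localForm k A (localAct B k (y, h)) (fderiv ℝ (localAct B k) (y, h) (w, 0)) =
      adjoint ((extChartAt 𝓘(ℝ, EG) (1 : G)).symm h)⁻¹ (localForm k A y w) := by
  set g := (extChartAt 𝓘(ℝ, EG) (1 : G)).symm h with hg
  rw [fderiv_localAct_left hk hy hh hp]
  have h1 := mfderiv_symm_mfderiv hk hp
    (mfderiv 𝓘(ℝ, EuclideanSpace ℝ (Fin N)) 𝓘(ℝ, EuclideanSpace ℝ (Fin N))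
          (fun q => B.act q g) (k.symm y)
          (mfderiv 𝓘(ℝ, EuclideanSpace ℝ (Fin N)) 𝓘(ℝ, EuclideanSpace ℝ (Fin N)) k.symm y w))
  -- The base point `k.symm (k p)` equals `p` only propositionally, while `A.form` depends on it;
  -- the vector is kept in the model space to allow the rewriting.
  have h2 : ∀ q : P, q = B.act (k.symm y) g → ∀ v : EuclideanSpace ℝ (Fin N),
      A.form q v = A.form (B.act (k.symm y) g) v := fun q hq v => by rw [hq]
  refine (h2 _ (k.left_inv hp) _).trans ?_
  refine (congrArg (A.form (B.act (k.symm y) g)) h1).trans ?_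
  exact A.equivariant _ _ _

omit [IsManifold 𝓘(ℝ, EuclideanSpace ℝ (Fin N)) ∞ P] in
theorem fderiv_localAct_one (ξ : EG) :
    fderiv ℝ (localAct B k) (y, extChartAt 𝓘(ℝ, EG) (1 : G) 1) (0, ξ) = vertField B k ξ y := by
  rw [fderiv_localAct_right hk hy (mem_extChartAt_target (1 : G)) (act_chart_one_mem hy)]
  have h1 : mfderiv 𝓘(ℝ, EG) 𝓘(ℝ, EG) (extChartAt 𝓘(ℝ, EG) (1 : G)).symm
      (extChartAt 𝓘(ℝ, EG) (1 : G) 1) ξ = ξ := by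
    have := mfderivWithin_range_extChartAt_symm (I := 𝓘(ℝ, EG)) (x := (1 : G))
    rw [modelWithCornersSelf_coe, Set.range_id, mfderivWithin_univ] at this
    exact congrArg (fun L => L ξ) this
  have h2 : ∀ q : P, ∀ g : G, q = k.symm y → g = 1 →
      mfderiv 𝓘(ℝ, EuclideanSpace ℝ (Fin N)) 𝓘(ℝ, EuclideanSpace ℝ (Fin N)) k q
        (mfderiv 𝓘(ℝ, EG) 𝓘(ℝ, EuclideanSpace ℝ (Fin N)) (fun g => B.act (k.symm y) g) g ξ) =
      vertField B k ξ y := by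
    rintro q g rfl rfl
    rfl
  exact (congrArg _ (congrArg _ h1)).trans (h2 _ _ (act_chart_one _) (extChartAt_symm_one G))

omit [IsManifold 𝓘(ℝ, EuclideanSpace ℝ (Fin N)) ∞ P] in
-- A fundamental field is a partial derivative of the smooth local action in the group variable at
-- `1`.
theorem contDiffAt_vertField (ξ : EG) : ContDiffAt ℝ ∞ (vertField B k ξ) y := by
  have h1 : ContDiffAt ℝ ∞ (fun z => fderiv ℝ (localAct B k)
      (z, extChartAt 𝓘(ℝ, EG) (1 : G) 1) (0, ξ)) y := by
    have h2 := (contDiffAt_localAct (B := B) hk hy (mem_extChartAt_target (1 : G))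
      (act_chart_one_mem hy)).fderiv_right (m := ∞) (by simp)
    exact (h2.comp (f := fun z => (z, extChartAt 𝓘(ℝ, EG) (1 : G) 1)) y
      (contDiffAt_id.prodMk contDiffAt_const)).clm_apply contDiffAt_const
  refine h1.congr_of_eventuallyEq ?_
  filter_upwards [k.open_target.mem_nhds hy] with z hz
  exact (fderiv_localAct_one hz hk ξ).symm

omit [IsManifold 𝓘(ℝ, EuclideanSpace ℝ (Fin N)) ∞ P] [LieGroup 𝓘(ℝ, EG) ∞ G] hk in
theorem eventually_act_mem : ∀ᶠ h in 𝓝 (extChartAt 𝓘(ℝ, EG) (1 : G) 1),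
    h ∈ (extChartAt 𝓘(ℝ, EG) (1 : G)).target ∧
      B.act (k.symm y) ((extChartAt 𝓘(ℝ, EG) (1 : G)).symm h) ∈ k.source := by
  have h1 : ContinuousAt (fun h => B.act (k.symm y) ((extChartAt 𝓘(ℝ, EG) (1 : G)).symm h))
      (extChartAt 𝓘(ℝ, EG) (1 : G) 1) :=
    (B.mdifferentiable_act (k.symm y)).continuous.continuousAt.comp
      (continuousAt_extChartAt_symm (1 : G))
  filter_upwards [(isOpen_extChartAt_target (1 : G)).mem_nhds (mem_extChartAt_target (1 : G)),
    h1.preimage_mem_nhds (k.open_source.mem_nhds (act_chart_one_mem hy))] with h h2 h3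
  exact ⟨h2, h3⟩

end LocalBundle

end

/-! ### Brackets of fundamental vector fields and horizontality of the curvature -/

section

open Filter Topology VectorField

section LocalBundle

variable {EG : Type*} [NormedAddCommGroup EG] [NormedSpace ℝ EG] [CompleteSpace EG]
  {G : Type*} [TopologicalSpace G] [ChartedSpace EG G] [Group G] [LieGroup 𝓘(ℝ, EG) ∞ G]
  {ES : Type*} [NormedAddCommGroup ES] [NormedSpace ℝ ES]
  {Sg : Type*} [TopologicalSpace Sg] [ChartedSpace ES Sg]
  {N : ℕ} {P : Type*} [TopologicalSpace P] [ChartedSpace (EuclideanSpace ℝ (Fin N)) P]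
  [IsManifold 𝓘(ℝ, EuclideanSpace ℝ (Fin N)) ∞ P]
  {B : PrincipalBundle (EG := EG) (ES := ES) (N := N) G P Sg} (A : Connection B)
  {k : OpenPartialHomeomorph P (EuclideanSpace ℝ (Fin N))}

variable (EG G) in
omit [CompleteSpace EG] in
theorem lieGroup_minSmoothness (j : ℕ) : LieGroup 𝓘(ℝ, EG) (minSmoothness ℝ j) G :=
  LieGroup.of_le (n := ∞) (minSmoothness_le_infty j)

variable (G) in
/-- A left invariant vector field in the preferred chart at `1`. -/
def leftField (ξ : EG) (h : EG) : EG :=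
  mpullbackWithin 𝓘(ℝ, EG) 𝓘(ℝ, EG) (extChartAt 𝓘(ℝ, EG) (1 : G)).symm
    (mulInvariantVectorField (I := 𝓘(ℝ, EG)) (G := G) ξ) (Set.range 𝓘(ℝ, EG)) h

theorem differentiableAt_leftField (ξ : EG) :
    DifferentiableAt ℝ (leftField G ξ) (extChartAt 𝓘(ℝ, EG) (1 : G) 1) := by
  have : LieGroup 𝓘(ℝ, EG) (minSmoothness ℝ 3) G := lieGroup_minSmoothness EG G 3
  have h1 := (mdifferentiableAt_mulInvariantVectorField (I := 𝓘(ℝ, EG)) (G := G)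
    ξ (g := 1)).mdifferentiableWithinAt (s := Set.univ)
  have h2 := h1.differentiableWithinAt_mpullbackWithin_vectorField
  have hs : (extChartAt 𝓘(ℝ, EG) (1 : G)).symm ⁻¹' Set.univ ∩ Set.range 𝓘(ℝ, EG) = Set.univ := by simp
  rw [hs] at h2
  exact differentiableWithinAt_univ.1 h2

omit [CompleteSpace EG] in
-- The bracket on `T_1 G` is that of left invariant fields at `1`. The derivative of the preferred
-- chart at its base point is the identity, so it can be computed in that chart without correction.
theorem lieBr_eq (ξ η : EG) : lieBr G ξ η =
    lieBracket ℝ (leftField G ξ) (leftField G η) (extChartAt 𝓘(ℝ, EG) (1 : G) 1) := by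
  have h := mlieBracketWithin_apply (I := 𝓘(ℝ, EG)) (s := Set.univ) (x₀ := (1 : G))
    (V := mulInvariantVectorField (I := 𝓘(ℝ, EG)) (G := G) ξ)
    (W := mulInvariantVectorField (I := 𝓘(ℝ, EG)) (G := G) η)
  rw [mlieBracketWithin_univ, mfderiv_extChartAt_self] at h
  have hs : (extChartAt 𝓘(ℝ, EG) (1 : G)).symm ⁻¹' Set.univ ∩ Set.range 𝓘(ℝ, EG) = Set.univ := by simp
  have hi : ∀ v : EG, (ContinuousLinearMap.id ℝ EG).inverse v = v := by simp
  refine h.trans ((hi _).trans ?_)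
  change lieBracketWithin ℝ (leftField G ξ) (leftField G η) _ _ = _
  rw [hs, lieBracketWithin_univ]

omit [CompleteSpace EG] in
theorem mfderiv_symm_leftField (ξ : EG) {h : EG} (hh : h ∈ (extChartAt 𝓘(ℝ, EG) (1 : G)).target) :
    mfderiv 𝓘(ℝ, EG) 𝓘(ℝ, EG) (extChartAt 𝓘(ℝ, EG) (1 : G)).symm h (leftField (EG := EG) G ξ h) =
      mulInvariantVectorField (I := 𝓘(ℝ, EG)) (G := G) ξ ((extChartAt 𝓘(ℝ, EG) (1 : G)).symm h) := by
  have h1 := isInvertible_mfderivWithin_extChartAt_symm (I := 𝓘(ℝ, EG)) (x := (1 : G)) hh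
  rw [← mfderivWithin_univ]
  obtain ⟨M, hM⟩ := h1
  have hu : Set.range 𝓘(ℝ, EG) = Set.univ := by simp
  change mfderivWithin 𝓘(ℝ, EG) 𝓘(ℝ, EG) (extChartAt 𝓘(ℝ, EG) (1 : G)).symm Set.univ h
    ((mfderivWithin 𝓘(ℝ, EG) 𝓘(ℝ, EG) (extChartAt 𝓘(ℝ, EG) (1 : G)).symm
      (Set.range 𝓘(ℝ, EG)) h).inverse _) = _
  rw [hu] at hM ⊢
  rw [← hM, ContinuousLinearMap.inverse_equiv]
  exact M.apply_symm_apply _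

variable {y : EuclideanSpace ℝ (Fin N)} (hy : y ∈ k.target)
  (hk : k ∈ IsManifold.maximalAtlas 𝓘(ℝ, EuclideanSpace ℝ (Fin N)) ∞ P)
include hy hk

omit [CompleteSpace EG] [IsManifold 𝓘(ℝ, EuclideanSpace ℝ (Fin N)) ∞ P] in
-- By `p(gx) = (pg)x`, the orbit map `g ↦ pg` takes the left invariant field of `ξ` at `g` to the
-- fundamental field of `ξ` at `pg`.
theorem fderiv_localAct_leftField (ξ : EG) {h : EG}
    (hh : h ∈ (extChartAt 𝓘(ℝ, EG) (1 : G)).target)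
    (hp : B.act (k.symm y) ((extChartAt 𝓘(ℝ, EG) (1 : G)).symm h) ∈ k.source) :
    fderiv ℝ (localAct B k) (y, h) (0, leftField G ξ h) = vertField B k ξ (localAct B k (y, h)) := by
  rw [fderiv_localAct_right hk hy hh hp]
  set g := (extChartAt 𝓘(ℝ, EG) (1 : G)).symm h with hg
  have h1 : mfderiv 𝓘(ℝ, EG) 𝓘(ℝ, EuclideanSpace ℝ (Fin N)) (fun g => B.act (k.symm y) g) g
      (mulInvariantVectorField (I := 𝓘(ℝ, EG)) (G := G) ξ g) =
      B.fundamental (B.act (k.symm y) g) ξ := by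
    have hm : MDifferentiableAt 𝓘(ℝ, EG) 𝓘(ℝ, EG) (fun x : G => g * x) 1 :=
      (contMDiff_mul_left (I := 𝓘(ℝ, EG)) (n := ∞) (a := g)).mdifferentiable (by simp) 1
    have h2 := mfderiv_comp_apply_of_eq (g := fun g => B.act (k.symm y) g) (f := fun x : G => g * x)
      (y := g) 1 (B.mdifferentiable_act (k.symm y) g) hm (mul_one g) ξ
    refine h2.symm.trans ?_
    have h3 : ((fun g => B.act (k.symm y) g) ∘ fun x : G => g * x) =
        fun x => B.act (B.act (k.symm y) g) x := funext fun x => B.act_mul _ _ _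
    rw [h3]
    rfl
  have h4 : localAct B k (y, h) = k (B.act (k.symm y) g) := rfl
  rw [h4, vertField, k.left_inv hp, ← h1]
  exact congrArg _ (congrArg _ (mfderiv_symm_leftField ξ hh))

omit [IsManifold 𝓘(ℝ, EuclideanSpace ℝ (Fin N)) ∞ P] in
/-- `ξ ↦ v_ξ` is a homomorphism of Lie algebras. -/
theorem lieBracket_vertField (ξ η : EG) :
    lieBracket ℝ (vertField B k ξ) (vertField B k η) y = vertField B k (lieBr G ξ η) y := by
  set h := extChartAt 𝓘(ℝ, EG) (1 : G) 1 with hh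
  have hla : ContDiffAt ℝ ∞ (localAct B k) (y, h) :=
    contDiffAt_localAct hk hy (mem_extChartAt_target (1 : G)) (act_chart_one_mem hy)
  have hσ : ContDiffAt ℝ ∞ (fun x => localAct B k (y, x)) h :=
    hla.comp h (contDiffAt_const.prodMk contDiffAt_id)
  have hfd : ∀ x ∈ (extChartAt 𝓘(ℝ, EG) (1 : G)).target,
      B.act (k.symm y) ((extChartAt 𝓘(ℝ, EG) (1 : G)).symm x) ∈ k.source → ∀ ζ,
      fderiv ℝ (fun x => localAct B k (y, x)) x ζ = fderiv ℝ (localAct B k) (y, x) (0, ζ) := by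
    intro x hx hx' ζ
    have h1 := ((contDiffAt_localAct (B := B) hk hy hx hx').differentiableAt (by simp)).hasFDerivAt
    have h2 := (h1.comp x (hasFDerivAt_prodMk_right (𝕜 := ℝ) y x)).fderiv
    refine (congrArg (fun L => L ζ) h2).trans ?_
    simp
  have hrel : ∀ ζ, ∀ᶠ x in 𝓝 h, fderiv ℝ (fun x => localAct B k (y, x)) x (leftField G ζ x) =
      vertField B k ζ (localAct B k (y, x)) := fun ζ => by
    filter_upwards [eventually_act_mem (B := B) hy] with x hx
    rw [hfd x hx.1 hx.2, fderiv_localAct_leftField hy hk ζ hx.1 hx.2]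
  have hy' : localAct B k (y, h) = y := localAct_one hy
  have hz : ∀ ζ, DifferentiableAt ℝ (vertField B k ζ) (localAct B k (y, h)) := fun ζ => by
    rw [hy']
    exact (contDiffAt_vertField hy hk ζ).differentiableAt (by simp)
  -- Left invariant fields and fundamental fields are related by the orbit map through `y`, and so
  -- are their brackets. With a right action no sign appears.
  have key := fderiv_apply_lieBracket_of_related hσ (differentiableAt_leftField ξ)
    (differentiableAt_leftField η) (hz ξ) (hz η) (hrel ξ) (hrel η)
  rw [hfd h (mem_extChartAt_target _) (act_chart_one_mem hy), ← lieBr_eq, fderiv_localAct_one hy hk,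
    hy'] at key
  exact key.symm

/-- The curvature of a connection vanishes on fundamental vectors. -/
theorem fderiv_localForm_vertField (ξ : EG) (w : EuclideanSpace ℝ (Fin N)) :
    fderiv ℝ (localForm k A) y (vertField B k ξ y) w - fderiv ℝ (localForm k A) y w (vertField B k ξ y) =
      -lieBr G ξ (localForm k A y w) := by
  have hα : DifferentiableAt ℝ (localForm k A) y :=
    (contDiffAt_localForm A hy hk).differentiableAt (by simp)
  have hv : ∀ ζ, DifferentiableAt ℝ (vertField B k ζ) y := fun ζ =>
    (contDiffAt_vertField hy hk ζ).differentiableAt (by simp)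
  -- The derivative of the constant `α(v_ζ) = ζ`.
  have hconst : ∀ ζ u, fderiv ℝ (localForm k A) y u (vertField B k ζ y) +
      localForm k A y (fderiv ℝ (vertField B k ζ) y u) = 0 := fun ζ u => by
    have h1 : (fun z => localForm k A z (vertField B k ζ z)) =ᶠ[𝓝 y] fun _ => ζ := by
      filter_upwards [k.open_target.mem_nhds hy] with z hz
      exact localForm_vertField A hz hk ζ
    have h2 := congrArg (fun L : EuclideanSpace ℝ (Fin N) →L[ℝ] EG => L u) (h1.fderiv_eq (𝕜 := ℝ))
    rw [fderiv_clm_apply hα (hv ζ)] at h2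
    simpa [add_comm] using h2
  -- For horizontal `u` the right side of the theorem vanishes, and the exterior derivative vanishes
  -- on the pair `v_ξ, u` by equivariance.
  have hker : ∀ u, localForm k A y u = 0 → fderiv ℝ (localForm k A) y (vertField B k ξ y) u =
      fderiv ℝ (localForm k A) y u (vertField B k ξ y) := fun u hu => by
    set h := extChartAt 𝓘(ℝ, EG) (1 : G) 1 with hh
    have h1 := fderiv_form_symm_of_ker (a := localAct B k) (α := localForm k A) (y := y) (w := u)
      (h := h) (η := ξ) (ξ := ξ)
      (contDiffAt_localAct hk hy (mem_extChartAt_target (1 : G)) (act_chart_one_mem hy)) hα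
      (by filter_upwards [k.open_target.mem_nhds hy] with z hz using localAct_one hz)
      (by
        filter_upwards [eventually_act_mem (B := B) hy] with x hx
        rw [localForm_fderiv_localAct A hy hk hx.1 hx.2, hu]
        exact map_zero (mfderiv _ _ _ _))
      (by
        filter_upwards [k.open_target.mem_nhds hy] with z hz
        rw [fderiv_localAct_one hz hk, localForm_vertField A hz hk])
    rwa [fderiv_localAct_one hy hk] at h1
  -- Split `w` into a horizontal vector and `v_η`. On the pair `v_ξ, v_η` the constancy of `α` on
  -- fundamental fields turns the exterior derivative into `-α([v_ξ, v_η])`, and the bracket is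
  -- known.
  set η := localForm k A y w with hη
  have hu : localForm k A y (w - vertField B k η y) = 0 := by
    rw [map_sub, localForm_vertField A hy hk, hη, sub_self]
  have h1 := hker _ hu
  have h2 := hconst η (vertField B k ξ y)
  have h3 := hconst ξ (vertField B k η y)
  have h4 : localForm k A y (fderiv ℝ (vertField B k η) y (vertField B k ξ y) -
      fderiv ℝ (vertField B k ξ) y (vertField B k η y)) = lieBr G ξ η :=
    (congrArg (fun v => localForm k A y v) (lieBracket_vertField hy hk ξ η)).trans
      (localForm_vertField A hy hk _)
  rw [map_sub] at h4
  simp only [map_sub, sub_apply] at h1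
  rw [← h4]
  have e1 := eq_neg_of_add_eq_zero_left h2
  have e2 := eq_neg_of_add_eq_zero_left h3
  rw [e1, e2] at h1
  rw [sub_eq_iff_eq_add] at h1 ⊢
  rw [h1]
  abel

end LocalBundle

end

section

open Filter Topology VectorField

/-! ## Coordinate expressions of the geometric data -/

section Euclidean

variable {m : ℕ}

theorem euclidean_sum_single (v : EuclideanSpace ℝ (Fin m)) :
    ∑ i, v i • EuclideanSpace.single i (1 : ℝ) = v := by
  ext j
  simp [Pi.single_apply]

theorem sum_mul_pderiv (h : EuclideanSpace ℝ (Fin m) → ℝ) (x v : EuclideanSpace ℝ (Fin m)) :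
    ∑ i, v i * GaugeQK.pderiv i h x = fderiv ℝ h x v := by
  conv_rhs => rw [← euclidean_sum_single v, map_sum]
  exact Finset.sum_congr rfl fun i _ => by
    rw [map_smul]
    rfl

theorem fderiv_coord {E : Type*} [NormedAddCommGroup E] [NormedSpace ℝ E]
    {F : E → EuclideanSpace ℝ (Fin m)} {x : E} (hF : DifferentiableAt ℝ F x) (j : Fin m) (w : E) :
    fderiv ℝ (fun y => F y j) x w = fderiv ℝ F x w j := by
  have h := (((EuclideanSpace.proj j : EuclideanSpace ℝ (Fin m) →L[ℝ] ℝ).hasFDerivAt).comp x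
    hF.hasFDerivAt).fderiv
  exact congrArg (fun L : E →L[ℝ] ℝ => L w) h

end Euclidean

section StructureConstants

variable {EG : Type*} [NormedAddCommGroup EG] [NormedSpace ℝ EG] [CompleteSpace EG]
  {G : Type*} [TopologicalSpace G] [ChartedSpace EG G] [Group G] [LieGroup 𝓘(ℝ, EG) ∞ G]
  {r : ℕ} (b : Module.Basis (Fin r) ℝ EG)

variable (G) in
/-- The Lie bracket as a bilinear map. -/
def lieBrBilin : EG →ₗ[ℝ] EG →ₗ[ℝ] EG :=
  have : LieGroup 𝓘(ℝ, EG) (minSmoothness ℝ 3) G := lieGroup_minSmoothness EG G 3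
  LinearMap.mk₂ ℝ (lieBr G)
    (fun x y z => add_lie (L := GroupLieAlgebra 𝓘(ℝ, EG) G) (M := GroupLieAlgebra 𝓘(ℝ, EG) G) x y z)
    (fun c x y => smul_lie (R := ℝ) (L := GroupLieAlgebra 𝓘(ℝ, EG) G)
      (M := GroupLieAlgebra 𝓘(ℝ, EG) G) c x y)
    (fun x y z => lie_add (L := GroupLieAlgebra 𝓘(ℝ, EG) G) (M := GroupLieAlgebra 𝓘(ℝ, EG) G) x y z)
    (fun c x y => lie_smul (R := ℝ) (L := GroupLieAlgebra 𝓘(ℝ, EG) G)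
      (M := GroupLieAlgebra 𝓘(ℝ, EG) G) c x y)

omit [CompleteSpace EG] [LieGroup 𝓘(ℝ, EG) ∞ G] in
theorem lieBr_skew (ξ η : EG) : lieBr G ξ η = -lieBr G η ξ :=
  mlieBracket_swap_apply

theorem lieBr_jacobi (ξ η ζ : EG) : lieBr G ξ (lieBr G η ζ) =
    lieBr G (lieBr G ξ η) ζ + lieBr G η (lieBr G ξ ζ) :=
  have : LieGroup 𝓘(ℝ, EG) (minSmoothness ℝ 3) G := lieGroup_minSmoothness EG G 3
  LieRing.leibniz_lie (L := GroupLieAlgebra 𝓘(ℝ, EG) G) ξ η ζ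

theorem repr_lieBr_left (ξ η : EG) (a : Fin r) :
    b.repr (lieBr G ξ η) a = ∑ i, b.repr ξ i * b.repr (lieBr G (b i) η) a := by
  change b.coord a (lieBrBilin G ξ η) = _
  conv_lhs => rw [← b.sum_repr ξ]
  simp only [map_sum, map_smul, LinearMap.sum_apply, LinearMap.smul_apply, smul_eq_mul]
  rfl

theorem repr_lieBr_right (ξ η : EG) (a : Fin r) :
    b.repr (lieBr G ξ η) a = ∑ i, b.repr η i * b.repr (lieBr G ξ (b i)) a := by
  change b.coord a (lieBrBilin G ξ η) = _
  conv_lhs => rw [← b.sum_repr η]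
  simp only [map_sum, map_smul, smul_eq_mul]
  rfl

theorem repr_lieBr (ξ η : EG) (a : Fin r) :
    b.repr (lieBr G ξ η) a = ∑ i, ∑ j, structConst G b i j a * (b.repr ξ i * b.repr η j) := by
  rw [repr_lieBr_left b]
  refine Finset.sum_congr rfl fun i _ => ?_
  rw [repr_lieBr_right b, Finset.mul_sum]
  refine Finset.sum_congr rfl fun j _ => ?_
  rw [structConst]
  ring

theorem isLieConst_structConst : IsLieConst (structConst G b) where
  anti i j a := by
    rw [structConst, structConst, lieBr_skew, map_neg]
    rfl
  jacobi i j k a := by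
    have h := congrArg (fun ξ => b.repr ξ a) (lieBr_jacobi (G := G) (b i) (b j) (b k))
    simp only [map_add, Finsupp.add_apply] at h
    rw [repr_lieBr_right b (b i), repr_lieBr_left b _ (b k), repr_lieBr_right b (b j)] at h
    exact h

end StructureConstants

section Coefficients

variable {EG : Type*} [NormedAddCommGroup EG] [NormedSpace ℝ EG] [FiniteDimensional ℝ EG]
  {G : Type*} [TopologicalSpace G] [ChartedSpace EG G] [Group G] [LieGroup 𝓘(ℝ, EG) ∞ G]
  {ES : Type*} [NormedAddCommGroup ES] [NormedSpace ℝ ES]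
  {Sg : Type*} [TopologicalSpace Sg] [ChartedSpace ES Sg]
  {N : ℕ} {P : Type*} [TopologicalSpace P] [ChartedSpace (EuclideanSpace ℝ (Fin N)) P]
  [IsManifold 𝓘(ℝ, EuclideanSpace ℝ (Fin N)) ∞ P]
  {B : PrincipalBundle (EG := EG) (ES := ES) (N := N) G P Sg} (A : Connection B)
  {r : ℕ} (b : Module.Basis (Fin r) ℝ EG)
  {k : OpenPartialHomeomorph P (EuclideanSpace ℝ (Fin N))}
  (hk : k ∈ IsManifold.maximalAtlas 𝓘(ℝ, EuclideanSpace ℝ (Fin N)) ∞ P)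

/-- A coordinate of the Lie algebra, as a continuous functional. -/
def coordCLM (a : Fin r) : EG →L[ℝ] ℝ := LinearMap.toContinuousLinearMap (b.coord a)

omit [LieGroup 𝓘(ℝ, EG) ∞ G] in
theorem connCoeff_sum (a : Fin r) (y w : EuclideanSpace ℝ (Fin N)) :
    ∑ j, connCoeff A b k a j y * w j = coordCLM b a (localForm k A y w) := by
  conv_rhs => rw [← euclidean_sum_single w, map_sum, map_sum]
  refine Finset.sum_congr rfl fun j _ => ?_
  rw [map_smul, map_smul, smul_eq_mul, mul_comm]
  rfl

omit [LieGroup 𝓘(ℝ, EG) ∞ G] [FiniteDimensional ℝ EG]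
  [IsManifold 𝓘(ℝ, EuclideanSpace ℝ (Fin N)) ∞ P] in
theorem vertField_sum (ξ : EG) (j : Fin N) (y : EuclideanSpace ℝ (Fin N)) :
    vertField B k ξ y j = ∑ c, b.repr ξ c * vertCoeff B b k c j y := by
  let L : EG →L[ℝ] EuclideanSpace ℝ (Fin N) :=
    (show EuclideanSpace ℝ (Fin N) →L[ℝ] EuclideanSpace ℝ (Fin N) from
      mfderiv 𝓘(ℝ, EuclideanSpace ℝ (Fin N)) 𝓘(ℝ, EuclideanSpace ℝ (Fin N)) k (k.symm y)).comp
    (show EG →L[ℝ] EuclideanSpace ℝ (Fin N) from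
      mfderiv 𝓘(ℝ, EG) 𝓘(ℝ, EuclideanSpace ℝ (Fin N)) (fun g : G => B.act (k.symm y) g) 1)
  have h : ∀ ζ, vertField B k ζ y = L ζ := fun _ => rfl
  rw [h]
  conv_lhs => rw [← b.sum_repr ξ]
  rw [map_sum]
  simp only [map_smul, WithLp.ofLp_sum, Finset.sum_apply]
  rfl

include hk

omit [LieGroup 𝓘(ℝ, EG) ∞ G] in
theorem contDiffOn_connCoeff (a : Fin r) (j : Fin N) :
    ContDiffOn ℝ ∞ (connCoeff A b k a j) k.target := fun y hy => by
  have h1 := (contDiffAt_localForm A hy hk).clm_apply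
    (contDiffAt_const (c := EuclideanSpace.single j (1 : ℝ)))
  exact ((coordCLM b a).contDiff.contDiffAt.comp y h1).contDiffWithinAt

omit [FiniteDimensional ℝ EG] [IsManifold 𝓘(ℝ, EuclideanSpace ℝ (Fin N)) ∞ P] in
theorem contDiffOn_vertCoeff (a : Fin r) (j : Fin N) :
    ContDiffOn ℝ ∞ (vertCoeff B b k a j) k.target :=
  contDiffOn_coord (fun _ hy => (contDiffAt_vertField hy hk (b a)).contDiffWithinAt) j

omit [LieGroup 𝓘(ℝ, EG) ∞ G] in
theorem connCoeff_vertCoeff (a c : Fin r) : ∀ u ∈ k.target,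
    ∑ j, connCoeff A b k a j u * vertCoeff B b k c j u = if a = c then 1 else 0 := fun u hu => by
  refine (connCoeff_sum A b a u (vertField B k (b c) u)).trans ?_
  rw [localForm_vertField A hu hk]
  change b.repr (b c) a = _
  rw [b.repr_self, Finsupp.single_apply]
  simp only [eq_comm]

omit [IsManifold 𝓘(ℝ, EuclideanSpace ℝ (Fin N)) ∞ P] in
theorem bracket_vertCoeff (a c : Fin r) (j : Fin N) : ∀ u ∈ k.target,
    ∑ i, (vertCoeff B b k a i u * GaugeQK.pderiv i (vertCoeff B b k c j) u -
      vertCoeff B b k c i u * GaugeQK.pderiv i (vertCoeff B b k a j) u) =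
    ∑ e, structConst G b a c e * vertCoeff B b k e j u := fun u hu => by
  have : CompleteSpace EG := FiniteDimensional.complete ℝ EG
  have hd : ∀ e, DifferentiableAt ℝ (vertField B k (b e)) u := fun e =>
    (contDiffAt_vertField hu hk (b e)).differentiableAt (by simp)
  have h1 : ∀ e e', ∑ i, vertCoeff B b k e i u * GaugeQK.pderiv i (vertCoeff B b k e' j) u =
      fderiv ℝ (vertField B k (b e')) u (vertField B k (b e) u) j := fun e e' =>
    (sum_mul_pderiv _ u (vertField B k (b e) u)).trans (fderiv_coord (hd e') j _)
  rw [Finset.sum_sub_distrib, h1, h1]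
  refine (congrArg (fun v : EuclideanSpace ℝ (Fin N) => v j)
    (lieBracket_vertField hu hk (b a) (b c))).trans ?_
  exact vertField_sum b _ j u

/-- The vector `w` of `fderiv_localForm_vertField` is taken to be a coordinate vector, and its
bracket term is expanded in the basis. -/
theorem curvature_vertCoeff (a c : Fin r) (j : Fin N) : ∀ u ∈ k.target,
    ∑ i, vertCoeff B b k c i u * (GaugeQK.pderiv i (connCoeff A b k a j) u -
      GaugeQK.pderiv j (connCoeff A b k a i) u) =
    -∑ e, structConst G b c e a * connCoeff A b k e j u := fun u hu => by
  have : CompleteSpace EG := FiniteDimensional.complete ℝ EG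
  have hα : DifferentiableAt ℝ (localForm k A) u :=
    (contDiffAt_localForm A hu hk).differentiableAt (by simp)
  have h1 : ∀ i v, fderiv ℝ (connCoeff A b k a i) u v =
      coordCLM b a (fderiv ℝ (localForm k A) u v (EuclideanSpace.single i 1)) := fun i v => by
    have h2 := ((coordCLM b a).hasFDerivAt.comp u
      (hα.hasFDerivAt.clm_apply (hasFDerivAt_const (EuclideanSpace.single i (1 : ℝ)) u))).fderiv
    refine (congrArg (fun L : EuclideanSpace ℝ (Fin N) →L[ℝ] ℝ => L v) h2).trans ?_
    simp
  have h3 := congrArg (coordCLM b a)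
    (fderiv_localForm_vertField A hu hk (b c) (EuclideanSpace.single j 1))
  rw [map_sub, map_neg] at h3
  simp only [mul_sub, Finset.sum_sub_distrib]
  have e1 : ∑ i, vertCoeff B b k c i u * GaugeQK.pderiv i (connCoeff A b k a j) u =
      coordCLM b a (fderiv ℝ (localForm k A) u (vertField B k (b c) u) (EuclideanSpace.single j 1)) :=
    (sum_mul_pderiv _ u (vertField B k (b c) u)).trans (h1 _ _)
  have e2 : ∑ i, vertCoeff B b k c i u * GaugeQK.pderiv j (connCoeff A b k a i) u =
      coordCLM b a (fderiv ℝ (localForm k A) u (EuclideanSpace.single j 1) (vertField B k (b c) u)) := by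
    conv_rhs => rw [← euclidean_sum_single (vertField B k (b c) u), map_sum, map_sum]
    refine Finset.sum_congr rfl fun i _ => ?_
    rw [map_smul, map_smul, smul_eq_mul, ← h1]
    rfl
  rw [e1, e2, h3]
  refine congrArg Neg.neg ((repr_lieBr_right b _ _ a).trans (Finset.sum_congr rfl fun e _ => ?_))
  exact mul_comm _ _

end Coefficients

end

/-! ### Changes of charts, gauge parameters and pullbacks in coordinates -/

section

open Filter Topology

section ChartChange

variable {EG : Type*} [NormedAddCommGroup EG] [NormedSpace ℝ EG]
  {G : Type*} [TopologicalSpace G] [ChartedSpace EG G] [Group G]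
  {ES : Type*} [NormedAddCommGroup ES] [NormedSpace ℝ ES]
  {Sg : Type*} [TopologicalSpace Sg] [ChartedSpace ES Sg]
  {N : ℕ} {P : Type*} [TopologicalSpace P] [ChartedSpace (EuclideanSpace ℝ (Fin N)) P]
  [IsManifold 𝓘(ℝ, EuclideanSpace ℝ (Fin N)) ∞ P]
  {B : PrincipalBundle (EG := EG) (ES := ES) (N := N) G P Sg} (A : Connection B)
  {r : ℕ} (b : Module.Basis (Fin r) ℝ EG)
  {k k' : OpenPartialHomeomorph P (EuclideanSpace ℝ (Fin N))}
  (hk : k ∈ IsManifold.maximalAtlas 𝓘(ℝ, EuclideanSpace ℝ (Fin N)) ∞ P)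
  (hk' : k' ∈ IsManifold.maximalAtlas 𝓘(ℝ, EuclideanSpace ℝ (Fin N)) ∞ P)
  (hkk : k.source ⊆ k'.source)

include hk in
theorem localForm_mfderiv {p : P} (hp : p ∈ k.source)
    (v : TangentSpace 𝓘(ℝ, EuclideanSpace ℝ (Fin N)) p) :
    localForm k A (k p)
      (mfderiv 𝓘(ℝ, EuclideanSpace ℝ (Fin N)) 𝓘(ℝ, EuclideanSpace ℝ (Fin N)) k p v) = A.form p v := by
  have h2 : ∀ q : P, q = p → ∀ w : EuclideanSpace ℝ (Fin N), A.form q w = A.form p w :=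
    fun q hq w => by rw [hq]
  exact (h2 _ (k.left_inv hp) _).trans (congrArg (A.form p) (mfderiv_symm_mfderiv hk hp v))

include hk hk' hkk

omit [IsManifold 𝓘(ℝ, EuclideanSpace ℝ (Fin N)) ∞ P] in
theorem contDiffOn_chartChange : ContDiffOn ℝ ∞ (fun y => k' (k.symm y)) k.target := by
  rw [← contMDiffOn_iff_contDiffOn]
  exact (contMDiffOn_of_mem_maximalAtlas hk').comp (contMDiffOn_symm_of_mem_maximalAtlas hk)
    fun y hy => hkk (k.map_target hy)

omit [IsManifold 𝓘(ℝ, EuclideanSpace ℝ (Fin N)) ∞ P] in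
theorem fderiv_chartChange {y : EuclideanSpace ℝ (Fin N)} (hy : y ∈ k.target)
    (w : EuclideanSpace ℝ (Fin N)) : fderiv ℝ (fun y => k' (k.symm y)) y w =
      mfderiv 𝓘(ℝ, EuclideanSpace ℝ (Fin N)) 𝓘(ℝ, EuclideanSpace ℝ (Fin N)) k' (k.symm y)
        (mfderiv 𝓘(ℝ, EuclideanSpace ℝ (Fin N)) 𝓘(ℝ, EuclideanSpace ℝ (Fin N)) k.symm y w) := by
  rw [← mfderiv_eq_fderiv]
  exact mfderiv_comp_apply (g := k') (f := k.symm) y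
    ((mdifferentiable_of_mem_maximalAtlas hk').mdifferentiableAt (hkk (k.map_target hy)))
    ((mdifferentiable_of_mem_maximalAtlas hk).mdifferentiableAt_symm hy) w

omit [IsManifold 𝓘(ℝ, EuclideanSpace ℝ (Fin N)) ∞ P] in
theorem differentiableAt_chartChange {y : EuclideanSpace ℝ (Fin N)} (hy : y ∈ k.target) :
    DifferentiableAt ℝ (fun y => k' (k.symm y)) y :=
  ((contDiffOn_chartChange hk hk' hkk).contDiffAt (k.open_target.mem_nhds hy)).differentiableAt
    (by simp)

omit [IsManifold 𝓘(ℝ, EuclideanSpace ℝ (Fin N)) ∞ P] in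
theorem vertCoeff_chartChange (a : Fin r) (j : Fin N) : ∀ y ∈ k.target,
    ∑ i, GaugeQK.pderiv i (fun y => k' (k.symm y) j) y * vertCoeff B b k a i y =
      vertCoeff B b k' a j (k' (k.symm y)) := fun y hy => by
  simp only [mul_comm (GaugeQK.pderiv _ _ _)]
  refine (sum_mul_pderiv _ y (vertField B k (b a) y)).trans ?_
  rw [fderiv_coord (differentiableAt_chartChange hk hk' hkk hy),
    fderiv_chartChange hk hk' hkk hy]
  refine congrArg (fun v : EuclideanSpace ℝ (Fin N) => v j) (?_ : _ = vertField B k' (b a) _)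
  have e : vertField B k' (b a) (k' (k.symm y)) = mfderiv 𝓘(ℝ, EuclideanSpace ℝ (Fin N))
      𝓘(ℝ, EuclideanSpace ℝ (Fin N)) k' (k.symm y) (B.fundamental (k.symm y) (b a)) := by
    rw [vertField, k'.left_inv (hkk (k.map_target hy))]
  have h1 := mfderiv_symm_mfderiv hk (k.map_target hy) (B.fundamental (k.symm y) (b a))
  rw [k.right_inv hy] at h1
  exact (congrArg _ h1).trans e.symm

theorem connCoeff_chartChange [FiniteDimensional ℝ EG] (a : Fin r) (i : Fin N) : ∀ y ∈ k.target,
    ∑ j, connCoeff A b k' a j (k' (k.symm y)) * GaugeQK.pderiv i (fun y => k' (k.symm y) j) y =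
      connCoeff A b k a i y := fun y hy => by
  have h1 : ∀ j, GaugeQK.pderiv i (fun y => k' (k.symm y) j) y =
      fderiv ℝ (fun y => k' (k.symm y)) y (EuclideanSpace.single i 1) j := fun j =>
    fderiv_coord (differentiableAt_chartChange hk hk' hkk hy) j _
  simp only [h1]
  rw [connCoeff_sum, fderiv_chartChange hk hk' hkk hy]
  exact congrArg (coordCLM b a) (localForm_mfderiv A hk' (hkk (k.map_target hy)) _)

end ChartChange

section Base

variable {EG : Type*} [NormedAddCommGroup EG] [NormedSpace ℝ EG] [FiniteDimensional ℝ EG]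
  {G : Type*} [TopologicalSpace G] [ChartedSpace EG G] [Group G] [LieGroup 𝓘(ℝ, EG) ∞ G]
  {n : ℕ} {M : Type*} [TopologicalSpace M] [ChartedSpace (EuclideanSpace ℝ (Fin n)) M]
  {r : ℕ} (b : Module.Basis (Fin r) ℝ EG)
  {c : OpenPartialHomeomorph M (EuclideanSpace ℝ (Fin n))}
  (hc : c ∈ IsManifold.maximalAtlas 𝓘(ℝ, EuclideanSpace ℝ (Fin n)) ∞ M)

omit [FiniteDimensional ℝ EG] in
theorem gaugeComp_linear (s : ℝ) (l₁ l₂ : GaugeAlgebra EG n M) (a : Fin r)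
    (x : EuclideanSpace ℝ (Fin n)) :
    gaugeComp b c (s • l₁ + l₂) a x = s * gaugeComp b c l₁ a x + gaugeComp b c l₂ a x := by
  simp [gaugeComp]

theorem gaugeComp_bracket {l₁ l₂ l₃ : GaugeAlgebra EG n M} (h : gaugeBr G l₁ l₂ l₃) (a : Fin r)
    (x : EuclideanSpace ℝ (Fin n)) : gaugeComp b c l₃ a x =
      ∑ i, ∑ j, structConst G b i j a * (gaugeComp b c l₁ i x * gaugeComp b c l₂ j x) := by
  have : CompleteSpace EG := FiniteDimensional.complete ℝ EG
  rw [gaugeComp, h]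
  exact repr_lieBr b _ _ a

include hc

omit [FiniteDimensional ℝ EG] in
theorem contDiffOn_gauge (l : GaugeAlgebra EG n M) :
    ContDiffOn ℝ ∞ (fun x => l (c.symm x)) c.target := by
  rw [← contMDiffOn_iff_contDiffOn]
  exact l.contMDiff.comp_contMDiffOn (contMDiffOn_symm_of_mem_maximalAtlas hc)

theorem contDiffOn_gaugeComp (l : GaugeAlgebra EG n M) (a : Fin r) :
    ContDiffOn ℝ ∞ (gaugeComp b c l a) c.target :=
  (coordCLM b a).contDiff.comp_contDiffOn (contDiffOn_gauge hc l)

/-- Partial derivatives of Lie algebra valued functions on a coordinate domain extend, locally, to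
the whole manifold. -/
theorem hasLocalPartials_gaugeComp [T2Space M] [IsManifold 𝓘(ℝ, EuclideanSpace ℝ (Fin n)) ∞ M] :
    HasLocalPartials c.target (gaugeComp (EG := EG) b c) := by
  intro l x hx
  -- A bump function supported in the chart domain. Multiplied by it, the partial derivatives of `l`
  -- extend by zero to smooth functions on `M`, and nothing changes near the given point, where it
  -- equals one.
  obtain ⟨χ, -, hχ⟩ := (SmoothBumpFunction.nhds_basis_tsupport
    (I := 𝓘(ℝ, EuclideanSpace ℝ (Fin n))) (c.symm x)).mem_iff.1
    (c.open_source.mem_nhds (c.map_target hx))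
  have hd : ∀ μ : Fin n, ContDiffOn ℝ ∞ (fun y => fderiv ℝ (fun x => l (c.symm x)) y
      (EuclideanSpace.single μ (1 : ℝ))) c.target := fun μ =>
    ((contDiffOn_gauge hc l).fderiv_of_isOpen c.open_target (m := ∞) (by simp)).clm_apply
      contDiffOn_const
  have hs : ∀ μ : Fin n, ContMDiff 𝓘(ℝ, EuclideanSpace ℝ (Fin n)) 𝓘(ℝ, EG) ∞ (fun m : M =>
      χ m • fderiv ℝ (fun x => l (c.symm x)) (c m) (EuclideanSpace.single μ (1 : ℝ))) := fun μ => by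
    refine contMDiff_of_tsupport fun m hm => ?_
    have hm' : m ∈ c.source := hχ (closure_mono (Function.support_smul_subset_left _ _) hm)
    refine χ.contMDiff.contMDiffAt.smul ?_
    exact (((hd μ).contDiffAt (c.open_target.mem_nhds (c.map_source hm'))).contMDiffAt).comp m
      (contMDiffAt_of_mem_maximalAtlas hc hm')
  have h1 : ∀ᶠ y in 𝓝 x, χ (c.symm y) = 1 :=
    (c.continuousAt_symm hx).eventually χ.eventuallyEq_one
  obtain ⟨W, hW, hWo, hxW⟩ := eventually_nhds_iff.1 h1
  refine ⟨W, hWo, hxW, fun μ => ⟨_, hs μ⟩, fun μ a y hy hyc => ?_⟩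
  have h2 : gaugeComp b c ⟨_, hs μ⟩ a y = coordCLM b a (χ (c.symm y) •
      fderiv ℝ (fun x => l (c.symm x)) (c (c.symm y)) (EuclideanSpace.single μ (1 : ℝ))) := rfl
  rw [h2, hW y hy, one_smul, c.right_inv hyc]
  have h3 := ((coordCLM b a).hasFDerivAt.comp y (((contDiffOn_gauge hc l).contDiffAt
    (c.open_target.mem_nhds hyc)).differentiableAt (by simp)).hasFDerivAt).fderiv
  exact (congrArg (fun L : EuclideanSpace ℝ (Fin n) →L[ℝ] ℝ => L (EuclideanSpace.single μ 1))
    h3).symm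

end Base

section Pullback

variable {EG : Type*} [NormedAddCommGroup EG] [NormedSpace ℝ EG] [FiniteDimensional ℝ EG]
  {G : Type*} [TopologicalSpace G] [ChartedSpace EG G] [Group G]
  {ES : Type*} [NormedAddCommGroup ES] [NormedSpace ℝ ES]
  {Sg : Type*} [TopologicalSpace Sg] [ChartedSpace ES Sg]
  {N : ℕ} {P : Type*} [TopologicalSpace P] [ChartedSpace (EuclideanSpace ℝ (Fin N)) P]
  [IsManifold 𝓘(ℝ, EuclideanSpace ℝ (Fin N)) ∞ P]
  {B : PrincipalBundle (EG := EG) (ES := ES) (N := N) G P Sg} (A : Connection B)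
  {r : ℕ} (b : Module.Basis (Fin r) ℝ EG)
  {k : OpenPartialHomeomorph P (EuclideanSpace ℝ (Fin N))}
  (hk : k ∈ IsManifold.maximalAtlas 𝓘(ℝ, EuclideanSpace ℝ (Fin N)) ∞ P)
  {n : ℕ} {M : Type*} [TopologicalSpace M] [ChartedSpace (EuclideanSpace ℝ (Fin n)) M]
  {c : OpenPartialHomeomorph M (EuclideanSpace ℝ (Fin n))}
  (hc : c ∈ IsManifold.maximalAtlas 𝓘(ℝ, EuclideanSpace ℝ (Fin n)) ∞ M)
  (f : C^∞⟮𝓘(ℝ, EuclideanSpace ℝ (Fin n)), M; 𝓘(ℝ, EuclideanSpace ℝ (Fin N)), P⟯)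
include hk hc

omit [IsManifold 𝓘(ℝ, EuclideanSpace ℝ (Fin N)) ∞ P] in
theorem contDiffOn_coordMap : ContDiffOn ℝ ∞ (fun y => k (f (c.symm y)))
    (c.target ∩ c.symm ⁻¹' (f ⁻¹' k.source)) := by
  rw [← contMDiffOn_iff_contDiffOn]
  exact (contMDiffOn_of_mem_maximalAtlas hk).comp (f.contMDiff.comp_contMDiffOn
    ((contMDiffOn_symm_of_mem_maximalAtlas hc).mono Set.inter_subset_left)) fun y hy => hy.2

omit hk hc [IsManifold 𝓘(ℝ, EuclideanSpace ℝ (Fin N)) ∞ P] in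
theorem isOpen_coordMap_domain : IsOpen (c.target ∩ c.symm ⁻¹' (f ⁻¹' k.source)) :=
  c.isOpen_inter_preimage_symm (k.open_source.preimage f.contMDiff.continuous)

/-- The components of the pullback of a connection form, in coordinates. -/
theorem pullback_connCoeff (a : Fin r) (μ : Fin n) :
    ∀ x ∈ c.target ∩ c.symm ⁻¹' (f ⁻¹' k.source),
    b.repr (A.form (f (c.symm x))
      (mfderiv 𝓘(ℝ, EuclideanSpace ℝ (Fin n)) 𝓘(ℝ, EuclideanSpace ℝ (Fin N)) f (c.symm x)
        (mfderiv 𝓘(ℝ, EuclideanSpace ℝ (Fin n)) 𝓘(ℝ, EuclideanSpace ℝ (Fin n)) c.symm x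
          (EuclideanSpace.single μ (1 : ℝ))))) a =
    ∑ j, connCoeff A b k a j (k (f (c.symm x))) *
      GaugeQK.pderiv μ (fun y => k (f (c.symm y)) j) x := fun x hx => by
  have hd : DifferentiableAt ℝ (fun y => k (f (c.symm y))) x :=
    ((contDiffOn_coordMap hk hc f).contDiffAt
      ((isOpen_coordMap_domain f).mem_nhds hx)).differentiableAt (by simp)
  have h1 : ∀ j, GaugeQK.pderiv μ (fun y => k (f (c.symm y)) j) x =
      fderiv ℝ (fun y => k (f (c.symm y))) x (EuclideanSpace.single μ 1) j := fun j =>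
    fderiv_coord hd j _
  simp only [h1]
  rw [connCoeff_sum]
  have hs := (mdifferentiable_of_mem_maximalAtlas hc).mdifferentiableAt_symm hx.1
  have hf : MDifferentiableAt 𝓘(ℝ, EuclideanSpace ℝ (Fin n)) 𝓘(ℝ, EuclideanSpace ℝ (Fin N)) f
    (c.symm x) := f.contMDiff.mdifferentiable (by simp) _
  have h2 : fderiv ℝ (fun y => k (f (c.symm y))) x (EuclideanSpace.single μ 1) =
      mfderiv 𝓘(ℝ, EuclideanSpace ℝ (Fin N)) 𝓘(ℝ, EuclideanSpace ℝ (Fin N)) k (f (c.symm x))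
      (mfderiv 𝓘(ℝ, EuclideanSpace ℝ (Fin n)) 𝓘(ℝ, EuclideanSpace ℝ (Fin N)) f (c.symm x)
        (mfderiv 𝓘(ℝ, EuclideanSpace ℝ (Fin n)) 𝓘(ℝ, EuclideanSpace ℝ (Fin n)) c.symm x
          (EuclideanSpace.single μ (1 : ℝ)))) := by
    rw [← mfderiv_eq_fderiv]
    refine (mfderiv_comp_apply (g := k) (f := fun y => f (c.symm y)) x
      ((mdifferentiable_of_mem_maximalAtlas hk).mdifferentiableAt hx.2) (hf.comp x hs) _).trans ?_
    exact congrArg _ (mfderiv_comp_apply (g := f) (f := c.symm) x hf hs _)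
  rw [h2]
  exact (congrArg (coordCLM b a) (localForm_mfderiv A hk hx.2 _)).symm

end Pullback

end

/-! ### The map of jets covered by the Weil homomorphism -/

section

open Patch

section MapJets

variable {EG : Type*} [NormedAddCommGroup EG] [NormedSpace ℝ EG] [FiniteDimensional ℝ EG]
  {G : Type*} [TopologicalSpace G] [ChartedSpace EG G] [Group G]
  {ES : Type*} [NormedAddCommGroup ES] [NormedSpace ℝ ES]
  {Sg : Type*} [TopologicalSpace Sg] [ChartedSpace ES Sg]
  {N : ℕ} {P : Type*} [TopologicalSpace P] [ChartedSpace (EuclideanSpace ℝ (Fin N)) P]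
  [IsManifold 𝓘(ℝ, EuclideanSpace ℝ (Fin N)) ∞ P]
  {B : PrincipalBundle (EG := EG) (ES := ES) (N := N) G P Sg} {A : Connection B}
  {r : ℕ} {b : Module.Basis (Fin r) ℝ EG}
  {k : OpenPartialHomeomorph P (EuclideanSpace ℝ (Fin N))}
  {n : ℕ} {M : Type*} [TopologicalSpace M] [ChartedSpace (EuclideanSpace ℝ (Fin n)) M]
  {c : OpenPartialHomeomorph M (EuclideanSpace ℝ (Fin n))}

omit [ChartedSpace (EuclideanSpace ℝ (Fin N)) P] [ChartedSpace (EuclideanSpace ℝ (Fin n)) M]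
  [IsManifold 𝓘(ℝ, EuclideanSpace ℝ (Fin N)) ∞ P] in
theorem mapJet_eq_jetOf (f : M → P) (x : EuclideanSpace ℝ (Fin n)) :
    mapJet c k f x = jetOf (fun y => k (f (c.symm y))) x := by
  funext i
  cases i <;> rfl

/-- The Weil homomorphism covers the map of jets induced by `f ↦ A(Tf)`. -/
theorem IsWeilHom.covers_mapJet {𝔏 : Type*} {f : Fin r → Fin r → Fin r → ℝ}
    {comp : 𝔏 → Fin r → EuclideanSpace ℝ (Fin n) → ℝ}
    {vert : Fin r → Fin N → EuclideanSpace ℝ (Fin N) → ℝ}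
    {S : (universalPatch r n c.target).Operators 𝔏} {S' : (mappingPatch n N c.target k.target).Operators 𝔏}
    {Φ : (universalPatch r n c.target).Fn →ₐ[ℝ] (mappingPatch n N c.target k.target).Fn}
    (h : IsWeilHom f (connCoeff A b k) S S' Φ)
    (hS : IsUniversalStructure f comp S) (hS' : IsCanonicalStructure comp vert S')
    (hk : k ∈ IsManifold.maximalAtlas 𝓘(ℝ, EuclideanSpace ℝ (Fin N)) ∞ P)
    (hc : c ∈ IsManifold.maximalAtlas 𝓘(ℝ, EuclideanSpace ℝ (Fin n)) ∞ M)
    {τ : (mappingPatch n N c.target k.target).dom → (universalPatch r n c.target).dom}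
    (hτ : Covers Φ τ)
    (m : C^∞⟮𝓘(ℝ, EuclideanSpace ℝ (Fin n)), M; 𝓘(ℝ, EuclideanSpace ℝ (Fin N)), P⟯)
    {x : EuclideanSpace ℝ (Fin n)} (hx : x ∈ c.target) (hxk : m (c.symm x) ∈ k.source)
    {q : (mappingPatch n N c.target k.target).dom} (hq : q.1 = mapJet c k m x) :
    (τ q).1 = pullbackConnJet A b c m x := by
  have hX := isOpen_universalPatch_dom r c.open_target
  have hY := isOpen_mappingPatch_dom (n := n) (N := N) c.open_target k.open_target
  have hO := isOpen_coordMap_domain (c := c) (k := k) m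
  have huV : ∀ y ∈ c.target ∩ c.symm ⁻¹' (m ⁻¹' k.source), k (m (c.symm y)) ∈ k.target :=
    fun y hy => k.map_source hy.2
  have hq' : q = jetPt (U := c.target) (V := k.target) Set.inter_subset_left huV ⟨x, hx, hxk⟩ :=
    Subtype.ext (hq.trans (mapJet_eq_jetOf m x))
  rw [hq']
  funext i
  cases i with
  | x μ =>
    exact hτ.apply_eq (coordLoc (BaseCoord.x μ) : LocFun (mappingPatch n N c.target k.target).dom).2
      (h.x μ) _
  | jet aμ I =>
    exact h.covers_jet hO (contDiffOn_coordMap hk hc m) hX hY Set.inter_subset_left huV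
      (contDiffOn_connCoeff A b hk) hS hS' hτ (pullback_connCoeff A b hk hc m) ⟨x, hx, hxk⟩ aμ.1 aμ.2 I

end MapJets

end

end GaugeQK

end

theorem theorem6p2
    {EG : Type*} [NormedAddCommGroup EG] [NormedSpace ℝ EG] [FiniteDimensional ℝ EG]
    {G : Type*} [TopologicalSpace G] [ChartedSpace EG G] [Group G] [LieGroup 𝓘(ℝ, EG) ∞ G]
    {ES : Type*} [NormedAddCommGroup ES] [NormedSpace ℝ ES] [FiniteDimensional ℝ ES]
    {Sg : Type*} [TopologicalSpace Sg] [ChartedSpace ES Sg] [IsManifold 𝓘(ℝ, ES) ∞ Sg]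
    {N : ℕ} {P : Type*} [TopologicalSpace P] [ChartedSpace (EuclideanSpace ℝ (Fin N)) P]
    [IsManifold 𝓘(ℝ, EuclideanSpace ℝ (Fin N)) ∞ P]
    {n : ℕ} {M : Type*} [TopologicalSpace M] [T2Space M]
    [ChartedSpace (EuclideanSpace ℝ (Fin n)) M]
    [IsManifold 𝓘(ℝ, EuclideanSpace ℝ (Fin n)) ∞ M]
    (B : PrincipalBundle (EG := EG) (ES := ES) (N := N) G P Sg) (A : Connection B)
    {r : ℕ} (b : Module.Basis (Fin r) ℝ EG)
    (c : OpenPartialHomeomorph M (EuclideanSpace ℝ (Fin n)))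
    (hc : c ∈ IsManifold.maximalAtlas 𝓘(ℝ, EuclideanSpace ℝ (Fin n)) ∞ M)
    (k : OpenPartialHomeomorph P (EuclideanSpace ℝ (Fin N)))
    (hk : k ∈ IsManifold.maximalAtlas 𝓘(ℝ, EuclideanSpace ℝ (Fin N)) ∞ P) :
    -- the structures on both sides exist and are determined by their defining formulas
    (∃! S : (universalPatch r n c.target).Operators (GaugeAlgebra EG n M),
      IsUniversalStructure (structConst G b) (gaugeComp b c) S) ∧
    (∃! S' : (mappingPatch n N c.target k.target).Operators (GaugeAlgebra EG n M),
      IsCanonicalStructure (gaugeComp b c) (vertCoeff B b k) S') ∧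
    ∀ (S : (universalPatch r n c.target).Operators (GaugeAlgebra EG n M))
      (S' : (mappingPatch n N c.target k.target).Operators (GaugeAlgebra EG n M)),
      IsUniversalStructure (structConst G b) (gaugeComp b c) S →
      IsCanonicalStructure (gaugeComp b c) (vertCoeff B b k) S' →
      -- both sides are h-simple `QK_{vg}`-manifolds
      S.IsQKvg (gaugeBr G) ∧ S.IsHSimple ∧ S'.IsQKvg (gaugeBr G) ∧ S'.IsHSimple ∧
      -- the Weil homomorphism exists, and is unique
      (∃! Φ, IsWeilHom (structConst G b) (connCoeff A b k) S S' Φ) ∧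
      ∀ Φ, IsWeilHom (structConst G b) (connCoeff A b k) S S' Φ →
        -- it intertwines `Q`, `K`, `L`, `ι_λ` and `δ_λ`
        Patch.Intertwines S S' Φ ∧
        -- it sends the universal connection and curvature to the pulled back ones
        (∀ a, Φ (universalConnection a) =
          vertConn n c.target k.target (connCoeff A b k) a
            + horConn n c.target k.target (connCoeff A b k) a) ∧
        (∀ a, Φ (universalCurvature (structConst G b) S a) =
          vertCurv (structConst G b) (connCoeff A b k) S' a
            + mixedCurv (structConst G b) (connCoeff A b k) S' a
            + horCurv (structConst G b) (connCoeff A b k) S' a) ∧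
        -- it covers the map induced on jets by `f ↦ A(Tf)`
        (∃ τ, Patch.Covers Φ τ ∧
          ∀ f : C^∞⟮𝓘(ℝ, EuclideanSpace ℝ (Fin n)), M; 𝓘(ℝ, EuclideanSpace ℝ (Fin N)), P⟯,
            ∀ x ∈ c.target, f (c.symm x) ∈ k.source →
            ∀ q : (mappingPatch n N c.target k.target).dom,
              q.1 = mapJet c k f x → (τ q).1 = pullbackConnJet A b c f x) ∧
        -- it does not depend on the chart of `P`: it is compatible with restrictions and changes
        -- of charts, which preserve all the structure
        ∀ k' ∈ IsManifold.maximalAtlas 𝓘(ℝ, EuclideanSpace ℝ (Fin N)) ∞ P, k.source ⊆ k'.source →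
          ∀ S'' : (mappingPatch n N c.target k'.target).Operators (GaugeAlgebra EG n M),
            IsCanonicalStructure (gaugeComp b c) (vertCoeff B b k') S'' →
            (∃! T, IsFibreChange (fun y => k' (k.symm y)) S'' S' T) ∧
            ∀ T, IsFibreChange (fun y => k' (k.symm y)) S'' S' T →
              Patch.Intertwines S'' S' T ∧
              ∀ Φ', IsWeilHom (structConst G b) (connCoeff A b k') S S'' Φ' → T.comp Φ' = Φ := by
  have hX := isOpen_universalPatch_dom r c.open_target
  have hU := c.open_target
  have hV := k.open_target
  have hY := isOpen_mappingPatch_dom (n := n) (N := N) hU hV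
  have : CompleteSpace EG := FiniteDimensional.complete ℝ EG
  have hf := isLieConst_structConst (G := G) b
  have hsm := contDiffOn_gaugeComp (EG := EG) b hc
  have hp := hasLocalPartials_gaugeComp (EG := EG) b hc
  have hcomp : ∀ (s : ℝ) (l₁ l₂ : GaugeAlgebra EG n M) a, ∀ x ∈ c.target,
      gaugeComp b c (s • l₁ + l₂) a x = s * gaugeComp b c l₁ a x + gaugeComp b c l₂ a x :=
    fun s l₁ l₂ a x _ => gaugeComp_linear b s l₁ l₂ a x
  have hbr : ∀ l₁ l₂ l₃ : GaugeAlgebra EG n M, gaugeBr G l₁ l₂ l₃ → ∀ a, ∀ x ∈ c.target,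
      gaugeComp b c l₃ a x =
        ∑ i, ∑ j, structConst G b i j a * (gaugeComp b c l₁ i x * gaugeComp b c l₂ j x) :=
    fun l₁ l₂ l₃ h a x _ => gaugeComp_bracket b h a x
  have hvs := fun (k : OpenPartialHomeomorph P (EuclideanSpace ℝ (Fin N))) hk =>
    contDiffOn_vertCoeff (B := B) b (k := k) hk
  have hcf := fun (k : OpenPartialHomeomorph P (EuclideanSpace ℝ (Fin N))) hk =>
    contDiffOn_connCoeff A b (k := k) hk
  refine ⟨?_, ?_, ?_⟩
  · obtain ⟨S, hS⟩ := exists_isUniversalStructure hU (structConst G b) (gaugeComp (EG := EG) b c)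
    exact ⟨S, hS, fun S' hS' => hS'.unique hX hS⟩
  · obtain ⟨S, hS⟩ := exists_isCanonicalStructure hU hV (gaugeComp (EG := EG) b c) (vertCoeff B b k)
    exact ⟨S, hS, fun S' hS' => hS'.unique hY hS⟩
  intro S S' hS hS'
  have hqk := hS.isQKvg hX hU hf hcomp hsm hbr
  have hqk' := hS'.isQKvg hU hV hsm (hvs k hk) hcomp hbr (bracket_vertCoeff b hk)
  refine ⟨hqk, hS.isHSimple hX hU hsm hp hqk, hqk', hS'.isHSimple hU hV hsm (hvs k hk) hp hqk', ?_, ?_⟩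
  · obtain ⟨Φ, hΦ⟩ := exists_isWeilHom (f := structConst G b) (cf := connCoeff A b k) hU hV hS hS'
    exact ⟨Φ, hΦ, fun Φ' hΦ' => hΦ'.unique hX hY hS hS' hΦ⟩
  intro Φ h
  refine ⟨h.intertwines hX hY hS hS' hqk hqk' hV hsm (hvs k hk) (hcf k hk) hf
    (connCoeff_vertCoeff A b hk) (curvature_vertCoeff A b hk), h.map_universalConnection,
    h.map_universalCurvature, ?_, ?_⟩
  · obtain ⟨τ, hτ⟩ := h.morphism.covers
    exact ⟨τ, hτ, fun f x hx hxk q hq => h.covers_mapJet hS hS' hk hc hτ f hx hxk hq⟩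
  intro k' hk' hkk S'' hS''
  have hV' := k'.open_target
  have ht := contDiffOn_chartChange hk hk' hkk
  have htV : ∀ y ∈ k.target, k' (k.symm y) ∈ k'.target := fun y hy =>
    k'.map_source (hkk (k.map_target hy))
  have hqk'' := hS''.isQKvg hU hV' hsm (hvs k' hk') hcomp hbr (bracket_vertCoeff b hk')
  refine ⟨?_, fun T hT => ⟨?_, fun Φ' hΦ' => ?_⟩⟩
  · obtain ⟨T, hT⟩ := exists_isFibreChange hU hV hV' hS' hS'' hqk'.Q_Q ht htV
    exact ⟨T, hT, fun T' hT' => hT'.unique hU hV hV' hS' hS'' hT⟩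
  · exact hT.intertwines hU hV hV' hS' hS'' ht htV hsm (hvs k hk) (hvs k' hk')
      (vertCoeff_chartChange b hk hk' hkk) hqk' hqk''
  -- The composite and `Φ` are both Weil homomorphisms over the smaller chart, so uniqueness
  -- identifies them.
  · exact (hT.comp_isWeilHom hU hV hS' hS'' ht htV (hcf k hk) (hcf k' hk')
      (connCoeff_chartChange A b hk hk' hkk) hΦ').unique hX hY hS hS' h
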